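/- Let $n\in\{1,2\}$ and let $a,b,c,d\in\mathbb R$ satisfy $b\ge 0$, $d\ge 0$, $a\le 0$, $c\le 0$ and $$\big((a+b)(a+d)(c+b)(c+d)\big)^2+(a+b+c+d)^2>0 .$$ Put $$g(y)=y\sqrt{\frac{(1-ay^2)(1-cy^2)}{(1+by^2)(1+dy^2)}} ,$$ and define $\ell$ and $\alpha$ by the following table: - $b=d=0$, $a<0$, $c<0$: $\ell=0$, $\alpha=1$; - $b=d=0$, $ac=0$, $a+c<0$: $\ell=0$, $\alpha=0$; - $bd=0$, $b+d>0$, $ac\ne0$: $\ell=0$, $\alpha=0$; - $bd=0$, $b+d>0$, $ac=0$, $a+c<0$: $\ell=\sqrt{\frac{-(a+c)}{b+d}}$, $\alpha=-3$; - $bd=0$, $b+d>0$, $a=c=0$: $\ell=0$, $\alpha=-4$; - $bd\neq0$, $a=c=0$: $\ell=0$, $\alpha=-3$; - $bd\ne0$, $ac=0$, $a+c<0$, $b(a+c)+bd+(a+c)d\neq0$: $\ell=0$, $\alpha=-4$; - $bd\ne0$, $ac=0$, $a+c<0$, $b(a+c)+bd+(a+c)d=0$: $\ell=0$, $\alpha=-6$;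 - $abcd\ne0$, $abc+abd+acd+bcd\neq0$: $\ell=\sqrt{\frac{ac}{bd}}$, $\alpha=-3$; - $abcd\ne0$, $abc+abd+acd+bcd=0$: $\ell=\sqrt{\frac{ac}{bd}}$, $\alpha=-5$. For a smooth symbol $m$ with derivatives of at most polynomial growth, $m(D)$ denotes the Fourier multiplier with symbol $m(\xi)$, where $D=-i\nabla$, acting on tempered distributions on $\mathbb R^n$. The $L^p$ norm of a tempered distribution is that of the $L^p$ function representing it, and $+\infty$ if there is none. A pair $(q,r)\in[2,\infty]^2$ is sharp $\sigma$-admissible if $\frac1q+\frac\sigma r=\frac\sigma2$ and $(q,r,\sigma)\ne(2,\infty,1)$. Then there exists $y_1>0$ such that for every smooth compactly supported function $\chi:\mathbb R\to\mathbb C$ equal to $1$ on $[-y_1,y_1]$ and every sharp $\frac n2$-admissible pair $(q,r)$ there exists $C>0$ such that for all $\mu\in(0,1]$, all $t\in\mathbb R\setminus\{0\}$ and all tempered distributions $u_0$ on $\mathbb R^n$: 1. if $n=2$ and $\ell\neq0$, $$\big\|e^{i\frac{t}{\sqrt\mu}g(\sqrt\mu|D|)}(1-\chi(\sqrt\mu|D|))u_0\big\|_{L^\infty_x}\le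 C\mu^{-\frac{\alpha+1}4}\,\frac{\big\||D|^{\frac{1-\alpha}2}(1-\chi(\sqrt\mu|D|))u_0\big\|_{L^1}}{|t|},$$ $$\big\|e^{i\frac{t}{\sqrt\mu}g(\sqrt\mu|D|)}(1-\chi(\sqrt\mu|D|))u_0\big\|_{L^q_tL^r_x}\le C\mu^{-\frac{\alpha+1}4(\frac12-\frac1r)}\big\||D|^{\frac{1-\alpha}2(\frac12-\frac1r)}(1-\chi(\sqrt\mu|D|))u_0\big\|_{L^2};$$ 2. otherwise, $$\big\|e^{i\frac{t}{\sqrt\mu}g(\sqrt\mu|D|)}(1-\chi(\sqrt\mu|D|))u_0\big\|_{L^\infty_x}\le C\mu^{-\frac n2\frac{\alpha+1}2}\,\frac{\big\||D|^{-\frac n2\alpha}(1-\chi(\sqrt\mu|D|))u_0\big\|_{L^1}}{|t|^{\frac n2}},$$ $$\big\|e^{i\frac{t}{\sqrt\mu}g(\sqrt\mu|D|)}(1-\chi(\sqrt\mu|D|))u_0\big\|_{L^q_tL^r_x}\le C\mu^{-\frac n2\frac{\alpha+1}2(\frac12-\frac1r)}\big\||D|^{-\frac n2\alpha(\frac12-\frac1r)}(1-\chi(\sqrt\mu|D|))u_0\big\|_{L^2}.$$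 -/

import Mathlib

open Real MeasureTheory
open scoped ENNReal SchwartzMap ContDiff

noncomputable section

/-- The phase `g(y) = y φ(y)` of the abcd-Boussinesq dispersion relation, where
`φ(y) = √((1 - a y²)(1 - c y²) / ((1 + b y²)(1 + d y²)))`. -/
def abcdPhase (a b c d y : ℝ) : ℝ :=
  y * √(((1 - a * y ^ 2) * (1 - c * y ^ 2)) / ((1 + b * y ^ 2) * (1 + d * y ^ 2)))

open Classical in
/-- The table of the pairs `(ℓ, α)`, row by row. The rows exclude each other, and they exhaust all
`b, d ≥ 0`, `a, c ≤ 0` with `((a+b)(a+d)(c+b)(c+d))² + (a+b+c+d)² > 0`,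
so the final default value is never used for such parameters. -/
def abcdTable (a b c d : ℝ) : ℝ × ℝ :=
  if b = 0 ∧ d = 0 ∧ a < 0 ∧ c < 0 then (0, 1)
  else if b = 0 ∧ d = 0 ∧ a * c = 0 ∧ a + c < 0 then (0, 0)
  else if b * d = 0 ∧ 0 < b + d ∧ a * c ≠ 0 then (0, 0)
  else if b * d = 0 ∧ 0 < b + d ∧ a * c = 0 ∧ a + c < 0 then (√(-(a + c) / (b + d)), -3)
  else if b * d = 0 ∧ 0 < b + d ∧ a = 0 ∧ c = 0 then (0, -4)
  else if b * d ≠ 0 ∧ a = 0 ∧ c = 0 then (0, -3)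
  else if b * d ≠ 0 ∧ a * c = 0 ∧ a + c < 0 ∧ b * (a + c) + b * d + (a + c) * d ≠ 0 then (0, -4)
  else if b * d ≠ 0 ∧ a * c = 0 ∧ a + c < 0 ∧ b * (a + c) + b * d + (a + c) * d = 0 then (0, -6)
  else if a * b * c * d ≠ 0 ∧ a * b * c + a * b * d + a * c * d + b * c * d ≠ 0 then
    (√(a * c / (b * d)), -3)
  else if a * b * c * d ≠ 0 ∧ a * b * c + a * b * d + a * c * d + b * c * d = 0 then
    (√(a * c / (b * d)), -5)
  else (0, 0)

/-- Sharp `σ`-admissible pairs `(q, r) ∈ [2, ∞]²`; here `1 / ∞ = 0`. -/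
def SharpAdmissible (σ : ℝ) (q r : ℝ≥0∞) : Prop :=
  2 ≤ q ∧ 2 ≤ r ∧ (q⁻¹).toReal + σ * (r⁻¹).toReal = σ / 2 ∧ ¬ (q = 2 ∧ r = ⊤ ∧ σ = 1)

/-- The Fourier multiplier `m(D)` on tempered distributions on `ℝⁿ`, for the normalization in which
`D = -i∇`, that is, `m(D) e^{i x·ξ} = m(ξ) e^{i x·ξ}`. Mathlib's Fourier transform has the kernel
`e^{-2π i x·ξ}`, which is why its symbol is rescaled by `2π`. The symbol has to be smooth, with all
derivatives of at most polynomial growth. -/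
def fourierMult {n : ℕ} (m : EuclideanSpace ℝ (Fin n) → ℂ)
    (u : 𝓢'(EuclideanSpace ℝ (Fin n), ℂ)) : 𝓢'(EuclideanSpace ℝ (Fin n), ℂ) :=
  TemperedDistribution.fourierMultiplierCLM ℂ (fun ξ => m ((2 * π) • ξ)) u

/-- The `L^p` norm of a tempered distribution on `ℝⁿ`: the norm of the `L^p` function that
represents it, and `∞` if there is none. (Two such functions agree almost everywhere.) -/
def distLpNorm {n : ℕ} (p : ℝ≥0∞) (u : 𝓢'(EuclideanSpace ℝ (Fin n), ℂ)) : ℝ≥0∞ :=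
  ⨅ (f : EuclideanSpace ℝ (Fin n) → ℂ) (_ : MemLp f p volume)
    (_ : ∀ φ : 𝓢(EuclideanSpace ℝ (Fin n), ℂ), u φ = ∫ x, φ x * f x), eLpNorm f p volume

/-- The mixed norm `‖F‖_{L^q_t L^r_x}` of a family `t ↦ F(t)` of tempered distributions. -/
def mixedNorm {n : ℕ} (q r : ℝ≥0∞) (F : ℝ → 𝓢'(EuclideanSpace ℝ (Fin n), ℂ)) : ℝ≥0∞ :=
  eLpNorm (fun t => distLpNorm r (F t)) q volume

/-- `e^{i (t/√μ) g(√μ |D|)} (1 - χ(√μ |D|)) u₀`, with `g` the abcd-Boussinesq phase. It is one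
multiplier: the product of the symbols is smooth, as `1 - χ(√μ |ξ|)` vanishes near `0`. -/
def highFreqFlow {n : ℕ} (a b c d μ : ℝ) (χ : ℝ → ℂ) (t : ℝ)
    (u₀ : 𝓢'(EuclideanSpace ℝ (Fin n), ℂ)) : 𝓢'(EuclideanSpace ℝ (Fin n), ℂ) :=
  fourierMult (fun ξ => Complex.exp (Complex.I * ((t / √μ * abcdPhase a b c d (√μ * ‖ξ‖) : ℝ) : ℂ))
    * (1 - χ (√μ * ‖ξ‖))) u₀

/-- `|D|^s (1 - χ(√μ |D|)) u₀`. -/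
def highFreqWeight {n : ℕ} (μ : ℝ) (χ : ℝ → ℂ) (s : ℝ)
    (u₀ : 𝓢'(EuclideanSpace ℝ (Fin n), ℂ)) : 𝓢'(EuclideanSpace ℝ (Fin n), ℂ) :=
  fourierMult (fun ξ => ((‖ξ‖ ^ s : ℝ) : ℂ) * (1 - χ (√μ * ‖ξ‖))) u₀

end

/-! ### The Hardy-Littlewood-Sobolev inequality on the line, in bilinear diagonal form -/

/-! Put `h = 2π√μ`. Only large `h|ξ|` matters, so the estimates depend only on `g` at infinity.
There `g r = e + ℓ r + r ^ β * G (r⁻²)` with `β = α + 2`, `G` smooth and `G 0 ≠ 0`. The affine part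
does not disperse; the rest has curvature of exact size `r ^ (β - 2)`. The nondegeneracy hypothesis
excludes the parameters for which `g` is linear. This is `abcdPhase_expansion`.

Dispersion. The kernel of the flow is a radial Fourier integral. Angular integration turns it into
an integral in `r` of the waves `exp (± i |x| r)` with amplitudes of symbol order `-(n - 1) / 2`:
the constant 1 for `n = 1`, the Bessel amplitude for `n = 2`. On the dyadic scale `h r ≈ R` the
phase has linear slope `A = |t ℓ + w| R`, with `w` proportional to `± |x|`, and a curved part of
size `λ = |t| R ^ β`. Unless `A ≈ λ` the piece is non-stationary, and in all cases the second
derivative test gives `λ ^ (-1/2)` (`exists_dyadic_piece_bound`). As `β ≠ 0, 1`, both `λ` and `A /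
λ` run through geometric progressions, so the pieces sum uniformly in `x` and `t`
(`exists_dyadic_sum_bound`). In dimension two the amplitude adds `(|w| R) ^ (-1/2)`. If `ℓ = 0`,
stationarity means `|w| R ≈ λ`, and the total decay is `λ⁻¹`. If `ℓ > 0`, then `β ≤ -1` and
stationarity forces `|w| ≳ ℓ |t|`, so the gain is only `(|t| R) ^ (-1/2)`. This is the source of the
two cases of the theorem.

Strichartz. The kernel bound (`exists_kernel_bound`) also holds with the weight raised to the power
`1 + iτ`, at the cost of a factor quadratic in `τ`. Stein interpolation with Plancherel
(`stein_interpolation`) then gives decay `|t| ^ (-2/q)` from `L^{r'}` to `L^r`, using the fraction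
`θ = 1 - 2/r` of the weight. Half of that weight goes to each side of a `TT*` argument, which the
Hardy-Littlewood-Sobolev inequality closes (`lintegral_iSup_inner_rpow_le`). Norms of distributions
are reached by duality: a functional bounded in the `L^p` norm, `p ≤ 2`, is represented by an
`L^{p'}` function (`distLpNorm_le_of_forall_norm_le`). -/

theorem lintegral_comp_abs_eq {F : ℝ → ℝ≥0∞} :
    ∫⁻ u, F |u| = 2 * ∫⁻ u in Set.Ioi 0, F u := by
  have h1 : ∫⁻ u in Set.Ioi (0 : ℝ), F |u| = ∫⁻ u in Set.Ioi 0, F u :=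
    setLIntegral_congr_fun measurableSet_Ioi fun u hu => by rw [abs_of_pos hu]
  have h2 : ∫⁻ u in Set.Iic (0 : ℝ), F |u| = ∫⁻ u in Set.Ioi 0, F u := by
    rw [← h1, ← setLIntegral_congr (μ := volume) (Iio_ae_eq_Iic (a := (0 : ℝ)))]
    have := (Measure.measurePreserving_neg (volume : Measure ℝ)).setLIntegral_comp_preimage_emb
      (MeasurableEquiv.neg ℝ).measurableEmbedding (fun u => F |u|) (Set.Ioi 0)
    rw [← this]
    simp
  rw [← lintegral_add_compl (fun u => F |u|) (measurableSet_Ioi (a := (0 : ℝ))), h1,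
    Set.compl_Ioi, h2, two_mul]

theorem lintegral_abs_sub_eq {F : ℝ → ℝ≥0∞} (t : ℝ) :
    ∫⁻ s, F |t - s| = 2 * ∫⁻ u in Set.Ioi 0, F u := by
  rw [← lintegral_comp_abs_eq, lintegral_sub_left_eq_self (fun u => F |u|) t]

theorem lintegral_near_singularity {r : ℝ} (hr : r < 1) {δ : ℝ} (hδ : 0 < δ) (t : ℝ) :
    ∫⁻ s, (Set.Iic δ).indicator (fun u => ENNReal.ofReal (u ^ (-r))) |t - s| =
      ENNReal.ofReal (2 / (1 - r) * δ ^ (1 - r)) := by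
  rw [lintegral_abs_sub_eq, setLIntegral_indicator measurableSet_Iic, Set.Iic_inter_Ioi]
  have hi : IntegrableOn (fun u : ℝ => u ^ (-r)) (Set.Ioc 0 δ) := by
    have := intervalIntegral.intervalIntegrable_rpow' (a := 0) (b := δ) (r := -r) (by linarith)
    rwa [intervalIntegrable_iff, Set.uIoc_of_le hδ.le] at this
  rw [← ofReal_integral_eq_lintegral_ofReal hi
    ((ae_restrict_iff' measurableSet_Ioc).2 (.of_forall fun u hu => rpow_nonneg hu.1.le _)),
    ← intervalIntegral.integral_of_le hδ.le, integral_rpow (Or.inl (by linarith)),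
    zero_rpow (by linarith), show (2 : ℝ≥0∞) = ENNReal.ofReal 2 by simp,
    ← ENNReal.ofReal_mul (by norm_num)]
  congr 1
  rw [show -r + 1 = 1 - r by ring]
  ring

theorem lintegral_off_singularity {δ : ℝ} (hδ : 0 < δ) (t : ℝ) :
    ∫⁻ s, (Set.Ioi δ).indicator (fun u => ENNReal.ofReal (u ^ (-2 : ℝ))) |t - s| =
      ENNReal.ofReal (2 / δ) := by
  rw [lintegral_abs_sub_eq, setLIntegral_indicator measurableSet_Ioi, Set.Ioi_inter_Ioi,
    max_eq_left hδ.le,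
    ← ofReal_integral_eq_lintegral_ofReal (integrableOn_Ioi_rpow_of_lt (by norm_num) hδ)
    ((ae_restrict_iff' measurableSet_Ioi).2
      (.of_forall fun u hu => rpow_nonneg (hδ.le.trans (le_of_lt hu)) _)),
    integral_Ioi_rpow_of_lt (by norm_num) hδ, show (2 : ℝ≥0∞) = ENNReal.ofReal 2 by simp,
    ← ENNReal.ofReal_mul (by norm_num)]
  congr 1
  norm_num [rpow_neg_one]
  ring

/-- The part of the fractional integral of `h` over the points where `h` is smaller than at `t`. -/
theorem lintegral_sublevel_mul_kernel_le {p q : ℝ} (hpq : p.HolderConjugate q) (hq : 2 < q)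
    {h : ℝ → ℝ} (hm : Measurable h) {A : ℝ} (hA : 0 < A)
    (hI : ∫⁻ s, ENNReal.ofReal (h s) ^ p = ENNReal.ofReal A) (t : ℝ) (ht : 0 < h t) :
    ∫⁻ s, {s | h s ≤ h t}.indicator
        (fun s => ENNReal.ofReal (h s) * ENNReal.ofReal (|t - s| ^ (-(2 / q)))) s ≤
      ENNReal.ofReal ((2 / (1 - 2 / q) + 2) * A ^ (1 - 2 / q) * h t ^ (p - 1)) := by
  have hp0 := hpq.pos
  have hq0 := hpq.symm.pos
  have hrel : p⁻¹ = 1 - q⁻¹ := by have := hpq.inv_add_inv_eq_one; linarith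
  have hpq' : p * q = p + q := hpq.mul_eq_add
  have hr1 : 2 / q < 1 := by rw [div_lt_one hq0]; exact hq
  -- The distance at which two bounds meet. Within `δ` of `t` one uses `h s ≤ h t`; beyond it,
  -- Hölder against the kernel, whose `q`-th power `|u| ^ (-2)` is integrable there. Both
  -- contributions become multiples of `A ^ (1 - 2/q) * h t ^ (p - 1)`.
  set δ := A / h t ^ p with hδd
  have hδ : 0 < δ := by positivity
  set N : ℝ → ℝ≥0∞ := fun s =>
    (Set.Iic δ).indicator (fun u => ENNReal.ofReal (u ^ (-(2 / q)))) |t - s| with hN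
  set O : ℝ → ℝ≥0∞ := fun s =>
    (Set.Ioi δ).indicator (fun u => ENNReal.ofReal (u ^ (-(2 / q)))) |t - s| with hO
  have hOm : Measurable O := by
    refine Measurable.comp (g := (Set.Ioi δ).indicator fun u => ENNReal.ofReal (u ^ (-(2 / q))))
      ?_ (by fun_prop)
    exact (by fun_prop : Measurable fun u : ℝ => ENNReal.ofReal (u ^ (-(2 / q)))).indicator
      measurableSet_Ioi
  have key : ∀ s, {s | h s ≤ h t}.indicator
        (fun s => ENNReal.ofReal (h s) * ENNReal.ofReal (|t - s| ^ (-(2 / q)))) s ≤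
      ENNReal.ofReal (h t) * N s + ENNReal.ofReal (h s) * O s := by
    intro s
    by_cases hs : h s ≤ h t
    · rw [Set.indicator_of_mem (by exact hs)]
      rcases le_or_gt |t - s| δ with hd | hd
      · refine le_add_right ?_
        rw [hN]; simp only
        rw [Set.indicator_of_mem (by exact hd)]
        gcongr
      · refine le_add_left ?_
        rw [hO]; simp only
        rw [Set.indicator_of_mem (by exact hd)]
    · rw [Set.indicator_of_notMem (by exact hs)]
      exact zero_le
  refine (lintegral_mono key).trans ?_
  have hNm : Measurable N := by
    refine Measurable.comp (g := (Set.Iic δ).indicator fun u => ENNReal.ofReal (u ^ (-(2 / q))))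
      ?_ (by fun_prop)
    exact (by fun_prop : Measurable fun u : ℝ => ENNReal.ofReal (u ^ (-(2 / q)))).indicator
      measurableSet_Iic
  rw [lintegral_add_left (hNm.const_mul _), lintegral_const_mul _ hNm,
    lintegral_near_singularity hr1 hδ]
  have hOq : ∫⁻ s, O s ^ q = ENNReal.ofReal (2 / δ) := by
    rw [← lintegral_off_singularity hδ t]
    congr 1 with s
    rw [hO]; simp only [Set.indicator_apply]
    split_ifs with hs
    · have : 0 < |t - s| := hδ.trans hs
      rw [ENNReal.ofReal_rpow_of_nonneg (by positivity) hq0.le, ← rpow_mul (abs_nonneg _)]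
      congr 2; field_simp
    · simp [hq0]
  have hHol := ENNReal.lintegral_mul_le_Lp_mul_Lq volume hpq
    (f := fun s => ENNReal.ofReal (h s)) (g := O) (by fun_prop) hOm.aemeasurable
  rw [hI, hOq] at hHol
  refine (add_le_add le_rfl hHol).trans ?_
  rw [ENNReal.ofReal_rpow_of_nonneg hA.le (by positivity),
    ENNReal.ofReal_rpow_of_nonneg (by positivity) (by positivity), ← ENNReal.ofReal_mul ht.le,
    ← ENNReal.ofReal_mul (by positivity),
    ← ENNReal.ofReal_add (by have : 0 < 1 - 2 / q := by linarith
                             positivity) (by positivity)]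
  apply ENNReal.ofReal_le_ofReal
  have e1 : h t * δ ^ (1 - 2 / q) = A ^ (1 - 2 / q) * h t ^ (p - 1) := by
    rw [hδd, div_rpow hA.le (by positivity), ← rpow_mul ht.le]
    have : p * (1 - 2 / q) = 2 - p := by field_simp; linarith
    rw [this, mul_div_assoc', mul_comm (h t), mul_div_assoc]
    congr 1
    rw [div_eq_mul_inv, ← rpow_neg ht.le]
    nth_rewrite 1 [← rpow_one (h t)]
    rw [← rpow_add ht]; congr 1; ring
  have e2 : A ^ (1 / p) * (2 / δ) ^ (1 / q) = 2 ^ (1 / q) * (A ^ (1 - 2 / q) * h t ^ (p - 1)) := by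
    have : 2 / δ = 2 * (h t ^ p / A) := by rw [hδd]; field_simp
    rw [this, mul_rpow (by norm_num) (by positivity), div_rpow (by positivity) hA.le,
      ← rpow_mul ht.le]
    have h1 : p * (1 / q) = p - 1 := by field_simp; linarith
    have h2 : 1 - 2 / q = 1 / p - 1 / q := by rw [one_div, hrel]; ring
    rw [h1, h2, rpow_sub hA]; ring
  have e3 : (2 : ℝ) ^ (1 / q) ≤ 2 := by
    calc (2 : ℝ) ^ (1 / q) ≤ 2 ^ (1 : ℝ) :=
          rpow_le_rpow_of_exponent_le (by norm_num) (by rw [div_le_one hq0]; linarith)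
      _ = 2 := rpow_one _
  calc h t * (2 / (1 - 2 / q) * δ ^ (1 - 2 / q)) + A ^ (1 / p) * (2 / δ) ^ (1 / q)
      = (2 / (1 - 2 / q) + 2 ^ (1 / q)) * (A ^ (1 - 2 / q) * h t ^ (p - 1)) := by
        rw [e2, mul_left_comm, e1]; ring
    _ ≤ (2 / (1 - 2 / q) + 2) * (A ^ (1 - 2 / q) * h t ^ (p - 1)) := by gcongr
    _ = _ := by ring

/-- The kernel is symmetric, so it suffices to integrate over `h s ≤ h t`. The inner integral is
then `≲ A ^ (1 - 2/q) * h t ^ (p - 1)`, the outer factor completes this to `h t ^ p`, and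
integration gives `A ^ (2 - 2/q) = A ^ (2/p)`. -/
theorem hardy_littlewood_sobolev_diagonal {p q : ℝ} (hpq : p.HolderConjugate q) (hq : 2 < q)
    {h : ℝ → ℝ} (hm : Measurable h) (h0 : ∀ t, 0 ≤ h t) {A : ℝ} (hA : 0 < A)
    (hI : ∫⁻ s, ENNReal.ofReal (h s) ^ p = ENNReal.ofReal A) :
    ∫⁻ t, ∫⁻ s, ENNReal.ofReal (h t) * ENNReal.ofReal (h s) *
        ENNReal.ofReal (|t - s| ^ (-(2 / q))) ≤
      ENNReal.ofReal (2 * (2 / (1 - 2 / q) + 2) * A ^ (2 / p)) := by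
  have hp0 := hpq.pos
  have hq0 := hpq.symm.pos
  have hrel : p⁻¹ = 1 - q⁻¹ := by have := hpq.inv_add_inv_eq_one; linarith
  have hr1 : 2 / q < 1 := by rw [div_lt_one hq0]; exact hq
  have hc0 : 0 < 1 - 2 / q := by linarith
  set k : ℝ → ℝ → ℝ≥0∞ := fun t s => ENNReal.ofReal (|t - s| ^ (-(2 / q))) with hk
  set G : ℝ → ℝ → ℝ≥0∞ := fun t s => {s | h s ≤ h t}.indicator
    (fun s => ENNReal.ofReal (h t) * (ENNReal.ofReal (h s) * k t s)) s with hG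
  have hGm : Measurable (Function.uncurry G) := by
    have : Function.uncurry G = {z : ℝ × ℝ | h z.2 ≤ h z.1}.indicator (fun z =>
        ENNReal.ofReal (h z.1) * (ENNReal.ofReal (h z.2) * k z.1 z.2)) := by
      ext ⟨t, s⟩; simp [hG, Function.uncurry, Set.indicator_apply]
    rw [this]
    refine Measurable.indicator ?_ (measurableSet_le (by fun_prop) (by fun_prop))
    simp only [hk]; fun_prop
  have hle : ∀ t s, ENNReal.ofReal (h t) * ENNReal.ofReal (h s) * k t s ≤ G t s + G s t := by
    intro t s
    rcases le_total (h s) (h t) with hs | hs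
    · refine le_add_right ?_
      simp only [hG]
      rw [Set.indicator_of_mem (by exact hs), mul_assoc]
    · refine le_add_left ?_
      simp only [hG]
      have hsymm : k t s = k s t := by simp only [hk]; rw [abs_sub_comm]
      rw [Set.indicator_of_mem (by exact hs), hsymm]
      apply le_of_eq; ring
  have hhalf : ∫⁻ t, ∫⁻ s, G t s ≤ ENNReal.ofReal ((2 / (1 - 2 / q) + 2) * A ^ (2 / p)) := by
    have : ∀ t, ∫⁻ s, G t s ≤
        ENNReal.ofReal ((2 / (1 - 2 / q) + 2) * A ^ (1 - 2 / q)) * ENNReal.ofReal (h t) ^ p := by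
      intro t
      rcases (h0 t).eq_or_lt with ht | ht
      · simp [hG, ← ht]
      · have e : ∀ s, G t s = ENNReal.ofReal (h t) * {s | h s ≤ h t}.indicator
            (fun s => ENNReal.ofReal (h s) * k t s) s := by
          intro s; simp only [hG, Set.indicator_apply]; split_ifs <;> simp
        simp_rw [e]
        rw [lintegral_const_mul' _ _ ENNReal.ofReal_ne_top]
        refine (mul_le_mul_right (lintegral_sublevel_mul_kernel_le hpq hq hm hA hI t ht) _).trans ?_
        rw [ENNReal.ofReal_rpow_of_nonneg ht.le hp0.le, ← ENNReal.ofReal_mul ht.le,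
          ← ENNReal.ofReal_mul (by positivity)]
        apply ENNReal.ofReal_le_ofReal
        have : h t ^ p = h t * h t ^ (p - 1) := by
          nth_rewrite 2 [← rpow_one (h t)]
          rw [← rpow_add ht]; congr 1; ring
        rw [this]; apply le_of_eq; ring
    refine (lintegral_mono this).trans ?_
    rw [lintegral_const_mul' _ _ ENNReal.ofReal_ne_top, hI, ← ENNReal.ofReal_mul (by positivity)]
    apply ENNReal.ofReal_le_ofReal
    have : A ^ (2 / p) = A ^ (1 - 2 / q) * A := by
      nth_rewrite 3 [← rpow_one A]
      rw [← rpow_add hA]; congr 1; rw [div_eq_mul_inv, hrel]; ring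
    rw [this, mul_assoc]
  calc _ ≤ ∫⁻ t, ∫⁻ s, (G t s + G s t) := lintegral_mono fun t => lintegral_mono fun s => hle t s
    _ = ∫⁻ t, ((∫⁻ s, G t s) + ∫⁻ s, G s t) := by
        congr 1 with t
        exact lintegral_add_left (hGm.comp (by fun_prop : Measurable fun s => (t, s))) _
    _ = (∫⁻ t, ∫⁻ s, G t s) + ∫⁻ t, ∫⁻ s, G s t :=
        lintegral_add_left hGm.lintegral_prod_right' _
    _ = (∫⁻ t, ∫⁻ s, G t s) + ∫⁻ t, ∫⁻ s, G t s := by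
        congr 1
        exact lintegral_lintegral_swap (f := fun t s => G s t)
          (hGm.comp measurable_swap).aemeasurable
    _ ≤ _ := by
        refine (add_le_add hhalf hhalf).trans ?_
        rw [← ENNReal.ofReal_add (by positivity) (by positivity)]
        apply ENNReal.ofReal_le_ofReal
        apply le_of_eq; ring

/-! ### The abstract `TT*` argument -/

section TTStar

variable {H : Type*} [NormedAddCommGroup H] [InnerProductSpace ℂ H]

/-- Duality: with `φ = ⟨w, f⟩`, the vector `W = ∫ |φ| ^ (q-2) φ w` satisfies `⟨W, f⟩ = ∫ |φ| ^ q`,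
while `‖W‖²` is a Hardy-Littlewood-Sobolev form in `|φ| ^ (q-1)`. The set `J` and the bound `B` only
make the integral finite, so that a power of it may be cancelled; the constant does not see them. -/
theorem integral_norm_inner_rpow_le [CompleteSpace H] {q : ℝ} (hq : 2 < q) {w : ℝ → H} (hw :
    StronglyMeasurable w)
    {J : Set ℝ} (hJ : MeasurableSet J) (hJf : volume J ≠ ⊤) {B : ℝ} (hB : ∀ t ∈ J, ‖w t‖ ≤ B)
    {K : ℝ} (hK : 0 ≤ K)
    (hker : ∀ t s, t ≠ s → ‖inner ℂ (w t) (w s)‖ ≤ K * |t - s| ^ (-(2 / q))) (f : H) :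
    ∫⁻ t in J, ‖inner ℂ (w t) f‖ₑ ^ q ≤
      ENNReal.ofReal ((2 * (2 / (1 - 2 / q) + 2)) ^ (q / 2) * K ^ (q / 2) * ‖f‖ ^ q) := by
  have hq0 : 0 < q := by linarith
  obtain ⟨p, hpq'⟩ : ∃ p, p = q.conjExponent := ⟨_, rfl⟩
  have hpq : p.HolderConjugate q := by
    rw [hpq']; exact (Real.HolderConjugate.conjExponent (by linarith)).symm
  have hp0 := hpq.pos
  have hrel : p⁻¹ = 1 - q⁻¹ := by have := hpq.inv_add_inv_eq_one; linarith
  have hpq1 : (q - 1) * p = q := by have := hpq.mul_eq_add; linarith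
  have hr1 : 2 / q < 1 := by rw [div_lt_one hq0]; exact hq
  have hc0 : 0 < 1 - 2 / q := by linarith
  set C := 2 * (2 / (1 - 2 / q) + 2) with hC
  have hC0 : 0 < C := by positivity
  set φ : ℝ → ℂ := fun t => inner ℂ (w t) f with hφ
  have hφm : StronglyMeasurable φ := hw.inner stronglyMeasurable_const
  have hφB : ∀ t ∈ J, ‖φ t‖ ≤ B * ‖f‖ := fun t ht =>
    (norm_inner_le_norm _ _).trans (by gcongr; exact hB t ht)
  set X := ∫ t in J, ‖φ t‖ ^ q with hX
  have hint : IntegrableOn (fun t => ‖φ t‖ ^ q) J := by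
    refine Measure.integrableOn_of_bounded (M := (B * ‖f‖) ^ q) hJf ?_ ?_
    · exact (hφm.measurable.norm.pow_const q).aestronglyMeasurable
    · refine (ae_restrict_iff' hJ).2 (.of_forall fun t ht => ?_)
      rw [Real.norm_of_nonneg (by positivity)]
      exact rpow_le_rpow (norm_nonneg _) (hφB t ht) hq0.le
  have hlX : ∫⁻ t in J, ‖φ t‖ₑ ^ q = ENNReal.ofReal X := by
    rw [hX, ofReal_integral_eq_lintegral_ofReal hint (.of_forall fun t => by positivity)]
    congr 1 with t
    rw [← ENNReal.ofReal_rpow_of_nonneg (norm_nonneg _) hq0.le, ofReal_norm]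
  rw [hlX]
  apply ENNReal.ofReal_le_ofReal
  have hX0 : 0 ≤ X := integral_nonneg fun t => by positivity
  rcases hX0.eq_or_lt with hX0 | hX0
  · rw [← hX0]; positivity
  set a : ℝ → ℂ := fun t => ((‖φ t‖ ^ (q - 2) : ℝ) : ℂ) * φ t with ha
  have han : ∀ t, ‖a t‖ = ‖φ t‖ ^ (q - 1) := by
    intro t
    simp only [ha, norm_mul, Complex.norm_real]
    rw [Real.norm_of_nonneg (by positivity)]
    nth_rewrite 2 [← rpow_one ‖φ t‖]
    rcases (norm_nonneg (φ t)).eq_or_lt with h | h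
    · rw [← h, zero_rpow (by linarith), zero_rpow (by linarith), zero_rpow (by linarith), zero_mul]
    · rw [← rpow_add h]; congr 1; ring
  have ham : StronglyMeasurable a := by
    refine StronglyMeasurable.mul ?_ hφm
    exact (Complex.measurable_ofReal.comp (hφm.measurable.norm.pow_const _)).stronglyMeasurable
  set F : ℝ → H := fun t => a t • w t with hF
  have hFi : IntegrableOn F J := by
    refine Measure.integrableOn_of_bounded (M := (B * ‖f‖) ^ (q - 1) * B) hJf
      (ham.smul hw).aestronglyMeasurable ?_
    refine (ae_restrict_iff' hJ).2 (.of_forall fun t ht => ?_)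
    rw [hF, norm_smul, han]
    have h1 := hφB t ht
    have h2 := hB t ht
    have h3 : 0 ≤ B := (norm_nonneg _).trans h2
    gcongr
    linarith
  set W := ∫ t in J, F t with hW
  have hinner : inner ℂ W f = (X : ℂ) := by
    rw [← inner_conj_symm, hW, ← integral_inner hFi, ← integral_conj, hX, ← integral_complex_ofReal]
    congr 1 with t
    rw [inner_conj_symm, hF, inner_smul_left]
    simp only [ha, map_mul, Complex.conj_ofReal]
    rw [mul_assoc, ← Complex.normSq_eq_conj_mul_self, Complex.normSq_eq_norm_sq,
      ← Complex.ofReal_mul, ← rpow_natCast ‖φ t‖ 2]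
    congr 1
    rcases (norm_nonneg (φ t)).eq_or_lt with h | h
    · rw [← h, zero_rpow (by linarith), zero_rpow (by norm_num), zero_rpow (by linarith), zero_mul]
    · rw [← rpow_add h]; congr 1; push_cast; ring
  have hXle : X ≤ ‖W‖ * ‖f‖ := by
    have := norm_inner_le_norm (𝕜 := ℂ) W f
    rwa [hinner, Complex.norm_real, Real.norm_of_nonneg hX0.le] at this
  set h : ℝ → ℝ := J.indicator (fun t => ‖φ t‖ ^ (q - 1)) with hh
  have hhm : Measurable h := (hφm.measurable.norm.pow_const _).indicator hJ
  have hh0 : ∀ t, 0 ≤ h t := fun t => Set.indicator_nonneg (fun t _ => by positivity) t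
  have hhI : ∫⁻ s, ENNReal.ofReal (h s) ^ p = ENNReal.ofReal X := by
    rw [← hlX, ← lintegral_indicator hJ]
    congr 1 with s
    simp only [hh]
    by_cases hs : s ∈ J
    · rw [Set.indicator_of_mem hs, Set.indicator_of_mem hs,
        ENNReal.ofReal_rpow_of_nonneg (by positivity) hp0.le, ← rpow_mul (norm_nonneg _), hpq1,
        ← ENNReal.ofReal_rpow_of_nonneg (norm_nonneg _) hq0.le, ofReal_norm]
    · rw [Set.indicator_of_notMem hs, Set.indicator_of_notMem hs]; simp [hp0]
  have hWW : ‖W‖ ^ 2 ≤ K * (C * X ^ (2 / p)) := by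
    have h1 : ‖(inner ℂ W W : ℂ)‖ₑ ≤ ∫⁻ t in J, ∫⁻ s in J, ‖inner ℂ (F t) (F s)‖ₑ := by
      have e1 : (inner ℂ W W : ℂ) = ∫ t in J, inner ℂ W (F t) := by rw [integral_inner hFi]
      rw [e1]
      refine (enorm_integral_le_lintegral_enorm _).trans (lintegral_mono fun t => ?_)
      rw [← inner_conj_symm, RCLike.enorm_conj, hW, ← integral_inner hFi]
      exact enorm_integral_le_lintegral_enorm _
    have h2 : ∫⁻ t in J, ∫⁻ s in J, ‖inner ℂ (F t) (F s)‖ₑ ≤ ENNReal.ofReal K *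
        ∫⁻ t, ∫⁻ s, ENNReal.ofReal (h t) * ENNReal.ofReal (h s) *
          ENNReal.ofReal (|t - s| ^ (-(2 / q))) := by
      rw [← lintegral_const_mul' _ _ ENNReal.ofReal_ne_top, ← lintegral_indicator hJ]
      refine lintegral_mono fun t => ?_
      by_cases ht : t ∈ J
      · rw [Set.indicator_of_mem ht, ← lintegral_const_mul' _ _ ENNReal.ofReal_ne_top,
          ← lintegral_indicator hJ]
        refine lintegral_mono_ae ?_
        have : ∀ᵐ s, s ≠ t := by simp [ae_iff]
        filter_upwards [this] with s hst
        by_cases hs : s ∈ J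
        · rw [Set.indicator_of_mem hs]
          simp only [hh, hF]
          rw [Set.indicator_of_mem hs, Set.indicator_of_mem ht, inner_smul_left, inner_smul_right,
            ← ofReal_norm, norm_mul, norm_mul, RCLike.norm_conj, han, han,
            ← ENNReal.ofReal_mul (by positivity), ← ENNReal.ofReal_mul (by positivity),
            ← ENNReal.ofReal_mul hK]
          apply ENNReal.ofReal_le_ofReal
          calc _ ≤ ‖φ t‖ ^ (q - 1) * (‖φ s‖ ^ (q - 1) * (K * |t - s| ^ (-(2 / q)))) := by
                gcongr; exact hker t s hst.symm
            _ = _ := by ring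
        · rw [Set.indicator_of_notMem hs]; exact zero_le
      · rw [Set.indicator_of_notMem ht]; exact zero_le
    have h3 := (h1.trans h2).trans (mul_le_mul_right
      (hardy_littlewood_sobolev_diagonal hpq hq hhm hh0 hX0 hhI) _)
    rw [← ENNReal.ofReal_mul hK, ← ofReal_norm, ENNReal.ofReal_le_ofReal_iff (by positivity)] at h3
    rwa [inner_self_eq_norm_sq_to_K, ← RCLike.ofReal_pow, RCLike.norm_ofReal,
      abs_of_nonneg (by positivity)] at h3
  -- Since `2/p + 2/q = 2`, the power `X ^ (2/p)` cancels from `X ^ 2`.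
  have hfin : X ^ (2 / q) ≤ C * K * ‖f‖ ^ 2 := by
    have h1 : X ^ 2 ≤ (K * (C * X ^ (2 / p))) * ‖f‖ ^ 2 := by
      calc X ^ 2 ≤ (‖W‖ * ‖f‖) ^ 2 := by gcongr
        _ = ‖W‖ ^ 2 * ‖f‖ ^ 2 := by ring
        _ ≤ _ := by gcongr
    have h2 : X ^ 2 = X ^ (2 / q) * X ^ (2 / p) := by
      rw [← rpow_add hX0, ← rpow_natCast]; congr 1
      rw [div_eq_mul_inv, div_eq_mul_inv, hrel]; push_cast; ring
    have h3 : 0 < X ^ (2 / p) := by positivity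
    rw [h2] at h1
    nlinarith [h1, h3]
  calc X = (X ^ (2 / q)) ^ (q / 2) := by
        rw [← rpow_mul hX0.le]; field_simp; simp
    _ ≤ (C * K * ‖f‖ ^ 2) ^ (q / 2) := by gcongr
    _ = _ := by
        rw [mul_rpow (by positivity) (by positivity), mul_rpow hC0.le hK, ← rpow_natCast,
          ← rpow_mul (norm_nonneg _)]
        congr 2; push_cast; ring

/-- At each time, one of the first `m + 1` vectors which has the largest pairing with `f`. -/
noncomputable def maximizingVector (v : ℕ → ℝ → H) (f : H) : ℕ → ℝ → H
  | 0 => v 0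
  | m + 1 => fun t => open Classical in
      if ‖inner ℂ (maximizingVector v f m t) f‖ < ‖inner ℂ (v (m + 1) t) f‖ then v (m + 1) t
      else maximizingVector v f m t

theorem maximizingVector_stronglyMeasurable {v : ℕ → ℝ → H} (hv : ∀ i, Continuous (v i)) (f : H)
    (m : ℕ) : StronglyMeasurable (maximizingVector v f m) := by
  borelize H
  induction m with
  | zero => exact (hv 0).stronglyMeasurable
  | succ m ih =>
    refine StronglyMeasurable.ite ?_ (hv _).stronglyMeasurable ih
    exact measurableSet_lt (ih.inner stronglyMeasurable_const).measurable.norm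
      ((hv _).stronglyMeasurable.inner stronglyMeasurable_const).measurable.norm

theorem maximizingVector_mem (v : ℕ → ℝ → H) (f : H) (m : ℕ) (t : ℝ) :
    ∃ i ≤ m, maximizingVector v f m t = v i t := by
  induction m with
  | zero => exact ⟨0, le_rfl, rfl⟩
  | succ m ih =>
    obtain ⟨i, hi, h⟩ := ih
    by_cases hc : ‖inner ℂ (maximizingVector v f m t) f‖ < ‖inner ℂ (v (m + 1) t) f‖
    · exact ⟨m + 1, le_rfl, by simp [maximizingVector, hc]⟩
    · exact ⟨i, hi.trans (Nat.le_succ m), by rw [← h]; simp only [maximizingVector, if_neg hc]⟩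

theorem norm_inner_maximizingVector_mono (v : ℕ → ℝ → H) (f : H) (t : ℝ) :
    Monotone fun m => ‖inner ℂ (maximizingVector v f m t) f‖ := by
  refine monotone_nat_of_le_succ fun m => ?_
  by_cases hc : ‖inner ℂ (maximizingVector v f m t) f‖ < ‖inner ℂ (v (m + 1) t) f‖
  · simpa [maximizingVector, hc] using hc.le
  · simp [maximizingVector, hc]

theorem norm_inner_le_maximizingVector (v : ℕ → ℝ → H) (f : H) (m : ℕ) (t : ℝ) :
    ‖inner ℂ (v m t) f‖ ≤ ‖inner ℂ (maximizingVector v f m t) f‖ := by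
  cases m with
  | zero => exact le_rfl
  | succ m =>
    by_cases hc : ‖inner ℂ (maximizingVector v f m t) f‖ < ‖inner ℂ (v (m + 1) t) f‖
    · simp [maximizingVector, hc]
    · simp only [maximizingVector, if_neg hc]; exact not_lt.1 hc

/-- The supremum is linearized: choosing at each time a maximizer among the first `m + 1` vectors
gives one measurable curve, and it obeys the same kernel bound because that bound is assumed across
all pairs of indices. Monotone convergence in `m`, on intervals growing with `m`, does the rest.
Applied to normalized test functions, the supremum is an `L^r` norm in space. -/
theorem lintegral_iSup_inner_rpow_le [CompleteSpace H] {q : ℝ} (hq : 2 < q) {v : ℕ → ℝ → H}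
    (hv : ∀ i, Continuous (v i)) {K : ℝ} (hK : 0 ≤ K)
    (hker : ∀ i j t s, t ≠ s → ‖inner ℂ (v i t) (v j s)‖ ≤ K * |t - s| ^ (-(2 / q))) (f : H) :
    ∫⁻ t, (⨆ i, ‖inner ℂ (v i t) f‖ₑ) ^ q ≤
      ENNReal.ofReal ((2 * (2 / (1 - 2 / q) + 2)) ^ (q / 2) * K ^ (q / 2) * ‖f‖ ^ q) := by
  have hq0 : 0 < q := by linarith
  set C := ENNReal.ofReal ((2 * (2 / (1 - 2 / q) + 2)) ^ (q / 2) * K ^ (q / 2) * ‖f‖ ^ q)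
  set J : ℕ → Set ℝ := fun m => Set.Icc (-(m : ℝ)) m with hJ
  set Y : ℕ → ℝ → ℝ≥0∞ := fun m =>
    (J m).indicator fun t => ‖inner ℂ (maximizingVector v f m t) f‖ₑ ^ q with hY
  have hYm : ∀ m, Measurable (Y m) := fun m =>
    (((maximizingVector_stronglyMeasurable hv f m).inner
      stronglyMeasurable_const).measurable.enorm.pow_const q).indicator measurableSet_Icc
  have hYmono : Monotone Y := by
    refine monotone_nat_of_le_succ fun m t => ?_
    simp only [hY, Set.indicator_apply]
    split_ifs with h1 h2
    · gcongr
      rw [← ofReal_norm, ← ofReal_norm]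
      exact ENNReal.ofReal_le_ofReal (norm_inner_maximizingVector_mono v f t (Nat.le_succ m))
    · exfalso; apply h2
      simp only [hJ, Set.mem_Icc] at h1 ⊢
      push_cast
      constructor <;> linarith [h1.1, h1.2]
    · exact zero_le
    · exact le_rfl
  have hYle : ∀ m, ∫⁻ t, Y m t ≤ C := by
    intro m
    rw [hY, lintegral_indicator measurableSet_Icc]
    obtain ⟨B, hB⟩ : ∃ B, ∀ i ≤ m, ∀ t ∈ J m, ‖v i t‖ ≤ B := by
      have : ∀ i, ∃ B, ∀ t ∈ J m, ‖v i t‖ ≤ B := fun i =>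
        isCompact_Icc.exists_bound_of_continuousOn (hv i).continuousOn
      choose B hB using this
      refine ⟨∑ i ∈ Finset.range (m + 1), |B i|, fun i hi t ht => (hB i t ht).trans
        ((le_abs_self _).trans ?_)⟩
      exact Finset.single_le_sum (f := fun i => |B i|) (fun _ _ => abs_nonneg _)
        (Finset.mem_range.2 (by omega))
    refine integral_norm_inner_rpow_le hq (maximizingVector_stronglyMeasurable hv f m)
      measurableSet_Icc (isCompact_Icc.measure_lt_top.ne) (B := B) ?_ hK ?_ f
    · intro t ht
      obtain ⟨i, hi, h⟩ := maximizingVector_mem v f m t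
      rw [h]; exact hB i hi t ht
    · intro t s hts
      obtain ⟨i, -, h⟩ := maximizingVector_mem v f m t
      obtain ⟨j, -, h'⟩ := maximizingVector_mem v f m s
      rw [h, h']; exact hker i j t s hts
  have hsup : ∀ t, (⨆ i, ‖inner ℂ (v i t) f‖ₑ) ^ q ≤ ⨆ m, Y m t := by
    intro t
    rw [← ENNReal.le_rpow_inv_iff hq0]
    refine iSup_le fun i => ?_
    rw [ENNReal.le_rpow_inv_iff hq0]
    obtain ⟨n, hn⟩ := exists_nat_ge |t|
    have hmem : t ∈ J (max i n) := by
      simp only [hJ, Set.mem_Icc]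
      rw [← abs_le]
      exact hn.trans (by simp)
    refine le_trans ?_ (le_iSup _ (max i n))
    simp only [hY]
    rw [Set.indicator_of_mem hmem]
    gcongr
    rw [← ofReal_norm, ← ofReal_norm]
    exact ENNReal.ofReal_le_ofReal ((norm_inner_le_maximizingVector v f i t).trans
      (norm_inner_maximizingVector_mono v f t (le_max_left i n)))
  calc _ ≤ ∫⁻ t, ⨆ m, Y m t := lintegral_mono hsup
    _ = ⨆ m, ∫⁻ t, Y m t := lintegral_iSup hYm hYmono
    _ ≤ C := iSup_le hYle

end TTStar

/-! ### One-dimensional oscillatory integrals -/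

theorem hasDerivAt_cexp_I_mul {φ : ℝ → ℝ} {φ' s : ℝ} (h : HasDerivAt φ φ' s) :
    HasDerivAt (fun s => Complex.exp (Complex.I * φ s))
      (Complex.exp (Complex.I * φ s) * (Complex.I * φ')) s :=
  (h.ofReal_comp.const_mul Complex.I).cexp

theorem norm_cexp_I_mul_ofReal (x : ℝ) : ‖Complex.exp (Complex.I * x)‖ = 1 := by
  rw [mul_comm]; exact Complex.norm_exp_ofReal_mul_I x

theorem oscillatory_integral_by_parts {φ φ₁ φ₂ : ℝ → ℝ} {a a₁ : ℝ → ℂ} {u v : ℝ} (huv : u ≤ v)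
    (hφ : ∀ s ∈ Set.Icc u v, HasDerivAt φ (φ₁ s) s)
    (hφ₁ : ∀ s ∈ Set.Icc u v, HasDerivAt φ₁ (φ₂ s) s) (hφ₂ : ContinuousOn φ₂ (Set.Icc u v))
    (ha : ∀ s ∈ Set.Icc u v, HasDerivAt a (a₁ s) s) (ha₁ : ContinuousOn a₁ (Set.Icc u v))
    (h0 : ∀ s ∈ Set.Icc u v, φ₁ s ≠ 0) :
    ∫ s in u..v, Complex.exp (Complex.I * φ s) * a s =
      Complex.exp (Complex.I * φ v) * (a v / (Complex.I * φ₁ v)) -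
        Complex.exp (Complex.I * φ u) * (a u / (Complex.I * φ₁ u)) +
      Complex.I * ∫ s in u..v, Complex.exp (Complex.I * φ s) *
        (a₁ s / φ₁ s - a s * φ₂ s / φ₁ s ^ 2) := by
  have hφc : ContinuousOn φ (Set.Icc u v) := fun s hs => (hφ s hs).continuousAt.continuousWithinAt
  have hφ₁c : ContinuousOn φ₁ (Set.Icc u v) :=
    fun s hs => (hφ₁ s hs).continuousAt.continuousWithinAt
  have hac : ContinuousOn a (Set.Icc u v) := fun s hs => (ha s hs).continuousAt.continuousWithinAt
  have h0' : ∀ s ∈ Set.Icc u v, (φ₁ s : ℂ) ≠ 0 := fun s hs => by exact_mod_cast h0 s hs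
  have hE : ContinuousOn (fun s => Complex.exp (Complex.I * φ s)) (Set.Icc u v) :=
    (continuousOn_const.mul (Complex.continuous_ofReal.comp_continuousOn hφc)).cexp
  have hF₁ := Complex.continuous_ofReal.comp_continuousOn hφ₁c
  have hF₂ := Complex.continuous_ofReal.comp_continuousOn hφ₂
  have hb : ContinuousOn (fun s => a₁ s / φ₁ s - a s * φ₂ s / φ₁ s ^ 2) (Set.Icc u v) :=
    (ha₁.div hF₁ h0').sub ((hac.mul hF₂).div (hF₁.pow 2) fun s hs => pow_ne_zero _ (h0' s hs))
  have hd : ∀ s ∈ Set.uIcc u v, HasDerivAt (fun s => Complex.exp (Complex.I * φ s) *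
      (a s / (Complex.I * φ₁ s))) (Complex.exp (Complex.I * φ s) * a s -
        Complex.I * (Complex.exp (Complex.I * φ s) *
          (a₁ s / φ₁ s - a s * φ₂ s / φ₁ s ^ 2))) s := by
    intro s hs
    rw [Set.uIcc_of_le huv] at hs
    have h1 := (hasDerivAt_cexp_I_mul (hφ s hs)).mul
      ((ha s hs).div ((hφ₁ s hs).ofReal_comp.const_mul Complex.I)
        (mul_ne_zero Complex.I_ne_zero (h0' s hs)))
    refine h1.congr_deriv ?_
    have := h0' s hs
    have hI := Complex.I_ne_zero
    simp only [Pi.div_apply]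
    field_simp
    linear_combination (φ₁ s * a₁ s - a s * φ₂ s) * Complex.I_sq
  have hi1 : IntervalIntegrable (fun s => Complex.exp (Complex.I * φ s) * a s) volume u v := by
    apply ContinuousOn.intervalIntegrable; rw [Set.uIcc_of_le huv]; exact hE.mul hac
  have hi2 : IntervalIntegrable (fun s => Complex.I * (Complex.exp (Complex.I * φ s) *
      (a₁ s / φ₁ s - a s * φ₂ s / φ₁ s ^ 2))) volume u v := by
    apply ContinuousOn.intervalIntegrable; rw [Set.uIcc_of_le huv]
    exact continuousOn_const.mul (hE.mul hb)
  have := intervalIntegral.integral_eq_sub_of_hasDerivAt hd (hi1.sub hi2)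
  rw [intervalIntegral.integral_sub hi1 hi2, intervalIntegral.integral_const_mul] at this
  rw [← this]; ring

/-- Non-stationary phase: two integrations by parts. -/
theorem norm_oscillatory_integral_le_of_nonstationary {φ φ₁ φ₂ φ₃ : ℝ → ℝ} {a a₁ a₂ : ℝ → ℂ}
    {u v Y C M : ℝ} (huv : u ≤ v) (hY : 0 < Y) (hC : 0 ≤ C)
    (hφ : ∀ s ∈ Set.Icc u v, HasDerivAt φ (φ₁ s) s)
    (hφ₁ : ∀ s ∈ Set.Icc u v, HasDerivAt φ₁ (φ₂ s) s)
    (hφ₂ : ∀ s ∈ Set.Icc u v, HasDerivAt φ₂ (φ₃ s) s) (hφ₃ : ContinuousOn φ₃ (Set.Icc u v))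
    (ha : ∀ s ∈ Set.Icc u v, HasDerivAt a (a₁ s) s)
    (ha₁ : ∀ s ∈ Set.Icc u v, HasDerivAt a₁ (a₂ s) s) (ha₂ : ContinuousOn a₂ (Set.Icc u v))
    (hau : a u = 0) (hav : a v = 0) (hau₁ : a₁ u = 0) (hav₁ : a₁ v = 0)
    (h1 : ∀ s ∈ Set.Icc u v, Y ≤ |φ₁ s|) (h2 : ∀ s ∈ Set.Icc u v, |φ₂ s| ≤ C * Y)
    (h3 : ∀ s ∈ Set.Icc u v, |φ₃ s| ≤ C * Y)
    (hM : ∀ s ∈ Set.Icc u v, ‖a s‖ ≤ M) (hM₁ : ∀ s ∈ Set.Icc u v, ‖a₁ s‖ ≤ M)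
    (hM₂ : ∀ s ∈ Set.Icc u v, ‖a₂ s‖ ≤ M) :
    ‖∫ s in u..v, Complex.exp (Complex.I * φ s) * a s‖ ≤
      (1 + 4 * C + 3 * C ^ 2) * (v - u) * M / Y ^ 2 := by
  have h0 : ∀ s ∈ Set.Icc u v, φ₁ s ≠ 0 := fun s hs h => by
    have := h1 s hs; rw [h, abs_zero] at this; linarith
  have h0' : ∀ s ∈ Set.Icc u v, (φ₁ s : ℂ) ≠ 0 := fun s hs => by exact_mod_cast h0 s hs
  have hM0 : 0 ≤ M := (norm_nonneg _).trans (hM u ⟨le_rfl, huv⟩)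
  have hφ₁c : ContinuousOn φ₁ (Set.Icc u v) :=
    fun s hs => (hφ₁ s hs).continuousAt.continuousWithinAt
  have hφ₂c : ContinuousOn φ₂ (Set.Icc u v) :=
    fun s hs => (hφ₂ s hs).continuousAt.continuousWithinAt
  have hac : ContinuousOn a (Set.Icc u v) := fun s hs => (ha s hs).continuousAt.continuousWithinAt
  have ha₁c : ContinuousOn a₁ (Set.Icc u v) :=
    fun s hs => (ha₁ s hs).continuousAt.continuousWithinAt
  set b : ℝ → ℂ := fun s => a₁ s / φ₁ s - a s * φ₂ s / φ₁ s ^ 2 with hb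
  set b₁ : ℝ → ℂ := fun s => a₂ s / φ₁ s - 2 * a₁ s * φ₂ s / φ₁ s ^ 2 - a s * φ₃ s / φ₁ s ^ 2 +
    2 * a s * φ₂ s ^ 2 / φ₁ s ^ 3 with hb₁
  have hbd : ∀ s ∈ Set.Icc u v, HasDerivAt b (b₁ s) s := by
    intro s hs
    have hc1 := (hφ₁ s hs).ofReal_comp
    have hc2 := (hφ₂ s hs).ofReal_comp
    have := ((ha₁ s hs).div hc1 (h0' s hs)).sub
      (((ha s hs).mul hc2).div (hc1.pow 2) (pow_ne_zero 2 (h0' s hs)))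
    refine this.congr_deriv ?_
    have := h0' s hs
    simp only [hb₁, Pi.mul_apply, Pi.pow_apply]
    field_simp
    push_cast
    ring
  have hF₁ := Complex.continuous_ofReal.comp_continuousOn hφ₁c
  have hF₂ := Complex.continuous_ofReal.comp_continuousOn hφ₂c
  have hF₃ := Complex.continuous_ofReal.comp_continuousOn hφ₃
  have hb₁c : ContinuousOn b₁ (Set.Icc u v) := by
    refine ((((ha₂.div hF₁ h0').sub (((continuousOn_const.mul ha₁c).mul hF₂).div (hF₁.pow 2)
      fun s hs => pow_ne_zero _ (h0' s hs))).sub ((hac.mul hF₃).div (hF₁.pow 2)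
      fun s hs => pow_ne_zero _ (h0' s hs))).add
      (((continuousOn_const.mul hac).mul (hF₂.pow 2)).div (hF₁.pow 3)
      fun s hs => pow_ne_zero _ (h0' s hs)))
  rw [oscillatory_integral_by_parts huv hφ hφ₁ hφ₂c ha ha₁c h0,
    oscillatory_integral_by_parts huv hφ hφ₁ hφ₂c hbd hb₁c h0]
  simp only [hb, hau, hav, hau₁, hav₁, zero_div, zero_mul, mul_zero, sub_zero, zero_add, norm_mul,
    Complex.norm_I, one_mul]
  refine (intervalIntegral.norm_integral_le_of_norm_le_const
    (C := (1 + 4 * C + 3 * C ^ 2) * M / Y ^ 2) ?_).trans (le_of_eq ?_)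
  swap
  · rw [abs_of_nonneg (by linarith)]; ring
  intro s hs
  rw [Set.uIoc_of_le huv] at hs
  have hs : s ∈ Set.Icc u v := Set.Ioc_subset_Icc_self hs
  rw [norm_mul, norm_cexp_I_mul_ofReal, one_mul]
  set y := |φ₁ s| with hy
  have hyY := h1 s hs
  have hy0 : 0 < y := hY.trans_le hyY
  have g0 := hM s hs
  have g1 := hM₁ s hs
  have g2 := hM₂ s hs
  have p2 : |φ₂ s| ≤ C * y := (h2 s hs).trans (by gcongr)
  have p3 : |φ₃ s| ≤ C * y := (h3 s hs).trans (by gcongr)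
  have e1 : ‖b s‖ ≤ M * (1 + C) / y := by
    calc ‖b s‖ ≤ ‖a₁ s‖ / y + ‖a s‖ * |φ₂ s| / y ^ 2 := by
          refine (norm_sub_le _ _).trans (le_of_eq ?_)
          simp [hy]
      _ ≤ M / y + M * (C * y) / y ^ 2 := by gcongr
      _ = _ := by field_simp
  have e2 : ‖b₁ s‖ ≤ M * (1 + 3 * C + 2 * C ^ 2) / y := by
    calc ‖b₁ s‖ ≤ ‖a₂ s‖ / y + 2 * ‖a₁ s‖ * |φ₂ s| / y ^ 2 + ‖a s‖ * |φ₃ s| / y ^ 2 +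
          2 * ‖a s‖ * |φ₂ s| ^ 2 / y ^ 3 := by
          refine (norm_add_le _ _).trans (add_le_add ((norm_sub_le _ _).trans
            (add_le_add ((norm_sub_le _ _).trans (le_of_eq ?_)) (le_of_eq ?_))) (le_of_eq ?_)) <;>
          simp [hy]
      _ ≤ M / y + 2 * M * (C * y) / y ^ 2 + M * (C * y) / y ^ 2 + 2 * M * (C * y) ^ 2 / y ^ 3 := by
          gcongr
      _ = _ := by field_simp; ring
  calc ‖b₁ s / φ₁ s - b s * φ₂ s / φ₁ s ^ 2‖ ≤ ‖b₁ s‖ / y + ‖b s‖ * |φ₂ s| / y ^ 2 := by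
        refine (norm_sub_le _ _).trans (le_of_eq ?_)
        simp [hy]
    _ ≤ (M * (1 + 3 * C + 2 * C ^ 2) / y) / y + (M * (1 + C) / y) * (C * y) / y ^ 2 := by gcongr
    _ = (1 + 4 * C + 3 * C ^ 2) * M / y ^ 2 := by field_simp; ring
    _ ≤ _ := by gcongr

/-- A piece of a van der Corput estimate, at distance `δ` from the almost stationary point. -/
theorem norm_oscillatory_integral_le_off_stationary {φ φ₁ φ₂ : ℝ → ℝ} {a a₁ : ℝ → ℂ}
    {u v m κ M δ s₀ : ℝ} (huv : u ≤ v) (hm : 0 < m) (hκ : 0 ≤ κ) (hδ : 0 < δ)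
    (hφ : ∀ s ∈ Set.Icc u v, HasDerivAt φ (φ₁ s) s)
    (hφ₁ : ∀ s ∈ Set.Icc u v, HasDerivAt φ₁ (φ₂ s) s) (hφ₂ : ContinuousOn φ₂ (Set.Icc u v))
    (ha : ∀ s ∈ Set.Icc u v, HasDerivAt a (a₁ s) s) (ha₁ : ContinuousOn a₁ (Set.Icc u v))
    (h1 : ∀ s ∈ Set.Icc u v, m / 2 * |s - s₀| ≤ |φ₁ s|) (hs₀ : ∀ s ∈ Set.Icc u v, δ ≤ |s - s₀|)
    (h2 : ∀ s ∈ Set.Icc u v, |φ₂ s| ≤ κ * m)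
    (hM : ∀ s ∈ Set.Icc u v, ‖a s‖ ≤ M) (hM₁ : ∀ s ∈ Set.Icc u v, ‖a₁ s‖ ≤ M) :
    ‖∫ s in u..v, Complex.exp (Complex.I * φ s) * a s‖ ≤
      (4 + 2 * (v - u) + 8 * κ) * M / (m * δ) := by
  have hM0 : 0 ≤ M := (norm_nonneg _).trans (hM u ⟨le_rfl, huv⟩)
  have hlow : ∀ s ∈ Set.Icc u v, m / 2 * δ ≤ |φ₁ s| := fun s hs =>
    (mul_le_mul_of_nonneg_left (hs₀ s hs) (by positivity)).trans (h1 s hs)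
  have h0 : ∀ s ∈ Set.Icc u v, φ₁ s ≠ 0 := fun s hs h => by
    have := hlow s hs; rw [h, abs_zero] at this
    have : 0 < m / 2 * δ := by positivity
    linarith
  have hne : ∀ s ∈ Set.Icc u v, s - s₀ ≠ 0 := fun s hs h => by
    have := hs₀ s hs; rw [h, abs_zero] at this; linarith
  rw [oscillatory_integral_by_parts huv hφ hφ₁ hφ₂ ha ha₁ h0]
  have hbd : ∀ s ∈ Set.Icc u v,
      ‖Complex.exp (Complex.I * φ s) * (a s / (Complex.I * φ₁ s))‖ ≤ 2 * M / (m * δ) := by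
    intro s hs
    rw [norm_mul, norm_cexp_I_mul_ofReal, one_mul, norm_div, norm_mul, Complex.norm_I, one_mul,
      Complex.norm_real, Real.norm_eq_abs]
    calc ‖a s‖ / |φ₁ s| ≤ M / (m / 2 * δ) := by
          have := hM s hs
          have := hlow s hs
          gcongr
      _ = _ := by field_simp
  have hint : ∫ s in u..v, ((s - s₀) ^ 2)⁻¹ = (u - s₀)⁻¹ - (v - s₀)⁻¹ := by
    rw [intervalIntegral.integral_eq_sub_of_hasDerivAt (f := fun s => -(s - s₀)⁻¹)]
    · ring
    · intro s hs
      rw [Set.uIcc_of_le huv] at hs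
      have := (((hasDerivAt_id s).sub_const s₀).inv (hne s hs)).neg
      refine this.congr_deriv ?_
      simp [neg_div]
    · apply ContinuousOn.intervalIntegrable
      rw [Set.uIcc_of_le huv]
      exact ContinuousOn.inv₀ (by fun_prop) fun s hs => pow_ne_zero 2 (hne s hs)
  have hinv : ∀ s ∈ Set.Icc u v, |(s - s₀)⁻¹| ≤ 1 / δ := fun s hs => by
    rw [abs_inv, one_div]
    exact inv_anti₀ hδ (hs₀ s hs)
  have hmain : ‖∫ s in u..v, Complex.exp (Complex.I * φ s) *
        (a₁ s / φ₁ s - a s * φ₂ s / φ₁ s ^ 2)‖ ≤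
      ∫ s in u..v, (2 * M / (m * δ) + 4 * κ * M / m * ((s - s₀) ^ 2)⁻¹) := by
    refine intervalIntegral.norm_integral_le_of_norm_le huv (.of_forall fun s hs => ?_) ?_
    · have hs : s ∈ Set.Icc u v := Set.Ioc_subset_Icc_self hs
      rw [norm_mul, norm_cexp_I_mul_ofReal, one_mul]
      have g1 := h1 s hs
      have g2 := hlow s hs
      have g3 := h2 s hs
      have g4 := hM s hs
      have g5 := hM₁ s hs
      have g6 : 0 < |s - s₀| := abs_pos.2 (hne s hs)
      calc ‖a₁ s / φ₁ s - a s * φ₂ s / φ₁ s ^ 2‖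
          ≤ ‖a₁ s‖ / |φ₁ s| + ‖a s‖ * |φ₂ s| / |φ₁ s| ^ 2 := by
            refine (norm_sub_le _ _).trans (le_of_eq ?_)
            simp
        _ ≤ M / (m / 2 * δ) + M * (κ * m) / (m / 2 * |s - s₀|) ^ 2 := by gcongr
        _ = _ := by
            rw [mul_pow, sq_abs]
            have := hne s hs
            field_simp; ring
    · apply ContinuousOn.intervalIntegrable
      rw [Set.uIcc_of_le huv]
      exact continuousOn_const.add (continuousOn_const.mul
        (ContinuousOn.inv₀ (by fun_prop) fun s hs => pow_ne_zero 2 (hne s hs)))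
  have hval : ∫ s in u..v, (2 * M / (m * δ) + 4 * κ * M / m * ((s - s₀) ^ 2)⁻¹) ≤
      2 * M / (m * δ) * (v - u) + 4 * κ * M / m * (2 / δ) := by
    rw [intervalIntegral.integral_add (by simp), intervalIntegral.integral_const,
      intervalIntegral.integral_const_mul, hint, smul_eq_mul, mul_comm (v - u)]
    · gcongr
      have g1 := hinv u ⟨le_rfl, huv⟩
      have g2 := hinv v ⟨huv, le_rfl⟩
      calc _ ≤ |(u - s₀)⁻¹| + |(v - s₀)⁻¹| := (le_abs_self _).trans (abs_sub _ _)
        _ ≤ 1 / δ + 1 / δ := add_le_add g1 g2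
        _ = _ := by ring
    · apply ContinuousOn.intervalIntegrable
      rw [Set.uIcc_of_le huv]
      exact (continuousOn_const.mul
        (ContinuousOn.inv₀ (by fun_prop) fun s hs => pow_ne_zero 2 (hne s hs)))
  refine (norm_add_le _ _).trans ?_
  rw [norm_mul, Complex.norm_I, one_mul]
  calc _ ≤ (2 * M / (m * δ) + 2 * M / (m * δ)) +
        (2 * M / (m * δ) * (v - u) + 4 * κ * M / m * (2 / δ)) :=
        add_le_add ((norm_sub_le _ _).trans (add_le_add (hbd v ⟨huv, le_rfl⟩)
          (hbd u ⟨le_rfl, huv⟩))) (hmain.trans hval)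
    _ = _ := by field_simp; ring

/-- Van der Corput's second derivative estimate, with an amplitude. -/
theorem norm_oscillatory_integral_le_of_second_deriv {φ φ₁ φ₂ : ℝ → ℝ} {a a₁ : ℝ → ℂ}
    {u v m κ M : ℝ} (huv : u ≤ v) (hm : 0 < m) (hκ : 0 ≤ κ)
    (hφ : ∀ s ∈ Set.Icc u v, HasDerivAt φ (φ₁ s) s)
    (hφ₁ : ∀ s ∈ Set.Icc u v, HasDerivAt φ₁ (φ₂ s) s) (hφ₂ : ContinuousOn φ₂ (Set.Icc u v))
    (ha : ∀ s ∈ Set.Icc u v, HasDerivAt a (a₁ s) s) (ha₁ : ContinuousOn a₁ (Set.Icc u v))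
    (h1 : ∀ s ∈ Set.Icc u v, m ≤ |φ₂ s|) (h2 : ∀ s ∈ Set.Icc u v, |φ₂ s| ≤ κ * m)
    (hM : ∀ s ∈ Set.Icc u v, ‖a s‖ ≤ M) (hM₁ : ∀ s ∈ Set.Icc u v, ‖a₁ s‖ ≤ M) :
    ‖∫ s in u..v, Complex.exp (Complex.I * φ s) * a s‖ ≤
      (10 + 4 * (v - u) + 16 * κ) * M * m ^ (-(1 / 2) : ℝ) := by
  have hM0 : 0 ≤ M := (norm_nonneg _).trans (hM u ⟨le_rfl, huv⟩)
  have hφ₁c : ContinuousOn φ₁ (Set.Icc u v) :=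
    fun s hs => (hφ₁ s hs).continuousAt.continuousWithinAt
  -- `φ₁` need not vanish at `s₀`. The mean value theorem gives `m |s - s₀| ≤ |φ₁ s - φ₁ s₀|`, and
  -- by minimality the right side is at most `2 |φ₁ s|`.
  obtain ⟨s₀, hs₀, hmin⟩ := isCompact_Icc.exists_isMinOn (Set.nonempty_Icc.2 huv) hφ₁c.abs
  have hmvt : ∀ s ∈ Set.Icc u v, m * |s - s₀| ≤ |φ₁ s - φ₁ s₀| := by
    have aux : ∀ x ∈ Set.Icc u v, ∀ y ∈ Set.Icc u v, x < y → m * |y - x| ≤ |φ₁ y - φ₁ x| := by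
      intro x hx y hy hxy
      have hsub : Set.Icc x y ⊆ Set.Icc u v := Set.Icc_subset_Icc hx.1 hy.2
      obtain ⟨c, hc, hce⟩ := exists_hasDerivAt_eq_slope φ₁ φ₂ hxy (hφ₁c.mono hsub)
        fun z hz => hφ₁ z (hsub (Set.Ioo_subset_Icc_self hz))
      have hyx : y - x ≠ 0 := by linarith
      have : φ₁ y - φ₁ x = φ₂ c * (y - x) := by rw [hce]; field_simp
      rw [this, abs_mul]
      gcongr
      exact h1 c (hsub (Set.Ioo_subset_Icc_self hc))
    intro s hs
    rcases lt_trichotomy s s₀ with h | h | h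
    · rw [abs_sub_comm, abs_sub_comm (φ₁ s)]; exact aux s hs s₀ hs₀ h
    · simp [h]
    · exact aux s₀ hs₀ s hs h
  have hlow : ∀ s ∈ Set.Icc u v, m / 2 * |s - s₀| ≤ |φ₁ s| := by
    intro s hs
    have e1 := hmvt s hs
    have e2 : |φ₁ s₀| ≤ |φ₁ s| := hmin hs
    have e3 := abs_sub (φ₁ s) (φ₁ s₀)
    linarith
  -- Balances the trivial bound `δ` near `s₀` with the bound `1 / (m δ)` away from it.
  set δ := m ^ (-(1 / 2) : ℝ) with hδd
  have hδ : 0 < δ := by positivity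
  have hmδ : m * δ * δ = 1 := by
    rw [mul_assoc, hδd, ← rpow_add hm]; norm_num
    rw [rpow_neg_one]; exact mul_inv_cancel₀ hm.ne'
  have hmδ' : 1 / (m * δ) = δ := by field_simp; linarith
  set p := max u (s₀ - δ) with hp
  set r := min v (s₀ + δ) with hr
  have hup : u ≤ p := le_max_left _ _
  have hrv : r ≤ v := min_le_left _ _
  have hps : p ≤ s₀ := max_le hs₀.1 (by linarith)
  have hsr : s₀ ≤ r := le_min hs₀.2 (by linarith)
  have hcont : ContinuousOn (fun s => Complex.exp (Complex.I * φ s) * a s) (Set.Icc u v) :=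
    fun s hs => (((hasDerivAt_cexp_I_mul (hφ s hs)).continuousAt).mul
      (ha s hs).continuousAt).continuousWithinAt
  have hII : ∀ x y, u ≤ x → x ≤ y → y ≤ v → IntervalIntegrable
      (fun s => Complex.exp (Complex.I * φ s) * a s) volume x y := fun x y hx hxy hy => by
    apply ContinuousOn.intervalIntegrable
    rw [Set.uIcc_of_le hxy]; exact hcont.mono (Set.Icc_subset_Icc hx hy)
  have hpiece : ∀ x y, u ≤ x → x ≤ y → y ≤ v → (∀ s ∈ Set.Icc x y, δ ≤ |s - s₀|) →
      ‖∫ s in x..y, Complex.exp (Complex.I * φ s) * a s‖ ≤ (4 + 2 * (v - u) + 8 * κ) * M * δ := by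
    intro x y hx hxy hy hd
    have hsub : Set.Icc x y ⊆ Set.Icc u v := Set.Icc_subset_Icc hx hy
    refine (norm_oscillatory_integral_le_off_stationary hxy hm hκ hδ (fun s hs => hφ s (hsub hs))
      (fun s hs => hφ₁ s (hsub hs)) (hφ₂.mono hsub) (fun s hs => ha s (hsub hs)) (ha₁.mono hsub)
      (fun s hs => hlow s (hsub hs)) hd (fun s hs => h2 s (hsub hs)) (fun s hs => hM s (hsub hs))
      (fun s hs => hM₁ s (hsub hs))).trans ?_
    rw [div_eq_mul_one_div, hmδ']
    gcongr
  have hL : ‖∫ s in u..p, Complex.exp (Complex.I * φ s) * a s‖ ≤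
      (4 + 2 * (v - u) + 8 * κ) * M * δ := by
    rcases max_choice u (s₀ - δ) with h | h
    · rw [hp, h, intervalIntegral.integral_same, norm_zero]
      have : 0 ≤ v - u := by linarith
      positivity
    · refine hpiece u p le_rfl hup (hps.trans hs₀.2) fun s hs => ?_
      rw [hp, h] at hs
      rw [abs_sub_comm]
      exact (by linarith [hs.2] : δ ≤ s₀ - s).trans (le_abs_self _)
  have hR : ‖∫ s in r..v, Complex.exp (Complex.I * φ s) * a s‖ ≤
      (4 + 2 * (v - u) + 8 * κ) * M * δ := by
    rcases min_choice v (s₀ + δ) with h | h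
    · rw [hr, h, intervalIntegral.integral_same, norm_zero]
      have : 0 ≤ v - u := by linarith
      positivity
    · refine hpiece r v (hs₀.1.trans hsr) hrv le_rfl fun s hs => ?_
      rw [hr, h] at hs
      exact (by linarith [hs.1] : δ ≤ s - s₀).trans (le_abs_self _)
  have hMid : ‖∫ s in p..r, Complex.exp (Complex.I * φ s) * a s‖ ≤ M * (2 * δ) := by
    refine (intervalIntegral.norm_integral_le_of_norm_le_const (C := M) fun s hs => ?_).trans ?_
    · rw [Set.uIoc_of_le (hps.trans hsr)] at hs
      rw [norm_mul, norm_cexp_I_mul_ofReal, one_mul]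
      exact hM s ⟨hup.trans hs.1.le, hs.2.trans hrv⟩
    · rw [abs_of_nonneg (by linarith)]
      gcongr
      have := le_max_right u (s₀ - δ)
      have := min_le_right v (s₀ + δ)
      linarith
  rw [← intervalIntegral.integral_add_adjacent_intervals
      (hII u p le_rfl hup (hps.trans hs₀.2)) (hII p v hup (hps.trans hs₀.2) le_rfl),
    ← intervalIntegral.integral_add_adjacent_intervals
      (hII p r hup (hps.trans hsr) hrv) (hII r v (hs₀.1.trans hsr) hrv le_rfl)]
  calc _ ≤ _ := (norm_add_le _ _).trans (add_le_add hL ((norm_add_le _ _).trans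
        (add_le_add hMid hR)))
    _ = _ := by ring

/-! ### The Bessel function of order zero: amplitude and phase -/

/-- `B` is twice differentiable and decays like a symbol of order `-κ`. -/
def HasSymbolBounds (κ : ℝ) (B : ℝ → ℂ) : Prop :=
  ∃ (B₁ B₂ : ℝ → ℂ) (C : ℝ), 0 ≤ C ∧ (∀ σ, HasDerivAt B (B₁ σ) σ) ∧ (∀ σ, HasDerivAt B₁ (B₂ σ) σ) ∧
    Continuous B₂ ∧ ∀ σ, ‖B σ‖ ≤ C * (1 + |σ|) ^ (-κ) ∧ |σ| * ‖B₁ σ‖ ≤ C * (1 + |σ|) ^ (-κ) ∧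
      |σ| ^ 2 * ‖B₂ σ‖ ≤ C * (1 + |σ|) ^ (-κ)

theorem hasSymbolBounds_one : HasSymbolBounds 0 (fun _ => 1) :=
  ⟨fun _ => 0, fun _ => 0, 1, zero_le_one, fun σ => hasDerivAt_const _ _,
    fun σ => hasDerivAt_const _ _, continuous_const, fun σ => by simp⟩

/-- The stationary points `0` and `π` of `cos` are nondegenerate. On the outer thirds of `[0, π]`
the second derivative test applies since `|cos| ≥ 1/2`; on the middle third `sin ≥ 1/2` and the
phase is non-stationary. -/
theorem exists_norm_integral_cos_phase_le {A : ℝ → ℂ} (hA : ContDiff ℝ 1 A) :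
    ∃ C, 0 ≤ C ∧ ∀ σ : ℝ, 1 ≤ |σ| →
      ‖∫ θ in 0..π, Complex.exp (Complex.I * ((σ * cos θ : ℝ) : ℂ)) * A θ‖ ≤
        C * |σ| ^ (-(1 / 2) : ℝ) := by
  obtain ⟨M₀, hM₀⟩ := (isCompact_Icc (a := 0) (b := π)).exists_bound_of_continuousOn
    hA.continuous.continuousOn
  obtain ⟨M₁, hM₁⟩ := (isCompact_Icc (a := 0) (b := π)).exists_bound_of_continuousOn
    (hA.continuous_deriv le_rfl).continuousOn
  set M := max M₀ M₁
  have hπ := pi_pos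
  have hπ3 : π < 3.15 := pi_lt_d2
  have hπ3' : 3.14 < π := pi_gt_d2
  have hM0 : 0 ≤ M := ((norm_nonneg _).trans (hM₀ 0 ⟨le_rfl, hπ.le⟩)).trans (le_max_left _ _)
  refine ⟨400 * M, by positivity, fun σ hσ => ?_⟩
  have hσ0 : 0 < |σ| := by linarith
  have hφ : ∀ θ : ℝ, HasDerivAt (fun θ => σ * cos θ) (-σ * sin θ) θ := fun θ =>
    ((hasDerivAt_cos θ).const_mul σ).congr_deriv (by ring)
  have hφ₁ : ∀ θ : ℝ, HasDerivAt (fun θ => -σ * sin θ) (-σ * cos θ) θ := fun θ =>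
    (hasDerivAt_sin θ).const_mul (-σ)
  have hAd : ∀ θ, HasDerivAt A (deriv A θ) θ := fun θ =>
    (hA.differentiable (by norm_num) θ).hasDerivAt
  have hM : ∀ θ ∈ Set.Icc 0 π, ‖A θ‖ ≤ M := fun θ h => (hM₀ θ h).trans (le_max_left _ _)
  have hM' : ∀ θ ∈ Set.Icc 0 π, ‖deriv A θ‖ ≤ M := fun θ h => (hM₁ θ h).trans (le_max_right _ _)
  have hvdc : ∀ u v, 0 ≤ u → u ≤ v → v ≤ π → (∀ θ ∈ Set.Icc u v, 1 / 2 ≤ |cos θ|) →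
      ‖∫ θ in u..v, Complex.exp (Complex.I * ((σ * cos θ : ℝ) : ℂ)) * A θ‖ ≤
        (10 + 4 * (v - u) + 16 * 2) * M * (|σ| / 2) ^ (-(1 / 2) : ℝ) := by
    intro u v hu huv hv hc
    have hsub : Set.Icc u v ⊆ Set.Icc 0 π := Set.Icc_subset_Icc hu hv
    refine norm_oscillatory_integral_le_of_second_deriv huv (by positivity) (by norm_num)
      (fun θ _ => hφ θ) (fun θ _ => hφ₁ θ) (by fun_prop) (fun θ _ => hAd θ)
      (hA.continuous_deriv le_rfl).continuousOn (fun θ h => ?_) (fun θ h => ?_)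
      (fun θ h => hM θ (hsub h)) (fun θ h => hM' θ (hsub h))
    · rw [abs_mul, abs_neg]; have := hc θ h; nlinarith
    · rw [abs_mul, abs_neg]; have := abs_cos_le_one θ; nlinarith
  have hcos3 : cos (π / 3) = 1 / 2 := cos_pi_div_three
  have hcos23 : cos (2 * π / 3) = -(1 / 2) := by
    rw [show 2 * π / 3 = π - π / 3 by ring, cos_pi_sub, hcos3]
  have h1 := hvdc 0 (π / 3) le_rfl (by linarith) (by linarith) fun θ h => by
    have := cos_le_cos_of_nonneg_of_le_pi h.1 (by linarith) h.2
    rw [hcos3] at this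
    exact this.trans (le_abs_self _)
  have h3 := hvdc (2 * π / 3) π (by linarith) (by linarith) le_rfl fun θ h => by
    have := cos_le_cos_of_nonneg_of_le_pi (by linarith) h.2 h.1
    rw [hcos23] at this
    exact (by linarith : 1 / 2 ≤ -cos θ).trans (neg_le_abs _)
  have h2 : ‖∫ θ in (π / 3)..(2 * π / 3), Complex.exp (Complex.I * ((σ * cos θ : ℝ) : ℂ)) * A θ‖ ≤
      (4 + 2 * (2 * π / 3 - π / 3) + 8 * 4) * M / (|σ| / 4 * 1) := by
    have hsub : Set.Icc (π / 3) (2 * π / 3) ⊆ Set.Icc 0 π :=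
      Set.Icc_subset_Icc (by linarith) (by linarith)
    -- No point is stationary here; `s₀ = 0` merely lies at distance at least `1` from the interval,
    -- as `π / 3 ≥ 1`, and `m = |σ| / 4` is small enough for the slope bound up to `θ ≤ 2.1`.
    refine norm_oscillatory_integral_le_off_stationary (s₀ := 0) (by linarith) (by positivity)
      (by norm_num) one_pos
      (fun θ _ => hφ θ) (fun θ _ => hφ₁ θ) (by fun_prop) (fun θ _ => hAd θ)
      (hA.continuous_deriv le_rfl).continuousOn (fun θ h => ?_) (fun θ h => ?_) (fun θ h => ?_)
      (fun θ h => hM θ (hsub h)) (fun θ h => hM' θ (hsub h))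
    · have c1 := cos_le_cos_of_nonneg_of_le_pi (by linarith) (by linarith [h.2]) h.1
      have c2 := cos_le_cos_of_nonneg_of_le_pi (by linarith [h.1]) (by linarith) h.2
      rw [hcos3] at c1
      rw [hcos23] at c2
      have hs : 0 ≤ sin θ := sin_nonneg_of_nonneg_of_le_pi (by linarith [h.1]) (by linarith [h.2])
      have hs2 : 1 / 2 ≤ sin θ := by nlinarith [sin_sq_add_cos_sq θ]
      rw [sub_zero, abs_mul, abs_neg, abs_of_nonneg hs,
        abs_of_nonneg (show 0 ≤ θ by linarith [h.1])]
      have : θ ≤ 2.1 := by linarith [h.2]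
      nlinarith
    · rw [sub_zero, abs_of_nonneg (show 0 ≤ θ by linarith [h.1])]; linarith [h.1]
    · rw [abs_mul, abs_neg]; have := abs_cos_le_one θ; nlinarith
  have hII : ∀ x y, IntervalIntegrable
      (fun θ => Complex.exp (Complex.I * ((σ * cos θ : ℝ) : ℂ)) * A θ) volume x y := fun x y => by
    apply Continuous.intervalIntegrable
    have := hA.continuous
    fun_prop
  rw [← intervalIntegral.integral_add_adjacent_intervals (hII 0 (π / 3)) (hII (π / 3) π),
    ← intervalIntegral.integral_add_adjacent_intervals (hII (π / 3) (2 * π / 3))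
      (hII (2 * π / 3) π)]
  have hpow : (|σ| / 2) ^ (-(1 / 2) : ℝ) ≤ 2 * |σ| ^ (-(1 / 2) : ℝ) := by
    rw [div_rpow hσ0.le (by norm_num), div_eq_mul_inv, mul_comm, ← rpow_neg (by norm_num), neg_neg]
    gcongr
    calc (2 : ℝ) ^ (1 / 2 : ℝ) ≤ 2 ^ (1 : ℝ) :=
          rpow_le_rpow_of_exponent_le (by norm_num) (by norm_num)
      _ = 2 := rpow_one _
  have hinv : |σ|⁻¹ ≤ |σ| ^ (-(1 / 2) : ℝ) := by
    rw [← rpow_neg_one]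
    exact rpow_le_rpow_of_exponent_le hσ (by norm_num)
  have hp0 : 0 ≤ |σ| ^ (-(1 / 2) : ℝ) := by positivity
  have h2' : (4 + 2 * (2 * π / 3 - π / 3) + 8 * 4) * M / (|σ| / 4 * 1) ≤
      160 * M * |σ| ^ (-(1 / 2) : ℝ) := by
    calc _ = 4 * (4 + 2 * (2 * π / 3 - π / 3) + 8 * 4) * M * |σ|⁻¹ := by field_simp
      _ ≤ 160 * M * |σ| ^ (-(1 / 2) : ℝ) := by
        gcongr
        linarith
  have h1' : (10 + 4 * (π / 3 - 0) + 16 * 2) * M * (|σ| / 2) ^ (-(1 / 2) : ℝ) ≤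
      47 * M * (2 * |σ| ^ (-(1 / 2) : ℝ)) := by gcongr; linarith
  have h3' : (10 + 4 * (π - 2 * π / 3) + 16 * 2) * M * (|σ| / 2) ^ (-(1 / 2) : ℝ) ≤
      47 * M * (2 * |σ| ^ (-(1 / 2) : ℝ)) := by gcongr; linarith
  refine (norm_add_le _ _).trans ((add_le_add (h1.trans h1') ((norm_add_le _ _).trans
    (add_le_add (h2.trans h2') (h3.trans h3')))).trans ?_)
  have : 0 ≤ M * |σ| ^ (-(1 / 2) : ℝ) := by positivity
  linarith

/-- A factor `sin θ` is the derivative of the phase up to the factor `-σ`, so each such factor can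
be traded for one power of `1 / σ`. -/
theorem integral_cos_phase_sin_mul {D D' : ℝ → ℂ} (hD : ∀ θ, HasDerivAt D (D' θ) θ)
    (hD' : Continuous D') (h0 : D 0 = 0) (hπ : D π = 0) {σ : ℝ} (hσ : σ ≠ 0) :
    ∫ θ in 0..π, Complex.exp (Complex.I * ((σ * cos θ : ℝ) : ℂ)) * ((sin θ : ℂ) * D θ) =
      (Complex.I * σ)⁻¹ * ∫ θ in 0..π, Complex.exp (Complex.I * ((σ * cos θ : ℝ) : ℂ)) * D' θ := by
  have hσ' : (σ : ℂ) ≠ 0 := by exact_mod_cast hσ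
  have hDc : Continuous D := continuous_iff_continuousAt.2 fun θ => (hD θ).continuousAt
  have hd : ∀ θ ∈ Set.uIcc 0 π, HasDerivAt
      (fun θ => Complex.exp (Complex.I * ((σ * cos θ : ℝ) : ℂ)) * D θ)
      (Complex.exp (Complex.I * ((σ * cos θ : ℝ) : ℂ)) * D' θ - Complex.I * σ *
        (Complex.exp (Complex.I * ((σ * cos θ : ℝ) : ℂ)) * ((sin θ : ℂ) * D θ))) θ := by
    intro θ _
    have h1 : HasDerivAt (fun θ => σ * cos θ) (-σ * sin θ) θ :=
      ((hasDerivAt_cos θ).const_mul σ).congr_deriv (by ring)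
    refine ((hasDerivAt_cexp_I_mul h1).mul (hD θ)).congr_deriv ?_
    push_cast; ring
  have hi1 : IntervalIntegrable (fun θ => Complex.exp (Complex.I * ((σ * cos θ : ℝ) : ℂ)) * D' θ)
      volume 0 π := Continuous.intervalIntegrable (by fun_prop) _ _
  have hi2 : IntervalIntegrable (fun θ => Complex.I * σ *
      (Complex.exp (Complex.I * ((σ * cos θ : ℝ) : ℂ)) * ((sin θ : ℂ) * D θ))) volume 0 π :=
    Continuous.intervalIntegrable (by fun_prop) _ _
  have := intervalIntegral.integral_eq_sub_of_hasDerivAt hd (hi1.sub hi2)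
  rw [intervalIntegral.integral_sub hi1 hi2, intervalIntegral.integral_const_mul, h0, hπ] at this
  simp only [mul_zero, sub_zero] at this
  rw [sub_eq_zero.1 this]
  field_simp

theorem hasDerivAt_integral_exp_mul {κ A : ℝ → ℂ} (hκ : Continuous κ) (hA : Continuous A)
    (a b σ : ℝ) :
    HasDerivAt (fun σ : ℝ => ∫ θ in a..b, Complex.exp (σ * κ θ) * A θ)
      (∫ θ in a..b, Complex.exp (σ * κ θ) * (κ θ * A θ)) σ := by
  refine (intervalIntegral.hasDerivAt_integral_of_dominated_loc_of_deriv_le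
    (F' := fun (σ : ℝ) θ => Complex.exp (σ * κ θ) * (κ θ * A θ))
    (bound := fun θ => Real.exp ((|σ| + 1) * ‖κ θ‖) * (‖κ θ‖ * ‖A θ‖))
    (s := Metric.ball σ 1) (Metric.ball_mem_nhds σ one_pos) ?_ ?_ ?_ ?_ ?_ ?_).2
  · exact .of_forall fun x => (Continuous.aestronglyMeasurable (by fun_prop))
  · exact Continuous.intervalIntegrable (by fun_prop) _ _
  · exact Continuous.aestronglyMeasurable (by fun_prop)
  · refine .of_forall fun θ _ x hx => ?_
    rw [norm_mul, norm_mul, Complex.norm_exp]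
    gcongr
    refine (Complex.re_le_norm _).trans ?_
    rw [norm_mul, Complex.norm_real]
    gcongr
    rw [Metric.mem_ball, Real.dist_eq] at hx
    have := abs_sub_abs_le_abs_sub x σ
    rw [Real.norm_eq_abs]; linarith
  · exact Continuous.intervalIntegrable (by fun_prop) _ _
  · refine .of_forall fun θ _ x _ => ?_
    have h1 : HasDerivAt (fun x : ℝ => (x : ℂ) * κ θ) (κ θ) x := by
      simpa using (Complex.ofRealCLM.hasDerivAt (x := x)).mul_const (κ θ)
    exact (h1.cexp.mul_const (A θ)).congr_deriv (by ring)

/-- The partition of unity `P(u) + P(-u) = 1` that separates the two stationary points. -/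
noncomputable def besselCutoff (u : ℂ) : ℂ := (1 + u) ^ 2 * (2 - u) / 4

/-- The amplitude of the Bessel function of order zero. -/
noncomputable def besselAmplitude (σ : ℝ) : ℂ :=
  2 * ∫ θ in 0..π, Complex.exp (σ * (-Complex.I * (1 - (cos θ : ℂ)))) *
    besselCutoff (cos θ : ℂ)

theorem besselAmplitude_phase_eq (σ : ℝ) (A : ℝ → ℂ) :
    ∫ θ in 0..π, Complex.exp (σ * (-Complex.I * (1 - (cos θ : ℂ)))) * A θ =
      Complex.exp (-(Complex.I * σ)) *
        ∫ θ in 0..π, Complex.exp (Complex.I * ((σ * cos θ : ℝ) : ℂ)) * A θ := by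
  rw [← intervalIntegral.integral_const_mul]
  congr 1 with θ
  rw [← mul_assoc (Complex.exp (-(Complex.I * σ))), ← Complex.exp_add]
  congr 2; push_cast; ring

/-- The left side is `2π J₀(s)`. The cutoff isolates the stationary point `θ = 0`; the complementary
part, around `θ = π`, becomes the same integral at `-s` under `θ ↦ π - θ`. -/
theorem integral_exp_cos_eq (s : ℝ) :
    2 * ∫ θ in 0..π, Complex.exp (Complex.I * ((s * cos θ : ℝ) : ℂ)) =
      Complex.exp (Complex.I * s) * besselAmplitude s +
        Complex.exp (-(Complex.I * s)) * besselAmplitude (-s) := by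
  unfold besselAmplitude
  rw [besselAmplitude_phase_eq, besselAmplitude_phase_eq]
  have hflip : ∫ θ in 0..π, Complex.exp (Complex.I * ((-s * cos θ : ℝ) : ℂ)) *
      besselCutoff (cos θ : ℂ) = ∫ θ in 0..π, Complex.exp (Complex.I * ((s * cos θ : ℝ) : ℂ)) *
      besselCutoff (-(cos θ : ℂ)) := by
    have := intervalIntegral.integral_comp_sub_left (a := 0) (b := π) (fun θ =>
      Complex.exp (Complex.I * ((-s * cos θ : ℝ) : ℂ)) * besselCutoff (cos θ : ℂ)) π
    simp only [sub_zero, sub_self] at this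
    rw [← this]
    congr 1 with θ
    rw [cos_pi_sub]; push_cast; simp
  rw [hflip]
  have hc : Continuous besselCutoff := by unfold besselCutoff; fun_prop
  have hsum : ∫ θ in 0..π, Complex.exp (Complex.I * ((s * cos θ : ℝ) : ℂ)) =
      (∫ θ in 0..π, Complex.exp (Complex.I * ((s * cos θ : ℝ) : ℂ)) * besselCutoff (cos θ : ℂ)) +
      ∫ θ in 0..π, Complex.exp (Complex.I * ((s * cos θ : ℝ) : ℂ)) *
        besselCutoff (-(cos θ : ℂ)) := by
    rw [← intervalIntegral.integral_add (Continuous.intervalIntegrable (by fun_prop) _ _)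
      (Continuous.intervalIntegrable (by fun_prop) _ _)]
    congr 1 with θ
    unfold besselCutoff; ring
  have e1 : Complex.exp (Complex.I * s) * Complex.exp (-(Complex.I * s)) = 1 := by
    rw [← Complex.exp_add]; simp
  have e2 : Complex.exp (-(Complex.I * s)) * Complex.exp (-(Complex.I * ((-s : ℝ) : ℂ))) = 1 := by
    rw [← Complex.exp_add]; simp
  rw [hsum]
  linear_combination (-2 * ∫ θ in 0..π, Complex.exp (Complex.I * ((s * cos θ : ℝ) : ℂ)) *
    besselCutoff (cos θ : ℂ)) * e1 - (2 * ∫ θ in 0..π,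
    Complex.exp (Complex.I * ((s * cos θ : ℝ) : ℂ)) * besselCutoff (-(cos θ : ℂ))) * e2

theorem symbol_bound_of_two_regimes {κ C₀ C₁ : ℝ} (hκ : 0 ≤ κ) (hC₁ : 0 ≤ C₁) {σ x : ℝ}
    (h0 : x ≤ C₀) (h1 : 1 ≤ |σ| → x ≤ C₁ * |σ| ^ (-κ)) :
    x ≤ (|C₀| + C₁) * 2 ^ κ * (1 + |σ|) ^ (-κ) := by
  have hp : 0 < 1 + |σ| := by positivity
  rcases le_total |σ| 1 with h | h
  · have : (2 : ℝ) ^ (-κ) ≤ (1 + |σ|) ^ (-κ) :=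
      rpow_le_rpow_of_nonpos hp (by linarith) (by linarith)
    calc x ≤ (|C₀| + C₁) * 2 ^ κ * 2 ^ (-κ) := by
          rw [mul_assoc, ← rpow_add (by norm_num), add_neg_cancel, rpow_zero, mul_one]
          linarith [le_abs_self C₀]
      _ ≤ _ := by gcongr
  · have hs : 0 < |σ| := by linarith
    have : (2 * |σ|) ^ (-κ) ≤ (1 + |σ|) ^ (-κ) :=
      rpow_le_rpow_of_nonpos hp (by linarith) (by linarith)
    calc x ≤ C₁ * |σ| ^ (-κ) := h1 h
      _ ≤ (|C₀| + C₁) * |σ| ^ (-κ) := by gcongr; linarith [abs_nonneg C₀]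
      _ = (|C₀| + C₁) * 2 ^ κ * (2 * |σ|) ^ (-κ) := by
          rw [mul_rpow (by norm_num) hs.le, mul_assoc, ← mul_assoc (2 ^ κ),
            ← rpow_add (by norm_num), add_neg_cancel, rpow_zero, one_mul]
      _ ≤ _ := by gcongr

/-- Each derivative in `σ` brings down `-i (1 - cos θ)`. This factor kills the stationary point `0`,
and the cutoff has a double zero at `θ = π`. Hence the first derivative has an integrand divisible
by `sin² θ`, the second by `sin⁴ θ`, and one, respectively two, integrations by parts recover the
powers of `σ`. What remains decays like `|σ| ^ (-1/2)`. -/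
theorem besselAmplitude_hasSymbolBounds : HasSymbolBounds (1 / 2) besselAmplitude := by
  set k : ℝ → ℂ := fun θ => -Complex.I * (1 - (cos θ : ℂ)) with hk
  set P : ℝ → ℂ := fun θ => besselCutoff (cos θ : ℂ) with hP
  have hkc : Continuous k := by fun_prop
  have hcut : Continuous besselCutoff := by unfold besselCutoff; fun_prop
  have hPc : Continuous P := by fun_prop
  have hkn : ∀ (σ : ℝ) θ, ‖Complex.exp (σ * k θ)‖ = 1 := fun σ θ => by
    rw [← norm_cexp_I_mul_ofReal (-(σ * (1 - cos θ)))]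
    congr 2; simp only [hk]; push_cast; ring
  have htriv : ∀ A : ℝ → ℂ, Continuous A → ∃ C, ∀ σ : ℝ,
      ‖2 * ∫ θ in 0..π, Complex.exp (σ * k θ) * A θ‖ ≤ C := by
    intro A hA
    obtain ⟨M, hM⟩ := (isCompact_Icc (a := 0) (b := π)).exists_bound_of_continuousOn
      hA.continuousOn
    refine ⟨2 * (M * |π - 0|), fun σ => ?_⟩
    rw [norm_mul, Complex.norm_ofNat]
    gcongr
    refine intervalIntegral.norm_integral_le_of_norm_le_const fun θ hθ => ?_
    rw [Set.uIoc_of_le pi_pos.le] at hθ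
    rw [norm_mul, hkn, one_mul]
    exact hM θ (Set.Ioc_subset_Icc_self hθ)
  have hphase : ∀ (σ : ℝ) (A : ℝ → ℂ), ‖2 * ∫ θ in 0..π, Complex.exp (σ * k θ) * A θ‖ =
      2 * ‖∫ θ in 0..π, Complex.exp (Complex.I * ((σ * cos θ : ℝ) : ℂ)) * A θ‖ := by
    intro σ A
    rw [hk, besselAmplitude_phase_eq, norm_mul, norm_mul, Complex.norm_ofNat,
      show -(Complex.I * (σ : ℂ)) = Complex.I * ((-σ : ℝ) : ℂ) by push_cast; ring,
      norm_cexp_I_mul_ofReal, one_mul]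
  have hsm : ∀ m, ContDiff ℝ m fun θ : ℝ => (sin θ : ℂ) := fun m =>
    Complex.ofRealCLM.contDiff.comp Real.contDiff_sin
  have hcm : ∀ m, ContDiff ℝ m fun θ : ℝ => (cos θ : ℂ) := fun m =>
    Complex.ofRealCLM.contDiff.comp Real.contDiff_cos
  have hsd : ∀ θ : ℝ, HasDerivAt (fun θ : ℝ => (sin θ : ℂ)) (cos θ : ℂ) θ := fun θ =>
    (hasDerivAt_sin θ).ofReal_comp
  have hcd : ∀ θ : ℝ, HasDerivAt (fun θ : ℝ => (cos θ : ℂ)) (-(sin θ : ℂ)) θ := fun θ => by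
    have := (hasDerivAt_cos θ).ofReal_comp
    rwa [Complex.ofReal_neg] at this
  have hsq : ∀ θ : ℝ, (sin θ : ℂ) ^ 2 = 1 - (cos θ : ℂ) ^ 2 := fun θ => by
    have := sin_sq θ; exact_mod_cast congrArg (Complex.ofReal) this
  -- the amplitude itself
  obtain ⟨C₀, hC₀, hb₀⟩ := exists_norm_integral_cos_phase_le (A := P)
    (by simp only [hP, besselCutoff]; have := hcm 1; fun_prop)
  obtain ⟨T₀, hT₀⟩ := htriv P hPc
  -- its first derivative
  set D₁ : ℝ → ℂ := fun θ => -Complex.I / 4 * ((sin θ : ℂ) * ((1 + cos θ) * (2 - cos θ)))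
  set D₁' : ℝ → ℂ := fun θ => -Complex.I / 4 * ((cos θ : ℂ) * ((1 + cos θ) * (2 - cos θ)) +
    (sin θ : ℂ) * (-(sin θ : ℂ) * (2 - cos θ) + (1 + cos θ) * (sin θ : ℂ))) with hD₁'
  have hD₁ : ∀ θ, HasDerivAt D₁ (D₁' θ) θ := fun θ => by
    refine (((hsd θ).mul (((hcd θ).const_add 1).mul ((hcd θ).const_sub 2))).const_mul
      (-Complex.I / 4)).congr_deriv ?_
    simp only [hD₁', Pi.mul_apply]; ring
  obtain ⟨C₁, hC₁, hb₁⟩ := exists_norm_integral_cos_phase_le (A := D₁')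
    (by simp only [hD₁']; have := hcm 1; have := hsm 1; fun_prop)
  have hkP : ∀ θ, k θ * P θ = (sin θ : ℂ) * D₁ θ := fun θ => by
    have := hsq θ
    simp only [hk, hP, D₁, besselCutoff]
    linear_combination (Complex.I / 4 * (1 + cos θ) * (2 - cos θ)) * this
  obtain ⟨T₁, hT₁⟩ := htriv (fun θ => k θ * P θ) (by fun_prop)
  -- its second derivative
  set D₂ : ℝ → ℂ := fun θ => -1 / 4 * ((sin θ : ℂ) ^ 3 * (2 - cos θ)) with hD₂d
  set D₃ : ℝ → ℂ := fun θ => -1 / 4 * (3 * (sin θ : ℂ) * cos θ * (2 - cos θ) + (sin θ : ℂ) ^ 3)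
    with hD₃d
  set D₃' : ℝ → ℂ := fun θ => -1 / 4 * (3 * (cos θ * cos θ * (2 - cos θ) +
    sin θ * (-sin θ * (2 - cos θ) + cos θ * sin θ)) + 3 * (sin θ : ℂ) ^ 2 * cos θ) with hD₃'
  have hD₂ : ∀ θ, HasDerivAt D₂ ((sin θ : ℂ) * D₃ θ) θ := fun θ => by
    refine ((((hsd θ).pow 3).mul ((hcd θ).const_sub 2)).const_mul (-1 / 4 : ℂ)).congr_deriv ?_
    simp only [hD₃d, Pi.pow_apply]; push_cast; ring
  have hD₃ : ∀ θ, HasDerivAt D₃ (D₃' θ) θ := fun θ => by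
    refine ((((((hsd θ).const_mul 3).mul (hcd θ)).mul ((hcd θ).const_sub 2)).add
      ((hsd θ).pow 3)).const_mul (-1 / 4 : ℂ)).congr_deriv ?_
    simp only [hD₃', Pi.mul_apply]; push_cast; ring
  obtain ⟨C₂, hC₂, hb₂⟩ := exists_norm_integral_cos_phase_le (A := D₃')
    (by simp only [hD₃']; have := hcm 1; have := hsm 1; fun_prop)
  -- `(1 - c)² (1 + c)² = sin⁴`. One sine is spent on the integration by parts; `D₂` keeps three,
  -- its derivative is `sin θ * D₃ θ`, and `D₃` still has one. So both rounds have zero boundary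
  -- terms.
  have hkkP : ∀ θ, k θ * (k θ * P θ) = (sin θ : ℂ) * D₂ θ := fun θ => by
    have h := hsq θ
    have hI := Complex.I_sq
    have : (sin θ : ℂ) * D₂ θ = -1 / 4 * (((sin θ : ℂ) ^ 2) ^ 2 * (2 - cos θ)) := by
      simp only [hD₂d]; ring
    rw [this, h]
    simp only [hk, hP, besselCutoff]
    linear_combination ((1 - (cos θ : ℂ)) ^ 2 * ((1 + cos θ) ^ 2 * (2 - cos θ) / 4)) * hI
  obtain ⟨T₂, hT₂⟩ := htriv (fun θ => k θ * (k θ * P θ)) (by fun_prop)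
  have hsin0 : (sin (0 : ℝ) : ℂ) = 0 := by simp
  have hsinπ : (sin π : ℂ) = 0 := by rw [sin_pi]; simp
  have hdec₀ : ∀ σ : ℝ, 1 ≤ |σ| → ‖2 * ∫ θ in 0..π, Complex.exp (σ * k θ) * P θ‖ ≤
      2 * C₀ * |σ| ^ (-(1 / 2) : ℝ) := fun σ h => by
    rw [hphase, mul_assoc]; gcongr; exact hb₀ σ h
  have hdec₁ : ∀ σ : ℝ, 1 ≤ |σ| → |σ| * ‖2 * ∫ θ in 0..π, Complex.exp (σ * k θ) * (k θ * P θ)‖ ≤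
      2 * C₁ * |σ| ^ (-(1 / 2) : ℝ) := fun σ h => by
    have hσ : σ ≠ 0 := by rintro rfl; simp at h; linarith
    have hσ0 : 0 < |σ| := abs_pos.2 hσ
    rw [hphase]
    simp_rw [hkP]
    rw [integral_cos_phase_sin_mul hD₁ (by simp only [hD₁']; fun_prop)
      (by simp [D₁]) (by simp only [D₁]; rw [hsinπ]; simp) hσ, norm_mul, norm_inv, norm_mul,
      Complex.norm_I, one_mul, Complex.norm_real, Real.norm_eq_abs]
    have := hb₁ σ h
    field_simp
    linarith
  have hdec₂ : ∀ σ : ℝ, 1 ≤ |σ| →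
      |σ| ^ 2 * ‖2 * ∫ θ in 0..π, Complex.exp (σ * k θ) * (k θ * (k θ * P θ))‖ ≤
      2 * C₂ * |σ| ^ (-(1 / 2) : ℝ) := fun σ h => by
    have hσ : σ ≠ 0 := by rintro rfl; simp at h; linarith
    have hσ0 : 0 < |σ| := abs_pos.2 hσ
    rw [hphase]
    simp_rw [hkkP]
    rw [integral_cos_phase_sin_mul hD₂ (by simp only [hD₃d]; fun_prop)
      (by simp [D₂]) (by simp only [D₂]; rw [hsinπ]; simp) hσ,
      integral_cos_phase_sin_mul hD₃ (by simp only [hD₃']; fun_prop)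
      (by simp [D₃]) (by simp only [D₃]; rw [hsinπ]; simp) hσ, norm_mul, norm_mul, norm_inv,
      norm_mul, Complex.norm_I, one_mul, Complex.norm_real, Real.norm_eq_abs]
    have := hb₂ σ h
    field_simp
    linarith
  have hder : ∀ (A : ℝ → ℂ), Continuous A → ∀ σ : ℝ, HasDerivAt
      (fun σ : ℝ => 2 * ∫ θ in 0..π, Complex.exp (σ * k θ) * A θ)
      (2 * ∫ θ in 0..π, Complex.exp (σ * k θ) * (k θ * A θ)) σ := fun A hA σ =>
    (hasDerivAt_integral_exp_mul hkc hA 0 π σ).const_mul 2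
  have hlow : ∀ {j : ℕ} {T x σ : ℝ}, 0 ≤ x → x ≤ T → |σ| ≤ 1 → |σ| ^ j * x ≤ |T| := by
    intro j T x σ hx hxT hσ
    calc |σ| ^ j * x ≤ 1 * x := by gcongr; exact pow_le_one₀ (abs_nonneg _) hσ
      _ ≤ |T| := by rw [one_mul]; exact hxT.trans (le_abs_self _)
  have hreg : ∀ {j : ℕ} {T c x σ : ℝ}, 0 ≤ c → 0 ≤ x → x ≤ T →
      (1 ≤ |σ| → |σ| ^ j * x ≤ 2 * c * |σ| ^ (-(1 / 2) : ℝ)) →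
      |σ| ^ j * x ≤ (|T| + 2 * c + 2 * c) * 2 ^ (1 / 2 : ℝ) * (1 + |σ|) ^ (-(1 / 2) : ℝ) := by
    intro j T c x σ hc hx hxT h
    have := symbol_bound_of_two_regimes (κ := 1 / 2) (C₀ := |T| + 2 * c) (C₁ := 2 * c) (σ := σ)
      (x := |σ| ^ j * x) (by norm_num) (by positivity) ?_ h
    · rwa [abs_of_nonneg (by positivity : 0 ≤ |T| + 2 * c)] at this
    · rcases le_total |σ| 1 with hσ | hσ
      · have := hlow (j := j) hx hxT hσ
        linarith
      · refine (h hσ).trans ?_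
        have : |σ| ^ (-(1 / 2) : ℝ) ≤ 1 := rpow_le_one_of_one_le_of_nonpos hσ (by norm_num)
        have := abs_nonneg T
        nlinarith
  set W := (|T₀| + 2 * C₀ + 2 * C₀) + (|T₁| + 2 * C₁ + 2 * C₁) + (|T₂| + 2 * C₂ + 2 * C₂) with hW
  refine ⟨_, _, W * 2 ^ (1 / 2 : ℝ), by positivity, hder P hPc, hder _ (by fun_prop), ?_,
    fun σ => ⟨?_, ?_, ?_⟩⟩
  · exact continuous_iff_continuousAt.2 fun σ =>
      (hder (fun θ => k θ * (k θ * P θ)) (by fun_prop) σ).continuousAt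
  · have := hreg (j := 0) hC₀ (norm_nonneg _) (hT₀ σ) (by simpa using hdec₀ σ)
    rw [pow_zero, one_mul] at this
    refine this.trans ?_
    gcongr
    rw [hW]
    linarith [abs_nonneg T₁, abs_nonneg T₂]
  · have := hreg (j := 1) hC₁ (norm_nonneg _) (hT₁ σ) (by simpa using hdec₁ σ)
    rw [pow_one] at this
    refine this.trans ?_
    gcongr
    rw [hW]
    linarith [abs_nonneg T₀, abs_nonneg T₂]
  · have := hreg (j := 2) hC₂ (norm_nonneg _) (hT₂ σ) (hdec₂ σ)
    refine this.trans ?_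
    gcongr
    rw [hW]
    linarith [abs_nonneg T₀, abs_nonneg T₁]

/-! ### Asymptotic form of the phase -/

/-- `g(r) = const + ℓ r + γ(r)` with `γ` behaving like `r ^ β`, together with its derivatives. -/
def HasPhaseExpansion (g : ℝ → ℝ) (ℓ β : ℝ) : Prop :=
  ∃ (y₀ c C : ℝ) (g₁ g₂ g₃ : ℝ → ℝ), 0 < y₀ ∧ 0 < c ∧ 0 < C ∧ ContinuousOn g₃ (Set.Ici y₀) ∧
    ∀ r, y₀ ≤ r → HasDerivAt g (ℓ + g₁ r) r ∧ HasDerivAt g₁ (g₂ r) r ∧ HasDerivAt g₂ (g₃ r) r ∧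
      c * r ^ (β - 1) ≤ |g₁ r| ∧ |g₁ r| ≤ C * r ^ (β - 1) ∧
      c * r ^ (β - 2) ≤ |g₂ r| ∧ |g₂ r| ≤ C * r ^ (β - 2) ∧ |g₃ r| ≤ C * r ^ (β - 3)

open Filter Topology

theorem tendsto_inv_sq_atTop : Tendsto (fun y : ℝ => (y ^ 2)⁻¹) atTop (𝓝 0) :=
  (tendsto_pow_atTop (by norm_num)).inv_tendsto_atTop

/-- The functions `y ^ β * G (y⁻²)` are stable under differentiation: the exponent drops by one, the
leading coefficient is multiplied by `β`, and one degree of smoothness of `G` is lost. The exact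
size of all derivatives can thus be read off at `0`. -/
theorem rpow_mul_comp_inv_sq_deriv {G : ℝ → ℝ} {k : ℕ} (hG : ContDiffAt ℝ (k + 1) G 0) (β : ℝ) :
    ∃ H : ℝ → ℝ, ContDiffAt ℝ k H 0 ∧ H 0 = β * G 0 ∧
      ∀ᶠ y : ℝ in atTop, HasDerivAt (fun y : ℝ => y ^ β * G (y ^ 2)⁻¹)
        (y ^ (β - 1) * H (y ^ 2)⁻¹) y := by
  refine ⟨fun z => β * G z - 2 * z * deriv G z, ?_, by simp, ?_⟩
  · have h1 : ContDiffAt ℝ k (deriv G) 0 := by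
      have := hG.fderiv_right_succ.clm_apply (contDiffAt_const (c := (1 : ℝ)))
      simpa only [fderiv_apply_one_eq_deriv] using this
    have h2 : ContDiffAt ℝ k G 0 := hG.of_le (by exact_mod_cast Nat.le_succ k)
    fun_prop
  · have h1 : ∀ᶠ z in 𝓝 (0 : ℝ), DifferentiableAt ℝ G z := by
      have := hG.eventually (by simp)
      filter_upwards [this] with z hz
      exact hz.differentiableAt (by simp)
    filter_upwards [tendsto_inv_sq_atTop.eventually h1, eventually_gt_atTop 0] with y hy hy0
    have e1 : HasDerivAt (fun y : ℝ => (y ^ 2)⁻¹) (-(2 * y) / (y ^ 2) ^ 2) y := by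
      have := (hasDerivAt_pow 2 y).inv (by positivity)
      simp only [Nat.cast_ofNat, Nat.add_one_sub_one, pow_one] at this
      exact this
    have e2 : HasDerivAt (fun y : ℝ => y ^ β) (β * y ^ (β - 1)) y :=
      hasDerivAt_rpow_const (Or.inl hy0.ne')
    refine (e2.mul (hy.hasDerivAt.comp y e1)).congr_deriv ?_
    have : y ^ β = y ^ (β - 1) * y := by
      nth_rewrite 3 [← rpow_one y]
      rw [← rpow_add hy0]; congr 1; ring
    simp only [Function.comp_apply]
    rw [this]
    field_simp
    ring

theorem rpow_mul_comp_inv_sq_bounds {G : ℝ → ℝ} (hG : ContinuousAt G 0) (β : ℝ) :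
    ∀ᶠ y : ℝ in atTop, |y ^ β * G (y ^ 2)⁻¹| ≤ (|G 0| + 1) * y ^ β ∧
      (|G 0| / 2) * y ^ β ≤ |y ^ β * G (y ^ 2)⁻¹| := by
  have h1 : ∀ᶠ z in 𝓝 (0 : ℝ), |G z| ≤ |G 0| + 1 ∧ |G 0| / 2 ≤ |G z| := by
    have hc := hG.abs
    refine (hc.eventually (Iic_mem_nhds (lt_add_one _))).and ?_
    rcases (abs_nonneg (G 0)).eq_or_lt with h | h
    · filter_upwards with z
      rw [← h]; simp
    · exact hc.eventually (Ici_mem_nhds (half_lt_self h))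
  filter_upwards [tendsto_inv_sq_atTop.eventually h1, eventually_gt_atTop 0] with y hy hy0
  have : 0 < y ^ β := by positivity
  rw [abs_mul, abs_of_pos this, mul_comm]
  exact ⟨by gcongr; exact hy.1, by gcongr; exact hy.2⟩

/-- The first two derivatives of the correction have leading coefficients `β G(0)` and `β (β - 1)
G(0)`; this is where `β ≠ 0` and `β ≠ 1` are needed. Four derivatives of `G` suffice for three
steps, with a continuous third derivative. -/
theorem hasPhaseExpansion_of_eq {g G : ℝ → ℝ} {e ℓ β : ℝ} (hG : ContDiffAt ℝ 4 G 0)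
    (hG0 : G 0 ≠ 0) (hβ : β ≠ 0) (hβ1 : β ≠ 1)
    (h : ∀ y, 0 < y → g y = e + ℓ * y + y ^ β * G (y ^ 2)⁻¹) : HasPhaseExpansion g ℓ β := by
  obtain ⟨G₁, hG₁, hG₁0, hd₁⟩ := rpow_mul_comp_inv_sq_deriv (k := 3) (by exact_mod_cast hG) β
  obtain ⟨G₂, hG₂, hG₂0, hd₂⟩ := rpow_mul_comp_inv_sq_deriv (k := 2) (by exact_mod_cast hG₁) (β - 1)
  obtain ⟨G₃, hG₃, hG₃0, hd₃⟩ :=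
    rpow_mul_comp_inv_sq_deriv (k := 1) (by exact_mod_cast hG₂) (β - 1 - 1)
  have hb₁ := rpow_mul_comp_inv_sq_bounds hG₁.continuousAt (β - 1)
  have hb₂ := rpow_mul_comp_inv_sq_bounds hG₂.continuousAt (β - 1 - 1)
  have hb₃ := rpow_mul_comp_inv_sq_bounds hG₃.continuousAt (β - 1 - 1 - 1)
  have hc₃ : ∀ᶠ y : ℝ in atTop, ContinuousAt (fun y : ℝ => y ^ (β - 1 - 1 - 1) * G₃ (y ^ 2)⁻¹) y :=
      by
    have h1 : ∀ᶠ z in 𝓝 (0 : ℝ), ContinuousAt G₃ z := by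
      filter_upwards [hG₃.eventually (by simp)] with z hz using hz.continuousAt
    filter_upwards [tendsto_inv_sq_atTop.eventually h1, eventually_gt_atTop 0] with y hy hy0
    refine ContinuousAt.mul (continuousAt_rpow_const _ _ (Or.inl hy0.ne')) ?_
    exact ContinuousAt.comp (f := fun y : ℝ => (y ^ 2)⁻¹) hy
      (ContinuousAt.inv₀ (by fun_prop) (by positivity))
  obtain ⟨Y, hY⟩ := eventually_atTop.1 (hd₁.and (hd₂.and (hd₃.and (hb₁.and (hb₂.and
    (hb₃.and hc₃))))))
  have hpos₁ : 0 < |G₁ 0| := by rw [hG₁0]; exact abs_pos.2 (mul_ne_zero hβ hG0)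
  have hpos₂ : 0 < |G₂ 0| := by
    rw [hG₂0]; exact abs_pos.2 (mul_ne_zero (sub_ne_zero.2 hβ1) (abs_pos.1 hpos₁))
  have e2 : β - 1 - 1 = β - 2 := by ring
  have e3 : β - 1 - 1 - 1 = β - 3 := by ring
  refine ⟨max Y 1, min (|G₁ 0| / 2) (|G₂ 0| / 2), |G₁ 0| + |G₂ 0| + |G₃ 0| + 1,
    fun y => y ^ (β - 1) * G₁ (y ^ 2)⁻¹, fun y => y ^ (β - 1 - 1) * G₂ (y ^ 2)⁻¹,
    fun y => y ^ (β - 1 - 1 - 1) * G₃ (y ^ 2)⁻¹, by positivity, by positivity, by positivity,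
    fun y hy => (hY y ((le_max_left _ _).trans hy)).2.2.2.2.2.2.continuousWithinAt,
    fun r hr => ?_⟩
  obtain ⟨p1, p2, p3, q1, q2, q3, -⟩ := hY r ((le_max_left _ _).trans hr)
  have hr0 : 0 < r := zero_lt_one.trans_le ((le_max_right _ _).trans hr)
  refine ⟨?_, p2, p3, ?_, ?_, ?_, ?_, ?_⟩
  · have : HasDerivAt (fun y => e + ℓ * y + y ^ β * G (y ^ 2)⁻¹)
        (ℓ + r ^ (β - 1) * G₁ (r ^ 2)⁻¹) r := by
      refine ((((hasDerivAt_id r).const_mul ℓ).const_add e).add p1).congr_deriv ?_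
      simp
    refine this.congr_of_eventuallyEq ?_
    filter_upwards [lt_mem_nhds hr0] with y hy using h y hy
  · refine le_trans ?_ q1.2; gcongr; exact min_le_left _ _
  · refine q1.1.trans ?_
    gcongr
    linarith [abs_nonneg (G₂ 0), abs_nonneg (G₃ 0)]
  · rw [← e2]; refine le_trans ?_ q2.2; gcongr; exact min_le_right _ _
  · rw [← e2]; refine q2.1.trans ?_
    gcongr
    linarith [abs_nonneg (G₁ 0), abs_nonneg (G₃ 0)]
  · rw [← e3]; refine q3.1.trans ?_
    gcongr
    linarith [abs_nonneg (G₁ 0), abs_nonneg (G₂ 0)]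

theorem HasPhaseExpansion.congr {g : ℝ → ℝ} {ℓ ℓ' β β' : ℝ} (h : HasPhaseExpansion g ℓ β)
    (hℓ : ℓ = ℓ') (hβ : β = β') : HasPhaseExpansion g ℓ' β' := hℓ ▸ hβ ▸ h

theorem hasPhaseExpansion_of_sqrt {g Q : ℝ → ℝ} {β : ℝ} (hQ : ContDiffAt ℝ 4 Q 0) (hQ0 : 0 < Q 0)
    (hβ : β ≠ 0) (hβ1 : β ≠ 1) (h : ∀ y, 0 < y → g y = y ^ β * √(Q (y ^ 2)⁻¹)) :
    HasPhaseExpansion g 0 β :=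
  hasPhaseExpansion_of_eq (e := 0) (G := fun z => √(Q z)) (hQ.sqrt hQ0.ne')
    (sqrt_pos.2 hQ0).ne' hβ hβ1 fun y hy => by rw [h y hy]; ring

/-- The leading term of the phase is affine, and the first non-vanishing correction decides. -/
theorem hasPhaseExpansion_of_sqrt_correction {g Q R : ℝ → ℝ} {e ℓ m : ℝ} (k : ℕ)
    (hQ : ContDiffAt ℝ 4 Q 0) (hQ0 : 0 < Q 0) (hR : ContDiffAt ℝ 4 R 0) (hR0 : R 0 ≠ 0)
    (hQR : ∀ z, 0 < z → 0 ≤ Q z ∧ Q z = Q 0 + z ^ k * R z)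
    (hβ : m - 2 * k ≠ 0) (hβ1 : m - 2 * k ≠ 1)
    (hm : ∀ y, 0 < y → y ^ m * √(Q 0) = e + ℓ * y)
    (h : ∀ y, 0 < y → g y = y ^ m * √(Q (y ^ 2)⁻¹)) : HasPhaseExpansion g ℓ (m - 2 * k) := by
  have hs : 0 < √(Q 0) := sqrt_pos.2 hQ0
  refine hasPhaseExpansion_of_eq (e := e) (G := fun z => R z / (√(Q z) + √(Q 0)))
    (hR.div ((hQ.sqrt hQ0.ne').add contDiffAt_const) (by positivity))
    (div_ne_zero hR0 (by positivity)) hβ hβ1 fun y hy => ?_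
  rw [h y hy, ← hm y hy]
  have hz : 0 < (y ^ 2)⁻¹ := by positivity
  obtain ⟨q1, q2⟩ := hQR _ hz
  -- The difference of the two square roots is rationalized.
  have e1 : √(Q (y ^ 2)⁻¹) = √(Q 0) + (y ^ 2)⁻¹ ^ k *
      (R (y ^ 2)⁻¹ / (√(Q (y ^ 2)⁻¹) + √(Q 0))) := by
    have : (√(Q (y ^ 2)⁻¹) + √(Q 0)) ≠ 0 := by positivity
    have s1 := sq_sqrt q1
    have s2 := sq_sqrt hQ0.le
    rw [mul_div_assoc', eq_comm, ← eq_sub_iff_add_eq', div_eq_iff this]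
    linear_combination -q2 - s1 + s2
  have e2 : y ^ (m - 2 * k) = y ^ m * (y ^ 2)⁻¹ ^ k := by
    rw [rpow_sub hy, div_eq_mul_inv, ← rpow_natCast (y ^ 2)⁻¹ k, inv_rpow (by positivity),
      ← rpow_natCast y 2, ← rpow_mul hy.le]
    simp
  rw [e2, mul_assoc, ← mul_add, ← e1]

theorem abcdPhase_swap (a b c d : ℝ) : abcdPhase c d a b = abcdPhase a b c d := by
  ext y; unfold abcdPhase
  rw [mul_comm (1 - c * y ^ 2), mul_comm (1 + d * y ^ 2)]

theorem abcdPhase_swap_left (a b c d : ℝ) : abcdPhase c b a d = abcdPhase a b c d := by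
  ext y; unfold abcdPhase
  rw [mul_comm (1 - c * y ^ 2)]

theorem abcdPhase_swap_right (a b c d : ℝ) : abcdPhase a d c b = abcdPhase a b c d := by
  ext y; unfold abcdPhase
  rw [mul_comm (1 + d * y ^ 2)]

theorem mul_sqrt_eq_rpow_mul_sqrt {y m A B : ℝ} (hy : 0 < y) (h : A = y ^ (2 * (m - 1)) * B) :
    y * √A = y ^ m * √B := by
  have h1 : √(y ^ (2 * (m - 1))) = y ^ (m - 1) := by
    rw [sqrt_eq_rpow, ← rpow_mul hy.le]; congr 1; ring
  rw [h, sqrt_mul (by positivity), h1, ← mul_assoc]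
  congr 1
  nth_rewrite 1 [← rpow_one y]
  rw [← rpow_add hy]; congr 1; ring

/-! ### The asymptotic form of the abcd phase, row by row -/

section Table

variable {a b c d : ℝ}

theorem abcdPhase_expansion_cubic (ha : a < 0) (hc : c < 0) :
    HasPhaseExpansion (abcdPhase a 0 c 0) 0 3 := by
  refine hasPhaseExpansion_of_sqrt (Q := fun z => (z - a) * (z - c)) (by fun_prop) (by nlinarith)
    (by norm_num) (by norm_num) fun y hy => mul_sqrt_eq_rpow_mul_sqrt hy ?_
  rw [show (2 * (3 - 1) : ℝ) = (4 : ℕ) by norm_num, rpow_natCast]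
  field_simp; ring

theorem abcdPhase_expansion_quadratic (ha : a < 0) :
    HasPhaseExpansion (abcdPhase a 0 0 0) 0 2 := by
  refine hasPhaseExpansion_of_sqrt (Q := fun z => z - a) (by fun_prop) (by simpa using ha)
    (by norm_num) (by norm_num) fun y hy => mul_sqrt_eq_rpow_mul_sqrt hy ?_
  rw [show (2 * (2 - 1) : ℝ) = (2 : ℕ) by norm_num, rpow_natCast]
  field_simp; ring

theorem abcdPhase_expansion_quadratic' (ha : a < 0) (hb : 0 < b) (hc : c < 0) :
    HasPhaseExpansion (abcdPhase a b c 0) 0 2 := by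
  refine hasPhaseExpansion_of_sqrt (Q := fun z => (z - a) * (z - c) / (z + b))
    (ContDiffAt.div (by fun_prop) (by fun_prop) (by simpa using hb.ne'))
    (by have := mul_pos_of_neg_of_neg ha hc; simp; positivity)
    (by norm_num) (by norm_num) fun y hy => mul_sqrt_eq_rpow_mul_sqrt hy ?_
  rw [show (2 * (2 - 1) : ℝ) = (2 : ℕ) by norm_num, rpow_natCast]
  field_simp; ring

theorem abcdPhase_expansion_affine (ha : a < 0) (hb : 0 < b) (hab : a + b ≠ 0) :
    HasPhaseExpansion (abcdPhase a b 0 0) (√(-a / b)) (-1) := by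
  have := hasPhaseExpansion_of_sqrt_correction (g := abcdPhase a b 0 0)
    (Q := fun z => (z - a) / (z + b)) (R := fun z => (a + b) / (b * (z + b))) (e := 0)
    (ℓ := √(-a / b)) (m := 1) 1
    (ContDiffAt.div (by fun_prop) (by fun_prop) (by simpa using hb.ne'))
    (by have : 0 < -a := by linarith
        simp only [zero_sub, zero_add]; positivity)
    (ContDiffAt.div (by fun_prop) (by fun_prop) (by simpa using hb.ne'))
    (by simp only [zero_add]; exact div_ne_zero hab (by positivity))
    (fun z hz => ⟨by have : 0 < z - a := by linarith
                     positivity, by field_simp; ring⟩)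
    (by norm_num) (by norm_num) (fun y hy => by simp [mul_comm])
    (fun y hy => mul_sqrt_eq_rpow_mul_sqrt hy (by norm_num; field_simp))
  convert this using 1; norm_num

theorem abcdPhase_expansion_const (hb : 0 < b) :
    HasPhaseExpansion (abcdPhase 0 b 0 0) 0 (-2) := by
  have := hasPhaseExpansion_of_sqrt_correction (g := abcdPhase 0 b 0 0)
    (Q := fun z => 1 / (z + b)) (R := fun z => -1 / (b * (z + b))) (e := √(1 / b))
    (ℓ := 0) (m := 0) 1
    (ContDiffAt.div (by fun_prop) (by fun_prop) (by simpa using hb.ne'))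
    (by simp only [zero_add]; positivity)
    (ContDiffAt.div (by fun_prop) (by fun_prop) (by simpa using hb.ne'))
    (by simp only [zero_add]; exact div_ne_zero (by norm_num) (by positivity))
    (fun z hz => ⟨by positivity, by field_simp; ring⟩)
    (by norm_num) (by norm_num) (fun y hy => by simp)
    (fun y hy => mul_sqrt_eq_rpow_mul_sqrt hy (by
      rw [show (2 * (0 - 1) : ℝ) = -(2 : ℕ) by norm_num, rpow_neg hy.le, rpow_natCast]
      field_simp; ring))
  convert this using 1; norm_num

theorem abcdPhase_expansion_inv (hb : 0 < b) (hd : 0 < d) :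
    HasPhaseExpansion (abcdPhase 0 b 0 d) 0 (-1) := by
  refine hasPhaseExpansion_of_sqrt (Q := fun z => 1 / ((z + b) * (z + d)))
    (ContDiffAt.div (by fun_prop) (by fun_prop) (by simp [hb.ne', hd.ne']))
    (by simp only [zero_add]; positivity)
    (by norm_num) (by norm_num) fun y hy => mul_sqrt_eq_rpow_mul_sqrt hy ?_
  rw [show (2 * (-1 - 1) : ℝ) = -(4 : ℕ) by norm_num, rpow_neg hy.le, rpow_natCast]
  field_simp; ring

theorem abcdPhase_expansion_const_generic (ha : a < 0) (hb : 0 < b) (hd : 0 < d)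
    (hE : b * a + b * d + a * d ≠ 0) : HasPhaseExpansion (abcdPhase a b 0 d) 0 (-2) := by
  have := hasPhaseExpansion_of_sqrt_correction (g := abcdPhase a b 0 d)
    (Q := fun z => (z - a) / ((z + b) * (z + d)))
    (R := fun z => (a * z + (b * a + b * d + a * d)) / (b * d * ((z + b) * (z + d))))
    (e := √(-a / (b * d))) (ℓ := 0) (m := 0) 1
    (ContDiffAt.div (by fun_prop) (by fun_prop) (by simp [hb.ne', hd.ne']))
    (by have : 0 < -a := by linarith
        simp only [zero_sub, zero_add]; positivity)
    (ContDiffAt.div (by fun_prop) (by fun_prop) (by simp [hb.ne', hd.ne']))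
    (by simp only [zero_add, mul_zero]; exact div_ne_zero hE (by positivity))
    (fun z hz => ⟨by have : 0 < z - a := by linarith
                     positivity, by field_simp; ring⟩)
    (by norm_num) (by norm_num) (fun y hy => by simp)
    (fun y hy => mul_sqrt_eq_rpow_mul_sqrt hy (by
      rw [show (2 * (0 - 1) : ℝ) = -(2 : ℕ) by norm_num, rpow_neg hy.le, rpow_natCast]
      field_simp; ring))
  convert this using 1; norm_num

theorem abcdPhase_expansion_const_degenerate (ha : a < 0) (hb : 0 < b) (hd : 0 < d)
    (hE : b * a + b * d + a * d = 0) : HasPhaseExpansion (abcdPhase a b 0 d) 0 (-4) := by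
  have := hasPhaseExpansion_of_sqrt_correction (g := abcdPhase a b 0 d)
    (Q := fun z => (z - a) / ((z + b) * (z + d)))
    (R := fun z => a / (b * d * ((z + b) * (z + d))))
    (e := √(-a / (b * d))) (ℓ := 0) (m := 0) 2
    (ContDiffAt.div (by fun_prop) (by fun_prop) (by simp [hb.ne', hd.ne']))
    (by have : 0 < -a := by linarith
        simp only [zero_sub, zero_add]; positivity)
    (ContDiffAt.div (by fun_prop) (by fun_prop) (by simp [hb.ne', hd.ne']))
    (by simp only [zero_add]; exact div_ne_zero ha.ne (by positivity))
    (fun z hz => ⟨by have : 0 < z - a := by linarith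
                     positivity, by field_simp; linear_combination z * b * d * hE⟩)
    (by norm_num) (by norm_num) (fun y hy => by simp)
    (fun y hy => mul_sqrt_eq_rpow_mul_sqrt hy (by
      rw [show (2 * (0 - 1) : ℝ) = -(2 : ℕ) by norm_num, rpow_neg hy.le, rpow_natCast]
      field_simp; ring))
  convert this using 1; norm_num

theorem abcdPhase_expansion_affine_generic (ha : a < 0) (hb : 0 < b) (hc : c < 0) (hd : 0 < d)
    (hE : a * b * c + a * b * d + a * c * d + b * c * d ≠ 0) :
    HasPhaseExpansion (abcdPhase a b c d) (√(a * c / (b * d))) (-1) := by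
  have hac := mul_pos_of_neg_of_neg ha hc
  have := hasPhaseExpansion_of_sqrt_correction (g := abcdPhase a b c d)
    (Q := fun z => (z - a) * (z - c) / ((z + b) * (z + d)))
    (R := fun z => ((b * d - a * c) * z - (a * b * c + a * b * d + a * c * d + b * c * d)) /
      (b * d * ((z + b) * (z + d))))
    (e := 0) (ℓ := √(a * c / (b * d))) (m := 1) 1
    (ContDiffAt.div (by fun_prop) (by fun_prop) (by simp [hb.ne', hd.ne']))
    (by simp only [zero_sub, zero_add, neg_mul_neg]; positivity)
    (ContDiffAt.div (by fun_prop) (by fun_prop) (by simp [hb.ne', hd.ne']))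
    (by simp only [zero_add, mul_zero, zero_sub]; exact div_ne_zero (neg_ne_zero.2 hE) (by
        positivity))
    (fun z hz => ⟨by have : 0 < z - a := by linarith
                     have : 0 < z - c := by linarith
                     positivity, by field_simp; ring⟩)
    (by norm_num) (by norm_num) (fun y hy => by simp [mul_comm])
    (fun y hy => mul_sqrt_eq_rpow_mul_sqrt hy (by norm_num; field_simp))
  convert this using 1; norm_num

theorem abcdPhase_expansion_affine_degenerate (ha : a < 0) (hb : 0 < b) (hc : c < 0) (hd : 0 < d)
    (hE : a * b * c + a * b * d + a * c * d + b * c * d = 0) (hne : b * d - a * c ≠ 0) :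
    HasPhaseExpansion (abcdPhase a b c d) (√(a * c / (b * d))) (-3) := by
  have hac := mul_pos_of_neg_of_neg ha hc
  have := hasPhaseExpansion_of_sqrt_correction (g := abcdPhase a b c d)
    (Q := fun z => (z - a) * (z - c) / ((z + b) * (z + d)))
    (R := fun z => (b * d - a * c) / (b * d * ((z + b) * (z + d))))
    (e := 0) (ℓ := √(a * c / (b * d))) (m := 1) 2
    (ContDiffAt.div (by fun_prop) (by fun_prop) (by simp [hb.ne', hd.ne']))
    (by simp only [zero_sub, zero_add, neg_mul_neg]; positivity)
    (ContDiffAt.div (by fun_prop) (by fun_prop) (by simp [hb.ne', hd.ne']))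
    (by simp only [zero_add]; exact div_ne_zero hne (by positivity))
    (fun z hz => ⟨by have : 0 < z - a := by linarith
                     have : 0 < z - c := by linarith
                     positivity, by field_simp; linear_combination (-(z * b * d)) * hE⟩)
    (by norm_num) (by norm_num) (fun y hy => by simp [mul_comm])
    (fun y hy => mul_sqrt_eq_rpow_mul_sqrt hy (by norm_num; field_simp))
  convert this using 1; norm_num

set_option maxHeartbeats 1000000 in
/-- In each row of the table the phase has the announced asymptotic form. -/
theorem abcdPhase_expansion (ha : a ≤ 0) (hb : 0 ≤ b) (hc : c ≤ 0) (hd : 0 ≤ d)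
    (hnd : 0 < ((a + b) * (a + d) * (c + b) * (c + d)) ^ 2 + (a + b + c + d) ^ 2)
    {ℓ α : ℝ} (hT : (ℓ, α) = abcdTable a b c d) :
    HasPhaseExpansion (abcdPhase a b c d) ℓ (α + 2) ∧ α + 2 ≠ 0 ∧ α + 2 ≠ 1 ∧ 0 ≤ ℓ ∧
      (ℓ ≠ 0 → α ≤ -3) := by
  unfold abcdTable at hT
  split_ifs at hT with h1 h2 h3 h4 h5 h6 h7 h8 h9 h10 <;> obtain ⟨rfl, rfl⟩ := Prod.mk.inj hT
  · obtain ⟨rfl, rfl, ha, hc⟩ := h1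
    refine ⟨?_, by norm_num, by norm_num, le_rfl, by simp⟩
    exact (abcdPhase_expansion_cubic ha hc).congr (by norm_num) (by norm_num)
  · obtain ⟨rfl, rfl, hac, hs⟩ := h2
    refine ⟨?_, by norm_num, by norm_num, le_rfl, by simp⟩
    rcases mul_eq_zero.1 hac with rfl | rfl
    · rw [abcdPhase_swap_left c 0 0 0]
      exact (abcdPhase_expansion_quadratic (a := c) (by linarith)).congr (by norm_num) (by norm_num)
    · exact (abcdPhase_expansion_quadratic (a := a) (by linarith)).congr (by norm_num) (by norm_num)
  · obtain ⟨hbd, hs, hac⟩ := h3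
    have ha' : a < 0 := lt_of_le_of_ne ha (left_ne_zero_of_mul hac)
    have hc' : c < 0 := lt_of_le_of_ne hc (right_ne_zero_of_mul hac)
    refine ⟨?_, by norm_num, by norm_num, le_rfl, by simp⟩
    rcases mul_eq_zero.1 hbd with rfl | rfl
    · rw [abcdPhase_swap_right a d c 0]
      exact (abcdPhase_expansion_quadratic' ha' (b := d) (by linarith) hc').congr (by norm_num) (by
          norm_num)
    · exact (abcdPhase_expansion_quadratic' ha' (b := b) (by linarith) hc').congr (by norm_num) (by
          norm_num)
  · obtain ⟨hbd, hs, hac, hs'⟩ := h4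
    -- In this row one of `a, c` and one of `b, d` vanish, so the product in the nondegeneracy
    -- hypothesis is zero and the sum must carry it. A zero sum would make the phase exactly linear.
    have hne : a + b + c + d ≠ 0 := by
      intro h
      rw [h] at hnd
      rcases mul_eq_zero.1 hbd with rfl | rfl <;> rcases mul_eq_zero.1 hac with rfl | rfl <;>
        simp at hnd <;> grind
    refine ⟨?_, by norm_num, by norm_num, sqrt_nonneg _, fun _ => by norm_num⟩
    rcases mul_eq_zero.1 hbd with rfl | rfl <;> rcases mul_eq_zero.1 hac with rfl | rfl
    · rw [abcdPhase_swap c d 0 0]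
      exact (abcdPhase_expansion_affine (a := c) (b := d) (by linarith) (by linarith)
        (by intro h; apply hne; linarith)).congr (by norm_num) (by norm_num)
    · rw [abcdPhase_swap_right a d 0 0]
      exact (abcdPhase_expansion_affine (a := a) (b := d) (by linarith) (by linarith)
        (by intro h; apply hne; linarith)).congr (by norm_num) (by norm_num)
    · rw [abcdPhase_swap_left c b 0 0]
      exact (abcdPhase_expansion_affine (a := c) (b := b) (by linarith) (by linarith)
        (by intro h; apply hne; linarith)).congr (by norm_num) (by norm_num)
    · exact (abcdPhase_expansion_affine (a := a) (b := b) (by linarith) (by linarith)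
        (by intro h; apply hne; linarith)).congr (by norm_num) (by norm_num)
  · obtain ⟨hbd, hs, rfl, rfl⟩ := h5
    refine ⟨?_, by norm_num, by norm_num, le_rfl, by simp⟩
    rcases mul_eq_zero.1 hbd with rfl | rfl
    · rw [abcdPhase_swap 0 d 0 0]
      exact (abcdPhase_expansion_const (b := d) (by linarith)).congr (by norm_num) (by norm_num)
    · exact (abcdPhase_expansion_const (b := b) (by linarith)).congr (by norm_num) (by norm_num)
  · obtain ⟨hbd, rfl, rfl⟩ := h6
    have hb' : 0 < b := lt_of_le_of_ne hb (left_ne_zero_of_mul hbd).symm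
    have hd' : 0 < d := lt_of_le_of_ne hd (right_ne_zero_of_mul hbd).symm
    refine ⟨?_, by norm_num, by norm_num, le_rfl, by simp⟩
    exact (abcdPhase_expansion_inv hb' hd').congr (by norm_num) (by norm_num)
  · obtain ⟨hbd, hac, hs, hE⟩ := h7
    have hb' : 0 < b := lt_of_le_of_ne hb (left_ne_zero_of_mul hbd).symm
    have hd' : 0 < d := lt_of_le_of_ne hd (right_ne_zero_of_mul hbd).symm
    refine ⟨?_, by norm_num, by norm_num, le_rfl, by simp⟩
    rcases mul_eq_zero.1 hac with rfl | rfl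
    · rw [abcdPhase_swap_left c b 0 d]
      exact (abcdPhase_expansion_const_generic (a := c) (by linarith) hb' hd'
        (by simpa using hE)).congr (by norm_num) (by norm_num)
    · exact (abcdPhase_expansion_const_generic (a := a) (by linarith) hb' hd'
        (by simpa using hE)).congr (by norm_num) (by norm_num)
  · obtain ⟨hbd, hac, hs, hE⟩ := h8
    have hb' : 0 < b := lt_of_le_of_ne hb (left_ne_zero_of_mul hbd).symm
    have hd' : 0 < d := lt_of_le_of_ne hd (right_ne_zero_of_mul hbd).symm
    refine ⟨?_, by norm_num, by norm_num, le_rfl, by simp⟩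
    rcases mul_eq_zero.1 hac with rfl | rfl
    · rw [abcdPhase_swap_left c b 0 d]
      exact (abcdPhase_expansion_const_degenerate (a := c) (by linarith) hb' hd'
        (by simpa using hE)).congr (by norm_num) (by norm_num)
    · exact (abcdPhase_expansion_const_degenerate (a := a) (by linarith) hb' hd'
        (by simpa using hE)).congr (by norm_num) (by norm_num)
  · obtain ⟨hbd, hE⟩ := h9
    simp only [ne_eq, mul_eq_zero, not_or] at hbd
    obtain ⟨⟨⟨a0, b0⟩, c0⟩, d0⟩ := hbd
    refine ⟨?_, by norm_num, by norm_num, sqrt_nonneg _, fun _ => by norm_num⟩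
    exact (abcdPhase_expansion_affine_generic (lt_of_le_of_ne ha a0)
      (lt_of_le_of_ne hb (Ne.symm b0)) (lt_of_le_of_ne hc c0) (lt_of_le_of_ne hd (Ne.symm d0))
          hE).congr (by norm_num) (by norm_num)
  · obtain ⟨hbd, hE⟩ := h10
    simp only [ne_eq, mul_eq_zero, not_or] at hbd
    obtain ⟨⟨⟨a0, b0⟩, c0⟩, d0⟩ := hbd
    -- If `ac = bd`, the degenerate relation reads `ac (a + b + c + d) = 0`; the sum is then zero,
    -- so is `(a + b)(a + d)`, and both terms of the nondegeneracy hypothesis vanish.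
    have hne : b * d - a * c ≠ 0 := by
      intro h
      have hac : a * c ≠ 0 := mul_ne_zero a0 c0
      have hsum : a + b + c + d = 0 := by
        have : a * c * (a + b + c + d) = 0 := by linear_combination hE - (a + c) * h
        exact (mul_eq_zero.1 this).resolve_left hac
      have hprod : (a + b) * (a + d) = 0 := by
        linear_combination a * hsum + h
      rw [hsum, hprod] at hnd
      simp at hnd
    refine ⟨?_, by norm_num, by norm_num, sqrt_nonneg _, fun _ => by norm_num⟩
    exact (abcdPhase_expansion_affine_degenerate (lt_of_le_of_ne ha a0)
      (lt_of_le_of_ne hb (Ne.symm b0)) (lt_of_le_of_ne hc c0) (lt_of_le_of_ne hd (Ne.symm d0)) hE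
      hne).congr (by norm_num) (by norm_num)
  · exfalso
    rcases ha.eq_or_lt with rfl | ha' <;> rcases hb.eq_or_lt with rfl | hb' <;>
      rcases hc.eq_or_lt with rfl | hc' <;> rcases hd.eq_or_lt with rfl | hd' <;>
      simp_all [ne_of_gt, ne_of_lt, add_pos, add_neg]

end Table

/-! ### Dyadic cutoffs -/

/-- A smooth radial cutoff that vanishes for `|r| ≤ 1/2` and equals `1` for `|r| ≥ 1`, as a function
of `v = r ^ 2`. -/
noncomputable def cutoffRoot (v : ℝ) : ℝ := smoothTransition ((4 * v - 1) / 3)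

/-- The square of the radial cutoff, as a function of the radius. -/
noncomputable def radialCutoff (r : ℝ) : ℝ := cutoffRoot (r ^ 2) ^ 2

/-- The dyadic bump, supported in `1/2 ≤ |s| ≤ 2`. -/
noncomputable def dyadicBump (s : ℝ) : ℝ := radialCutoff s - radialCutoff (s / 2)

theorem cutoffRoot_contDiff {n : ℕ∞} : ContDiff ℝ n cutoffRoot :=
  smoothTransition.contDiff.comp (by fun_prop)

theorem cutoffRoot_nonneg (v : ℝ) : 0 ≤ cutoffRoot v := smoothTransition.nonneg _

theorem cutoffRoot_le_one (v : ℝ) : cutoffRoot v ≤ 1 := smoothTransition.le_one _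

theorem cutoffRoot_of_le {v : ℝ} (h : v ≤ 1 / 4) : cutoffRoot v = 0 :=
  smoothTransition.zero_of_nonpos (by linarith)

theorem cutoffRoot_of_ge {v : ℝ} (h : 1 ≤ v) : cutoffRoot v = 1 :=
  smoothTransition.one_of_one_le (by linarith)

theorem radialCutoff_contDiff {n : ℕ∞} : ContDiff ℝ n radialCutoff :=
  (cutoffRoot_contDiff.comp (contDiff_id.pow 2)).pow 2

theorem radialCutoff_nonneg (r : ℝ) : 0 ≤ radialCutoff r := sq_nonneg _

theorem radialCutoff_le_one (r : ℝ) : radialCutoff r ≤ 1 :=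
  pow_le_one₀ (cutoffRoot_nonneg _) (cutoffRoot_le_one _)

theorem radialCutoff_of_le {r : ℝ} (h0 : 0 ≤ r) (h : r ≤ 1 / 2) : radialCutoff r = 0 := by
  unfold radialCutoff; rw [cutoffRoot_of_le (by nlinarith)]; simp

theorem radialCutoff_of_ge {r : ℝ} (h : 1 ≤ r) : radialCutoff r = 1 := by
  unfold radialCutoff; rw [cutoffRoot_of_ge (by nlinarith)]; simp

theorem dyadicBump_contDiff {n : ℕ∞} : ContDiff ℝ n dyadicBump :=
  radialCutoff_contDiff.sub (radialCutoff_contDiff.comp (contDiff_id.div_const 2))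

theorem dyadicBump_of_le {s : ℝ} (h0 : 0 ≤ s) (h : s ≤ 1 / 2) : dyadicBump s = 0 := by
  unfold dyadicBump
  rw [radialCutoff_of_le h0 h, radialCutoff_of_le (by linarith) (by linarith), sub_zero]

theorem dyadicBump_of_ge {s : ℝ} (h : 2 ≤ s) : dyadicBump s = 0 := by
  unfold dyadicBump
  rw [radialCutoff_of_ge (by linarith), radialCutoff_of_ge (by linarith), sub_self]

theorem sum_dyadicBump (r : ℝ) (N : ℕ) :
    ∑ k ∈ Finset.range N, dyadicBump (r / 2 ^ k) = radialCutoff r - radialCutoff (r / 2 ^ N) := by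
  have : ∀ k, dyadicBump (r / 2 ^ k) = radialCutoff (r / 2 ^ k) - radialCutoff (r / 2 ^ (k + 1)) :=
    fun k => by unfold dyadicBump; rw [pow_succ, div_div]
  simp_rw [this]
  rw [Finset.sum_range_sub', pow_zero, div_one]

/-! ### Amplitudes on the unit scale -/

/-- `f`, with derivatives `f₁` and `f₂`, is bounded by `M` in `C²` of `[1/4, 4]`. -/
structure C2Bound (f f₁ f₂ : ℝ → ℂ) (M : ℝ) : Prop where
  deriv₁ : ∀ s ∈ Set.Icc (1 / 4 : ℝ) 4, HasDerivAt f (f₁ s) s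
  deriv₂ : ∀ s ∈ Set.Icc (1 / 4 : ℝ) 4, HasDerivAt f₁ (f₂ s) s
  cont : ContinuousOn f₂ (Set.Icc (1 / 4 : ℝ) 4)
  bound : ∀ s ∈ Set.Icc (1 / 4 : ℝ) 4, ‖f s‖ ≤ M
  bound₁ : ∀ s ∈ Set.Icc (1 / 4 : ℝ) 4, ‖f₁ s‖ ≤ M
  bound₂ : ∀ s ∈ Set.Icc (1 / 4 : ℝ) 4, ‖f₂ s‖ ≤ M

theorem C2Bound.mul {f f₁ f₂ g g₁ g₂ : ℝ → ℂ} {M N : ℝ} (hf : C2Bound f f₁ f₂ M)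
    (hg : C2Bound g g₁ g₂ N) :
    C2Bound (fun s => f s * g s) (fun s => f₁ s * g s + f s * g₁ s)
      (fun s => f₂ s * g s + 2 * f₁ s * g₁ s + f s * g₂ s) (4 * (M * N)) := by
  have hM : 0 ≤ M := (norm_nonneg _).trans (hf.bound 1 (by norm_num))
  have hN : 0 ≤ N := (norm_nonneg _).trans (hg.bound 1 (by norm_num))
  have hMN : 0 ≤ M * N := by positivity
  refine ⟨fun s hs => (hf.deriv₁ s hs).mul (hg.deriv₁ s hs), fun s hs => ?_, ?_, fun s hs => ?_,
    fun s hs => ?_, fun s hs => ?_⟩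
  · exact (((hf.deriv₂ s hs).mul (hg.deriv₁ s hs)).add
      ((hf.deriv₁ s hs).mul (hg.deriv₂ s hs))).congr_deriv (by ring)
  · have c1 : ContinuousOn f (Set.Icc (1 / 4 : ℝ) 4) :=
      fun s hs => (hf.deriv₁ s hs).continuousAt.continuousWithinAt
    have c2 : ContinuousOn f₁ (Set.Icc (1 / 4 : ℝ) 4) :=
      fun s hs => (hf.deriv₂ s hs).continuousAt.continuousWithinAt
    have c3 : ContinuousOn g (Set.Icc (1 / 4 : ℝ) 4) :=
      fun s hs => (hg.deriv₁ s hs).continuousAt.continuousWithinAt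
    have c4 : ContinuousOn g₁ (Set.Icc (1 / 4 : ℝ) 4) :=
      fun s hs => (hg.deriv₂ s hs).continuousAt.continuousWithinAt
    exact ((hf.cont.mul c3).add ((continuousOn_const.mul c2).mul c4)).add (c1.mul hg.cont)
  all_goals
    have a0 := hf.bound s hs
    have a1 := hf.bound₁ s hs
    have a2 := hf.bound₂ s hs
    have b0 := hg.bound s hs
    have b1 := hg.bound₁ s hs
    have b2 := hg.bound₂ s hs
  · rw [norm_mul]
    calc ‖f s‖ * ‖g s‖ ≤ M * N := by gcongr
      _ ≤ _ := by linarith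
  · calc _ ≤ ‖f₁ s‖ * ‖g s‖ + ‖f s‖ * ‖g₁ s‖ := by
          refine (norm_add_le _ _).trans (le_of_eq ?_); simp
      _ ≤ M * N + M * N := by gcongr
      _ ≤ _ := by linarith
  · calc _ ≤ ‖f₂ s‖ * ‖g s‖ + 2 * ‖f₁ s‖ * ‖g₁ s‖ + ‖f s‖ * ‖g₂ s‖ := by
          refine (norm_add_le _ _).trans (add_le_add ((norm_add_le _ _).trans (le_of_eq ?_))
            (le_of_eq ?_)) <;> simp
      _ ≤ M * N + 2 * M * N + M * N := by gcongr
      _ ≤ _ := by linarith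

theorem rpow_le_of_mem_Icc {s γ : ℝ} (hs : s ∈ Set.Icc (1 / 4 : ℝ) 4) : s ^ γ ≤ 4 ^ |γ| := by
  have hs0 : 0 < s := by linarith [hs.1]
  rcases le_total 0 γ with h | h
  · rw [abs_of_nonneg h]; exact rpow_le_rpow hs0.le hs.2 h
  · rw [abs_of_nonpos h]
    calc s ^ γ ≤ (1 / 4) ^ γ := rpow_le_rpow_of_nonpos (by norm_num) hs.1 h
      _ = 4 ^ (-γ) := by rw [one_div, inv_rpow (by norm_num), rpow_neg (by norm_num)]

theorem le_rpow_of_mem_Icc {s γ : ℝ} (hs : s ∈ Set.Icc (1 / 4 : ℝ) 4) : (4 ^ |γ|)⁻¹ ≤ s ^ γ := by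
  have hs0 : 0 < s := by linarith [hs.1]
  have := rpow_le_of_mem_Icc (γ := -γ) hs
  rw [rpow_neg hs0.le, abs_neg] at this
  exact inv_le_of_inv_le₀ (by positivity) this

/-- The power `s ^ ζ`. The constant is quadratic in `‖ζ‖`, one factor per derivative; complex
interpolation tolerates such growth in the imaginary part. -/
theorem c2Bound_cpow {γ : ℝ} (ζ : ℂ) (hζ : ζ.re = γ) :
    C2Bound (fun s => Complex.exp (ζ * (Real.log s : ℂ)))
      (fun s => ζ * (s : ℂ)⁻¹ * Complex.exp (ζ * (Real.log s : ℂ)))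
      (fun s => ζ * (ζ - 1) * (s : ℂ)⁻¹ ^ 2 * Complex.exp (ζ * (Real.log s : ℂ)))
      (16 * 4 ^ |γ| * (1 + ‖ζ‖) ^ 2) := by
  have hlog : ∀ s ∈ Set.Icc (1 / 4 : ℝ) 4, HasDerivAt (fun s => Complex.exp (ζ * (Real.log s : ℂ)))
      (ζ * (s : ℂ)⁻¹ * Complex.exp (ζ * (Real.log s : ℂ))) s := fun s hs => by
    have hs0 : s ≠ 0 := by have := hs.1; intro h; norm_num [h] at this
    refine (((hasDerivAt_log hs0).ofReal_comp.const_mul ζ).cexp).congr_deriv ?_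
    push_cast; ring
  have hinv : ∀ s ∈ Set.Icc (1 / 4 : ℝ) 4, HasDerivAt (fun s : ℝ => (s : ℂ)⁻¹)
      (-(s : ℂ)⁻¹ ^ 2) s := fun s hs => by
    have hs0 : s ≠ 0 := by have := hs.1; intro h; norm_num [h] at this
    have := (hasDerivAt_inv hs0).ofReal_comp
    simpa using this
  have hn : ∀ s ∈ Set.Icc (1 / 4 : ℝ) 4, ‖Complex.exp (ζ * (Real.log s : ℂ))‖ ≤ 4 ^ |γ| :=
    fun s hs => by
    have hs0 : 0 < s := by linarith [hs.1]
    rw [Complex.norm_exp, Complex.re_mul_ofReal, hζ, mul_comm, ← rpow_def_of_pos hs0]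
    exact rpow_le_of_mem_Icc hs
  have hi : ∀ s ∈ Set.Icc (1 / 4 : ℝ) 4, ‖(s : ℂ)⁻¹‖ ≤ 4 := fun s hs => by
    have hs0 : 0 < s := by linarith [hs.1]
    rw [norm_inv, Complex.norm_real, Real.norm_of_nonneg hs0.le]
    exact inv_le_of_inv_le₀ (by norm_num) (by linarith [hs.1])
  have hz := norm_nonneg ζ
  have hp : 0 < (4 : ℝ) ^ |γ| := by positivity
  refine ⟨hlog, fun s hs => ?_, ?_, fun s hs => ?_, fun s hs => ?_, fun s hs => ?_⟩
  · refine (((hinv s hs).const_mul ζ).mul (hlog s hs)).congr_deriv ?_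
    ring
  · refine ContinuousOn.mul (continuousOn_const.mul (ContinuousOn.pow (fun s hs =>
      (hinv s hs).continuousAt.continuousWithinAt) 2)) fun s hs =>
      (hlog s hs).continuousAt.continuousWithinAt
  · refine (hn s hs).trans ?_
    nlinarith [mul_nonneg hp.le hz, mul_nonneg hp.le (mul_nonneg hz hz)]
  · rw [norm_mul, norm_mul]
    calc ‖ζ‖ * ‖(s : ℂ)⁻¹‖ * ‖Complex.exp (ζ * (Real.log s : ℂ))‖ ≤ ‖ζ‖ * 4 * 4 ^ |γ| := by
          gcongr
          · exact hi s hs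
          · exact hn s hs
      _ ≤ _ := by nlinarith [mul_nonneg hp.le hz, mul_nonneg hp.le (mul_nonneg hz hz)]
  · rw [norm_mul, norm_mul, norm_mul, norm_pow]
    calc ‖ζ‖ * ‖ζ - 1‖ * ‖(s : ℂ)⁻¹‖ ^ 2 * ‖Complex.exp (ζ * (Real.log s : ℂ))‖
        ≤ ‖ζ‖ * (‖ζ‖ + 1) * 4 ^ 2 * 4 ^ |γ| := by
          gcongr
          · refine (norm_sub_le _ _).trans ?_; simp
          · exact hi s hs
          · exact hn s hs
      _ ≤ _ := by nlinarith [mul_nonneg hp.le hz, mul_nonneg hp.le (mul_nonneg hz hz)]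

/-- Symbol bounds are scale invariant: each derivative of `B (ρ s)` produces a factor `ρ`, which on
`s ≈ 1` is comparable to the argument `ρ s`. -/
theorem exists_c2Bound_comp_mul {κ : ℝ} (hκ : 0 ≤ κ) {B : ℝ → ℂ} (hB : HasSymbolBounds κ B) :
    ∃ C, 0 ≤ C ∧ ∀ ρ : ℝ, ∃ f₁ f₂ : ℝ → ℂ,
      C2Bound (fun s => B (ρ * s)) f₁ f₂ (C * (1 + |ρ|) ^ (-κ)) := by
  obtain ⟨B₁, B₂, C, hC, hd₁, hd₂, hc, hb⟩ := hB
  refine ⟨16 * C * 4 ^ κ, by positivity, fun ρ =>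
    ⟨fun s => ρ * B₁ (ρ * s), fun s => ρ ^ 2 * B₂ (ρ * s), ?_⟩⟩
  have hlin : ∀ s, HasDerivAt (fun s => ρ * s) ρ s := fun s => by
    simpa using (hasDerivAt_id s).const_mul ρ
  have hdec : ∀ s ∈ Set.Icc (1 / 4 : ℝ) 4, (1 + |ρ * s|) ^ (-κ) ≤ 4 ^ κ * (1 + |ρ|) ^ (-κ) := by
    intro s hs
    have : (1 + |ρ|) / 4 ≤ 1 + |ρ * s| := by
      rw [abs_mul, abs_of_pos (by linarith [hs.1] : 0 < s)]
      nlinarith [abs_nonneg ρ, hs.1]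
    calc (1 + |ρ * s|) ^ (-κ) ≤ ((1 + |ρ|) / 4) ^ (-κ) :=
          rpow_le_rpow_of_nonpos (by positivity) this (by linarith)
      _ = _ := by
          rw [div_rpow (by positivity) (by norm_num), rpow_neg (by norm_num : (0 : ℝ) ≤ 4)]
          field_simp
  refine ⟨fun s _ => ?_, fun s _ => ?_, ?_, fun s hs => ?_, fun s hs => ?_, fun s hs => ?_⟩
  · have := (hd₁ (ρ * s)).scomp s (hlin s)
    refine this.congr_deriv ?_
    simp
  · have := ((hd₂ (ρ * s)).scomp s (hlin s)).const_mul (ρ : ℂ)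
    refine this.congr_deriv ?_
    simp; ring
  · exact (continuous_const.mul (hc.comp (continuous_const.mul continuous_id))).continuousOn
  all_goals
    have hs4 : 1 ≤ 4 * s := by linarith [hs.1]
    have hs0 : 0 < s := by linarith [hs.1]
    obtain ⟨p0, p1, p2⟩ := hb (ρ * s)
    have hd := mul_le_mul_of_nonneg_left (hdec s hs) hC
    have hr : 0 ≤ (1 + |ρ|) ^ (-κ) := by positivity
    rw [abs_mul, abs_of_pos hs0] at p0 p1 p2 hd
    have hR : 0 ≤ C * (4 ^ κ * (1 + |ρ|) ^ (-κ)) := by positivity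
  · nlinarith
  · rw [norm_mul, Complex.norm_real, Real.norm_eq_abs]
    have hX : 0 ≤ |ρ| * ‖B₁ (ρ * s)‖ := by positivity
    calc |ρ| * ‖B₁ (ρ * s)‖ ≤ (4 * s) * (|ρ| * ‖B₁ (ρ * s)‖) := le_mul_of_one_le_left hX hs4
      _ = 4 * (|ρ| * s * ‖B₁ (ρ * s)‖) := by ring
      _ ≤ _ := by linarith
  · rw [norm_mul, norm_pow, Complex.norm_real, Real.norm_eq_abs]
    have hX : 0 ≤ |ρ| ^ 2 * ‖B₂ (ρ * s)‖ := by positivity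
    calc |ρ| ^ 2 * ‖B₂ (ρ * s)‖ ≤ (4 * s) ^ 2 * (|ρ| ^ 2 * ‖B₂ (ρ * s)‖) :=
          le_mul_of_one_le_left hX (one_le_pow₀ hs4)
      _ = 16 * ((|ρ| * s) ^ 2 * ‖B₂ (ρ * s)‖) := by ring
      _ ≤ _ := by linarith

/-- The amplitude of a dyadic piece, at unit scale. -/
noncomputable def pieceAmplitude (B : ℝ → ℂ) (ζ : ℂ) (ρ s : ℝ) : ℂ :=
  Complex.exp (ζ * (Real.log s : ℂ)) * (dyadicBump s : ℂ) * B (ρ * s)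

/-- The bump vanishes near `1/4` and `4`, which removes all boundary terms from later integrations
by parts. The constant depends on `ζ` through its real part, except for the explicit quadratic
factor in the imaginary part. -/
theorem exists_c2Bound_pieceAmplitude {κ : ℝ} (hκ : 0 ≤ κ) {B : ℝ → ℂ} (hB : HasSymbolBounds κ B)
    (γ : ℝ) :
    ∃ C, 0 ≤ C ∧ ∀ (ζ : ℂ) (ρ : ℝ), ζ.re = γ → ∃ f₁ f₂ : ℝ → ℂ,
      C2Bound (pieceAmplitude B ζ ρ) f₁ f₂ (C * (1 + |ζ.im|) ^ 2 * (1 + |ρ|) ^ (-κ)) ∧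
      pieceAmplitude B ζ ρ (1 / 4) = 0 ∧ pieceAmplitude B ζ ρ 4 = 0 ∧
      f₁ (1 / 4) = 0 ∧ f₁ 4 = 0 := by
  obtain ⟨C, hC, hCB⟩ := exists_c2Bound_comp_mul hκ hB
  obtain ⟨D, hD⟩ : ∃ D, C2Bound (fun s => (dyadicBump s : ℂ))
      (fun s => ((deriv dyadicBump s : ℝ) : ℂ))
      (fun s => ((deriv (deriv dyadicBump) s : ℝ) : ℂ)) D := by
    have h1 : ContDiff ℝ 1 (deriv dyadicBump) := by
      have : ContDiff ℝ (1 + 1) dyadicBump := dyadicBump_contDiff (n := 2)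
      exact (contDiff_succ_iff_deriv.1 this).2.2
    have c0 : Continuous dyadicBump := (dyadicBump_contDiff (n := 0)).continuous
    have c2 : Continuous (deriv (deriv dyadicBump)) := h1.continuous_deriv le_rfl
    obtain ⟨M₀, h₀⟩ := (isCompact_Icc (a := (1 / 4 : ℝ)) (b := 4)).exists_bound_of_continuousOn
      c0.continuousOn
    obtain ⟨M₁, h₁⟩ := (isCompact_Icc (a := (1 / 4 : ℝ)) (b := 4)).exists_bound_of_continuousOn
      h1.continuous.continuousOn
    obtain ⟨M₂, h₂⟩ := (isCompact_Icc (a := (1 / 4 : ℝ)) (b := 4)).exists_bound_of_continuousOn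
      c2.continuousOn
    refine ⟨max M₀ (max M₁ M₂), fun s _ => ?_, fun s _ => ?_, ?_, fun s hs => ?_, fun s hs => ?_,
      fun s hs => ?_⟩
    · exact ((dyadicBump_contDiff (n := 1)).differentiable (by norm_num) s).hasDerivAt.ofReal_comp
    · exact (h1.differentiable (by norm_num) s).hasDerivAt.ofReal_comp
    · exact (Complex.continuous_ofReal.comp c2).continuousOn
    · rw [Complex.norm_real]; exact (h₀ s hs).trans (le_max_left _ _)
    · rw [Complex.norm_real]; exact (h₁ s hs).trans ((le_max_left _ _).trans (le_max_right _ _))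
    · rw [Complex.norm_real]; exact (h₂ s hs).trans ((le_max_right _ _).trans (le_max_right _ _))
  have hD0 : 0 ≤ D := (norm_nonneg _).trans (hD.bound 1 (by norm_num))
  have hz1 : ∀ s : ℝ, s = 1 / 4 ∨ s = 4 → dyadicBump s = 0 ∧ deriv dyadicBump s = 0 := by
    intro s hs
    have hev : dyadicBump =ᶠ[nhds s] fun _ => 0 := by
      rcases hs with rfl | rfl
      · filter_upwards [Ioo_mem_nhds (show (0 : ℝ) < 1 / 4 by norm_num)
          (show (1 / 4 : ℝ) < 1 / 2 by norm_num)] with x hx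
        exact dyadicBump_of_le hx.1.le hx.2.le
      · filter_upwards [lt_mem_nhds (show (2 : ℝ) < 4 by norm_num)] with x hx
        exact dyadicBump_of_ge hx.le
    exact ⟨hev.eq_of_nhds, by rw [hev.deriv_eq]; simp⟩
  refine ⟨4 * (4 * (16 * 4 ^ |γ| * (1 + |γ|) ^ 2 * D) * C), by positivity, fun ζ ρ hζ => ?_⟩
  obtain ⟨f₁, f₂, hf⟩ := hCB ρ
  have := ((c2Bound_cpow ζ hζ).mul hD).mul hf
  refine ⟨_, _, ⟨this.deriv₁, this.deriv₂, this.cont, ?_, ?_, ?_⟩, ?_, ?_, ?_, ?_⟩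
  rotate_left 3
  · unfold pieceAmplitude; rw [(hz1 (1 / 4) (Or.inl rfl)).1]; simp
  · unfold pieceAmplitude; rw [(hz1 4 (Or.inr rfl)).1]; simp
  · have := hz1 (1 / 4) (Or.inl rfl)
    rw [this.1, this.2]; simp
  · have := hz1 4 (Or.inr rfl)
    rw [this.1, this.2]; simp
  all_goals
    have hle : 4 * (4 * (16 * 4 ^ |γ| * (1 + ‖ζ‖) ^ 2 * D) * (C * (1 + |ρ|) ^ (-κ))) ≤
        4 * (4 * (16 * 4 ^ |γ| * (1 + |γ|) ^ 2 * D) * C) * (1 + |ζ.im|) ^ 2 *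
          (1 + |ρ|) ^ (-κ) := by
      have h1 : (1 + ‖ζ‖) ≤ (1 + |γ|) * (1 + |ζ.im|) := by
        have := Complex.norm_le_abs_re_add_abs_im ζ
        rw [hζ] at this
        nlinarith [abs_nonneg γ, abs_nonneg ζ.im]
      have h2 : (1 + ‖ζ‖) ^ 2 ≤ ((1 + |γ|) * (1 + |ζ.im|)) ^ 2 := by gcongr
      calc _ ≤ 4 * (4 * (16 * 4 ^ |γ| * ((1 + |γ|) * (1 + |ζ.im|)) ^ 2 * D) *
            (C * (1 + |ρ|) ^ (-κ))) := by gcongr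
        _ = _ := by ring
    intro s hs
  · exact (this.bound s hs).trans hle
  · exact (this.bound₁ s hs).trans hle
  · exact (this.bound₂ s hs).trans hle

/-! ### A dyadic piece -/

/-- The phase has derivative `A + t R g₁(R s)` with `A = t ℓ R + w`; the second term and the next
two derivatives are at most of size `λ = |t| R ^ β`, and it and the second derivative are also at
least of that size. If `|A|` is much smaller or much larger than `λ`, the slope dominates both, and
two integrations by parts apply. In every case the second derivative test applies. -/
theorem exists_dyadic_piece_bound {g : ℝ → ℝ} {ℓ β : ℝ} (hg : HasPhaseExpansion g ℓ β) :
    ∃ y₀ c C K : ℝ, 0 < y₀ ∧ 0 < c ∧ 0 < C ∧ 0 < K ∧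
      ∀ (R t w M : ℝ) (a a₁ a₂ : ℝ → ℂ), y₀ ≤ R → t ≠ 0 → C2Bound a a₁ a₂ M →
        a (1 / 4) = 0 → a 4 = 0 → a₁ (1 / 4) = 0 → a₁ 4 = 0 →
        ∀ J : ℝ, J = ‖∫ s in (1 / 4 : ℝ)..4,
          Complex.exp (Complex.I * ((t * g (R * s) + w * s : ℝ) : ℂ)) * a s‖ →
        J ≤ K * M ∧
        ((|t * ℓ * R + w| ≤ c * (|t| * R ^ β) ∨ C * (|t| * R ^ β) ≤ |t * ℓ * R + w|) →
          J * (|t| * R ^ β) ^ 2 ≤ K * M ∧ J * |t * ℓ * R + w| ^ 2 ≤ K * M) ∧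
        J ≤ K * M * (|t| * R ^ β) ^ (-(1 / 2) : ℝ) := by
  obtain ⟨y₀, c, C, g₁, g₂, g₃, hy₀, hc, hC, hcont, hexp⟩ := hg
  set K₀ : ℝ := 4 ^ (|β - 1| + |β - 2| + |β - 3|) with hK₀
  have hK₀1 : 1 ≤ K₀ := one_le_rpow (by norm_num) (by positivity)
  have hK₀p : 0 < K₀ := by linarith
  have e1 : (4 : ℝ) ^ |β - 1| ≤ K₀ := rpow_le_rpow_of_exponent_le (by norm_num)
    (by have := abs_nonneg (β - 2); have := abs_nonneg (β - 3); linarith)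
  have e2 : (4 : ℝ) ^ |β - 2| ≤ K₀ := rpow_le_rpow_of_exponent_le (by norm_num)
    (by have := abs_nonneg (β - 1); have := abs_nonneg (β - 3); linarith)
  have e3 : (4 : ℝ) ^ |β - 3| ≤ K₀ := rpow_le_rpow_of_exponent_le (by norm_num)
    (by have := abs_nonneg (β - 1); have := abs_nonneg (β - 2); linarith)
  set c' := c / K₀ with hc'
  set C' := C * K₀ with hC'
  have hc'0 : 0 < c' := by positivity
  have hC'0 : 0 < C' := by positivity
  set E := 2 * C' / c' with hE
  have hE0 : 0 < E := by positivity
  set Q := (1 + 4 * E + 3 * E ^ 2) * (15 / 4) with hQ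
  have hQ0 : 0 < Q := by positivity
  set V := (10 + 4 * (15 / 4) + 16 * (C' / c')) * c' ^ (-(1 / 2) : ℝ) with hV
  have hV0 : 0 < V := by positivity
  set K := 4 + 4 * Q / c' ^ 2 + Q + 120 + 120 / (4 * C' ^ 2) + V with hK
  -- `4 * y₀` because `R s` may be as small as `R / 4`; `c' / 2` and `2 * C'` leave at least half of
  -- the dominant term of the slope.
  refine ⟨4 * y₀, c' / 2, 2 * C', K, by positivity, by positivity, by positivity, by positivity,
    fun R t w M a a₁ a₂ hR ht ha ha0 ha4 ha0' ha4' J hJ => ?_⟩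
  have hR0 : 0 < R := by linarith
  have hM0 : 0 ≤ M := (norm_nonneg _).trans (ha.bound 1 (by norm_num))
  set lam := |t| * R ^ β with hlam
  have ht0 : 0 < |t| := abs_pos.2 ht
  have hlam0 : 0 < lam := by positivity
  set A := t * ℓ * R + w with hA
  have hmem : ∀ s ∈ Set.Icc (1 / 4 : ℝ) 4, y₀ ≤ R * s := fun s hs => by nlinarith [hs.1]
  have hlin : ∀ s, HasDerivAt (fun s => R * s) R s := fun s => by
    simpa using (hasDerivAt_id s).const_mul R
  have hd0 : ∀ s ∈ Set.Icc (1 / 4 : ℝ) 4,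
      HasDerivAt (fun s => t * g (R * s) + w * s) (A + t * R * g₁ (R * s)) s := fun s hs => by
    refine ((((hexp _ (hmem s hs)).1.comp s (hlin s)).const_mul t).add
      ((hasDerivAt_id s).const_mul w)).congr_deriv ?_
    rw [hA]; ring
  have hd1 : ∀ s ∈ Set.Icc (1 / 4 : ℝ) 4,
      HasDerivAt (fun s => A + t * R * g₁ (R * s)) (t * R ^ 2 * g₂ (R * s)) s := fun s hs => by
    refine ((((hexp _ (hmem s hs)).2.1.comp s (hlin s)).const_mul (t * R)).const_add A).congr_deriv
      ?_
    ring
  have hd2 : ∀ s ∈ Set.Icc (1 / 4 : ℝ) 4,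
      HasDerivAt (fun s => t * R ^ 2 * g₂ (R * s)) (t * R ^ 3 * g₃ (R * s)) s := fun s hs => by
    refine (((hexp _ (hmem s hs)).2.2.1.comp s (hlin s)).const_mul (t * R ^ 2)).congr_deriv ?_
    ring
  have hc3 : ContinuousOn (fun s => t * R ^ 3 * g₃ (R * s)) (Set.Icc (1 / 4 : ℝ) 4) :=
    continuousOn_const.mul (hcont.comp (continuous_const.mul continuous_id).continuousOn hmem)
  have up : ∀ (j : ℕ) (x : ℝ), ∀ s ∈ Set.Icc (1 / 4 : ℝ) 4, (4 : ℝ) ^ |β - j| ≤ K₀ →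
      |x| ≤ C * (R * s) ^ (β - j) → |t * R ^ j * x| ≤ C' * lam := by
    intro j x s hs hj hx
    have hs0 : 0 < s := by linarith [hs.1]
    rw [abs_mul, abs_mul, abs_of_pos (pow_pos hR0 j)]
    calc |t| * R ^ j * |x| ≤ |t| * R ^ j * (C * (R ^ (β - j) * K₀)) := by
          rw [mul_rpow hR0.le hs0.le] at hx
          gcongr
          refine hx.trans ?_
          gcongr
          exact (rpow_le_of_mem_Icc hs).trans hj
      _ = C' * (|t| * (R ^ (j : ℝ) * R ^ (β - j))) := by rw [rpow_natCast]; ring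
      _ = C' * lam := by rw [← rpow_add hR0]; congr 3; ring_nf
  have low : ∀ (j : ℕ) (x : ℝ), ∀ s ∈ Set.Icc (1 / 4 : ℝ) 4, (4 : ℝ) ^ |β - j| ≤ K₀ →
      c * (R * s) ^ (β - j) ≤ |x| → c' * lam ≤ |t * R ^ j * x| := by
    intro j x s hs hj hx
    have hs0 : 0 < s := by linarith [hs.1]
    rw [abs_mul, abs_mul, abs_of_pos (pow_pos hR0 j)]
    calc c' * lam = c' * (|t| * (R ^ (j : ℝ) * R ^ (β - j))) := by
          rw [← rpow_add hR0, add_sub_cancel]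
      _ = |t| * R ^ j * (c * (R ^ (β - j) * K₀⁻¹)) := by rw [rpow_natCast]; ring
      _ ≤ |t| * R ^ j * |x| := by
          rw [mul_rpow hR0.le hs0.le] at hx
          gcongr
          refine le_trans ?_ hx
          gcongr
          refine le_trans ?_ (le_rpow_of_mem_Icc hs)
          gcongr
  have u1 : ∀ s ∈ Set.Icc (1 / 4 : ℝ) 4, |t * R * g₁ (R * s)| ≤ C' * lam := fun s hs => by
    simpa using up 1 (g₁ (R * s)) s hs (by simpa using e1)
      (by simpa using (hexp _ (hmem s hs)).2.2.2.2.1)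
  have l1 : ∀ s ∈ Set.Icc (1 / 4 : ℝ) 4, c' * lam ≤ |t * R * g₁ (R * s)| := fun s hs => by
    simpa using low 1 (g₁ (R * s)) s hs (by simpa using e1)
      (by simpa using (hexp _ (hmem s hs)).2.2.2.1)
  have u2 : ∀ s ∈ Set.Icc (1 / 4 : ℝ) 4, |t * R ^ 2 * g₂ (R * s)| ≤ C' * lam := fun s hs =>
    up 2 (g₂ (R * s)) s hs (by simpa using e2)
      (by simpa using (hexp _ (hmem s hs)).2.2.2.2.2.2.1)
  have l2 : ∀ s ∈ Set.Icc (1 / 4 : ℝ) 4, c' * lam ≤ |t * R ^ 2 * g₂ (R * s)| := fun s hs =>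
    low 2 (g₂ (R * s)) s hs (by simpa using e2)
      (by simpa using (hexp _ (hmem s hs)).2.2.2.2.2.1)
  have u3 : ∀ s ∈ Set.Icc (1 / 4 : ℝ) 4, |t * R ^ 3 * g₃ (R * s)| ≤ C' * lam := fun s hs =>
    up 3 (g₃ (R * s)) s hs (by simpa using e3)
      (by simpa using (hexp _ (hmem s hs)).2.2.2.2.2.2.2)
  have hJ0 : 0 ≤ J := hJ ▸ norm_nonneg _
  have triv : J ≤ 15 / 4 * M := by
    rw [hJ]
    refine (intervalIntegral.norm_integral_le_of_norm_le_const (C := M) fun s hs => ?_).trans ?_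
    · rw [Set.uIoc_of_le (by norm_num)] at hs
      rw [norm_mul, norm_cexp_I_mul_ofReal, one_mul]
      exact ha.bound s ⟨hs.1.le, hs.2⟩
    · rw [abs_of_pos (by norm_num)]; linarith
  refine ⟨triv.trans ?_, fun h => ?_, ?_⟩
  · gcongr
    have : 0 ≤ 4 * Q / c' ^ 2 + Q + 120 + 120 / (4 * C' ^ 2) + V := by positivity
    linarith
  · rcases h with h | h
    · have hb := norm_oscillatory_integral_le_of_nonstationary (Y := c' * lam / 2) (C := E)
        (by norm_num : (1 / 4 : ℝ) ≤ 4)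
        (by positivity) hE0.le hd0 hd1 hd2 hc3 ha.deriv₁ ha.deriv₂ ha.cont ha0 ha4 ha0' ha4'
        (fun s hs => by
          have h1 := l1 s hs
          have h2 := abs_sub_abs_le_abs_sub (t * R * g₁ (R * s)) (-A)
          rw [abs_neg, sub_neg_eq_add, add_comm _ A] at h2
          linarith)
        (fun s hs => (u2 s hs).trans (le_of_eq (by rw [hE]; field_simp)))
        (fun s hs => (u3 s hs).trans (le_of_eq (by rw [hE]; field_simp)))
        ha.bound ha.bound₁ ha.bound₂
      rw [← hJ] at hb
      have h1 : J * (c' * lam / 2) ^ 2 ≤ Q * M := by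
        rw [le_div_iff₀ (by positivity)] at hb
        refine hb.trans (le_of_eq ?_)
        rw [hQ]; ring
      constructor
      · calc J * lam ^ 2 = 4 / c' ^ 2 * (J * (c' * lam / 2) ^ 2) := by field_simp; ring
          _ ≤ 4 / c' ^ 2 * (Q * M) := by gcongr
          _ = 4 * Q / c' ^ 2 * M := by ring
          _ ≤ K * M := by
              gcongr
              have : 0 ≤ 4 + Q + 120 + 120 / (4 * C' ^ 2) + V := by positivity
              linarith
      · calc J * |A| ^ 2 ≤ J * (c' * lam / 2) ^ 2 := by
              gcongr; linarith
          _ ≤ Q * M := h1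
          _ ≤ K * M := by
              gcongr
              have : 0 ≤ 4 + 4 * Q / c' ^ 2 + 120 + 120 / (4 * C' ^ 2) + V := by positivity
              linarith
    · have hA0 : 0 < |A| := lt_of_lt_of_le (by positivity) h
      have hb := norm_oscillatory_integral_le_of_nonstationary (Y := |A| / 2) (C := 1)
        (by norm_num : (1 / 4 : ℝ) ≤ 4)
        (by positivity) zero_le_one hd0 hd1 hd2 hc3 ha.deriv₁ ha.deriv₂ ha.cont ha0 ha4 ha0' ha4'
        (fun s hs => by
          have h1 := u1 s hs
          have h2 := abs_sub_abs_le_abs_sub A (-(t * R * g₁ (R * s)))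
          rw [abs_neg, sub_neg_eq_add] at h2
          linarith)
        (fun s hs => (u2 s hs).trans (by linarith))
        (fun s hs => (u3 s hs).trans (by linarith))
        ha.bound ha.bound₁ ha.bound₂
      rw [← hJ] at hb
      have h1 : J * |A| ^ 2 ≤ 120 * M := by
        rw [le_div_iff₀ (by positivity)] at hb
        linarith
      constructor
      · calc J * lam ^ 2 = J * (2 * C' * lam) ^ 2 / (4 * C' ^ 2) := by field_simp; ring
          _ ≤ J * |A| ^ 2 / (4 * C' ^ 2) := by gcongr
          _ ≤ 120 * M / (4 * C' ^ 2) := by gcongr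
          _ = 120 / (4 * C' ^ 2) * M := by ring
          _ ≤ K * M := by
              gcongr
              have : 0 ≤ 4 + 4 * Q / c' ^ 2 + Q + 120 + V := by positivity
              linarith
      · refine h1.trans ?_
        gcongr
        have : 0 ≤ 4 + 4 * Q / c' ^ 2 + Q + 120 / (4 * C' ^ 2) + V := by positivity
        linarith
  · have hb := norm_oscillatory_integral_le_of_second_deriv (m := c' * lam) (κ := C' / c')
      (by norm_num : (1 / 4 : ℝ) ≤ 4) (by positivity) (by positivity) hd0 hd1
      (fun s hs => (hd2 s hs).continuousAt.continuousWithinAt) ha.deriv₁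
      (fun s hs => (ha.deriv₂ s hs).continuousAt.continuousWithinAt) l2
      (fun s hs => (u2 s hs).trans (le_of_eq (by field_simp))) ha.bound ha.bound₁
    rw [← hJ, mul_rpow hc'0.le hlam0.le] at hb
    calc J ≤ V * M * lam ^ (-(1 / 2) : ℝ) := hb.trans (le_of_eq (by rw [hV]; ring))
      _ ≤ K * M * lam ^ (-(1 / 2) : ℝ) := by
          gcongr
          have : 0 ≤ 4 + 4 * Q / c' ^ 2 + Q + 120 + 120 / (4 * C' ^ 2) := by positivity
          linarith

/-! ### Summation over the dyadic scales -/

/-- Two geometric series, on either side of the index where `x q ^ k ≈ 1`. The induction peels off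
the term `k = 0` and replaces `x` by `x q`; it closes because the claim is sharpened to decay in `1
/ x` for `x ≥ 1` and to gain `(q - 1)⁻¹ x` for `x ≤ 1`. -/
theorem sum_min_geometric_le_of_one_lt {q : ℝ} (hq : 1 < q) (N : ℕ) (x : ℝ) (hx : 0 ≤ x) :
    ∑ k ∈ Finset.range N, min (x * q ^ k) (x * q ^ k)⁻¹ ≤ q / (q - 1) + 1 + (q - 1)⁻¹ := by
  have hq1 : 0 < q - 1 := by linarith
  suffices h : ∀ N x, 0 ≤ x →
      (1 ≤ x → ∑ k ∈ Finset.range N, min (x * q ^ k) (x * q ^ k)⁻¹ ≤ q / (q - 1) * x⁻¹) ∧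
      (x ≤ 1 → ∑ k ∈ Finset.range N, min (x * q ^ k) (x * q ^ k)⁻¹ ≤
        q / (q - 1) + 1 + (q - 1)⁻¹ - (q - 1)⁻¹ * x) by
    rcases le_total 1 x with h1 | h1
    · refine ((h N x hx).1 h1).trans ?_
      have : q / (q - 1) * x⁻¹ ≤ q / (q - 1) * 1 := by gcongr; exact inv_le_one_of_one_le₀ h1
      have : 0 < (q - 1)⁻¹ := by positivity
      linarith
    · refine ((h N x hx).2 h1).trans ?_
      have : 0 ≤ (q - 1)⁻¹ * x := by positivity
      linarith
  intro N
  induction N with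
  | zero =>
    intro x hx
    refine ⟨fun _ => by simp; positivity, fun h1 => ?_⟩
    have : (q - 1)⁻¹ * x ≤ (q - 1)⁻¹ * 1 := by gcongr
    have : 0 < q / (q - 1) := by positivity
    simp; linarith
  | succ N ih =>
    intro x hx
    have hs : ∑ k ∈ Finset.range (N + 1), min (x * q ^ k) (x * q ^ k)⁻¹ =
        (∑ k ∈ Finset.range N, min ((x * q) * q ^ k) ((x * q) * q ^ k)⁻¹) + min x x⁻¹ := by
      rw [Finset.sum_range_succ', pow_zero, mul_one]
      congr 1
      refine Finset.sum_congr rfl fun k _ => ?_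
      rw [pow_succ', mul_assoc]
    rw [hs]
    have hxq : x ≤ x * q := le_mul_of_one_le_right hx hq.le
    refine ⟨fun h1 => ?_, fun h1 => ?_⟩
    · have := (ih (x * q) (by positivity)).1 (h1.trans hxq)
      have h2 : min x x⁻¹ ≤ x⁻¹ := min_le_right _ _
      have h3 : q / (q - 1) * (x * q)⁻¹ + x⁻¹ = q / (q - 1) * x⁻¹ := by field_simp; ring
      linarith
    · have h2 : min x x⁻¹ ≤ x := min_le_left _ _
      rcases le_total 1 (x * q) with h3 | h3
      · have h4 := (ih (x * q) (by positivity)).1 h3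
        have h5 : q / (q - 1) * (x * q)⁻¹ ≤ q / (q - 1) * 1 := by
          gcongr; exact inv_le_one_of_one_le₀ h3
        have h6 : (q - 1)⁻¹ * x ≤ (q - 1)⁻¹ * 1 := by gcongr
        linarith
      · have h4 := (ih (x * q) (by positivity)).2 h3
        have h5 : (q - 1)⁻¹ * (x * q) = (q - 1)⁻¹ * x + x := by field_simp; ring
        linarith

/-- For `q < 1` the sum is read backwards, with ratio `q⁻¹`. What matters is uniformity in `x`,
which will carry the time and the position. -/
theorem exists_sum_min_geometric_le {q : ℝ} (hq0 : 0 < q) (hq : q ≠ 1) :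
    ∃ C, 0 ≤ C ∧ ∀ (N : ℕ) (x : ℝ), 0 ≤ x →
      ∑ k ∈ Finset.range N, min (x * q ^ k) (x * q ^ k)⁻¹ ≤ C := by
  rcases lt_or_gt_of_ne hq with h | h
  · have hq' : 1 < q⁻¹ := (one_lt_inv₀ hq0).2 h
    have hq1 : 0 < q⁻¹ - 1 := by linarith
    refine ⟨q⁻¹ / (q⁻¹ - 1) + 1 + (q⁻¹ - 1)⁻¹, by positivity, fun N x hx => ?_⟩
    refine le_trans (le_of_eq ?_)
      (sum_min_geometric_le_of_one_lt hq' N (x * q ^ (N - 1)) (by positivity))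
    rw [← Finset.sum_range_reflect]
    refine Finset.sum_congr rfl fun k hk => ?_
    have hk' : k ≤ N - 1 := by have := Finset.mem_range.1 hk; omega
    have : x * q ^ (N - 1 - k) = x * q ^ (N - 1) * q⁻¹ ^ k := by
      rw [pow_sub₀ q hq0.ne' hk', inv_pow]; ring
    rw [this]
  · have hq1 : 0 < q - 1 := by linarith
    exact ⟨_, by positivity, fun N x hx => sum_min_geometric_le_of_one_lt h N x hx⟩

theorem min_inv_nonneg {x : ℝ} (hx : 0 ≤ x) : 0 ≤ min x x⁻¹ := le_min hx (inv_nonneg.2 hx)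

theorem min_le_min_inv_of_mem_Icc {x c C : ℝ} (hc : 0 < c) (h1 : c ≤ x) (h2 : x ≤ C) :
    min c C⁻¹ ≤ min x x⁻¹ :=
  min_le_min h1 (inv_anti₀ (by linarith) h2)

/-- The bounds for a dyadic piece, weighted by `√lam`. -/
theorem sqrt_mul_le_of_dyadic_bounds {J lam A c C E : ℝ} (hlam : 0 < lam) (hJ : 0 ≤ J)
    (hc : 0 < c) (hC : 0 < C) (hE : 0 ≤ E) (hA : 0 ≤ A) (h1 : J ≤ E)
    (h2 : (A ≤ c * lam ∨ C * lam ≤ A) → J * lam ^ 2 ≤ E)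
    (h3 : J ≤ E * lam ^ (-(1 / 2) : ℝ)) :
    lam ^ (1 / 2 : ℝ) * J ≤ E * (min (lam ^ (1 / 2 : ℝ)) (lam ^ (1 / 2 : ℝ))⁻¹ +
      (min c C⁻¹)⁻¹ * min (A / lam) (A / lam)⁻¹) := by
  have hp : 0 < lam ^ (1 / 2 : ℝ) := by positivity
  have hmm := min_inv_nonneg hp.le
  have hAl : 0 ≤ A / lam := by positivity
  -- Either the piece is non-stationary, and `J ≲ min (1, λ⁻²)`; or `A / λ` lies in `[c, C]`, where
  -- the second minimum is bounded below and so pays for the stationary estimate.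
  by_cases h : A ≤ c * lam ∨ C * lam ≤ A
  · have h4 : lam ^ (1 / 2 : ℝ) * J ≤ E * min (lam ^ (1 / 2 : ℝ)) (lam ^ (1 / 2 : ℝ))⁻¹ := by
      rcases le_total (lam ^ (1 / 2 : ℝ)) (lam ^ (1 / 2 : ℝ))⁻¹ with h5 | h5
      · rw [min_eq_left h5, mul_comm]; gcongr
      · rw [min_eq_right h5, ← div_eq_mul_inv, le_div_iff₀ hp]
        have h6 : lam ^ (1 / 2 : ℝ) * lam ^ (1 / 2 : ℝ) = lam := by
          rw [← rpow_add hlam]; norm_num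
        have h7 : 1 ≤ lam := by
          have := mul_le_mul_of_nonneg_left h5 hp.le
          rwa [mul_inv_cancel₀ hp.ne', h6] at this
        calc lam ^ (1 / 2 : ℝ) * J * lam ^ (1 / 2 : ℝ)
            = J * (lam ^ (1 / 2 : ℝ) * lam ^ (1 / 2 : ℝ)) := by ring
          _ = J * lam := by rw [h6]
          _ ≤ J * lam ^ 2 := by gcongr; nlinarith
          _ ≤ E := h2 h
    refine h4.trans ?_
    gcongr
    have : 0 ≤ (min c C⁻¹)⁻¹ * min (A / lam) (A / lam)⁻¹ := by
      have : 0 ≤ min c C⁻¹ := le_min hc.le (inv_nonneg.2 hC.le)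
      have := min_inv_nonneg hAl
      positivity
    linarith
  · push Not at h
    have h4 : min c C⁻¹ ≤ min (A / lam) (A / lam)⁻¹ :=
      min_le_min_inv_of_mem_Icc hc ((le_div_iff₀ hlam).2 h.1.le) ((div_le_iff₀ hlam).2 h.2.le)
    have h5 : 0 < min c C⁻¹ := lt_min hc (inv_pos.2 hC)
    have h6 : 1 ≤ (min c C⁻¹)⁻¹ * min (A / lam) (A / lam)⁻¹ := by
      rw [inv_mul_eq_div, le_div_iff₀ h5]; linarith
    calc lam ^ (1 / 2 : ℝ) * J ≤ lam ^ (1 / 2 : ℝ) * (E * lam ^ (-(1 / 2) : ℝ)) := by gcongr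
      _ = E * (lam ^ (1 / 2 : ℝ) * lam ^ (-(1 / 2) : ℝ)) := by ring
      _ = E * 1 := by rw [← rpow_add hlam]; norm_num
      _ ≤ _ := by gcongr; linarith

/-- The bounds for a dyadic piece whose amplitude decays like `A ^ (-1/2)`, weighted by `lam`. -/
theorem mul_le_of_dyadic_bounds {J lam A c C E : ℝ} (hlam : 0 < lam) (hJ : 0 ≤ J)
    (hc : 0 < c) (hC : 0 < C) (hE : 0 ≤ E) (hA : 0 ≤ A) (h1 : J ≤ E)
    (h2 : (A ≤ c * lam ∨ C * lam ≤ A) → J * lam ^ 2 ≤ E)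
    (h3 : J ≤ E * (1 + A) ^ (-(1 / 2) : ℝ) * lam ^ (-(1 / 2) : ℝ)) :
    lam * J ≤ E * (min lam lam⁻¹ +
      c ^ (-(1 / 2) : ℝ) * (min c C⁻¹)⁻¹ * min (A / lam) (A / lam)⁻¹) := by
  have hAl : 0 ≤ A / lam := by positivity
  have h5 : 0 < min c C⁻¹ := lt_min hc (inv_pos.2 hC)
  have hmm := min_inv_nonneg hAl
  by_cases h : A ≤ c * lam ∨ C * lam ≤ A
  · have h4 : lam * J ≤ E * min lam lam⁻¹ := by
      rcases le_total lam lam⁻¹ with h5 | h5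
      · rw [min_eq_left h5, mul_comm]; gcongr
      · rw [min_eq_right h5, ← div_eq_mul_inv, le_div_iff₀ hlam]
        exact le_trans (le_of_eq (by ring)) (h2 h)
    refine h4.trans ?_
    gcongr
    have : 0 ≤ c ^ (-(1 / 2) : ℝ) * (min c C⁻¹)⁻¹ * min (A / lam) (A / lam)⁻¹ := by positivity
    linarith
  · push Not at h
    have hA0 : 0 < A := lt_trans (by positivity) h.1
    have h4 : min c C⁻¹ ≤ min (A / lam) (A / lam)⁻¹ :=
      min_le_min_inv_of_mem_Icc hc ((le_div_iff₀ hlam).2 h.1.le) ((div_le_iff₀ hlam).2 h.2.le)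
    have h6 : 1 ≤ (min c C⁻¹)⁻¹ * min (A / lam) (A / lam)⁻¹ := by
      rw [inv_mul_eq_div, le_div_iff₀ h5]; linarith
    -- On stationary scales `A ≥ c λ`, so the decay of the amplitude supplies a second factor `λ ^
    -- (-1/2)`.
    have h7 : (1 + A) ^ (-(1 / 2) : ℝ) ≤ c ^ (-(1 / 2) : ℝ) * lam ^ (-(1 / 2) : ℝ) := by
      rw [← mul_rpow hc.le hlam.le]
      exact rpow_le_rpow_of_nonpos (by positivity) (by linarith [h.1]) (by norm_num)
    have h8 : 0 ≤ min lam lam⁻¹ := min_inv_nonneg hlam.le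
    calc lam * J ≤ lam * (E * (c ^ (-(1 / 2) : ℝ) * lam ^ (-(1 / 2) : ℝ)) *
          lam ^ (-(1 / 2) : ℝ)) := by
          gcongr; exact h3.trans (by gcongr)
      _ = E * (c ^ (-(1 / 2) : ℝ) * (lam ^ (1 : ℝ) * lam ^ (-(1 / 2) : ℝ) *
          lam ^ (-(1 / 2) : ℝ))) := by rw [rpow_one]; ring
      _ = E * (c ^ (-(1 / 2) : ℝ) * 1) := by rw [← rpow_add hlam, ← rpow_add hlam]; norm_num
      _ ≤ E * (c ^ (-(1 / 2) : ℝ) * ((min c C⁻¹)⁻¹ * min (A / lam) (A / lam)⁻¹)) := by gcongr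
      _ ≤ _ := by
          gcongr
          rw [← mul_assoc]
          linarith

/-- The exponents `κ`, `γ`, `σ` for which the dyadic sums are bounded: `κ` is the decay of the
amplitude, `γ` the weight, and `σ` the decay in time. -/
def DyadicExponents (ℓ β κ γ σ : ℝ) : Prop :=
  (κ = 0 ∧ γ + 1 = β / 2 ∧ σ = 1 / 2) ∨ (κ = 1 / 2 ∧ γ + 1 = β ∧ σ = 1 ∧ ℓ = 0) ∨
    (κ = 1 / 2 ∧ γ + 1 = (β + 1) / 2 ∧ σ = 1 ∧ 0 < ℓ ∧ β ≤ -1)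

set_option maxHeartbeats 1000000 in
-- The cases of `DyadicExponents` are `n = 1`, then `n = 2` with `ℓ = 0`, then `n = 2` with `ℓ > 0`.
-- The weight `R ^ (γ + 1)` is what turns the bound for a piece into `|t| ^ (-σ)` times bumps `min x
-- x⁻¹` in `λ ^ (1/2)`, `λ` and `A / λ`, each summable over the scales. The third case adds a
-- convergent series in `R⁻¹`.
theorem exists_dyadic_sum_bound {g : ℝ → ℝ} {ℓ β κ γ σ : ℝ} (hg : HasPhaseExpansion g ℓ β)
    (hβ0 : β ≠ 0) (hβ1 : β ≠ 1) (hexp : DyadicExponents ℓ β κ γ σ) {B : ℝ → ℂ}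
    (hB : HasSymbolBounds κ B) :
    ∃ y₁ C : ℝ, 1 ≤ y₁ ∧ 0 < C ∧ ∀ (t w : ℝ) (ζ : ℂ) (N : ℕ), t ≠ 0 → ζ.re = γ →
      ∑ k ∈ Finset.range N, (y₁ * 2 ^ k) ^ (γ + 1) * ‖∫ s in (1 / 4 : ℝ)..4,
        Complex.exp (Complex.I * ((t * g (y₁ * 2 ^ k * s) + w * (y₁ * 2 ^ k) * s : ℝ) : ℂ)) *
          pieceAmplitude B ζ (w * (y₁ * 2 ^ k)) s‖ ≤
      C * (1 + |ζ.im|) ^ 2 * |t| ^ (-σ) := by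
  have hκ : 0 ≤ κ := by rcases hexp with h | h | h <;> rw [h.1] <;> norm_num
  obtain ⟨y₀, c, C, K, hy₀, hc, hC, hK, hpiece⟩ := exists_dyadic_piece_bound hg
  obtain ⟨D, hD, hamp⟩ := exists_c2Bound_pieceAmplitude hκ hB γ
  have hq1 : (0 : ℝ) < 2 ^ (1 - β) := by positivity
  have hq2 : (0 : ℝ) < 2 ^ (β / 2) := by positivity
  have hq3 : (0 : ℝ) < 2 ^ β := by positivity
  have hne : ∀ x : ℝ, x ≠ 0 → (2 : ℝ) ^ x ≠ 1 := fun x hx h => by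
    rw [← rpow_zero (2 : ℝ)] at h
    exact hx ((rpow_right_inj (by norm_num) (by norm_num)).1 h)
  obtain ⟨S₁, hS₁0, hS₁⟩ := exists_sum_min_geometric_le hq1 (hne _ (sub_ne_zero.2 hβ1.symm))
  obtain ⟨S₂, hS₂0, hS₂⟩ := exists_sum_min_geometric_le hq2 (hne _ (by simpa using hβ0))
  obtain ⟨S₃, hS₃0, hS₃⟩ := exists_sum_min_geometric_le hq3 (hne _ hβ0)
  -- the first scale
  obtain ⟨y₁, hy₁0, hy₁1, hy₁⟩ : ∃ y₁ : ℝ, y₀ ≤ y₁ ∧ 1 ≤ y₁ ∧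
      (0 < ℓ → β ≤ -1 → ∀ R, y₁ ≤ R → C * R ^ β ≤ ℓ / 2 * R) := by
    -- Beyond `2C / ℓ` the linear term dominates the curved one, because `R ^ β ≤ 1`. For `ℓ = 0`
    -- the quotient is `0` and the maximum ignores it.
    refine ⟨max (max y₀ 1) (2 * C / ℓ), (le_max_left _ _).trans (le_max_left _ _),
      (le_max_right _ _).trans (le_max_left _ _), fun hℓ hβ R hR => ?_⟩
    have hR1 : 1 ≤ R := ((le_max_right _ _).trans (le_max_left _ _)).trans hR
    have hR2 : 2 * C / ℓ ≤ R := (le_max_right _ _).trans hR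
    rw [div_le_iff₀ hℓ] at hR2
    have : R ^ β ≤ 1 := rpow_le_one_of_one_le_of_nonpos hR1 (by linarith)
    nlinarith
  set W := (min c C⁻¹)⁻¹ with hW
  have hW0 : 0 < W := inv_pos.2 (lt_min hc (inv_pos.2 hC))
  have hcc : 0 < c ^ (-(1 / 2) : ℝ) := by positivity
  set G := K * D * (1 + if 0 < ℓ then (ℓ / 2) ^ (-(1 / 2) : ℝ) else 0) with hG
  have hG0 : 0 ≤ G := by
    have : 0 ≤ if 0 < ℓ then (ℓ / 2) ^ (-(1 / 2) : ℝ) else 0 := by split_ifs <;> positivity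
    positivity
  set H := if 0 < ℓ then 2 * (K * D) / ℓ else 0 with hH
  have hH0 : 0 ≤ H := by rw [hH]; split_ifs <;> positivity
  refine ⟨y₁, G * (S₂ + S₃ + (W + c ^ (-(1 / 2) : ℝ) * W) * S₁) + H * 2 + 1, hy₁1, by positivity,
    fun t w ζ N ht hζ => ?_⟩
  set P := (1 + |ζ.im|) ^ 2 with hP
  have hP0 : 0 < P := by positivity
  have hy₁p : 0 < y₁ := by linarith
  have htp : 0 < |t| := abs_pos.2 ht
  have hgeo : ∀ (k : ℕ) (x : ℝ), (y₁ * 2 ^ k) ^ x = y₁ ^ x * ((2 : ℝ) ^ x) ^ k := fun k x => by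
    rw [mul_rpow hy₁p.le (by positivity), ← rpow_natCast, ← rpow_natCast, ← rpow_mul (by norm_num),
      ← rpow_mul (by norm_num), mul_comm x]
  -- the three geometric sums
  have hT₁ : ∑ k ∈ Finset.range N, min (|t * ℓ * (y₁ * 2 ^ k) + w * (y₁ * 2 ^ k)| /
      (|t| * (y₁ * 2 ^ k) ^ β)) (|t * ℓ * (y₁ * 2 ^ k) + w * (y₁ * 2 ^ k)| /
      (|t| * (y₁ * 2 ^ k) ^ β))⁻¹ ≤ S₁ := by
    refine le_trans (le_of_eq (Finset.sum_congr rfl fun k _ => ?_))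
      (hS₁ N (|t * ℓ + w| / |t| * y₁ ^ (1 - β)) (by positivity))
    -- `A / λ` is geometric with ratio `2 ^ (1 - β)`; summability uses `β ≠ 1`.
    have : |t * ℓ * (y₁ * 2 ^ k) + w * (y₁ * 2 ^ k)| / (|t| * (y₁ * 2 ^ k) ^ β) =
        |t * ℓ + w| / |t| * y₁ ^ (1 - β) * ((2 : ℝ) ^ (1 - β)) ^ k := by
      have hR : 0 < y₁ * 2 ^ k := by positivity
      rw [← add_mul, abs_mul, abs_of_pos hR, mul_assoc _ (y₁ ^ (1 - β)), ← hgeo, rpow_sub hR,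
        rpow_one]
      field_simp
    rw [this]
  have hT₂ : ∑ k ∈ Finset.range N, min ((|t| * (y₁ * 2 ^ k) ^ β) ^ (1 / 2 : ℝ))
      ((|t| * (y₁ * 2 ^ k) ^ β) ^ (1 / 2 : ℝ))⁻¹ ≤ S₂ := by
    refine le_trans (le_of_eq (Finset.sum_congr rfl fun k _ => ?_))
      (hS₂ N (|t| ^ (1 / 2 : ℝ) * y₁ ^ (β / 2)) (by positivity))
    have : (|t| * (y₁ * 2 ^ k) ^ β) ^ (1 / 2 : ℝ) =
        |t| ^ (1 / 2 : ℝ) * y₁ ^ (β / 2) * ((2 : ℝ) ^ (β / 2)) ^ k := by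
      rw [mul_rpow (by positivity) (by positivity), ← rpow_mul (by positivity), mul_one_div, hgeo,
        mul_assoc]
    rw [this]
  have hT₃ : ∑ k ∈ Finset.range N, min (|t| * (y₁ * 2 ^ k) ^ β)
      (|t| * (y₁ * 2 ^ k) ^ β)⁻¹ ≤ S₃ := by
    refine le_trans (le_of_eq (Finset.sum_congr rfl fun k _ => ?_))
      (hS₃ N (|t| * y₁ ^ β) (by positivity))
    rw [hgeo, mul_assoc]
  have hT₄ : ∑ k ∈ Finset.range N, ((1 / 2 : ℝ)) ^ k ≤ 2 := sum_geometric_two_le N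
  -- the bound for each piece
  suffices hterm : ∀ k ∈ Finset.range N, (y₁ * 2 ^ k) ^ (γ + 1) * ‖∫ s in (1 / 4 : ℝ)..4,
        Complex.exp (Complex.I * ((t * g (y₁ * 2 ^ k * s) + w * (y₁ * 2 ^ k) * s : ℝ) : ℂ)) *
          pieceAmplitude B ζ (w * (y₁ * 2 ^ k)) s‖ ≤
      P * |t| ^ (-σ) * (G * (min ((|t| * (y₁ * 2 ^ k) ^ β) ^ (1 / 2 : ℝ))
        ((|t| * (y₁ * 2 ^ k) ^ β) ^ (1 / 2 : ℝ))⁻¹ + min (|t| * (y₁ * 2 ^ k) ^ β)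
        (|t| * (y₁ * 2 ^ k) ^ β)⁻¹ + (W + c ^ (-(1 / 2) : ℝ) * W) *
        min (|t * ℓ * (y₁ * 2 ^ k) + w * (y₁ * 2 ^ k)| /
        (|t| * (y₁ * 2 ^ k) ^ β)) (|t * ℓ * (y₁ * 2 ^ k) + w * (y₁ * 2 ^ k)| /
        (|t| * (y₁ * 2 ^ k) ^ β))⁻¹) + H * (1 / 2) ^ k) by
    refine (Finset.sum_le_sum hterm).trans ?_
    rw [← Finset.mul_sum, Finset.sum_add_distrib, ← Finset.mul_sum, Finset.sum_add_distrib,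
      Finset.sum_add_distrib, ← Finset.mul_sum, ← Finset.mul_sum]
    calc _ ≤ P * |t| ^ (-σ) * (G * (S₂ + S₃ + (W + c ^ (-(1 / 2) : ℝ) * W) * S₁) + H * 2) := by
          gcongr
      _ ≤ P * |t| ^ (-σ) * (G * (S₂ + S₃ + (W + c ^ (-(1 / 2) : ℝ) * W) * S₁) + H * 2 + 1) := by
          refine mul_le_mul_of_nonneg_left (by linarith) (by positivity)
      _ = _ := by ring
  intro k _
  set R := y₁ * 2 ^ k with hR
  have hRy : y₁ ≤ R := le_mul_of_one_le_right hy₁p.le (one_le_pow₀ (by norm_num))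
  have hRp : 0 < R := by linarith
  set lam := |t| * R ^ β with hlam
  have hlamp : 0 < lam := by positivity
  obtain ⟨f₁, f₂, hf, v1, v2, v3, v4⟩ := hamp ζ (w * R) hζ
  set M := D * P * (1 + |w * R|) ^ (-κ) with hM
  have hDP : 0 ≤ D * P := by positivity
  have hM1 : M ≤ D * P := by
    refine mul_le_of_le_one_right hDP (rpow_le_one_of_one_le_of_nonpos ?_ (by linarith))
    linarith [abs_nonneg (w * R)]
  have hM0 : 0 ≤ M := by positivity
  set J := ‖∫ s in (1 / 4 : ℝ)..4, Complex.exp (Complex.I * ((t * g (R * s) + w * R * s : ℝ) : ℂ)) *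
          pieceAmplitude B ζ (w * R) s‖ with hJ
  have hJ0 : 0 ≤ J := norm_nonneg _
  obtain ⟨j1, j2, j3⟩ := hpiece R t (w * R) M _ f₁ f₂ (by linarith) ht hf v1 v2 v3 v4 J hJ
  set A := |t * ℓ * R + w * R| with hA
  have hA0 : 0 ≤ A := abs_nonneg _
  have m1 := min_inv_nonneg (x := lam ^ (1 / 2 : ℝ)) (by positivity)
  have m2 := min_inv_nonneg hlamp.le
  have m3 := min_inv_nonneg (x := A / lam) (by positivity)
  set mm1 := min (lam ^ (1 / 2 : ℝ)) (lam ^ (1 / 2 : ℝ))⁻¹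
  set mm2 := min lam lam⁻¹
  set mm3 := min (A / lam) (A / lam)⁻¹
  have hpow : 0 ≤ H * (1 / 2 : ℝ) ^ k := by positivity
  have hKDG : K * D ≤ G := by
    rw [hG]
    refine le_mul_of_one_le_right (by positivity) ?_
    have : 0 ≤ if 0 < ℓ then (ℓ / 2) ^ (-(1 / 2) : ℝ) else 0 := by split_ifs <;> positivity
    linarith
  have hsqrt := sqrt_mul_le_of_dyadic_bounds hlamp hJ0 hc hC (mul_nonneg hK.le hM0) hA0 j1
    (fun h => (j2 h).1) j3
  have hlam2 : lam ^ (1 / 2 : ℝ) = |t| ^ (1 / 2 : ℝ) * R ^ (β / 2) := by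
    rw [hlam, mul_rpow htp.le (by positivity), ← rpow_mul hRp.le, mul_one_div]
  have fin1 : mm1 + W * mm3 ≤ mm1 + mm2 + (W + c ^ (-(1 / 2) : ℝ) * W) * mm3 := by
    have : 0 ≤ c ^ (-(1 / 2) : ℝ) * W * mm3 := by positivity
    linarith
  have fin2 : mm2 + c ^ (-(1 / 2) : ℝ) * W * mm3 ≤
      mm1 + mm2 + (W + c ^ (-(1 / 2) : ℝ) * W) * mm3 := by
    have : 0 ≤ W * mm3 := by positivity
    linarith
  set Z := mm1 + mm2 + (W + c ^ (-(1 / 2) : ℝ) * W) * mm3 with hZ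
  have hZ0 : 0 ≤ Z := by positivity
  rcases hexp with ⟨rfl, hγ, rfl⟩ | ⟨rfl, hγ, rfl, rfl⟩ | ⟨rfl, hγ, rfl, hℓ, hβ⟩
  · rw [hγ]
    have e : |t| ^ (-(1 / 2) : ℝ) * |t| ^ (1 / 2 : ℝ) = 1 := by rw [← rpow_add htp]; norm_num
    calc R ^ (β / 2) * J = |t| ^ (-(1 / 2) : ℝ) * (lam ^ (1 / 2 : ℝ) * J) := by
          rw [hlam2, ← mul_assoc, ← mul_assoc, e, one_mul]
      _ ≤ |t| ^ (-(1 / 2) : ℝ) * (K * M * (mm1 + W * mm3)) := by gcongr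
      _ ≤ |t| ^ (-(1 / 2) : ℝ) * (K * (D * P) * Z) := by gcongr
      _ = P * |t| ^ (-(1 / 2) : ℝ) * (K * D * Z) := by ring
      _ ≤ P * |t| ^ (-(1 / 2) : ℝ) * (G * Z) := by gcongr
      _ ≤ _ := by gcongr; linarith
  · rw [hγ]
    -- Without a linear term in `g`, the slope is the argument of the amplitude, so stationarity
    -- turns the decay of the amplitude into decay in `λ`.
    have hA' : A = |w * R| := by rw [hA]; simp
    have hKM : K * M ≤ K * (D * P) := by gcongr
    have := mul_le_of_dyadic_bounds hlamp hJ0 hc hC (mul_nonneg hK.le hDP) hA0 (j1.trans hKM)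
      (fun h => (j2 h).1.trans hKM) (by rw [hA']; exact j3.trans (le_of_eq (by rw [hM]; ring)))
    have e : |t| ^ (-1 : ℝ) * |t| = 1 := by rw [rpow_neg_one]; field_simp
    calc R ^ β * J = |t| ^ (-1 : ℝ) * (lam * J) := by
          rw [hlam, ← mul_assoc, ← mul_assoc, e, one_mul]
      _ ≤ |t| ^ (-1 : ℝ) * (K * (D * P) * (mm2 + c ^ (-(1 / 2) : ℝ) * W * mm3)) := by gcongr
      _ ≤ |t| ^ (-1 : ℝ) * (K * (D * P) * Z) := by gcongr
      _ = P * |t| ^ (-1 : ℝ) * (K * D * Z) := by ring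
      _ ≤ P * |t| ^ (-1 : ℝ) * (G * Z) := by gcongr
      _ ≤ _ := by gcongr; linarith
  · rw [hγ]
    have hℓ2 : 0 < ℓ / 2 := by linarith
    -- If `|w|` is at least `|t| ℓ / 2`, the amplitude decays like `(|t| R) ^ (-1/2)`, the missing
    -- half power of time. Otherwise `w` cannot cancel `t ℓ`, the slope is at least `|t| ℓ R / 2`,
    -- and non-stationary phase gives `J ≲ (|t| R)⁻¹`.
    rcases le_total (|t| * ℓ / 2) |w| with hw | hw
    · have e : |t| ^ (-(1 / 2) : ℝ) * |t| ^ (1 / 2 : ℝ) = 1 := by rw [← rpow_add htp]; norm_num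
      have e2 : |t| ^ (-(1 / 2) : ℝ) * |t| ^ (-(1 / 2) : ℝ) = |t| ^ (-1 : ℝ) := by
        rw [← rpow_add htp]; norm_num
      have hMd : R ^ (1 / 2 : ℝ) * M ≤ |t| ^ (-(1 / 2) : ℝ) * (D * P * (ℓ / 2) ^ (-(1 / 2) : ℝ)) :=
          by
        have : (1 + |w * R|) ^ (-(1 / 2) : ℝ) ≤
            |t| ^ (-(1 / 2) : ℝ) * (ℓ / 2) ^ (-(1 / 2) : ℝ) * R ^ (-(1 / 2) : ℝ) := by
          rw [← mul_rpow htp.le hℓ2.le, ← mul_rpow (by positivity) hRp.le]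
          refine rpow_le_rpow_of_nonpos (by positivity) ?_ (by norm_num)
          rw [abs_mul, abs_of_pos hRp]
          have := mul_le_mul_of_nonneg_right hw hRp.le
          linarith
        have e3 : R ^ (1 / 2 : ℝ) * R ^ (-(1 / 2) : ℝ) = 1 := by rw [← rpow_add hRp]; norm_num
        calc R ^ (1 / 2 : ℝ) * M ≤ R ^ (1 / 2 : ℝ) * (D * P * (|t| ^ (-(1 / 2) : ℝ) *
              (ℓ / 2) ^ (-(1 / 2) : ℝ) * R ^ (-(1 / 2) : ℝ))) := by rw [hM]; gcongr
          _ = (R ^ (1 / 2 : ℝ) * R ^ (-(1 / 2) : ℝ)) *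
              (|t| ^ (-(1 / 2) : ℝ) * (D * P * (ℓ / 2) ^ (-(1 / 2) : ℝ))) := by ring
          _ = _ := by rw [e3, one_mul]
      have hGl : K * D * (ℓ / 2) ^ (-(1 / 2) : ℝ) ≤ G := by
        rw [hG, if_pos hℓ]
        gcongr
        linarith
      calc R ^ ((β + 1) / 2) * J = R ^ (1 / 2 : ℝ) * (R ^ (β / 2) * J) := by
            rw [← mul_assoc, ← rpow_add hRp]; congr 2; ring
        _ = R ^ (1 / 2 : ℝ) * (|t| ^ (-(1 / 2) : ℝ) * (lam ^ (1 / 2 : ℝ) * J)) := by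
            rw [hlam2, ← mul_assoc (|t| ^ (-(1 / 2) : ℝ)), ← mul_assoc (|t| ^ (-(1 / 2) : ℝ)), e,
              one_mul]
        _ ≤ R ^ (1 / 2 : ℝ) * (|t| ^ (-(1 / 2) : ℝ) * (K * M * (mm1 + W * mm3))) := by gcongr
        _ = |t| ^ (-(1 / 2) : ℝ) * (K * (R ^ (1 / 2 : ℝ) * M) * (mm1 + W * mm3)) := by ring
        _ ≤ |t| ^ (-(1 / 2) : ℝ) * (K * (|t| ^ (-(1 / 2) : ℝ) *
            (D * P * (ℓ / 2) ^ (-(1 / 2) : ℝ))) * Z) := by gcongr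
        _ = P * (|t| ^ (-(1 / 2) : ℝ) * |t| ^ (-(1 / 2) : ℝ)) *
            (K * D * (ℓ / 2) ^ (-(1 / 2) : ℝ) * Z) := by ring
        _ ≤ P * |t| ^ (-1 : ℝ) * (G * Z) := by rw [e2]; gcongr
        _ ≤ _ := by gcongr; linarith
    · have hAl : |t| * (ℓ / 2) * R ≤ A := by
        rw [hA, ← add_mul, abs_mul, abs_of_pos hRp]
        gcongr
        have := abs_sub_abs_le_abs_sub (t * ℓ) (-w)
        rw [abs_neg, sub_neg_eq_add, abs_mul, abs_of_pos hℓ] at this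
        linarith
      have hAp : 0 < A := lt_of_lt_of_le (by positivity) hAl
      have hns : C * lam ≤ A := by
        refine le_trans ?_ hAl
        have := mul_le_mul_of_nonneg_left (hy₁ hℓ hβ R hRy) htp.le
        linarith
      have j4 := (j2 (Or.inr hns)).2
      have j5 : J * A ≤ K * M := by
        rcases le_total 1 A with h | h
        · refine le_trans ?_ j4
          gcongr; exact le_self_pow₀ h two_ne_zero
        · exact (mul_le_of_le_one_right hJ0 h).trans j1
      have hR1 : 1 ≤ R := hy₁1.trans hRy
      have hRk : R⁻¹ ≤ (1 / 2 : ℝ) ^ k := by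
        rw [one_div, inv_pow]
        refine inv_anti₀ (by positivity) ?_
        rw [hR]; exact le_mul_of_one_le_left (by positivity) hy₁1
      calc R ^ ((β + 1) / 2) * J ≤ 1 * J := by
            gcongr; exact rpow_le_one_of_one_le_of_nonpos hR1 (by linarith)
        _ = J * A / A := by field_simp
        _ ≤ K * M / A := by gcongr
        _ ≤ K * (D * P) / (|t| * (ℓ / 2) * R) := by gcongr
        _ = P * |t| ^ (-1 : ℝ) * (2 * (K * D) / ℓ * R⁻¹) := by
            rw [rpow_neg_one]; field_simp
        _ ≤ P * |t| ^ (-1 : ℝ) * (H * (1 / 2 : ℝ) ^ k) := by rw [hH, if_pos hℓ]; gcongr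
        _ ≤ _ := by
            gcongr
            have : 0 ≤ G * Z := by positivity
            linarith

/-! ### Fourier integrals of radial functions -/

theorem integral_exp_cos_sub_eq (s φ : ℝ) :
    ∫ θ in Set.Ioo (-π) π, Complex.exp (Complex.I * ((s * cos (θ - φ) : ℝ) : ℂ)) =
      Complex.exp (Complex.I * s) * besselAmplitude s +
        Complex.exp (-(Complex.I * s)) * besselAmplitude (-s) := by
  rw [← integral_exp_cos_eq, ← integral_Ioc_eq_integral_Ioo,
    ← intervalIntegral.integral_of_le (by linarith [pi_pos])]
  have hper : Function.Periodic
      (fun θ : ℝ => Complex.exp (Complex.I * ((s * cos θ : ℝ) : ℂ))) (2 * π) := fun θ => by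
    simp only [cos_add_two_pi]
  rw [intervalIntegral.integral_comp_sub_right
    (fun θ => Complex.exp (Complex.I * ((s * cos θ : ℝ) : ℂ))) φ]
  have h1 := hper.intervalIntegral_add_eq (-π - φ) (-π)
  rw [show -π - φ + 2 * π = π - φ by ring, show -π + 2 * π = π by ring] at h1
  have hint : ∀ a b : ℝ, IntervalIntegrable
      (fun θ : ℝ => Complex.exp (Complex.I * ((s * cos θ : ℝ) : ℂ))) volume a b := fun a b =>
    Continuous.intervalIntegrable (by fun_prop) _ _
  rw [h1, ← intervalIntegral.integral_add_adjacent_intervals (hint (-π) 0) (hint 0 π), two_mul]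
  congr 1
  have h2 := intervalIntegral.integral_comp_neg (a := 0) (b := π)
    (fun θ : ℝ => Complex.exp (Complex.I * ((s * cos θ : ℝ) : ℂ)))
  simp only [cos_neg, neg_zero] at h2
  exact h2.symm

theorem integral_exp_inner_radial_one {F : ℝ → ℂ} (hF : Continuous F)
    (hFc : ∃ T, ∀ r, T ≤ |r| → F r = 0) (x : EuclideanSpace ℝ (Fin 1)) :
    ∫ ξ, Complex.exp (Complex.I * ((2 * π * inner ℝ x ξ : ℝ) : ℂ)) * F ‖ξ‖ =
      ∫ r in Set.Ioi (0 : ℝ), F r * (Complex.exp (Complex.I * ((2 * π * ‖x‖ * r : ℝ) : ℂ)) +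
        Complex.exp (-(Complex.I * ((2 * π * ‖x‖ * r : ℝ) : ℂ)))) := by
  obtain ⟨T, hT⟩ := hFc
  set e : ℝ ≃ₗᵢ[ℝ] EuclideanSpace ℝ (Fin 1) := (OrthonormalBasis.singleton (Fin 1) ℝ).repr with he
  obtain ⟨w, rfl⟩ := e.surjective x
  rw [← e.measurePreserving.integral_comp e.toHomeomorph.measurableEmbedding]
  simp only [LinearIsometryEquiv.inner_map_map, LinearIsometryEquiv.norm_map]
  set G : ℝ → ℂ := fun r => Complex.exp (Complex.I * ((2 * π * inner ℝ w r : ℝ) : ℂ)) * F ‖r‖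
  have hG : Integrable G := by
    refine Continuous.integrable_of_hasCompactSupport ?_ ?_
    · exact (by fun_prop)
    · refine HasCompactSupport.intro (isCompact_Icc (a := -|T|) (b := |T|)) fun r hr => ?_
      have : T ≤ |‖r‖| := by
        rw [Real.norm_eq_abs, abs_abs]
        by_contra h
        exact hr (abs_le.1 ((not_le.1 h).le.trans (le_abs_self T)))
      simp only [G]
      rw [hT _ this, mul_zero]
  rw [← intervalIntegral.integral_Iic_add_Ioi (b := 0) hG.integrableOn hG.integrableOn]
  have h1 := integral_comp_neg_Ioi (0 : ℝ) G
  rw [neg_zero] at h1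
  rw [← h1, ← integral_add ((hG.comp_neg).integrableOn) hG.integrableOn]
  refine setIntegral_congr_fun measurableSet_Ioi fun r hr => ?_
  have hr0 : (0 : ℝ) < r := hr
  have e1 : ∀ v : ℝ, inner ℝ w v = w * v := fun v => by simp [mul_comm]
  simp only [G, e1, norm_neg, Real.norm_of_nonneg hr0.le]
  rcases le_total 0 w with h | h
  · rw [Real.norm_of_nonneg h]
    push_cast; ring_nf
  · rw [Real.norm_of_nonpos h]
    push_cast; ring_nf

theorem integral_exp_inner_radial_two {F : ℝ → ℂ} (hF : Continuous F)
    (hFc : ∃ T, ∀ r, T ≤ |r| → F r = 0) (x : EuclideanSpace ℝ (Fin 2)) :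
    ∫ ξ, Complex.exp (Complex.I * ((2 * π * inner ℝ x ξ : ℝ) : ℂ)) * F ‖ξ‖ =
      ∫ r in Set.Ioi (0 : ℝ), r * F r *
        (Complex.exp (Complex.I * ((2 * π * ‖x‖ * r : ℝ) : ℂ)) *
          besselAmplitude (2 * π * ‖x‖ * r) +
        Complex.exp (-(Complex.I * ((2 * π * ‖x‖ * r : ℝ) : ℂ))) *
          besselAmplitude (-(2 * π * ‖x‖ * r))) := by
  obtain ⟨T, hT⟩ := hFc
  set e : ℂ ≃ₗᵢ[ℝ] EuclideanSpace ℝ (Fin 2) := Complex.orthonormalBasisOneI.repr with he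
  obtain ⟨w, rfl⟩ := e.surjective x
  rw [← e.measurePreserving.integral_comp e.toHomeomorph.measurableEmbedding]
  simp only [LinearIsometryEquiv.inner_map_map, LinearIsometryEquiv.norm_map]
  rw [← Complex.integral_comp_polarCoord_symm, polarCoord_target]
  have hin : ∀ p : ℝ × ℝ, inner ℝ w (Complex.polarCoord.symm p) =
      ‖w‖ * p.1 * cos (p.2 - Complex.arg w) := fun p => by
    rw [Complex.inner, Complex.polarCoord_symm_apply, cos_sub]
    have h1 := Complex.norm_mul_cos_arg w
    have h2 := Complex.norm_mul_sin_arg w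
    simp only [Complex.mul_re, Complex.conj_re, Complex.conj_im, Complex.ofReal_re,
      Complex.ofReal_im, Complex.mul_im, Complex.add_re, Complex.add_im, Complex.I_re,
      Complex.I_im]
    linear_combination (-(p.1 * cos p.2)) * h1 - p.1 * sin p.2 * h2
  have hnorm : ∀ p : ℝ × ℝ, ‖Complex.polarCoord.symm p‖ = |p.1| := Complex.norm_polarCoord_symm
  simp only [hin, hnorm]
  rw [Measure.volume_eq_prod, setIntegral_prod]
  · refine setIntegral_congr_fun measurableSet_Ioi fun r hr => ?_
    have hr0 : (0 : ℝ) < r := hr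
    simp only
    rw [← integral_exp_cos_sub_eq _ (Complex.arg w), ← integral_const_mul]
    refine setIntegral_congr_fun measurableSet_Ioo fun θ _ => ?_
    simp only [abs_of_pos hr0, Complex.real_smul]
    push_cast
    ring_nf
  · have hcont : Continuous fun p : ℝ × ℝ => p.1 •
        (Complex.exp (Complex.I * ((2 * π * (‖w‖ * p.1 * cos (p.2 - Complex.arg w)) : ℝ) : ℂ)) *
          F |p.1|) := by fun_prop
    refine IntegrableOn.of_forall_diff_eq_zero (s := Set.Icc 0 |T| ×ˢ Set.Icc (-π) π)
      (hcont.continuousOn.integrableOn_compact (isCompact_Icc.prod isCompact_Icc))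
      (measurableSet_Ioi.prod measurableSet_Ioo) ?_
    rintro ⟨r, θ⟩ ⟨⟨h1, h2⟩, h3⟩
    have hr0 : (0 : ℝ) < r := h1
    have : T ≤ |(|r|)| := by
      rw [abs_abs, abs_of_pos hr0]
      by_contra h
      exact h3 ⟨⟨hr0.le, (not_le.1 h).le.trans (le_abs_self T)⟩, Set.Ioo_subset_Icc_self h2⟩
    simp only
    rw [hT _ this, mul_zero, smul_zero]

/-- A common form for both dimensions: two waves in `r` with an amplitude of symbol order `-(n - 1)
/ 2`. For `n = 1` the line is folded onto the half-line; for `n = 2` polar coordinates produce the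
Bessel amplitude. -/
theorem exists_integral_exp_inner_radial {n : ℕ} (hn : n = 1 ∨ n = 2) :
    ∃ b : ℝ → ℂ, HasSymbolBounds (((n : ℝ) - 1) / 2) b ∧
      ∀ F : ℝ → ℂ, Continuous F → (∃ T, ∀ r, T ≤ |r| → F r = 0) →
      ∀ x : EuclideanSpace ℝ (Fin n),
      ∫ ξ, Complex.exp (Complex.I * ((2 * π * inner ℝ x ξ : ℝ) : ℂ)) * F ‖ξ‖ =
        ∫ r in Set.Ioi (0 : ℝ), (r : ℂ) ^ (n - 1) * F r *
          (Complex.exp (Complex.I * ((2 * π * ‖x‖ * r : ℝ) : ℂ)) * b (2 * π * ‖x‖ * r) +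
          Complex.exp (-(Complex.I * ((2 * π * ‖x‖ * r : ℝ) : ℂ))) * b (-(2 * π * ‖x‖ * r))) := by
  rcases hn with rfl | rfl
  · refine ⟨fun _ => 1, by simpa using hasSymbolBounds_one, fun F hF hFc x => ?_⟩
    rw [integral_exp_inner_radial_one hF hFc]
    simp
  · refine ⟨besselAmplitude, ?_, fun F hF hFc x => ?_⟩
    · convert besselAmplitude_hasSymbolBounds using 1; norm_num
    · rw [integral_exp_inner_radial_two hF hFc]
      simp

/-! ### The kernel estimate -/

theorem HasSymbolBounds.continuous {κ : ℝ} {B : ℝ → ℂ} (hB : HasSymbolBounds κ B) :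
    Continuous B := by
  obtain ⟨B₁, B₂, C, hC, hd₁, -⟩ := hB
  exact continuous_iff_continuousAt.2 fun s => (hd₁ s).continuousAt

theorem dyadicBump_eq_zero_of_notMem_Icc {s : ℝ} (hs0 : 0 < s)
    (hs : s ∉ Set.Icc (1 / 4 : ℝ) 4) : dyadicBump s = 0 := by
  by_cases h : s ≤ 1 / 2
  · exact dyadicBump_of_le hs0.le h
  · refine dyadicBump_of_ge ?_
    by_contra h2
    exact hs ⟨by linarith, by linarith⟩

/-- The contribution of one dyadic scale to a radial Fourier integral. -/
noncomputable def dyadicIntegrand (g : ℝ → ℝ) (b : ℝ → ℂ) (j : ℕ) (ζ : ℂ) (t h R v r : ℝ) : ℂ :=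
  (r : ℂ) ^ j * (Complex.exp (Complex.I * ((t * g (h * r) : ℝ) : ℂ)) *
    Complex.exp (ζ * (Real.log r : ℂ)) * (dyadicBump (h * r / R) : ℂ)) *
    (Complex.exp (Complex.I * ((v * r : ℝ) : ℂ)) * b (v * r))

theorem dyadicIntegrand_eq_zero {g : ℝ → ℝ} {b : ℝ → ℂ} {j : ℕ} {ζ : ℂ} {t h R v r : ℝ}
    (hh : 0 < h) (hR : 0 < R) (hr : 0 < r) (hr' : r ∉ Set.Icc (R / h * (1 / 4)) (R / h * 4)) :
    dyadicIntegrand g b j ζ t h R v r = 0 := by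
  unfold dyadicIntegrand
  rw [dyadicBump_eq_zero_of_notMem_Icc (by positivity)]
  · simp
  · intro hm
    refine hr' ⟨?_, ?_⟩
    · have := hm.1; rw [le_div_iff₀ hR] at this
      rw [div_mul_eq_mul_div, div_le_iff₀ hh]; linarith
    · have := hm.2; rw [div_le_iff₀ hR] at this
      rw [div_mul_eq_mul_div, le_div_iff₀ hh]; linarith

theorem integrableOn_dyadicIntegrand {g : ℝ → ℝ} (hg : Continuous g) {b : ℝ → ℂ}
    (hb : Continuous b) (j : ℕ) (ζ : ℂ) (t : ℝ) {h R : ℝ} (hh : 0 < h) (hR : 0 < R) (v : ℝ) :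
    IntegrableOn (dyadicIntegrand g b j ζ t h R v) (Set.Ioi 0) := by
  refine IntegrableOn.of_forall_diff_eq_zero (s := Set.Icc (R / h * (1 / 4)) (R / h * 4))
    (ContinuousOn.integrableOn_compact isCompact_Icc ?_) measurableSet_Ioi
    fun r hr => dyadicIntegrand_eq_zero hh hR hr.1 hr.2
  have hbump : Continuous dyadicBump := (dyadicBump_contDiff (n := 0)).continuous
  have hlog : ContinuousOn Real.log (Set.Icc (R / h * (1 / 4)) (R / h * 4)) :=
    continuousOn_log.mono fun r hr h0 => by
      rw [Set.mem_singleton_iff] at h0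
      have : 0 < R / h * (1 / 4) := by positivity
      linarith [hr.1]
  have h1 : Continuous fun r : ℝ => (r : ℂ) ^ j := by fun_prop
  have h2 : Continuous fun r : ℝ => Complex.exp (Complex.I * ((t * g (h * r) : ℝ) : ℂ)) := by
    fun_prop
  have h3 : Continuous fun r : ℝ => (dyadicBump (h * r / R) : ℂ) :=
    Complex.continuous_ofReal.comp (hbump.comp (by fun_prop))
  have h4 : Continuous fun r : ℝ => Complex.exp (Complex.I * ((v * r : ℝ) : ℂ)) * b (v * r) := by
    fun_prop
  have h5 : ContinuousOn (fun r : ℝ => Complex.exp (ζ * (Real.log r : ℂ)))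
      (Set.Icc (R / h * (1 / 4)) (R / h * 4)) :=
    Complex.continuous_exp.comp_continuousOn
      (continuousOn_const.mul (Complex.continuous_ofReal.comp_continuousOn hlog))
  exact (h1.continuousOn.mul ((h2.continuousOn.mul h5).mul h3.continuousOn)).mul h4.continuousOn

/-- The substitution `r = (R / h) s`. The Jacobian factor `r ^ j` merges with the complex power into
the exponent `ζ + j`, and only the real part of `ζ` survives in the modulus of the prefactor. -/
theorem norm_integral_dyadicIntegrand (g : ℝ → ℝ) (b : ℝ → ℂ) (j : ℕ) (ζ : ℂ) (t : ℝ) {h R : ℝ}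
    (hh : 0 < h) (hR : 0 < R) (v : ℝ) :
    ‖∫ r in Set.Ioi (0 : ℝ), dyadicIntegrand g b j ζ t h R v r‖ =
      (R / h) ^ (j + 1 + ζ.re) * ‖∫ s in (1 / 4 : ℝ)..4,
        Complex.exp (Complex.I * ((t * g (R * s) + v / h * R * s : ℝ) : ℂ)) *
          pieceAmplitude b (ζ + j) (v / h * R) s‖ := by
  set c := R / h with hc
  have hc0 : 0 < c := by positivity
  have hch : h * c = R := by rw [hc]; field_simp
  have hsub := integral_comp_mul_left_Ioi (dyadicIntegrand g b j ζ t h R v) 0 hc0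
  rw [mul_zero] at hsub
  have h1 : ∫ r in Set.Ioi (0 : ℝ), dyadicIntegrand g b j ζ t h R v r =
      (c : ℂ) * ∫ s in Set.Ioi (0 : ℝ), dyadicIntegrand g b j ζ t h R v (c * s) := by
    rw [hsub, Complex.real_smul, ← mul_assoc, ← Complex.ofReal_mul, mul_inv_cancel₀ hc0.ne']
    simp
  have h2 : ∫ s in Set.Ioi (0 : ℝ), dyadicIntegrand g b j ζ t h R v (c * s) =
      ∫ s in Set.Icc (1 / 4 : ℝ) 4, dyadicIntegrand g b j ζ t h R v (c * s) := by
    refine (setIntegral_eq_of_subset_of_forall_diff_eq_zero measurableSet_Ioi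
      (fun s hs => lt_of_lt_of_le (by norm_num) hs.1) fun s hs => ?_)
    have hs0 : (0 : ℝ) < s := hs.1
    refine dyadicIntegrand_eq_zero hh hR (by positivity) fun hm => hs.2 ⟨?_, ?_⟩
    · exact le_of_mul_le_mul_left hm.1 hc0
    · exact le_of_mul_le_mul_left hm.2 hc0
  have h3 : ∀ s ∈ Set.Icc (1 / 4 : ℝ) 4, dyadicIntegrand g b j ζ t h R v (c * s) =
      ((c : ℂ) ^ j * Complex.exp (ζ * (Real.log c : ℂ))) *
      (Complex.exp (Complex.I * ((t * g (R * s) + v / h * R * s : ℝ) : ℂ)) *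
          pieceAmplitude b (ζ + j) (v / h * R) s) := fun s hs => by
    have hs0 : 0 < s := by linarith [hs.1]
    have e1 : h * (c * s) = R * s := by rw [← mul_assoc, hch]
    have e2 : v * (c * s) = v / h * R * s := by rw [hc]; field_simp
    have e3 : h * (c * s) / R = s := by rw [e1]; field_simp
    have e4 : Complex.exp ((ζ + j) * (Real.log s : ℂ)) =
        (s : ℂ) ^ j * Complex.exp (ζ * (Real.log s : ℂ)) := by
      rw [add_mul, Complex.exp_add, Complex.exp_nat_mul, ← Complex.ofReal_exp, exp_log hs0,
        mul_comm]
    unfold dyadicIntegrand pieceAmplitude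
    rw [e3, e1, e2, e4, log_mul hc0.ne' hs0.ne']
    push_cast
    rw [mul_add, mul_add, Complex.exp_add, Complex.exp_add]
    ring
  rw [h1, h2, setIntegral_congr_fun measurableSet_Icc h3, integral_const_mul,
    integral_Icc_eq_integral_Ioc, ← intervalIntegral.integral_of_le (by norm_num), norm_mul,
    norm_mul, norm_mul, norm_pow, Complex.norm_real, Real.norm_of_nonneg hc0.le, Complex.norm_exp,
    Complex.re_mul_ofReal, mul_comm ζ.re, ← rpow_def_of_pos hc0, rpow_add hc0, rpow_add hc0,
    rpow_one, rpow_natCast]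
  ring

/-- The truncation telescopes into `N` dyadic pieces, whose sum is bounded uniformly in `N` and `x`.
The power of `h` comes from scaling, and the imaginary exponent `β₀ τ` costs the factor `(1 + |τ|) ^
2`. -/
theorem exists_kernel_bound {n : ℕ} (hn : n = 1 ∨ n = 2) {g : ℝ → ℝ} (hgc : Continuous g)
    {ℓ β β₀ σ : ℝ} (hg : HasPhaseExpansion g ℓ β) (hβ0 : β ≠ 0) (hβ1 : β ≠ 1)
    (hexp : DyadicExponents ℓ β (((n : ℝ) - 1) / 2) (β₀ + (n - 1)) σ) :
    ∃ y₁ C : ℝ, 1 ≤ y₁ ∧ 0 < C ∧ ∀ (h t τ : ℝ) (N : ℕ) (x : EuclideanSpace ℝ (Fin n)),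
      0 < h → t ≠ 0 →
      ‖∫ ξ, Complex.exp (Complex.I * ((2 * π * inner ℝ x ξ : ℝ) : ℂ)) *
        (Complex.exp (Complex.I * ((t * g (h * ‖ξ‖) : ℝ) : ℂ)) *
          Complex.exp (β₀ * (1 + τ * Complex.I) * (Real.log ‖ξ‖ : ℂ)) *
          ((radialCutoff (h * ‖ξ‖ / y₁) - radialCutoff (h * ‖ξ‖ / y₁ / 2 ^ N) : ℝ) : ℂ))‖ ≤
      C * (1 + |τ|) ^ 2 * h ^ (-(n + β₀)) * |t| ^ (-σ) := by
  obtain ⟨b, hb, hrad⟩ := exists_integral_exp_inner_radial hn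
  obtain ⟨y₁, C, hy₁, hC, hsum⟩ := exists_dyadic_sum_bound hg hβ0 hβ1 hexp hb
  refine ⟨y₁, 2 * (C * (1 + |β₀|) ^ 2), hy₁, by positivity, fun h t τ N x hh ht => ?_⟩
  have hy₁0 : 0 < y₁ := by linarith
  set ζ : ℂ := β₀ * (1 + τ * Complex.I) with hζ
  have hζre : ζ.re = β₀ := by simp [hζ]
  have hζim : ζ.im = β₀ * τ := by simp [hζ]
  have hcut : Continuous radialCutoff := (radialCutoff_contDiff (n := 0)).continuous
  -- The cutoff vanishes on `0 ≤ r ≤ 2 δ`, so replacing `r` by `max δ r` inside the logarithm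
  -- changes nothing for `r ≥ 0` and makes `F` continuous on the line.
  set δ := y₁ / (4 * h) with hδ
  have hδ0 : 0 < δ := by positivity
  set F : ℝ → ℂ := fun r => Complex.exp (Complex.I * ((t * g (h * r) : ℝ) : ℂ)) *
    Complex.exp (ζ * (Real.log (max δ r) : ℂ)) *
    ((radialCutoff (h * r / y₁) - radialCutoff (h * r / y₁ / 2 ^ N) : ℝ) : ℂ) with hF
  have hFc : Continuous F := by
    have : Continuous fun r => Real.log (max δ r) :=
      Continuous.log (by fun_prop) fun r => (lt_of_lt_of_le hδ0 (le_max_left _ _)).ne'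
    fun_prop
  have hcut1 : ∀ r : ℝ, 1 ≤ |r| → radialCutoff r = 1 := fun r hr => by
    have : radialCutoff r = radialCutoff |r| := by unfold radialCutoff; rw [sq_abs]
    rw [this, radialCutoff_of_ge hr]
  have hFs : ∃ T, ∀ r, T ≤ |r| → F r = 0 := by
    refine ⟨y₁ * 2 ^ N / h, fun r hr => ?_⟩
    have h1 : 1 ≤ |h * r / y₁ / 2 ^ N| := by
      rw [abs_div, abs_div, abs_mul, abs_of_pos hh, abs_of_pos hy₁0,
        abs_of_pos (by positivity : (0 : ℝ) < 2 ^ N), le_div_iff₀ (by positivity),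
        le_div_iff₀ hy₁0]
      rw [div_le_iff₀ hh] at hr
      linarith
    have h2 : 1 ≤ |h * r / y₁| := by
      rw [abs_div, abs_of_pos (by positivity : (0 : ℝ) < 2 ^ N), le_div_iff₀ (by positivity)] at h1
      refine le_trans ?_ h1
      rw [one_mul]; exact one_le_pow₀ (by norm_num)
    simp only [hF]
    rw [hcut1 _ h1, hcut1 _ h2]; simp
  have hFeq : ∀ r : ℝ, 0 ≤ r → Complex.exp (Complex.I * ((t * g (h * r) : ℝ) : ℂ)) *
    Complex.exp (ζ * (Real.log r : ℂ)) *
    ((radialCutoff (h * r / y₁) - radialCutoff (h * r / y₁ / 2 ^ N) : ℝ) : ℂ) = F r := fun r hr =>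
        by
    simp only [hF]
    rcases le_total δ r with h1 | h1
    · rw [max_eq_right h1]
    · have h2 : h * r / y₁ ≤ 1 / 2 := by
        rw [div_le_iff₀ hy₁0]
        rw [hδ, le_div_iff₀ (by positivity)] at h1
        linarith
      have h3 : h * r / y₁ / 2 ^ N ≤ h * r / y₁ :=
        div_le_self (by positivity) (one_le_pow₀ (by norm_num))
      rw [radialCutoff_of_le (by positivity) h2, radialCutoff_of_le (by positivity) (h3.trans h2)]
      simp
  simp_rw [hFeq _ (norm_nonneg _)]
  rw [hrad F hFc hFs x]
  set v := 2 * π * ‖x‖ with hv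
  have hsplit : ∀ r ∈ Set.Ioi (0 : ℝ), (r : ℂ) ^ (n - 1) * F r *
      (Complex.exp (Complex.I * ((v * r : ℝ) : ℂ)) * b (v * r) +
        Complex.exp (-(Complex.I * ((v * r : ℝ) : ℂ))) * b (-(v * r))) =
      ∑ k ∈ Finset.range N, (dyadicIntegrand g b (n - 1) ζ t h (y₁ * 2 ^ k) v r +
        dyadicIntegrand g b (n - 1) ζ t h (y₁ * 2 ^ k) (-v) r) := fun r hr => by
    have hr0 : (0 : ℝ) < r := hr
    rw [← hFeq r hr0.le, ← sum_dyadicBump, Complex.ofReal_sum]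
    simp only [Finset.mul_sum, Finset.sum_mul]
    refine Finset.sum_congr rfl fun k _ => ?_
    unfold dyadicIntegrand
    rw [div_div, neg_mul, Complex.ofReal_neg, mul_neg]
    ring
  have hRk : ∀ k : ℕ, 0 < y₁ * 2 ^ k := fun k => by positivity
  have hint : ∀ (k : ℕ) (v : ℝ), IntegrableOn (dyadicIntegrand g b (n - 1) ζ t h (y₁ * 2 ^ k) v)
      (Set.Ioi 0) := fun k v => integrableOn_dyadicIntegrand hgc hb.continuous _ _ _ hh (hRk k) _
  have hint2 : ∀ k ∈ Finset.range N, IntegrableOn (fun r =>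
      dyadicIntegrand g b (n - 1) ζ t h (y₁ * 2 ^ k) v r +
        dyadicIntegrand g b (n - 1) ζ t h (y₁ * 2 ^ k) (-v) r) (Set.Ioi 0) :=
    fun k _ => (hint k v).add (hint k (-v))
  rw [setIntegral_congr_fun measurableSet_Ioi hsplit, integral_finsetSum _ hint2]
  have hn1 : ((n - 1 : ℕ) : ℝ) = n - 1 := by rcases hn with rfl | rfl <;> norm_num
  have hn2 : ((n - 1 : ℕ) : ℂ) = (n : ℂ) - 1 := by rcases hn with rfl | rfl <;> norm_num
  have hre : (ζ + ((n - 1 : ℕ) : ℂ)).re = β₀ + (n - 1) := by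
    rw [hn2]; simp [hζre]
  have him : (ζ + ((n - 1 : ℕ) : ℂ)).im = β₀ * τ := by
    rw [hn2]; simp [hζim]
  have hone : ∀ v, ∑ k ∈ Finset.range N,
      ‖∫ r in Set.Ioi (0 : ℝ), dyadicIntegrand g b (n - 1) ζ t h (y₁ * 2 ^ k) v r‖ ≤
      h ^ (-(n + β₀)) * (C * (1 + |β₀ * τ|) ^ 2 * |t| ^ (-σ)) := fun v => by
    have := hsum t (v / h) (ζ + ((n - 1 : ℕ) : ℂ)) N ht hre
    rw [him] at this
    refine le_trans (le_of_eq ?_) (mul_le_mul_of_nonneg_left this (by positivity))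
    rw [Finset.mul_sum]
    refine Finset.sum_congr rfl fun k _ => ?_
    rw [norm_integral_dyadicIntegrand g b _ _ _ hh (hRk k)]
    rw [hζre, hn1, show (n : ℝ) - 1 + 1 + β₀ = n + β₀ by ring,
      show β₀ + ((n : ℝ) - 1) + 1 = n + β₀ by ring, div_rpow (hRk k).le hh.le, div_eq_inv_mul,
      ← rpow_neg hh.le]
    ring
  calc _ ≤ ∑ k ∈ Finset.range N,
        (‖∫ r in Set.Ioi (0 : ℝ), dyadicIntegrand g b (n - 1) ζ t h (y₁ * 2 ^ k) v r‖ +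
        ‖∫ r in Set.Ioi (0 : ℝ), dyadicIntegrand g b (n - 1) ζ t h (y₁ * 2 ^ k) (-v) r‖) := by
        refine (norm_sum_le _ _).trans (Finset.sum_le_sum fun k _ => ?_)
        rw [integral_add (hint k v) (hint k (-v))]
        exact norm_add_le _ _
    _ ≤ h ^ (-(n + β₀)) * (C * (1 + |β₀ * τ|) ^ 2 * |t| ^ (-σ)) +
        h ^ (-(n + β₀)) * (C * (1 + |β₀ * τ|) ^ 2 * |t| ^ (-σ)) := by
        rw [Finset.sum_add_distrib]
        exact add_le_add (hone v) (hone (-v))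
    _ = 2 * (C * (1 + |β₀ * τ|) ^ 2) * h ^ (-(n + β₀)) * |t| ^ (-σ) := by ring
    _ ≤ 2 * (C * ((1 + |β₀|) * (1 + |τ|)) ^ 2) * h ^ (-(n + β₀)) * |t| ^ (-σ) := by
        have : 1 + |β₀ * τ| ≤ (1 + |β₀|) * (1 + |τ|) := by
          rw [abs_mul]; nlinarith [abs_nonneg β₀, abs_nonneg τ]
        gcongr
    _ = _ := by ring

/-! ### Duality of Lebesgue norms -/

section Duality

variable {X : Type*} [MeasurableSpace X] {ν : Measure X}

/-- The converse of Hölder's inequality, tested on `|F| ^ (P' - 2) * conj F`. Finite measure and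
boundedness on `A` make the integral finite, so that it can be divided out. -/
theorem setLIntegral_rpow_le_of_pairing {P P' : ℝ} (hP : P.HolderConjugate P') {S : ℝ}
    (hS0 : 0 ≤ S) {F : X → ℂ} (hF : Measurable F) {A : Set X} (hA : MeasurableSet A) (hAf : ν A ≠
        ⊤) {k : ℝ}
    (hk : ∀ x ∈ A, ‖F x‖ ≤ k)
    (hS : ∀ ψ : X → ℂ, Measurable ψ → (∃ M, ∀ x, ‖ψ x‖ ≤ M) → (∀ x ∉ A, ψ x = 0) →
      ‖∫ x, ψ x * F x ∂ν‖ ≤ S * (∫ x, ‖ψ x‖ ^ P ∂ν) ^ (1 / P)) :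
    ∫⁻ x in A, ‖F x‖ₑ ^ P' ∂ν ≤ ENNReal.ofReal (S ^ P') := by
  have hP1 := hP.lt
  have hP'1 := hP.symm.lt
  have hP0 : 0 < P := by linarith
  have hP'0 : 0 < P' := by linarith
  set ψ : X → ℂ := A.indicator fun x => ((‖F x‖ ^ (P' - 2) : ℝ) : ℂ) * (starRingEnd ℂ) (F x)
    with hψ
  have hnorm : ∀ x, F x ≠ 0 →
      ‖((‖F x‖ ^ (P' - 2) : ℝ) : ℂ) * (starRingEnd ℂ) (F x)‖ = ‖F x‖ ^ (P' - 1) := fun x hx => by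
    have h0 : 0 < ‖F x‖ := norm_pos_iff.2 hx
    rw [norm_mul, RCLike.norm_conj, Complex.norm_real, Real.norm_of_nonneg (by positivity)]
    nth_rewrite 2 [← rpow_one ‖F x‖]
    rw [← rpow_add h0]; ring_nf
  have hnorm0 : ∀ x,
      ‖((‖F x‖ ^ (P' - 2) : ℝ) : ℂ) * (starRingEnd ℂ) (F x)‖ ≤ ‖F x‖ ^ (P' - 1) := fun x => by
    by_cases hx : F x = 0
    · rw [hx]; simp; positivity
    · exact (hnorm x hx).le
  have hψm : Measurable ψ := by
    refine Measurable.indicator ?_ hA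
    exact (Complex.measurable_ofReal.comp (hF.norm.pow_const _)).mul
      (Complex.continuous_conj.measurable.comp hF)
  have hψb : ∃ M, ∀ x, ‖ψ x‖ ≤ M := by
    refine ⟨max k 0 ^ (P' - 1), fun x => ?_⟩
    by_cases hx : x ∈ A
    · rw [hψ, Set.indicator_of_mem hx]
      exact (hnorm0 x).trans (rpow_le_rpow (norm_nonneg _) ((hk x hx).trans (le_max_left _ _))
        (by linarith))
    · rw [hψ, Set.indicator_of_notMem hx]; simp; positivity
  have h := hS ψ hψm hψb fun x hx => Set.indicator_of_notMem hx _
  set I := ∫ x in A, ‖F x‖ ^ P' ∂ν with hI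
  have hI0 : 0 ≤ I := integral_nonneg fun x => by positivity
  have e1 : ∫ x, ψ x * F x ∂ν = (I : ℂ) := by
    have : (fun x => ψ x * F x) = A.indicator fun x => ((‖F x‖ ^ P' : ℝ) : ℂ) := by
      funext x
      by_cases hx : x ∈ A
      · rw [hψ, Set.indicator_of_mem hx, Set.indicator_of_mem hx, mul_assoc, mul_comm _ (F x),
          Complex.mul_conj, Complex.normSq_eq_norm_sq, ← Complex.ofReal_mul]
        by_cases hx0 : F x = 0
        · simp [hx0, hP'0.ne']
        · rw [← rpow_natCast, ← rpow_add (norm_pos_iff.2 hx0)]; norm_num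
      · rw [hψ, Set.indicator_of_notMem hx, Set.indicator_of_notMem hx, zero_mul]
    rw [this, integral_indicator hA, integral_complex_ofReal]
  have e2 : ∫ x, ‖ψ x‖ ^ P ∂ν = I := by
    have : (fun x => ‖ψ x‖ ^ P) = A.indicator fun x => ‖F x‖ ^ P' := by
      funext x
      by_cases hx : x ∈ A
      · rw [hψ, Set.indicator_of_mem hx, Set.indicator_of_mem hx]
        by_cases hx0 : F x = 0
        · simp [hx0, hP'0.ne', hP0.ne']
        · rw [hnorm x hx0, ← rpow_mul (norm_nonneg _), hP.symm.sub_one_mul_conj]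
      · rw [hψ, Set.indicator_of_notMem hx, Set.indicator_of_notMem hx, norm_zero,
          zero_rpow hP0.ne']
    rw [this, integral_indicator hA]
  rw [e1, e2, Complex.norm_real, Real.norm_of_nonneg hI0] at h
  have hle : I ≤ S ^ P' := by
    rcases hI0.eq_or_lt with h0 | h0
    · rw [← h0]; positivity
    · have h1 : I ^ (1 / P') ≤ S := by
        have h2 : I = I ^ (1 / P') * I ^ (1 / P) := by
          rw [← rpow_add h0]
          have := hP.inv_add_inv_eq_one
          rw [one_div, one_div, add_comm, this, rpow_one]
        have h3 : 0 < I ^ (1 / P) := by positivity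
        nth_rewrite 1 [h2] at h
        exact le_of_mul_le_mul_right h h3
      calc I = (I ^ (1 / P')) ^ P' := by
            rw [← rpow_mul hI0, one_div, inv_mul_cancel₀ hP'0.ne', rpow_one]
        _ ≤ S ^ P' := by gcongr
  have hint : IntegrableOn (fun x => ‖F x‖ ^ P') A ν := by
    refine Measure.integrableOn_of_bounded hAf (hF.norm.pow_const _).aestronglyMeasurable
      (M := k ^ P') ?_
    filter_upwards [ae_restrict_mem hA] with x hx
    rw [Real.norm_of_nonneg (by positivity)]
    exact rpow_le_rpow (norm_nonneg _) (hk x hx) hP'0.le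
  refine le_trans (le_of_eq ?_) (ENNReal.ofReal_le_ofReal hle)
  rw [hI, ofReal_integral_eq_lintegral_ofReal hint (Filter.Eventually.of_forall fun x => by
      positivity)]
  refine lintegral_congr fun x => ?_
  rw [← ENNReal.ofReal_rpow_of_nonneg (norm_nonneg _) hP'0.le, ofReal_norm]

/-- The endpoint `P = 1`, tested on the conjugate sign of `F`: on a set where `|F| > S` the pairing
would exceed the bound unless the set is null. -/
theorem measure_eq_zero_of_pairing {S : ℝ} (hS0 : 0 ≤ S) {F : X → ℂ} (hF : Measurable F)
    {A : Set X} (hA : MeasurableSet A) (hAf : ν A ≠ ⊤) {k : ℝ} (hk : ∀ x ∈ A, ‖F x‖ ≤ k)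
    (hAS : ∀ x ∈ A, S < ‖F x‖)
    (hS : ∀ ψ : X → ℂ, Measurable ψ → (∃ M, ∀ x, ‖ψ x‖ ≤ M) → (∀ x ∉ A, ψ x = 0) →
      ‖∫ x, ψ x * F x ∂ν‖ ≤ S * ∫ x, ‖ψ x‖ ∂ν) :
    ν A = 0 := by
  set ψ : X → ℂ := A.indicator fun x => ((‖F x‖⁻¹ : ℝ) : ℂ) * (starRingEnd ℂ) (F x) with hψ
  have hF0 : ∀ x ∈ A, 0 < ‖F x‖ := fun x hx => hS0.trans_lt (hAS x hx)
  have hψ1 : ∀ x ∈ A, ‖ψ x‖ = 1 := fun x hx => by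
    rw [hψ, Set.indicator_of_mem hx, norm_mul, RCLike.norm_conj, Complex.norm_real, norm_inv,
      norm_norm, inv_mul_cancel₀ (hF0 x hx).ne']
  have hψm : Measurable ψ := Measurable.indicator ((Complex.measurable_ofReal.comp hF.norm.inv).mul
      (Complex.continuous_conj.measurable.comp hF)) hA
  have hψb : ∃ M, ∀ x, ‖ψ x‖ ≤ M := by
    refine ⟨1, fun x => ?_⟩
    by_cases hx : x ∈ A
    · exact (hψ1 x hx).le
    · rw [hψ, Set.indicator_of_notMem hx]; simp
  have h := hS ψ hψm hψb fun x hx => Set.indicator_of_notMem hx _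
  have e1 : ∫ x, ψ x * F x ∂ν = ((∫ x in A, ‖F x‖ ∂ν : ℝ) : ℂ) := by
    have : (fun x => ψ x * F x) = A.indicator fun x => ((‖F x‖ : ℝ) : ℂ) := by
      funext x
      by_cases hx : x ∈ A
      · rw [hψ, Set.indicator_of_mem hx, Set.indicator_of_mem hx, mul_assoc, mul_comm _ (F x),
          Complex.mul_conj, Complex.normSq_eq_norm_sq, ← Complex.ofReal_mul, sq,
          inv_mul_cancel_left₀ (hF0 x hx).ne']
      · rw [hψ, Set.indicator_of_notMem hx, Set.indicator_of_notMem hx, zero_mul]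
    rw [this, integral_indicator hA, integral_complex_ofReal]
  have e2 : ∫ x, ‖ψ x‖ ∂ν = ∫ _ in A, (1 : ℝ) ∂ν := by
    rw [← integral_indicator hA]
    refine integral_congr_ae (Filter.Eventually.of_forall fun x => ?_)
    by_cases hx : x ∈ A
    · simp only [Set.indicator_of_mem hx]; exact hψ1 x hx
    · simp only [hψ, Set.indicator_of_notMem hx, norm_zero]
  rw [e1, e2, Complex.norm_real, Real.norm_of_nonneg (integral_nonneg fun x => norm_nonneg _),
    ← integral_const_mul] at h
  have hint : IntegrableOn (fun x => ‖F x‖) A ν := by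
    refine Measure.integrableOn_of_bounded hAf hF.norm.aestronglyMeasurable (M := k) ?_
    filter_upwards [ae_restrict_mem hA] with x hx
    rw [norm_norm]; exact hk x hx
  have hint2 : IntegrableOn (fun _ => S * 1) A ν := integrableOn_const hAf
  have h3 : ∫ x in A, (‖F x‖ - S * 1) ∂ν ≤ 0 := by
    rw [integral_sub hint hint2]; linarith
  have h4 : 0 ≤ᵐ[ν.restrict A] fun x => ‖F x‖ - S * 1 := by
    filter_upwards [ae_restrict_mem hA] with x hx
    have := hAS x hx
    simp only [Pi.zero_apply]; linarith
  have h5 := (setIntegral_eq_zero_iff_of_nonneg_ae h4 (hint.sub hint2)).1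
    (le_antisymm h3 (integral_nonneg_of_ae h4))
  rw [Filter.EventuallyEq, ae_restrict_iff' hA, ae_iff] at h5
  refine measure_mono_null (fun x hx => ?_) h5
  have := hAS x hx
  simp only [Set.mem_setOf_eq, Pi.zero_apply, Classical.not_imp]
  exact ⟨hx, by linarith⟩

end Duality

set_option maxHeartbeats 1000000 in
-- The functional extends to `L^p` by density. Multiplication by a weight in `L^s` maps `L²` into
-- `L^p`, so the Riesz theorem in the Hilbert space `L²` represents the pulled-back functional;
-- dividing by the weight gives a function `F`. Its `L^{p'}` norm is then found by testing.
theorem distLpNorm_le_of_forall_norm_le {n : ℕ} {p p' : ℝ≥0∞} (hpp : ENNReal.HolderConjugate p p')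
    (hp2 : p ≤ 2) {S : ℝ} (hS : 0 ≤ S) (u : 𝓢'(EuclideanSpace ℝ (Fin n), ℂ))
    (hu : ∀ φ : 𝓢(EuclideanSpace ℝ (Fin n), ℂ), ‖u φ‖ ≤ S * (eLpNorm φ p volume).toReal) :
    distLpNorm p' u ≤ ENNReal.ofReal S := by
  have hp1 : 1 ≤ p := hpp.one_le
  have hpt : p ≠ ⊤ := (hp2.trans_lt (by simp)).ne
  haveI : Fact (1 ≤ p) := ⟨hp1⟩
  haveI h2 : Fact ((1 : ℝ≥0∞) ≤ 2) := ⟨by norm_num⟩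
  -- `1/s = 1/p - 1/2`; for `p = 2` this is `s = ∞`.
  obtain ⟨s, hs⟩ : ∃ s : ℝ≥0∞, ENNReal.HolderTriple s 2 p :=
    ⟨(p⁻¹ - 2⁻¹)⁻¹, ⟨by rw [inv_inv, tsub_add_cancel_of_le (ENNReal.inv_le_inv.2 hp2)]⟩⟩
  obtain ⟨k, hk⟩ := Measure.HasTemperateGrowth.exists_eLpNorm_lt_top
    (μ := (volume : Measure (EuclideanSpace ℝ (Fin n)))) s inferInstance
  set E := EuclideanSpace ℝ (Fin n)
  have hpos : ∀ x : E, 0 < 1 + ‖x‖ := fun x => by positivity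
  -- the functional on `L^p`, and its pullback to `L²` by a weight
  let v : 𝓢(E, ℂ) →ₗ[ℂ] ℂ :=
    { toFun := fun φ => u φ
      map_add' := fun φ ψ => map_add u φ ψ
      map_smul' := fun c φ => map_smul u c φ }
  have hdense : DenseRange (SchwartzMap.toLpCLM ℂ ℂ (E := E) p volume) :=
    SchwartzMap.denseRange_toLpCLM hpt
  have hv : ∀ φ, ‖v φ‖ ≤ S * ‖SchwartzMap.toLpCLM ℂ ℂ (E := E) p volume φ‖ := fun φ => by
    rw [SchwartzMap.toLpCLM_apply, SchwartzMap.norm_toLp]; exact hu φ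
  set T := v.extendOfNorm (SchwartzMap.toLpCLM ℂ ℂ (E := E) p volume).toLinearMap with hT
  have hTv : ∀ φ : 𝓢(E, ℂ), T (φ.toLp p volume) = u φ := fun φ =>
    LinearMap.extendOfNorm_eq (f := v) (e := (SchwartzMap.toLpCLM ℂ ℂ (E := E) p
        volume).toLinearMap)
      hdense ⟨S, hv⟩ φ
  have hTS : ∀ g : Lp ℂ p (volume : Measure E), ‖T g‖ ≤ S * ‖g‖ := fun g =>
    LinearMap.norm_extendOfNorm_apply_le (f := v)
      (e := (SchwartzMap.toLpCLM ℂ ℂ (E := E) p volume).toLinearMap) hdense S hv g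
  have hw : MemLp (fun x : E => (((1 + ‖x‖) ^ (-k : ℝ) : ℝ) : ℂ)) s volume :=
    MemLp.ofReal ⟨(by fun_prop : Measurable _).aestronglyMeasurable, hk⟩
  set W : Lp ℂ s (volume : Measure E) := hw.toLp with hW
  let Λ : Lp ℂ 2 (volume : Measure E) →L[ℂ] ℂ := LinearMap.mkContinuous
    { toFun := fun g => T (W • g : Lp ℂ p (volume : Measure E))
      map_add' := fun g g' => by rw [Lp.add_smul, map_add]
      map_smul' := fun c g => by rw [← Lp.smul_comm, map_smul, RingHom.id_apply] }
    (S * ‖W‖) fun g => by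
      refine (hTS _).trans ?_
      rw [mul_assoc]
      gcongr
      exact Lp.norm_smul_le W g
  set G := (InnerProductSpace.toDual ℂ (Lp ℂ 2 (volume : Measure E))).symm Λ with hG
  have hGΛ : ∀ g : Lp ℂ 2 (volume : Measure E), T (W • g : Lp ℂ p (volume : Measure E)) =
      ∫ x, (starRingEnd ℂ) (G x) * g x := fun g => by
    have : Λ g = inner ℂ G g := (InnerProductSpace.toDual_symm_apply).symm
    rw [L2.inner_def] at this
    refine this.trans (integral_congr_ae (Filter.Eventually.of_forall fun x => ?_))
    simp [mul_comm]
  set F : E → ℂ := fun x => (starRingEnd ℂ) (G x) * (((1 + ‖x‖) ^ k : ℝ) : ℂ) with hF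
  have hFm : Measurable F := by
    have := (Lp.stronglyMeasurable G).measurable
    fun_prop
  have hpair : ∀ (ψ : E → ℂ) (hψ : MemLp ψ p volume),
      MemLp (fun x => (((1 + ‖x‖) ^ k : ℝ) : ℂ) * ψ x) 2 volume →
      T hψ.toLp = ∫ x, ψ x * F x := fun ψ hψ hψ2 => by
    have e : hψ.toLp = (W • hψ2.toLp : Lp ℂ p (volume : Measure E)) := by
      refine Lp.ext ?_
      filter_upwards [Lp.coeFn_lpSMul (r := p) W hψ2.toLp, hψ.coeFn_toLp, hψ2.coeFn_toLp,
        hw.coeFn_toLp] with x h1 h2 h3 h4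
      rw [h1, h2, Pi.smul_apply', h3, h4, smul_eq_mul, ← mul_assoc, ← Complex.ofReal_mul,
        rpow_neg (hpos x).le, rpow_natCast, inv_mul_cancel₀ (pow_pos (hpos x) k).ne']
      simp
    rw [e, hGΛ]
    refine integral_congr_ae ?_
    filter_upwards [hψ2.coeFn_toLp] with x hx
    rw [hx, hF]; ring
  have hFu : ∀ φ : 𝓢(E, ℂ), u φ = ∫ x, φ x * F x := fun φ => by
    rw [← hTv]
    refine hpair φ (φ.memLp p volume) ?_
    have htg : (fun x : E => (((1 + ‖x‖ ^ 2) ^ k : ℝ) : ℂ)).HasTemperateGrowth := by fun_prop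
    refine ((SchwartzMap.smulLeftCLM ℂ (fun x : E => (((1 + ‖x‖ ^ 2) ^ k : ℝ) : ℂ)) φ).memLp 2
      volume).of_le_mul (c := 2 ^ k) (by fun_prop) (Filter.Eventually.of_forall fun x => ?_)
    rw [SchwartzMap.smulLeftCLM_apply_apply htg, smul_eq_mul, norm_mul, norm_mul,
      Complex.norm_real, Complex.norm_real, Real.norm_of_nonneg (by positivity),
      Real.norm_of_nonneg (by positivity), ← mul_assoc, ← mul_pow]
    gcongr
    nlinarith [sq_nonneg (‖x‖ - 1), sq_nonneg ‖x‖]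
  -- At this point `F` is only an `L²` function times a polynomial weight. On these sets it is
  -- bounded and the measure is finite, so bounded test functions are admissible; they exhaust the
  -- space.
  set A : ℕ → Set E := fun j => Metric.closedBall 0 j ∩ {x | ‖F x‖ ≤ j} with hA
  have hAm : ∀ j, MeasurableSet (A j) := fun j =>
    measurableSet_closedBall.inter (measurableSet_le hFm.norm measurable_const)
  have hAf : ∀ j, volume (A j) ≠ ⊤ := fun j => ((measure_mono Set.inter_subset_left).trans_lt
    measure_closedBall_lt_top).ne
  have hAu : ⋃ j, A j = Set.univ := by
    refine Set.eq_univ_of_forall fun x => ?_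
    obtain ⟨j, hj⟩ := exists_nat_ge (max ‖x‖ ‖F x‖)
    exact Set.mem_iUnion.2 ⟨j, by simpa using (le_max_left _ _).trans hj,
      (le_max_right _ _).trans hj⟩
  have hmem : ∀ (r : ℝ≥0∞) (B : Set E) (ψ : E → ℂ), MeasurableSet B → volume B ≠ ⊤ → Measurable ψ →
      (∃ M, ∀ x ∈ B, ‖ψ x‖ ≤ M) → (∀ x ∉ B, ψ x = 0) → MemLp ψ r volume := by
    intro r B ψ hB hBf hψ ⟨M, hM⟩ h0
    have : ψ = B.indicator ψ := by
      funext x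
      by_cases hx : x ∈ B
      · rw [Set.indicator_of_mem hx]
      · rw [Set.indicator_of_notMem hx, h0 x hx]
    rw [this, memLp_indicator_iff_restrict hB]
    haveI : IsFiniteMeasure (volume.restrict B) := ⟨by simpa using hBf.lt_top⟩
    exact MemLp.of_bound hψ.aestronglyMeasurable M (by
      filter_upwards [ae_restrict_mem hB] with x hx using hM x hx)
  have htest : ∀ (j : ℕ) (B : Set E), MeasurableSet B → B ⊆ A j → ∀ ψ : E → ℂ, Measurable ψ →
      (∃ M, ∀ x, ‖ψ x‖ ≤ M) → (∀ x ∉ B, ψ x = 0) → ∃ hψ : MemLp ψ p volume,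
      ‖∫ x, ψ x * F x‖ ≤ S * (eLpNorm ψ p volume).toReal := by
    intro j B hB hBA ψ hψ ⟨M, hM⟩ h0
    have hBf : volume B ≠ ⊤ := ((measure_mono hBA).trans_lt (hAf j).lt_top).ne
    have hm := hmem p B ψ hB hBf hψ ⟨M, fun x _ => hM x⟩ h0
    refine ⟨hm, ?_⟩
    rw [← hpair ψ hm (hmem 2 B _ hB hBf (by fun_prop) ⟨(1 + j) ^ k * M, fun x hx => ?_⟩
      fun x hx => by rw [h0 x hx, mul_zero])]
    · refine (hTS _).trans (le_of_eq ?_)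
      rw [Lp.norm_toLp]
    · have h1 : ‖x‖ ≤ j := by simpa using (hBA hx).1
      have hM0 : 0 ≤ M := (norm_nonneg _).trans (hM x)
      rw [norm_mul, Complex.norm_real, Real.norm_of_nonneg (by positivity)]
      gcongr
      exact hM x
  have hFn : eLpNorm F p' volume ≤ ENNReal.ofReal S := by
    rcases hp1.eq_or_lt with h1 | h1
    · have hp't : p' = ⊤ := by
        subst h1
        have := hpp.inv_add_inv_eq_inv
        simpa using this
      rw [hp't, eLpNorm_exponent_top]
      refine eLpNormEssSup_le_of_ae_bound ?_
      have hnull : ∀ j, volume (A j ∩ {x | S < ‖F x‖}) = 0 := fun j => by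
        have hB : MeasurableSet (A j ∩ {x | S < ‖F x‖}) :=
          (hAm j).inter (measurableSet_lt measurable_const hFm.norm)
        refine measure_eq_zero_of_pairing hS hFm hB
          ((measure_mono Set.inter_subset_left).trans_lt (hAf j).lt_top).ne (k := j)
          (fun x hx => hx.1.2) (fun x hx => hx.2) fun ψ hψ hb h0 => ?_
        obtain ⟨hm, h⟩ := htest j _ hB Set.inter_subset_left ψ hψ hb h0
        refine h.trans (le_of_eq ?_)
        rw [hm.eLpNorm_eq_integral_rpow_norm (by rw [← h1]; simp) hpt,
          ENNReal.toReal_ofReal (by positivity), ← h1]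
        simp
      rw [ae_iff]
      refine measure_mono_null (fun x hx => ?_) (measure_iUnion_null hnull)
      obtain ⟨j, hj⟩ := Set.mem_iUnion.1 (hAu ▸ Set.mem_univ x)
      exact Set.mem_iUnion.2 ⟨j, hj, not_le.1 hx⟩
    · have hp0 : p ≠ 0 := (zero_lt_one.trans h1).ne'
      have hp't : p' ≠ ⊤ := fun h => by
        have := hpp.inv_add_inv_eq_inv
        rw [h, ENNReal.inv_top, add_zero, inv_one, ENNReal.inv_eq_one] at this
        exact h1.ne' this
      have hp'0 : p' ≠ 0 := (zero_lt_one.trans_le hpp.symm.one_le).ne'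
      have hPP : p.toReal.HolderConjugate p'.toReal := by
        refine Real.holderConjugate_iff.2 ⟨?_, ?_⟩
        · rw [← ENNReal.toReal_one]; exact (ENNReal.toReal_lt_toReal (by simp) hpt).2 h1
        · have := hpp.inv_add_inv_eq_inv
          rw [← ENNReal.toReal_inv, ← ENNReal.toReal_inv, ← ENNReal.toReal_add (by simpa using hp0)
            (by simpa using hp'0), this]
          simp
      have hP'0 : 0 < p'.toReal := ENNReal.toReal_pos hp'0 hp't
      rw [eLpNorm_eq_lintegral_rpow_enorm_toReal hp'0 hp't, ← setLIntegral_univ, ← hAu,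
        setLIntegral_iUnion_of_directed]
      · have : ⨆ j, ∫⁻ x in A j, ‖F x‖ₑ ^ p'.toReal ≤ ENNReal.ofReal (S ^ p'.toReal) :=
          iSup_le fun j => setLIntegral_rpow_le_of_pairing hPP hS hFm (hAm j) (hAf j)
            (fun x hx => hx.2) fun ψ hψ hb h0 => by
              obtain ⟨hm, h⟩ := htest j _ (hAm j) subset_rfl ψ hψ hb h0
              refine h.trans (le_of_eq ?_)
              rw [hm.eLpNorm_eq_integral_rpow_norm hp0 hpt, ENNReal.toReal_ofReal (by positivity),
                one_div]
        calc _ ≤ ENNReal.ofReal (S ^ p'.toReal) ^ (1 / p'.toReal) := by gcongr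
          _ = ENNReal.ofReal S := by
              rw [← ENNReal.ofReal_rpow_of_nonneg hS hP'0.le, ← ENNReal.rpow_mul, mul_one_div,
                div_self hP'0.ne', ENNReal.rpow_one]
      · refine Monotone.directed_le fun i j hij => ?_
        refine Set.inter_subset_inter (Metric.closedBall_subset_closedBall (by exact_mod_cast hij))
          fun x (hx : ‖F x‖ ≤ i) => hx.trans (by exact_mod_cast hij)
  refine le_trans (iInf₂_le_of_le F ⟨hFm.aestronglyMeasurable, hFn.trans_lt ENNReal.ofReal_lt_top⟩
    (iInf_le _ hFu)) hFn

/-! ### Complex interpolation -/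

theorem norm_cexp_mul_ofReal_le {z : ℂ} (h0 : 0 ≤ z.re) (h1 : z.re ≤ 1) (A : ℝ) :
    ‖Complex.exp (z * A)‖ ≤ 1 + Real.exp A := by
  rw [Complex.norm_exp, Complex.re_mul_ofReal]
  rcases le_total 0 A with hA | hA
  · have : Real.exp (z.re * A) ≤ Real.exp A := exp_le_exp.2 (mul_le_of_le_one_left hA h1)
    linarith
  · have : Real.exp (z.re * A) ≤ 1 := exp_le_one_iff.2 (mul_nonpos_of_nonneg_of_nonpos h0 hA)
    linarith [exp_pos A]

/-- Differentiation in `z` costs a factor `A`, which the distance `δ` to the boundary of the strip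
absorbs. -/
theorem norm_mul_cexp_mul_ofReal_le {z : ℂ} {δ : ℝ} (hδ : 0 < δ) (h0 : δ ≤ z.re)
    (h1 : z.re ≤ 1 - δ) (A : ℝ) :
    ‖(A : ℂ) * Complex.exp (z * A)‖ ≤ δ⁻¹ * (1 + Real.exp A) := by
  rw [norm_mul, Complex.norm_real, Complex.norm_exp, Complex.re_mul_ofReal, Real.norm_eq_abs,
    inv_mul_eq_div, le_div_iff₀ hδ]
  rcases le_total 0 A with hA | hA
  · rw [abs_of_nonneg hA]
    have h2 : A * δ ≤ Real.exp (δ * A) := by have := add_one_le_exp (δ * A); linarith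
    have h3 : Real.exp (z.re * A) ≤ Real.exp ((1 - δ) * A) := by gcongr
    calc A * Real.exp (z.re * A) * δ = (A * δ) * Real.exp (z.re * A) := by ring
      _ ≤ Real.exp (δ * A) * Real.exp ((1 - δ) * A) := by gcongr
      _ = Real.exp A := by rw [← Real.exp_add]; ring_nf
      _ ≤ _ := by linarith
  · rw [abs_of_nonpos hA]
    have h2 : -A * δ ≤ Real.exp (-(δ * A)) := by have := add_one_le_exp (-(δ * A)); linarith
    have h3 : Real.exp (z.re * A) ≤ Real.exp (δ * A) :=
      exp_le_exp.2 (mul_le_mul_of_nonpos_right h0 hA)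
    calc -A * Real.exp (z.re * A) * δ = (-A * δ) * Real.exp (z.re * A) := by ring
      _ ≤ Real.exp (-(δ * A)) * Real.exp (δ * A) := by gcongr
      _ = 1 := by rw [← Real.exp_add]; simp
      _ ≤ _ := by linarith [exp_pos A]

section Laplace

variable {X : Type*} [MeasurableSpace X] {ν : Measure X}

open Complex.HadamardThreeLines in
-- On the strip `|exp (z A)| ≤ 1 + exp A`, so convergence on the two boundary lines dominates
-- everything between them.
theorem diffContOnCl_laplace {A : X → ℝ} {h : X → ℂ} (hA : Measurable A) (hh : Integrable h ν)
    (hh1 : Integrable (fun x => (Real.exp (A x) : ℂ) * h x) ν) :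
    DiffContOnCl ℂ (fun z : ℂ => ∫ x, Complex.exp (z * A x) * h x ∂ν) (verticalStrip 0 1) := by
  have hbd : Integrable (fun x => (1 + Real.exp (A x)) * ‖h x‖) ν := by
    refine (hh.norm.add hh1.norm).congr (Filter.Eventually.of_forall fun x => ?_)
    simp only [Pi.add_apply, norm_mul, Complex.norm_real, Real.norm_of_nonneg (exp_pos _).le]
    ring
  have hmeas : ∀ z : ℂ, AEStronglyMeasurable (fun x => Complex.exp (z * A x) * h x) ν := fun z =>
    (by fun_prop : Measurable fun x => Complex.exp (z * A x)).aestronglyMeasurable.mul hh.1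
  refine ⟨fun z hz => ?_, ?_⟩
  · have hz1 : 0 < z.re := hz.1
    have hz2 : z.re < 1 := hz.2
    set δ := min z.re (1 - z.re) / 2 with hδ
    have hδ0 : 0 < δ := by have := lt_min hz1 (sub_pos.2 hz2); positivity
    have hδ1 : 2 * δ ≤ z.re := by rw [hδ]; linarith [min_le_left z.re (1 - z.re)]
    have hδ2 : 2 * δ ≤ 1 - z.re := by rw [hδ]; linarith [min_le_right z.re (1 - z.re)]
    refine DifferentiableAt.differentiableWithinAt (HasDerivAt.differentiableAt
      (hasDerivAt_integral_of_dominated_loc_of_deriv_le (Metric.ball_mem_nhds z hδ0)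
      (F' := fun w x => A x * Complex.exp (w * A x) * h x)
      (bound := fun x => δ⁻¹ * ((1 + Real.exp (A x)) * ‖h x‖))
      (Filter.Eventually.of_forall hmeas) ?_ ?_ ?_ (hbd.const_mul _) ?_).2)
    · refine hbd.mono' (hmeas z) (Filter.Eventually.of_forall fun x => ?_)
      rw [norm_mul]
      gcongr
      exact norm_cexp_mul_ofReal_le hz1.le hz2.le _
    · exact (by fun_prop : Measurable fun x =>
        (A x : ℂ) * Complex.exp (z * A x)).aestronglyMeasurable.mul hh.1
    · refine Filter.Eventually.of_forall fun x w hw => ?_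
      have hre : |w.re - z.re| < δ := by
        rw [← Complex.sub_re]
        exact (Complex.abs_re_le_norm _).trans_lt (by simpa [dist_eq_norm] using hw)
      rw [abs_lt] at hre
      rw [norm_mul, ← mul_assoc]
      gcongr
      exact norm_mul_cexp_mul_ofReal_le hδ0 (by linarith) (by linarith) _
    · refine Filter.Eventually.of_forall fun x w _ => ?_
      refine ((((hasDerivAt_id w).mul_const (A x : ℂ)).cexp).mul_const (h x)).congr_deriv ?_
      simp only [id, one_mul]; ring
  · have hsub : closure (verticalStrip 0 1) ⊆ Complex.re ⁻¹' Set.Icc 0 1 :=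
      closure_minimal (Set.preimage_mono Set.Ioo_subset_Icc_self)
        (isClosed_Icc.preimage Complex.continuous_re)
    refine ContinuousOn.mono ?_ hsub
    refine continuousOn_of_dominated (bound := fun x => (1 + Real.exp (A x)) * ‖h x‖)
      (fun z _ => hmeas z) (fun z hz => Filter.Eventually.of_forall fun x => ?_) hbd
      (Filter.Eventually.of_forall fun x => ?_)
    · rw [norm_mul]
      gcongr
      exact norm_cexp_mul_ofReal_le hz.1 hz.2 _
    · fun_prop

end Laplace

/-! ### Plancherel for Fourier integrals and the trilinear form -/

section Fourier

open FourierTransform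

variable {E : Type*} [NormedAddCommGroup E] [InnerProductSpace ℝ E] [FiniteDimensional ℝ E]
  [MeasurableSpace E] [BorelSpace E]

theorem integral_mul_fourier_eq {u v : E → ℂ} (hu : Integrable u) (hv : Integrable v) :
    ∫ ξ, 𝓕 u ξ * v ξ = ∫ x, u x * 𝓕 v x := by
  have := VectorFourier.integral_fourierIntegral_smul_eq_flip (L := innerₗ E) (μ := volume)
    (ν := volume) continuous_fourierChar continuous_inner hu hv
  rw [flip_innerₗ] at this
  exact this

theorem norm_fourierInv_le {u : E → ℂ} (ξ : E) : ‖𝓕⁻ u ξ‖ ≤ ∫ x, ‖u x‖ := by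
  rw [Real.fourierInv_eq]
  exact (norm_integral_le_integral_norm _).trans (le_of_eq (by simp))

theorem continuous_fourier {u : E → ℂ} (hu : Integrable u) : Continuous (𝓕 u) :=
  VectorFourier.fourierIntegral_continuous continuous_fourierChar continuous_inner hu

theorem continuous_fourierInv {u : E → ℂ} (hu : Integrable u) : Continuous (𝓕⁻ u) := by
  have : 𝓕⁻ u = fun ξ => 𝓕 u (-ξ) := funext fun ξ => Real.fourierInv_eq_fourier_neg u ξ
  rw [this]
  exact (continuous_fourier hu).comp continuous_neg

/-- On `L¹ ∩ L²`, the Fourier integral represents the Fourier transform on `L²`. -/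
theorem fourier_toLp_ae_eq {u : E → ℂ} (h1 : Integrable u) (h2 : MemLp u 2) :
    (𝓕 (h2.toLp u) : Lp ℂ 2 (volume : Measure E)) =ᵐ[volume] 𝓕 u := by
  refine ae_eq_of_integral_contDiff_smul_eq ((Lp.memLp _).locallyIntegrable (by norm_num))
    (continuous_fourier h1).locallyIntegrable fun g hg hgc => ?_
  have hg₁ : HasCompactSupport (Complex.ofRealCLM ∘ g) := hgc.comp_left rfl
  have hg₂ : ContDiff ℝ ∞ (Complex.ofRealCLM ∘ g) := by fun_prop
  set φ : 𝓢(E, ℂ) := hg₁.toSchwartzMap hg₂ with hφ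
  have hφg : ∀ x, φ x = (g x : ℂ) := fun x => rfl
  have h := DFunLike.congr_fun (Lp.fourier_toTemperedDistribution_eq (h2.toLp u)) φ
  rw [TemperedDistribution.fourier_apply, Lp.toTemperedDistribution_apply,
    Lp.toTemperedDistribution_apply] at h
  have e1 : ∫ x, (𝓕 φ : 𝓢(E, ℂ)) x • (h2.toLp u) x = ∫ x, 𝓕 (φ : E → ℂ) x * u x := by
    refine integral_congr_ae ?_
    filter_upwards [h2.coeFn_toLp] with x hx
    rw [hx, smul_eq_mul, SchwartzMap.fourier_coe]
  rw [e1, integral_mul_fourier_eq φ.integrable h1] at h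
  simp only [hφg, smul_eq_mul] at h
  simp only [Complex.real_smul]
  exact h.symm

theorem integral_norm_sq_eq_eLpNorm {u : E → ℂ} (h2 : MemLp u 2) :
    ∫ x, ‖u x‖ ^ 2 = (eLpNorm u 2 volume).toReal ^ 2 := by
  rw [h2.eLpNorm_eq_integral_rpow_norm (by norm_num) (by norm_num),
    ENNReal.toReal_ofReal (by positivity), ← rpow_natCast _ 2, ← rpow_mul (by positivity)]
  simp

theorem memLp_fourier {u : E → ℂ} (h1 : Integrable u) (h2 : MemLp u 2) : MemLp (𝓕 u) 2 volume :=
  (memLp_congr_ae (fourier_toLp_ae_eq h1 h2)).1 (Lp.memLp _)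

theorem integral_norm_sq_fourier {u : E → ℂ} (h1 : Integrable u) (h2 : MemLp u 2) :
    ∫ ξ, ‖𝓕 u ξ‖ ^ 2 = ∫ x, ‖u x‖ ^ 2 := by
  rw [integral_norm_sq_eq_eLpNorm (memLp_fourier h1 h2), integral_norm_sq_eq_eLpNorm h2,
    ← eLpNorm_congr_ae (fourier_toLp_ae_eq h1 h2), ← Lp.norm_def, Lp.norm_fourier_eq, Lp.norm_toLp]

theorem memLp_fourierInv {u : E → ℂ} (h1 : Integrable u) (h2 : MemLp u 2) :
    MemLp (𝓕⁻ u) 2 volume := by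
  have : 𝓕⁻ u = 𝓕 u ∘ fun ξ => -ξ := funext fun ξ => Real.fourierInv_eq_fourier_neg u ξ
  rw [this]
  exact (memLp_fourier h1 h2).comp_measurePreserving (Measure.measurePreserving_neg volume)

theorem integral_norm_sq_fourierInv {u : E → ℂ} (h1 : Integrable u) (h2 : MemLp u 2) :
    ∫ ξ, ‖𝓕⁻ u ξ‖ ^ 2 = ∫ x, ‖u x‖ ^ 2 := by
  simp_rw [Real.fourierInv_eq_fourier_neg]
  rw [integral_neg_eq_self (fun ξ => ‖𝓕 u ξ‖ ^ 2), integral_norm_sq_fourier h1 h2]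

theorem norm_integral_mul_le_sqrt {u v : E → ℂ} (hu : MemLp u 2) (hv : MemLp v 2) :
    ‖∫ x, u x * v x‖ ≤ √(∫ x, ‖u x‖ ^ 2) * √(∫ x, ‖v x‖ ^ 2) := by
  refine (norm_integral_le_integral_norm _).trans ?_
  simp_rw [norm_mul]
  have := integral_mul_norm_le_Lp_mul_Lq (f := u) (g := v) (μ := volume)
    (Real.HolderConjugate.two_two) (by simpa using hu) (by simpa using hv)
  simpa [Real.sqrt_eq_rpow] using this

/-- The trilinear integrand. -/
theorem integrable_trilinear {M u v : E → ℂ} (hM : Integrable M) (hu : Integrable u)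
    (hv : Integrable v) :
    Integrable (fun p : E × E × E =>
      Complex.exp (Complex.I * ((2 * π * inner ℝ (p.2.1 - p.2.2) p.1 : ℝ) : ℂ)) *
        (M p.1 * (u p.2.1 * v p.2.2))) (volume.prod (volume.prod volume)) := by
  refine Integrable.bdd_mul (c := 1) (hM.mul_prod (hu.mul_prod hv)) ?_
    (Filter.Eventually.of_forall fun p => (norm_cexp_I_mul_ofReal _).le)
  exact Continuous.aestronglyMeasurable (by fun_prop)

/-- One absolutely convergent integral over `(ξ, x, y)`. Integrating in `ξ` last gives the Fourier
side, where Plancherel applies; integrating in `ξ` first exposes the convolution kernel at `x - y`.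
-/
theorem integral_trilinear_eq {M u v : E → ℂ} (hM : Integrable M) (hu : Integrable u)
    (hv : Integrable v) :
    ∫ p : E × E × E, Complex.exp (Complex.I * ((2 * π * inner ℝ (p.2.1 - p.2.2) p.1 : ℝ) : ℂ)) *
        (M p.1 * (u p.2.1 * v p.2.2)) ∂(volume.prod (volume.prod volume)) =
      ∫ ξ, M ξ * (𝓕⁻ u ξ * 𝓕 v ξ) := by
  rw [integral_prod _ (integrable_trilinear hM hu hv)]
  refine integral_congr_ae (Filter.Eventually.of_forall fun ξ => ?_)
  simp only
  rw [Real.fourierInv_eq', Real.fourier_eq', ← integral_prod_mul, ← integral_const_mul]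
  refine integral_congr_ae (Filter.Eventually.of_forall fun p => ?_)
  simp only [smul_eq_mul]
  have : Complex.exp (Complex.I * ((2 * π * inner ℝ (p.1 - p.2) ξ : ℝ) : ℂ)) =
      Complex.exp (((2 * π * inner ℝ p.1 ξ : ℝ) : ℂ) * Complex.I) *
        Complex.exp (((-2 * π * inner ℝ p.2 ξ : ℝ) : ℂ) * Complex.I) := by
    rw [← Complex.exp_add, inner_sub_left]
    congr 1
    push_cast; ring
  rw [this]; ring

theorem norm_integral_trilinear_le {M u v : E → ℂ} (hM : Integrable M) (hu : Integrable u)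
    (hv : Integrable v) {κ : ℝ}
    (hκ : ∀ x : E, ‖∫ ξ, Complex.exp (Complex.I * ((2 * π * inner ℝ x ξ : ℝ) : ℂ)) * M ξ‖ ≤ κ) :
    ‖∫ ξ, M ξ * (𝓕⁻ u ξ * 𝓕 v ξ)‖ ≤ κ * ((∫ x, ‖u x‖) * ∫ x, ‖v x‖) := by
  rw [← integral_trilinear_eq hM hu hv, integral_prod_symm _ (integrable_trilinear hM hu hv),
    ← integral_prod_mul, ← integral_const_mul]
  refine norm_integral_le_of_norm_le ((hu.norm.mul_prod hv.norm).const_mul κ)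
    (Filter.Eventually.of_forall fun p => ?_)
  simp only
  have : ∀ ξ, Complex.exp (Complex.I * ((2 * π * inner ℝ (p.1 - p.2) ξ : ℝ) : ℂ)) *
      (M ξ * (u p.1 * v p.2)) = Complex.exp (Complex.I * ((2 * π * inner ℝ (p.1 - p.2) ξ : ℝ) : ℂ))
          *
      M ξ * (u p.1 * v p.2) := fun ξ => by ring
  simp_rw [this]
  rw [integral_mul_const, norm_mul, norm_mul]
  gcongr
  exact hκ _

end Fourier

/-! ### Stein interpolation -/

section Stein

open FourierTransform Complex.HadamardThreeLines

variable {E : Type*} [NormedAddCommGroup E] [InnerProductSpace ℝ E] [FiniteDimensional ℝ E]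
  [MeasurableSpace E] [BorelSpace E]

/-- The analytic family `‖f‖ ^ ((1 + z) p / 2) * sign f`. -/
noncomputable def analyticPower (p : ℝ) (f : E → ℂ) (z : ℂ) (x : E) : ℂ :=
  Complex.exp (z * ((p / 2 * Real.log ‖f x‖ : ℝ) : ℂ)) * (((‖f x‖ ^ (p / 2 - 1) : ℝ) : ℂ) * f x)

theorem norm_analyticPower {p : ℝ} (hp : 0 < p) (f : E → ℂ) {z : ℂ} (hz : 0 ≤ z.re) (x : E) :
    ‖analyticPower p f z x‖ = ‖f x‖ ^ (p / 2 * (1 + z.re)) := by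
  unfold analyticPower
  by_cases h : f x = 0
  · rw [h, norm_zero, zero_rpow (mul_pos (half_pos hp) (by linarith)).ne']; simp
  · have h0 : 0 < ‖f x‖ := norm_pos_iff.2 h
    have e : Real.exp (z.re * (p / 2 * Real.log ‖f x‖)) = ‖f x‖ ^ (p / 2 * z.re) := by
      rw [rpow_def_of_pos h0]; ring_nf
    rw [norm_mul, norm_mul, Complex.norm_exp, Complex.re_mul_ofReal, Complex.norm_real,
      Real.norm_of_nonneg (by positivity), ← rpow_add_one h0.ne', e, ← rpow_add h0]
    ring_nf

theorem analyticPower_eq_self {p θ : ℝ} (hp : p / 2 * (1 + θ) = 1) (f : E → ℂ) :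
    analyticPower p f (θ : ℂ) = f := by
  funext x
  unfold analyticPower
  by_cases h : f x = 0
  · simp [h]
  · have h0 : 0 < ‖f x‖ := norm_pos_iff.2 h
    rw [← Complex.ofReal_mul, ← Complex.ofReal_exp, ← mul_assoc, ← Complex.ofReal_mul, ← mul_assoc,
      mul_comm _ (Real.log _), ← rpow_def_of_pos h0, ← rpow_add h0,
      show θ * (p / 2) + (p / 2 - 1) = 0 by linarith, rpow_zero]
    simp

theorem aestronglyMeasurable_analyticPower (p : ℝ) (f : 𝓢(E, ℂ)) (z : ℂ) :
    AEStronglyMeasurable (analyticPower p f z) volume := by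
  have hf : Measurable f := f.continuous.measurable
  unfold analyticPower
  exact (by fun_prop : Measurable _).aestronglyMeasurable

theorem integrable_norm_rpow (f : 𝓢(E, ℂ)) {s : ℝ} (hs : 0 < s) :
    Integrable (fun x => ‖f x‖ ^ s) := by
  have := (f.memLp (ENNReal.ofReal s) volume).integrable_norm_rpow (by simpa using hs) (by simp)
  rwa [ENNReal.toReal_ofReal hs.le] at this

theorem integrable_analyticPower {p : ℝ} (hp : 0 < p) (f : 𝓢(E, ℂ)) {z : ℂ} (hz : 0 ≤ z.re) :
    Integrable (analyticPower p f z) := by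
  refine (integrable_norm_iff (aestronglyMeasurable_analyticPower p f z)).1 ?_
  simp_rw [norm_analyticPower hp f hz]
  exact integrable_norm_rpow f (by positivity)

theorem norm_sq_analyticPower {p : ℝ} (hp : 0 < p) (f : E → ℂ) {z : ℂ} (hz : z.re = 0) (x : E) :
    ‖analyticPower p f z x‖ ^ 2 = ‖f x‖ ^ p := by
  rw [norm_analyticPower hp f hz.ge, hz, ← rpow_natCast, ← rpow_mul (norm_nonneg _)]
  norm_num

theorem memLp_two_analyticPower {p : ℝ} (hp : 0 < p) (f : 𝓢(E, ℂ)) {z : ℂ} (hz : z.re = 0) :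
    MemLp (analyticPower p f z) 2 volume := by
  refine (memLp_two_iff_integrable_sq_norm (aestronglyMeasurable_analyticPower p f z)).2 ?_
  simp_rw [norm_sq_analyticPower hp f hz]
  exact integrable_norm_rpow f hp

/-- On the line `Re z = 1` the factor `exp (z²)` has modulus `exp (1 - y²)`, which absorbs the
quadratic growth of the kernel bound in the imaginary direction. -/
theorem exp_mul_one_add_sq_le (y : ℝ) : Real.exp (1 - y ^ 2) * (1 + |y|) ^ 2 ≤ 2 * Real.exp 1 := by
  have h1 : (1 + |y|) ^ 2 ≤ 2 * (y ^ 2 + 1) := by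
    nlinarith [sq_nonneg (1 - |y|), sq_abs y]
  have h2 := add_one_le_exp (y ^ 2)
  calc Real.exp (1 - y ^ 2) * (1 + |y|) ^ 2 ≤ Real.exp (1 - y ^ 2) * (2 * Real.exp (y ^ 2)) := by
        gcongr; linarith
    _ = 2 * Real.exp 1 := by rw [mul_left_comm, ← Real.exp_add]; ring_nf

set_option maxHeartbeats 1000000 in
/-- Stein interpolation between the bound `‖m‖ ≤ 1` on `L²` and a dispersive bound. -/
theorem stein_interpolation {m : E → ℂ} {L : E → ℝ} (hm : Integrable m) (hm1 : ∀ ξ, ‖m ξ‖ ≤ 1)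
    (hL : Measurable L) (hΛ : ∃ Λ, ∀ ξ, m ξ ≠ 0 → |L ξ| ≤ Λ) {K : ℝ} (hK : 0 ≤ K)
    (hker : ∀ (τ : ℝ) (x : E), ‖∫ ξ, Complex.exp (Complex.I * ((2 * π * inner ℝ x ξ : ℝ) : ℂ)) *
      (Complex.exp ((1 + τ * Complex.I) * (L ξ : ℂ)) * m ξ)‖ ≤ K * (1 + |τ|) ^ 2)
    {θ p : ℝ} (hθ0 : 0 ≤ θ) (hθ1 : θ ≤ 1) (hp0 : 0 < p) (hp : p / 2 * (1 + θ) = 1)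
    (f g : 𝓢(E, ℂ)) :
    ‖∫ ξ, Complex.exp (θ * (L ξ : ℂ)) * m ξ * (𝓕⁻ (f : E → ℂ) ξ * 𝓕 (g : E → ℂ) ξ)‖ ≤
      (2 * Real.exp 1 * K) ^ θ *
        ((∫ x, ‖f x‖ ^ p) ^ (1 / p) * (∫ x, ‖g x‖ ^ p) ^ (1 / p)) := by
  obtain ⟨Λ, hΛ⟩ := hΛ
  have hexp : ∀ (z : ℂ) (ξ : E), ‖Complex.exp (z * (L ξ : ℂ)) * m ξ‖ ≤
      Real.exp (|z.re| * Λ) * ‖m ξ‖ := fun z ξ => by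
    by_cases h : m ξ = 0
    · simp [h]
    · rw [norm_mul, Complex.norm_exp, Complex.re_mul_ofReal]
      refine mul_le_mul_of_nonneg_right (exp_le_exp.2 ?_) (norm_nonneg _)
      calc z.re * L ξ ≤ |z.re * L ξ| := le_abs_self _
        _ = |z.re| * |L ξ| := abs_mul _ _
        _ ≤ |z.re| * Λ := by gcongr; exact hΛ ξ h
  have hMz : ∀ z : ℂ, Integrable fun ξ => Complex.exp (z * (L ξ : ℂ)) * m ξ := fun z =>
    (hm.norm.const_mul _).mono' ((by fun_prop : Measurable fun ξ =>
      Complex.exp (z * (L ξ : ℂ))).aestronglyMeasurable.mul hm.1) (Filter.Eventually.of_forall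
          (hexp z))
  have hfz := fun z (hz : 0 ≤ z.re) => integrable_analyticPower hp0 f (z := z) hz
  have hgz := fun z (hz : 0 ≤ z.re) => integrable_analyticPower hp0 g (z := z) hz
  -- Symbol and analytic powers depend on `z` only through exponentials of real functions, so the
  -- whole integrand is `exp (z A) h` and analyticity is that of a Laplace transform. Where `f` or
  -- `g` vanishes, the value `log 0 = 0` is harmless because `h` vanishes too.
  set A : E × E × E → ℝ := fun q => L q.1 + (p / 2 * Real.log ‖f q.2.1‖ +
    p / 2 * Real.log ‖g q.2.2‖) with hA
  set h : E × E × E → ℂ := fun q =>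
    Complex.exp (Complex.I * ((2 * π * inner ℝ (q.2.1 - q.2.2) q.1 : ℝ) : ℂ)) *
      (Complex.exp (0 * (L q.1 : ℂ)) * m q.1 *
        (analyticPower p f 0 q.2.1 * analyticPower p g 0 q.2.2)) with hh
  have hsplit : ∀ (z : ℂ) (q : E × E × E), Complex.exp (z * (A q : ℂ)) * h q =
      Complex.exp (Complex.I * ((2 * π * inner ℝ (q.2.1 - q.2.2) q.1 : ℝ) : ℂ)) *
      (Complex.exp (z * (L q.1 : ℂ)) * m q.1 *
        (analyticPower p f z q.2.1 * analyticPower p g z q.2.2)) := fun z q => by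
    simp only [hA, hh, analyticPower]
    push_cast
    rw [mul_add, mul_add, Complex.exp_add, Complex.exp_add]
    simp only [zero_mul, Complex.exp_zero]
    ring
  have hAm : Measurable A := by
    have hf : Measurable f := f.continuous.measurable
    have hg : Measurable g := g.continuous.measurable
    fun_prop
  have hint : Integrable h (volume.prod (volume.prod volume)) :=
    integrable_trilinear (hMz 0) (hfz 0 le_rfl) (hgz 0 le_rfl)
  have hint1 : Integrable (fun q => (Real.exp (A q) : ℂ) * h q)
      (volume.prod (volume.prod volume)) := by
    refine (integrable_trilinear (hMz 1) (hfz 1 (by simp)) (hgz 1 (by simp))).congr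
      (Filter.Eventually.of_forall fun q => ?_)
    simp only
    rw [← hsplit, one_mul, Complex.ofReal_exp]
  set Φ : ℂ → ℂ := fun z =>
    ∫ q, Complex.exp (z * (A q : ℂ)) * h q ∂(volume.prod (volume.prod volume)) with hΦ
  have hΦeq : ∀ z : ℂ, 0 ≤ z.re → Φ z = ∫ ξ, Complex.exp (z * (L ξ : ℂ)) * m ξ *
      (𝓕⁻ (analyticPower p f z) ξ * 𝓕 (analyticPower p g z) ξ) := fun z hz => by
    rw [hΦ, ← integral_trilinear_eq (hMz z) (hfz z hz) (hgz z hz)]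
    simp only [hsplit]
  have hΦd : DiffContOnCl ℂ Φ (verticalStrip 0 1) := diffContOnCl_laplace hAm hint hint1
  set a := ∫ x, ‖f x‖ ^ p with ha
  set b := ∫ x, ‖g x‖ ^ p with hb
  have ha0 : 0 ≤ a := integral_nonneg fun x => by positivity
  have hb0 : 0 ≤ b := integral_nonneg fun x => by positivity
  -- the function to which the three lines theorem is applied
  set Ψ : ℂ → ℂ := fun z => Complex.exp (z ^ 2) * Φ z with hΨ
  have hΨd : DiffContOnCl ℂ Ψ (verticalStrip 0 1) :=
    (Differentiable.diffContOnCl (f := fun z : ℂ => Complex.exp (z ^ 2)) (by fun_prop)).smul hΦd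
  have hre2 : ∀ z : ℂ, ‖Complex.exp (z ^ 2)‖ = Real.exp (z.re ^ 2 - z.im ^ 2) := fun z => by
    rw [Complex.norm_exp, sq, Complex.mul_re]; ring_nf
  have hB : BddAbove ((norm ∘ Ψ) '' verticalClosedStrip 0 1) := by
    refine ⟨Real.exp 1 * ∫ q, (1 + Real.exp (A q)) * ‖h q‖ ∂(volume.prod (volume.prod volume)), ?_⟩
    rintro _ ⟨z, hz, rfl⟩
    have hz0 : 0 ≤ z.re := hz.1
    have hz1 : z.re ≤ 1 := hz.2
    simp only [Function.comp, hΨ, norm_mul, hre2]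
    gcongr
    · nlinarith [sq_nonneg z.im]
    · refine norm_integral_le_of_norm_le ?_ (Filter.Eventually.of_forall fun q => ?_)
      · refine (hint.norm.add hint1.norm).congr (Filter.Eventually.of_forall fun q => ?_)
        simp only [Pi.add_apply, norm_mul, Complex.norm_real, Real.norm_of_nonneg (exp_pos _).le]
        ring
      · rw [norm_mul]
        gcongr
        exact norm_cexp_mul_ofReal_le hz0 hz1 _
  -- On `Re z = 0` the weight is unimodular and the analytic powers have squared `L²` norms `a` and
  -- `b`: Plancherel.
  have hleft : ∀ z ∈ Complex.re ⁻¹' {0}, ‖Ψ z‖ ≤ √a * √b := fun z hz => by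
    have hz0 : z.re = 0 := hz
    have h1 : ‖Complex.exp (z ^ 2)‖ ≤ 1 := by
      rw [hre2, hz0, exp_le_one_iff]; nlinarith [sq_nonneg z.im]
    have h2 : ‖Φ z‖ ≤ √a * √b := by
      have hfL := memLp_two_analyticPower hp0 f hz0
      have hgL := memLp_two_analyticPower hp0 g hz0
      rw [hΦeq z hz0.ge]
      have hv : MemLp (fun ξ => Complex.exp (z * (L ξ : ℂ)) * m ξ *
          𝓕⁻ (analyticPower p f z) ξ) 2 volume := by
        refine (memLp_fourierInv (hfz z hz0.ge) hfL).of_le ((hMz z).1.mul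
          (continuous_fourierInv (hfz z hz0.ge)).aestronglyMeasurable)
          (Filter.Eventually.of_forall fun ξ => ?_)
        rw [norm_mul]
        refine mul_le_of_le_one_left (norm_nonneg _) ((hexp z ξ).trans ?_)
        rw [hz0]; simpa using hm1 ξ
      have h3 := norm_integral_mul_le_sqrt hv (memLp_fourier (hgz z hz0.ge) hgL)
      simp only [mul_assoc] at h3 ⊢
      refine h3.trans ?_
      rw [integral_norm_sq_fourier (hgz z hz0.ge) hgL]
      simp only [norm_sq_analyticPower hp0 g hz0]
      gcongr
      refine le_trans (integral_mono_of_nonneg (Filter.Eventually.of_forall fun ξ => sq_nonneg _)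
        ((memLp_fourierInv (hfz z hz0.ge) hfL).integrable_norm_pow (by norm_num))
        (Filter.Eventually.of_forall fun ξ => ?_)) (le_of_eq (b := a) ?_)
      · simp only
        gcongr
        rw [← mul_assoc, norm_mul]
        refine mul_le_of_le_one_left (norm_nonneg _) ((hexp z ξ).trans ?_)
        rw [hz0]; simpa using hm1 ξ
      · rw [integral_norm_sq_fourierInv (hfz z hz0.ge) hfL]
        simp only [norm_sq_analyticPower hp0 f hz0]
        rfl
    calc ‖Ψ z‖ = ‖Complex.exp (z ^ 2)‖ * ‖Φ z‖ := norm_mul _ _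
      _ ≤ 1 * (√a * √b) := by gcongr
      _ = _ := one_mul _
  -- On `Re z = 1` the analytic powers have `L¹` norms `a` and `b`: the kernel bound.
  have hright : ∀ z ∈ Complex.re ⁻¹' {1}, ‖Ψ z‖ ≤ 2 * Real.exp 1 * K * (a * b) := fun z hz => by
    have hz1 : z.re = 1 := hz
    have hz0 : 0 ≤ z.re := by rw [hz1]; norm_num
    have hzz : z = 1 + z.im * Complex.I := by
      conv_lhs => rw [← Complex.re_add_im z, hz1]
      simp
    have h2 : ‖Φ z‖ ≤ K * (1 + |z.im|) ^ 2 * (a * b) := by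
      rw [hΦeq z hz0]
      have h3 := norm_integral_trilinear_le (hMz z) (hfz z hz0) (hgz z hz0)
        (κ := K * (1 + |z.im|) ^ 2) (fun x => by
          have := hker z.im x
          rwa [← hzz] at this)
      refine h3.trans (le_of_eq ?_)
      have e : p / 2 * (1 + 1) = p := by ring
      simp only [norm_analyticPower hp0 _ hz0, hz1, e]
      rfl
    calc ‖Ψ z‖ = Real.exp (1 - z.im ^ 2) * ‖Φ z‖ := by rw [hΨ, norm_mul, hre2, hz1, one_pow]
      _ ≤ Real.exp (1 - z.im ^ 2) * (K * (1 + |z.im|) ^ 2 * (a * b)) := by gcongr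
      _ = (Real.exp (1 - z.im ^ 2) * (1 + |z.im|) ^ 2) * (K * (a * b)) := by ring
      _ ≤ 2 * Real.exp 1 * (K * (a * b)) := by
          exact mul_le_mul_of_nonneg_right (exp_mul_one_add_sq_le _) (by positivity)
      _ = _ := by ring
  have h3 := norm_le_interp_of_mem_verticalClosedStrip₀₁' Ψ (z := (θ : ℂ))
    (by exact ⟨hθ0, hθ1⟩) hΨd hB hleft hright
  rw [Complex.ofReal_re] at h3
  -- At the real point `θ` the auxiliary factor is `exp (θ²) ≥ 1`.
  have h4 : ‖Φ θ‖ ≤ ‖Ψ θ‖ := by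
    rw [hΨ, norm_mul, hre2]
    refine le_mul_of_one_le_left (norm_nonneg _) (one_le_exp ?_)
    simp; positivity
  have h5 := hΦeq θ (by simpa using hθ0)
  rw [analyticPower_eq_self hp, analyticPower_eq_self hp] at h5
  rw [← h5]
  refine (h4.trans h3).trans (le_of_eq ?_)
  have hpθ : 1 / p = (1 - θ) / 2 + θ := by
    rw [div_eq_iff hp0.ne']; linarith
  have key : ∀ x : ℝ, 0 ≤ x → √x ^ (1 - θ) * x ^ θ = x ^ (1 / p) := fun x hx => by
    rw [Real.sqrt_eq_rpow, ← rpow_mul hx, ← rpow_add_of_nonneg hx (by linarith) hθ0, hpθ]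
    ring_nf
  rw [← key a ha0, ← key b hb0, mul_rpow (Real.sqrt_nonneg _) (Real.sqrt_nonneg _),
    mul_rpow (by positivity) (by positivity), mul_rpow ha0 hb0]
  ring

end Stein

/-! ### Symbols of temperate growth -/

section TemperateGrowth

variable {E : Type*} [NormedAddCommGroup E] [InnerProductSpace ℝ E]

/-- After scaling so that `f ≥ 1`, compose with `x ↦ x ^ r` on `(1/2, ∞)`, where all its derivatives
grow at most polynomially. -/
theorem hasTemperateGrowth_rpow_const {f : E → ℝ} (hf : f.HasTemperateGrowth) {c : ℝ} (hc : 0 < c)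
    (hfc : ∀ x, c ≤ f x) (r : ℝ) : (fun x => f x ^ r).HasTemperateGrowth := by
  set t := {y : ℝ | 1 / 2 < y} with ht
  have htr : Set.range (fun x => c⁻¹ * f x) ⊆ t := by
    rintro - ⟨x, rfl⟩
    have : 1 ≤ c⁻¹ * f x := by
      rw [inv_mul_eq_div, le_div_iff₀ hc, one_mul]; exact hfc x
    show 1 / 2 < c⁻¹ * f x
    linarith
  have hdiff : ContDiffOn ℝ ∞ (fun x : ℝ => x ^ r) t :=
    contDiffOn_fun_id.rpow_const_of_ne fun x hx => (lt_trans (by norm_num) hx).ne'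
  have hunique : UniqueDiffOn ℝ t := (isOpen_lt' (1 / 2)).uniqueDiffOn
  have key : ((fun x : ℝ => x ^ r) ∘ fun x => c⁻¹ * f x).HasTemperateGrowth := by
    refine Function.HasTemperateGrowth.comp' htr hunique hdiff (fun N => ?_) (by fun_prop)
    obtain ⟨k, hk⟩ := exists_nat_ge |r|
    refine ⟨k, ∑ k ∈ Finset.range (N + 1), ‖Polynomial.eval r (descPochhammer ℝ k)‖ *
      2 ^ ((N : ℝ) + |r|), by positivity, fun n hn x hx => ?_⟩
    have hx1 : 1 / 2 < x := hx
    have hx0 : 0 < x := by linarith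
    have hcd : ContDiffAt ℝ n (fun x : ℝ => x ^ r) x := Real.contDiffAt_rpow_const (Or.inl hx0.ne')
    rw [norm_iteratedFDerivWithin_eq_norm_iteratedDerivWithin,
      iteratedDerivWithin_eq_iteratedDeriv hunique hcd hx, iteratedDeriv_eq_iterate,
      Real.iter_deriv_rpow_const, norm_mul, ← Finset.sum_mul, mul_assoc]
    have hn' : n ∈ Finset.range (N + 1) := Finset.mem_range.2 (by omega)
    refine mul_le_mul (Finset.single_le_sum (f := fun k =>
      ‖Polynomial.eval r (descPochhammer ℝ k)‖) (fun _ _ => norm_nonneg _) hn') ?_ (norm_nonneg _)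
      (Finset.sum_nonneg fun _ _ => norm_nonneg _)
    have h1k : 1 ≤ (1 + ‖x‖) ^ k := one_le_pow₀ (by linarith [norm_nonneg x])
    have h2k : (1 : ℝ) ≤ 2 ^ ((N : ℝ) + |r|) := one_le_rpow (by norm_num) (by positivity)
    rw [Real.norm_of_nonneg (by positivity)]
    have hnN : (n : ℝ) ≤ N := by exact_mod_cast hn
    rcases le_total 0 (r - n) with h | h
    · calc x ^ (r - n) ≤ (1 + ‖x‖) ^ (r - n) :=
            rpow_le_rpow hx0.le (by linarith [le_norm_self x]) h
        _ ≤ (1 + ‖x‖) ^ (k : ℝ) := by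
            refine rpow_le_rpow_of_exponent_le (by linarith [norm_nonneg x]) ?_
            have := le_abs_self r
            have : (0 : ℝ) ≤ n := n.cast_nonneg
            linarith
        _ = (1 + ‖x‖) ^ k := rpow_natCast _ _
        _ ≤ _ := le_mul_of_one_le_left (by positivity) h2k
    · calc x ^ (r - n) ≤ (1 / 2) ^ (r - n) := rpow_le_rpow_of_nonpos (by norm_num) hx1.le h
        _ = 2 ^ (n - r) := by
            rw [one_div, inv_rpow (by norm_num), ← rpow_neg (by norm_num), neg_sub]
        _ ≤ 2 ^ ((N : ℝ) + |r|) := by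
            refine rpow_le_rpow_of_exponent_le (by norm_num) ?_
            have := neg_abs_le r
            linarith
        _ ≤ _ := le_mul_of_one_le_right (by positivity) h1k
  have : (fun x => f x ^ r) = fun x => c ^ r * ((fun x : ℝ => x ^ r) ∘ fun x => c⁻¹ * f x) x := by
    funext x
    have : 0 ≤ f x := hc.le.trans (hfc x)
    simp only [Function.comp]
    rw [← mul_rpow hc.le (by positivity), mul_inv_cancel_left₀ hc.ne']
  rw [this]
  exact (Function.HasTemperateGrowth.const _).mul key

theorem hasTemperateGrowth_cexp_I_mul :
    (fun x : ℝ => Complex.exp (Complex.I * x)).HasTemperateGrowth := by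
  refine ⟨(contDiff_const.mul Complex.ofRealCLM.contDiff).cexp, fun n => ⟨0, 1, fun x => ?_⟩⟩
  have : ∀ n : ℕ, iteratedDeriv n (fun x : ℝ => Complex.exp (Complex.I * x)) =
      fun x : ℝ => Complex.I ^ n * Complex.exp (Complex.I * x) := by
    intro n
    induction n with
    | zero => simp
    | succ n ih =>
      rw [iteratedDeriv_succ, ih]
      funext x
      have h : HasDerivAt (fun x : ℝ => Complex.exp (Complex.I * x))
          (Complex.I * Complex.exp (Complex.I * x)) x := by
        have h1 : HasDerivAt (fun x : ℝ => Complex.I * (x : ℂ)) (Complex.I * 1) x :=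
          (hasDerivAt_id x).ofReal_comp.const_mul _
        exact h1.cexp.congr_deriv (by ring)
      rw [(h.const_mul (Complex.I ^ n)).deriv]; ring
  rw [norm_iteratedFDeriv_eq_norm_iteratedDeriv, this]
  simp [norm_cexp_I_mul_ofReal]

theorem hasTemperateGrowth_cexp_I_mul_comp {f : E → ℝ} (hf : f.HasTemperateGrowth) :
    (fun x => Complex.exp (Complex.I * (f x : ℂ))).HasTemperateGrowth :=
  hasTemperateGrowth_cexp_I_mul.comp hf

theorem hasTemperateGrowth_ofReal_comp {f : E → ℝ} (hf : f.HasTemperateGrowth) :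
    (fun x => (f x : ℂ)).HasTemperateGrowth :=
  Function.Complex.hasTemperateGrowth_ofReal.comp hf

/-- One minus the cutoff is smooth with compact support. -/
theorem hasTemperateGrowth_cutoffRoot [FiniteDimensional ℝ E] {c : ℝ} (hc : 0 < c) :
    (fun ξ : E => cutoffRoot (c * ‖ξ‖ ^ 2)).HasTemperateGrowth := by
  have hsm : ContDiff ℝ ∞ fun ξ : E => cutoffRoot (c * ‖ξ‖ ^ 2) :=
    cutoffRoot_contDiff.comp (contDiff_const.mul (contDiff_norm_sq ℝ))
  have h1 : (fun ξ : E => 1 - cutoffRoot (c * ‖ξ‖ ^ 2)).HasTemperateGrowth := by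
    refine HasCompactSupport.hasTemperateGrowth ?_ (contDiff_const.sub hsm)
    refine HasCompactSupport.intro (isCompact_closedBall (0 : E) (√(c⁻¹))) fun ξ hξ => ?_
    have h2 : √(c⁻¹) < ‖ξ‖ := by simpa using hξ
    have h3 : c⁻¹ < ‖ξ‖ ^ 2 := (Real.sqrt_lt' ((Real.sqrt_nonneg _).trans_lt h2)).1 h2
    rw [cutoffRoot_of_ge, sub_self]
    rw [inv_lt_iff_one_lt_mul₀ hc] at h3
    linarith
  have h2 := (Function.HasTemperateGrowth.const (E := E) (1 : ℝ)).sub h1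
  convert h2 using 1
  funext ξ
  simp

/-- A smooth positive function that agrees with `(h ‖ξ‖) ^ 2` for `h ‖ξ‖ ≥ y / 2`. -/
noncomputable def regularizedSq (h y : ℝ) (ξ : E) : ℝ :=
  h ^ 2 * ‖ξ‖ ^ 2 + y ^ 2 * (1 - cutoffRoot (4 * h ^ 2 / y ^ 2 * ‖ξ‖ ^ 2))

theorem le_regularizedSq {h y : ℝ} (hy : 0 < y) (ξ : E) : y ^ 2 / 16 ≤ regularizedSq h y ξ := by
  unfold regularizedSq
  have h1 := cutoffRoot_le_one (4 * h ^ 2 / y ^ 2 * ‖ξ‖ ^ 2)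
  have hy2 : 0 < y ^ 2 := by positivity
  have h3 : 0 ≤ h ^ 2 * ‖ξ‖ ^ 2 := by positivity
  by_cases h2 : 4 * h ^ 2 / y ^ 2 * ‖ξ‖ ^ 2 ≤ 1 / 4
  · rw [cutoffRoot_of_le h2]; linarith
  · rw [div_mul_eq_mul_div, div_le_iff₀ hy2, not_le] at h2
    have : 0 ≤ y ^ 2 * (1 - cutoffRoot (4 * h ^ 2 / y ^ 2 * ‖ξ‖ ^ 2)) :=
      mul_nonneg hy2.le (by linarith)
    linarith

theorem regularizedSq_pos {h y : ℝ} (hy : 0 < y) (ξ : E) : 0 < regularizedSq h y ξ :=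
  (by positivity : 0 < y ^ 2 / 16).trans_le (le_regularizedSq hy ξ)

theorem regularizedSq_eq {h y : ℝ} (hy : 0 < y) {ξ : E} (hξ : y / 2 ≤ h * ‖ξ‖) :
    regularizedSq h y ξ = (h * ‖ξ‖) ^ 2 := by
  unfold regularizedSq
  rw [cutoffRoot_of_ge]
  · ring
  · rw [div_mul_eq_mul_div, le_div_iff₀ (by positivity)]
    nlinarith

theorem hasTemperateGrowth_regularizedSq [FiniteDimensional ℝ E] {h y : ℝ} (hh : 0 < h)
    (hy : 0 < y) : (regularizedSq h y : E → ℝ).HasTemperateGrowth := by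
  have h1 := hasTemperateGrowth_cutoffRoot (E := E) (c := 4 * h ^ 2 / y ^ 2) (by positivity)
  unfold regularizedSq
  fun_prop

theorem hasTemperateGrowth_regularizedSq_rpow [FiniteDimensional ℝ E] {h y : ℝ} (hh : 0 < h)
    (hy : 0 < y) (r : ℝ) : (fun ξ : E => regularizedSq h y ξ ^ r).HasTemperateGrowth :=
  hasTemperateGrowth_rpow_const (hasTemperateGrowth_regularizedSq hh hy) (c := y ^ 2 / 16)
    (by positivity) (le_regularizedSq hy) r

theorem regularizedSq_rpow_eq {h y : ℝ} (hy : 0 < y) {ξ : E} (hξ : y / 2 ≤ h * ‖ξ‖) (r : ℝ) :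
    regularizedSq h y ξ ^ (r / 2) = (h * ‖ξ‖) ^ r := by
  have : 0 ≤ h * ‖ξ‖ := (by positivity : 0 ≤ y / 2).trans hξ
  rw [regularizedSq_eq hy hξ, ← rpow_natCast, ← rpow_mul this]
  congr 1
  push_cast; ring

/-- A function of temperate growth that agrees with `abcdPhase a b c d (h ‖ξ‖)` for
`h ‖ξ‖ ≥ y / 2`. -/
noncomputable def regularizedPhase (a b c d h y : ℝ) (ξ : E) : ℝ :=
  regularizedSq h y ξ ^ (1 / 2 : ℝ) * ((1 - a * regularizedSq h y ξ) ^ (1 / 2 : ℝ) *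
    (1 - c * regularizedSq h y ξ) ^ (1 / 2 : ℝ)) *
    ((1 + b * regularizedSq h y ξ) ^ (-(1 / 2) : ℝ) *
      (1 + d * regularizedSq h y ξ) ^ (-(1 / 2) : ℝ))

theorem hasTemperateGrowth_regularizedPhase [FiniteDimensional ℝ E] {a b c d h y : ℝ} (ha : a ≤ 0)
    (hb : 0 ≤ b) (hc : c ≤ 0) (hd : 0 ≤ d) (hh : 0 < h) (hy : 0 < y) :
    (regularizedPhase a b c d h y : E → ℝ).HasTemperateGrowth := by
  have h0 := hasTemperateGrowth_regularizedSq (E := E) hh hy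
  have hpos := fun ξ : E => regularizedSq_pos (h := h) hy ξ
  have h1 := hasTemperateGrowth_regularizedSq_rpow (E := E) hh hy (1 / 2)
  have h2 : ∀ x ≤ (0 : ℝ),
      (fun ξ : E => (1 - x * regularizedSq h y ξ) ^ (1 / 2 : ℝ)).HasTemperateGrowth := fun x hx =>
    hasTemperateGrowth_rpow_const (f := fun ξ : E => 1 - x * regularizedSq h y ξ) (by fun_prop)
      zero_lt_one (fun ξ => by
        have := mul_nonpos_of_nonpos_of_nonneg hx (hpos ξ).le
        linarith) _
  have h3 : ∀ x, (0 : ℝ) ≤ x →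
      (fun ξ : E => (1 + x * regularizedSq h y ξ) ^ (-(1 / 2) : ℝ)).HasTemperateGrowth :=
    fun x hx => hasTemperateGrowth_rpow_const (f := fun ξ : E => 1 + x * regularizedSq h y ξ)
      (by fun_prop) zero_lt_one (fun ξ => by
        have := mul_nonneg hx (hpos ξ).le
        linarith) _
  exact (h1.mul ((h2 a ha).mul (h2 c hc))).mul ((h3 b hb).mul (h3 d hd))

theorem regularizedPhase_eq {a b c d h y : ℝ} (ha : a ≤ 0) (hb : 0 ≤ b) (hc : c ≤ 0) (hd : 0 ≤ d)
    (hy : 0 < y) {ξ : E} (hξ : y / 2 ≤ h * ‖ξ‖) :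
    regularizedPhase a b c d h y ξ = abcdPhase a b c d (h * ‖ξ‖) := by
  have h0 : 0 ≤ h * ‖ξ‖ := (by positivity : 0 ≤ y / 2).trans hξ
  unfold regularizedPhase abcdPhase
  rw [regularizedSq_rpow_eq hy hξ, rpow_one, regularizedSq_eq hy hξ]
  set v := (h * ‖ξ‖) ^ 2 with hv
  have hv0 : 0 ≤ v := sq_nonneg _
  have p1 : 0 ≤ 1 - a * v := by have := mul_nonpos_of_nonpos_of_nonneg ha hv0; linarith
  have p2 : 0 ≤ 1 - c * v := by have := mul_nonpos_of_nonpos_of_nonneg hc hv0; linarith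
  have p3 : 0 ≤ 1 + b * v := by positivity
  have p4 : 0 ≤ 1 + d * v := by positivity
  rw [Real.sqrt_eq_rpow, div_rpow (mul_nonneg p1 p2) (mul_nonneg p3 p4), mul_rpow p1 p2,
    mul_rpow p3 p4, rpow_neg p3, rpow_neg p4]
  ring

theorem continuous_abcdPhase {a b c d : ℝ} (hb : 0 ≤ b) (hd : 0 ≤ d) :
    Continuous (abcdPhase a b c d) := by
  unfold abcdPhase
  have : ∀ y : ℝ, (1 + b * y ^ 2) * (1 + d * y ^ 2) ≠ 0 := fun y => by positivity
  fun_prop (disch := assumption)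

/-- The high-frequency weight `(h ‖ξ‖) ^ e`, cut off to `h ‖ξ‖ ≥ y / 2`. -/
noncomputable def highFreqSymbol (h y e : ℝ) (ξ : E) : ℝ :=
  regularizedSq h y ξ ^ (e / 2) * cutoffRoot (h ^ 2 / y ^ 2 * ‖ξ‖ ^ 2)

theorem hasTemperateGrowth_highFreqSymbol [FiniteDimensional ℝ E] {h y : ℝ} (hh : 0 < h)
    (hy : 0 < y) (e : ℝ) : (highFreqSymbol h y e : E → ℝ).HasTemperateGrowth :=
  (hasTemperateGrowth_regularizedSq_rpow hh hy _).mul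
    (hasTemperateGrowth_cutoffRoot (by positivity))

theorem highFreqSymbol_eq {h y : ℝ} (hy : 0 < y) {ξ : E} (hξ : y ≤ h * ‖ξ‖) (e : ℝ) :
    highFreqSymbol h y e ξ = (h * ‖ξ‖) ^ e := by
  unfold highFreqSymbol
  rw [regularizedSq_rpow_eq hy (by linarith), cutoffRoot_of_ge, mul_one]
  rw [div_mul_eq_mul_div, le_div_iff₀ (by positivity)]
  nlinarith

/-- `TT*` squares the weight. This is why the radial cutoff is built as the square of a smooth
function. -/
theorem highFreqSymbol_sq {h y : ℝ} (hy : 0 < y) (ξ : E) (e : ℝ) :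
    highFreqSymbol h y e ξ ^ 2 = regularizedSq h y ξ ^ e * radialCutoff (h * ‖ξ‖ / y) := by
  unfold highFreqSymbol radialCutoff
  rw [mul_pow, ← rpow_natCast (_ ^ _), ← rpow_mul (regularizedSq_pos hy ξ).le]
  congr 2
  · push_cast; ring
  · congr 1; ring

end TemperateGrowth

/-! ### Bilinear estimates for the high-frequency flow -/

section Bilinear

open FourierTransform

variable {E : Type*} [NormedAddCommGroup E]

/-- The symbol `exp (i t g (h |ξ|))` localized to `y / 2 ≤ h |ξ| ≤ 2 ^ N y`. -/
noncomputable def truncatedSymbol (g : ℝ → ℝ) (h y t : ℝ) (N : ℕ) (ξ : E) : ℂ :=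
  Complex.exp (Complex.I * ((t * g (h * ‖ξ‖) : ℝ) : ℂ)) *
    ((radialCutoff (h * ‖ξ‖ / y) - radialCutoff (h * ‖ξ‖ / y / 2 ^ N) : ℝ) : ℂ)

theorem continuous_truncatedSymbol {g : ℝ → ℝ} (hg : Continuous g) (h y t : ℝ) (N : ℕ) :
    Continuous (truncatedSymbol g h y t N : E → ℂ) := by
  have h1 : Continuous radialCutoff := (radialCutoff_contDiff (n := 0)).continuous
  unfold truncatedSymbol
  fun_prop

theorem norm_truncatedSymbol_le (g : ℝ → ℝ) (h y t : ℝ) (N : ℕ) (ξ : E) :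
    ‖truncatedSymbol g h y t N ξ‖ ≤ 1 := by
  unfold truncatedSymbol
  rw [norm_mul, norm_cexp_I_mul_ofReal, one_mul, Complex.norm_real, Real.norm_eq_abs, abs_le]
  have h1 := radialCutoff_nonneg (h * ‖ξ‖ / y)
  have h2 := radialCutoff_le_one (h * ‖ξ‖ / y)
  have h3 := radialCutoff_nonneg (h * ‖ξ‖ / y / 2 ^ N)
  have h4 := radialCutoff_le_one (h * ‖ξ‖ / y / 2 ^ N)
  constructor <;> linarith

theorem truncatedSymbol_ne_zero {g : ℝ → ℝ} {h y t : ℝ} (hh : 0 < h) (hy : 0 < y) {N : ℕ} {ξ : E}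
    (hξ : truncatedSymbol g h y t N ξ ≠ 0) : y / 2 < h * ‖ξ‖ ∧ h * ‖ξ‖ < 2 ^ N * y := by
  have h0 : 0 ≤ h * ‖ξ‖ / y := by positivity
  have h1 : radialCutoff (h * ‖ξ‖ / y) - radialCutoff (h * ‖ξ‖ / y / 2 ^ N) ≠ 0 := fun h => by
    apply hξ
    simp only [truncatedSymbol]
    rw [h, Complex.ofReal_zero, mul_zero]
  constructor <;> by_contra! h2 <;> apply h1
  · have h3 : h * ‖ξ‖ / y ≤ 1 / 2 := by rw [div_le_iff₀ hy]; linarith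
    rw [radialCutoff_of_le h0 h3, radialCutoff_of_le (by positivity)
      ((div_le_self h0 (one_le_pow₀ (by norm_num))).trans h3), sub_zero]
  · have h3 : 2 ^ N ≤ h * ‖ξ‖ / y := by rwa [le_div_iff₀ hy]
    rw [radialCutoff_of_ge ((one_le_pow₀ (by norm_num)).trans h3), radialCutoff_of_ge, sub_self]
    rwa [le_div_iff₀ (by positivity), one_mul]

theorem integrable_truncatedSymbol [NormedSpace ℝ E] [FiniteDimensional ℝ E] [MeasureSpace E]
    [BorelSpace E] [IsFiniteMeasureOnCompacts (volume : Measure E)] {g : ℝ → ℝ} (hg : Continuous g)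
    {h y : ℝ} (hh : 0 < h) (hy : 0 < y) (t : ℝ) (N : ℕ) :
    Integrable (truncatedSymbol g h y t N : E → ℂ) := by
  refine (continuous_truncatedSymbol hg h y t N).integrable_of_hasCompactSupport
    (HasCompactSupport.intro (isCompact_closedBall (0 : E) (2 ^ N * y / h)) fun ξ hξ => ?_)
  by_contra h1
  have h2 := (truncatedSymbol_ne_zero hh hy h1).2
  have h3 : 2 ^ N * y / h < ‖ξ‖ := by simpa using hξ
  rw [div_lt_iff₀ hh] at h3
  linarith

theorem abs_log_le_of_truncatedSymbol_ne_zero {g : ℝ → ℝ} {h y t : ℝ} (hh : 0 < h) (hy : 0 < y)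
    {N : ℕ} {ξ : E} (hξ : truncatedSymbol g h y t N ξ ≠ 0) :
    |Real.log (h * ‖ξ‖)| ≤ |Real.log (y / 2)| + |Real.log (2 ^ N * y)| := by
  obtain ⟨h1, h2⟩ := truncatedSymbol_ne_zero hh hy hξ
  have h3 := Real.log_le_log (by positivity) h1.le
  have h4 := Real.log_le_log ((by positivity : 0 < y / 2).trans h1) h2.le
  rw [abs_le]
  have := neg_abs_le (Real.log (y / 2))
  have := le_abs_self (Real.log (2 ^ N * y))
  have := abs_nonneg (Real.log (y / 2))
  have := abs_nonneg (Real.log (2 ^ N * y))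
  constructor <;> linarith

variable [InnerProductSpace ℝ E] [FiniteDimensional ℝ E] [MeasurableSpace E] [BorelSpace E]

theorem exp_mul_truncatedSymbol {g : ℝ → ℝ} {h y t : ℝ} (hh : 0 < h) (hy : 0 < y) {N : ℕ}
    (ξ : E) (e : ℝ) :
    Complex.exp (((e * Real.log (h * ‖ξ‖) : ℝ) : ℂ)) * truncatedSymbol g h y t N ξ =
      ((regularizedSq h y ξ ^ (e / 2) : ℝ) : ℂ) * truncatedSymbol g h y t N ξ := by
  by_cases h0 : truncatedSymbol g h y t N ξ = 0
  · simp [h0]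
  · obtain ⟨h1, -⟩ := truncatedSymbol_ne_zero hh hy h0
    rw [regularizedSq_rpow_eq hy h1.le, rpow_def_of_pos ((by positivity : 0 < y / 2).trans h1),
      Complex.ofReal_exp, mul_comm e]

/-- For fixed `ξ` the integrand no longer changes once `2 ^ N` exceeds `2 h |ξ| / y`, and a Schwartz
function dominates. Bounds uniform in `N` therefore pass to the full high-frequency symbol. -/
theorem tendsto_integral_truncatedSymbol {g : ℝ → ℝ} (hg : Continuous g) {h y : ℝ} (hh : 0 < h)
    (hy : 0 < y) (t e : ℝ) {P : E → ℝ} (hP : ∀ ξ, y / 2 ≤ h * ‖ξ‖ → P ξ = g (h * ‖ξ‖))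
    {u : E → ℂ} (hu : Integrable u) (f : 𝓢(E, ℂ)) :
    Filter.Tendsto (fun N => ∫ ξ, ((regularizedSq h y ξ ^ e : ℝ) : ℂ) *
        truncatedSymbol g h y t N ξ * (𝓕⁻ u ξ * 𝓕 (f : E → ℂ) ξ)) Filter.atTop
      (nhds (∫ ξ, Complex.exp (Complex.I * ((t * P ξ : ℝ) : ℂ)) *
        ((highFreqSymbol h y e ξ ^ 2 : ℝ) : ℂ) * (𝓕⁻ u ξ * 𝓕 (f : E → ℂ) ξ))) := by
  have hreg := hasTemperateGrowth_regularizedSq_rpow (E := E) hh hy e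
  set w : 𝓢(E, ℂ) := SchwartzMap.smulLeftCLM ℂ (fun ξ => ((regularizedSq h y ξ ^ e : ℝ) : ℂ)) (𝓕 f)
    with hw
  have hwe : ∀ ξ, w ξ = ((regularizedSq h y ξ ^ e : ℝ) : ℂ) * 𝓕 (f : E → ℂ) ξ := fun ξ => by
    rw [hw, SchwartzMap.smulLeftCLM_apply_apply (hasTemperateGrowth_ofReal_comp hreg), smul_eq_mul,
      SchwartzMap.fourier_coe]
  have hcu : Continuous (𝓕⁻ u) := continuous_fourierInv hu
  refine tendsto_integral_of_dominated_convergence (fun ξ => (∫ x, ‖u x‖) * ‖w ξ‖) (fun N => ?_)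
    (w.integrable.norm.const_mul _) (fun N => Filter.Eventually.of_forall fun ξ => ?_)
    (Filter.Eventually.of_forall fun ξ => ?_)
  · have hc := continuous_truncatedSymbol (E := E) hg h y t N
    have : (fun ξ => ((regularizedSq h y ξ ^ e : ℝ) : ℂ) * truncatedSymbol g h y t N ξ *
        (𝓕⁻ u ξ * 𝓕 (f : E → ℂ) ξ)) = fun ξ => truncatedSymbol g h y t N ξ * 𝓕⁻ u ξ * w ξ := by
      funext ξ; rw [hwe]; ring
    rw [this]
    exact ((hc.mul hcu).mul w.continuous).aestronglyMeasurable
  · calc ‖((regularizedSq h y ξ ^ e : ℝ) : ℂ) * truncatedSymbol g h y t N ξ *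
        (𝓕⁻ u ξ * 𝓕 (f : E → ℂ) ξ)‖ = ‖truncatedSymbol g h y t N ξ‖ * (‖𝓕⁻ u ξ‖ * ‖w ξ‖) := by
          rw [hwe]; simp only [norm_mul]; ring
      _ ≤ 1 * ((∫ x, ‖u x‖) * ‖w ξ‖) := by
          gcongr
          · exact norm_truncatedSymbol_le ..
          · exact norm_fourierInv_le ξ
      _ = _ := one_mul _
  · refine tendsto_const_nhds.congr' ?_
    obtain ⟨N₀, hN₀⟩ := pow_unbounded_of_one_lt (2 * (h * ‖ξ‖ / y)) (one_lt_two (α := ℝ))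
    filter_upwards [Filter.eventually_ge_atTop N₀] with N hN
    congr 1
    have h0 : 0 ≤ h * ‖ξ‖ / y := by positivity
    have h2 : (2 : ℝ) ^ N₀ ≤ 2 ^ N := pow_le_pow_right₀ (by norm_num) hN
    rw [highFreqSymbol_sq hy, truncatedSymbol, radialCutoff_of_le (r := h * ‖ξ‖ / y / 2 ^ N)
      (by positivity) (by rw [div_le_iff₀ (by positivity)]; linarith), sub_zero]
    by_cases h1 : y / 2 ≤ h * ‖ξ‖
    · rw [hP ξ h1]; push_cast; ring
    · rw [radialCutoff_of_le h0 (by rw [div_le_iff₀ hy]; linarith)]; simp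

/-- The first bound is the kernel bound at `τ = 0`. The second is Stein interpolation for the family
with logarithmic weight `β₀ log (h |ξ|)`, evaluated at `θ`. -/
theorem norm_integral_cexp_mul_highFreqSymbol_le {g : ℝ → ℝ} (hg : Continuous g) {h y : ℝ}
    (hh : 0 < h) (hy : 0 < y) {t β₀ K : ℝ} (hK : 0 ≤ K) {P : E → ℝ}
    (hP : ∀ ξ, y / 2 ≤ h * ‖ξ‖ → P ξ = g (h * ‖ξ‖))
    (hker : ∀ (τ : ℝ) (N : ℕ) (x : E),
      ‖∫ ξ, Complex.exp (Complex.I * ((2 * π * inner ℝ x ξ : ℝ) : ℂ)) *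
        (Complex.exp ((1 + τ * Complex.I) * ((β₀ * Real.log (h * ‖ξ‖) : ℝ) : ℂ)) *
          truncatedSymbol g h y t N ξ)‖ ≤ K * (1 + |τ|) ^ 2) :
    (∀ {u : E → ℂ}, Integrable u → ∀ f : 𝓢(E, ℂ),
      ‖∫ ξ, Complex.exp (Complex.I * ((t * P ξ : ℝ) : ℂ)) *
        ((highFreqSymbol h y (β₀ / 2) ξ ^ 2 : ℝ) : ℂ) * (𝓕⁻ u ξ * 𝓕 (f : E → ℂ) ξ)‖ ≤
        K * ((∫ x, ‖u x‖) * ∫ x, ‖f x‖)) ∧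
    ∀ {θ p : ℝ}, 0 ≤ θ → θ ≤ 1 → 0 < p → p / 2 * (1 + θ) = 1 → ∀ f₁ f₂ : 𝓢(E, ℂ),
      ‖∫ ξ, Complex.exp (Complex.I * ((t * P ξ : ℝ) : ℂ)) *
        ((highFreqSymbol h y (θ * β₀ / 2) ξ ^ 2 : ℝ) : ℂ) *
          (𝓕⁻ (f₁ : E → ℂ) ξ * 𝓕 (f₂ : E → ℂ) ξ)‖ ≤
        (2 * Real.exp 1 * K) ^ θ *
          ((∫ x, ‖f₁ x‖ ^ p) ^ (1 / p) * (∫ x, ‖f₂ x‖ ^ p) ^ (1 / p)) := by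
  have hint := fun N => integrable_truncatedSymbol (E := E) hg hh hy t N
  have hΛ : ∀ N, ∃ Λ, ∀ ξ : E, truncatedSymbol g h y t N ξ ≠ 0 →
      |β₀ * Real.log (h * ‖ξ‖)| ≤ Λ := fun N =>
    ⟨|β₀| * (|Real.log (y / 2)| + |Real.log (2 ^ N * y)|), fun ξ hξ => by
      rw [abs_mul]
      gcongr
      exact abs_log_le_of_truncatedSymbol_ne_zero hh hy hξ⟩
  have hL : Measurable fun ξ : E => β₀ * Real.log (h * ‖ξ‖) := by fun_prop
  constructor
  · intro u hu f
    refine le_of_tendsto (tendsto_integral_truncatedSymbol hg hh hy t (β₀ / 2) hP hu f).norm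
      (Filter.Eventually.of_forall fun N => ?_)
    have heq := fun ξ : E => exp_mul_truncatedSymbol (g := g) (t := t) (N := N) hh hy ξ β₀
    have hM : Integrable fun ξ : E =>
        ((regularizedSq h y ξ ^ (β₀ / 2) : ℝ) : ℂ) * truncatedSymbol g h y t N ξ := by
      simp_rw [← heq]
      obtain ⟨Λ, hΛ⟩ := hΛ N
      refine ((hint N).norm.const_mul (Real.exp Λ)).mono' ((by fun_prop : Measurable fun ξ : E =>
        Complex.exp (((β₀ * Real.log (h * ‖ξ‖) : ℝ) : ℂ))).aestronglyMeasurable.mul (hint N).1)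
        (Filter.Eventually.of_forall fun ξ => ?_)
      by_cases h0 : truncatedSymbol g h y t N ξ = 0
      · simp [h0]
      · rw [norm_mul, Complex.norm_exp, Complex.ofReal_re]
        gcongr
        exact (le_abs_self _).trans (hΛ ξ h0)
    refine norm_integral_trilinear_le hM hu f.integrable fun x => ?_
    simp_rw [← heq]
    simpa using hker 0 N x
  · intro θ p hθ0 hθ1 hp0 hp f₁ f₂
    refine le_of_tendsto (tendsto_integral_truncatedSymbol hg hh hy t (θ * β₀ / 2) hP
      f₁.integrable f₂).norm (Filter.Eventually.of_forall fun N => ?_)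
    have heq := fun ξ : E => exp_mul_truncatedSymbol (g := g) (t := t) (N := N) hh hy ξ (θ * β₀)
    have := stein_interpolation (hint N) (norm_truncatedSymbol_le g h y t N) hL (hΛ N) hK
      (fun τ x => hker τ N x) hθ0 hθ1 hp0 hp f₁ f₂
    refine le_of_eq_of_le ?_ this
    simp_rw [← heq]
    congr 1
    refine integral_congr_ae (Filter.Eventually.of_forall fun ξ => ?_)
    push_cast
    ring_nf

end Bilinear

/-! ### The `TT*` argument -/

section Strichartz

open FourierTransform

section FlowVector

variable {E : Type*} [NormedAddCommGroup E] [InnerProductSpace ℝ E] [FiniteDimensional ℝ E]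
  [MeasurableSpace E] [BorelSpace E]

/-- Complex conjugation of Schwartz functions. -/
noncomputable def schwartzConj (f : 𝓢(E, ℂ)) : 𝓢(E, ℂ) :=
  SchwartzMap.postcompCLM (Complex.conjCLE : ℂ →L[ℝ] ℂ) f

theorem schwartzConj_apply (f : 𝓢(E, ℂ)) (x : E) : schwartzConj f x = (starRingEnd ℂ) (f x) := rfl

theorem eLpNorm_schwartzConj (f : 𝓢(E, ℂ)) (p : ℝ≥0∞) :
    eLpNorm (schwartzConj f) p volume = eLpNorm f p volume :=
  eLpNorm_congr_norm_ae (Filter.Eventually.of_forall fun x => by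
    rw [schwartzConj_apply, RCLike.norm_conj])

/-- The symbol of the flow `exp (i t P) ω`. -/
noncomputable def flowSymbol (P w : E → ℝ) (t : ℝ) (ξ : E) : ℂ :=
  Complex.exp (Complex.I * ((t * P ξ : ℝ) : ℂ)) * (w ξ : ℂ)

theorem hasTemperateGrowth_flowSymbol {P w : E → ℝ} (hP : P.HasTemperateGrowth)
    (hw : w.HasTemperateGrowth) (t : ℝ) : (flowSymbol P w t).HasTemperateGrowth :=
  (hasTemperateGrowth_cexp_I_mul_comp ((Function.HasTemperateGrowth.const t).mul hP)).mul
    (hasTemperateGrowth_ofReal_comp hw)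

/-- The vector in `L²` that represents `u ↦ (exp (i t P) ω (D) u) φ` on the Fourier side. -/
noncomputable def flowVector (P w : E → ℝ) (φ : 𝓢(E, ℂ)) (t : ℝ) : Lp ℂ 2 (volume : Measure E) :=
  (schwartzConj (SchwartzMap.smulLeftCLM ℂ (flowSymbol P w t) (𝓕⁻ φ))).toLp 2

theorem flowVector_ae_eq {P w : E → ℝ} (hP : P.HasTemperateGrowth)
    (hw : w.HasTemperateGrowth) (φ : 𝓢(E, ℂ)) (t : ℝ) :
    flowVector P w φ t =ᵐ[volume]
      fun ξ => (starRingEnd ℂ) (flowSymbol P w t ξ * 𝓕⁻ (φ : E → ℂ) ξ) := by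
  filter_upwards [SchwartzMap.coeFn_toLp
    (schwartzConj (SchwartzMap.smulLeftCLM ℂ (flowSymbol P w t) (𝓕⁻ φ))) 2 volume] with ξ hξ
  rw [flowVector, hξ, schwartzConj_apply,
    SchwartzMap.smulLeftCLM_apply_apply (hasTemperateGrowth_flowSymbol hP hw t), smul_eq_mul,
    SchwartzMap.fourierInv_coe]

theorem inner_flowVector_fourier {P w : E → ℝ} (hP : P.HasTemperateGrowth)
    (hw : w.HasTemperateGrowth) {f : E → ℂ} (hf : MemLp f 2 volume) {u : 𝓢'(E, ℂ)}
    (hu : ∀ φ : 𝓢(E, ℂ), u φ = ∫ x, φ x * f x) (φ : 𝓢(E, ℂ)) (t : ℝ) :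
    inner ℂ (flowVector P w φ t) (𝓕 (hf.toLp f)) =
      TemperedDistribution.fourierMultiplierCLM ℂ (flowSymbol P w t) u φ := by
  have hu' : u = ((hf.toLp f : Lp ℂ 2 (volume : Measure E)) : 𝓢'(E, ℂ)) := by
    ext ψ
    rw [hu, Lp.toTemperedDistribution_apply]
    refine integral_congr_ae ?_
    filter_upwards [hf.coeFn_toLp] with x hx
    rw [hx, smul_eq_mul]
  rw [TemperedDistribution.fourierMultiplierCLM_apply_apply, hu',
    ← TemperedDistribution.fourier_apply, Lp.fourier_toTemperedDistribution_eq,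
    Lp.toTemperedDistribution_apply, L2.inner_def]
  refine integral_congr_ae ?_
  filter_upwards [flowVector_ae_eq hP hw φ t] with ξ hξ
  rw [hξ, SchwartzMap.smulLeftCLM_apply_apply (hasTemperateGrowth_flowSymbol hP hw t),
    SchwartzMap.fourierInv_coe]
  simp [mul_comm]

/-- The `TT*` kernel: the phases combine to time `t - s`, the weights multiply to a square, and the
conjugate of `𝓕⁻ ψ` is the Fourier transform of the conjugate of `ψ`. -/
theorem inner_flowVector_flowVector {P w : E → ℝ} (hP : P.HasTemperateGrowth)
    (hw : w.HasTemperateGrowth) (φ ψ : 𝓢(E, ℂ)) (t s : ℝ) :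
    inner ℂ (flowVector P w φ t) (flowVector P w ψ s) =
      ∫ ξ, Complex.exp (Complex.I * (((t - s) * P ξ : ℝ) : ℂ)) * ((w ξ ^ 2 : ℝ) : ℂ) *
        (𝓕⁻ (φ : E → ℂ) ξ * 𝓕 (schwartzConj ψ : E → ℂ) ξ) := by
  rw [L2.inner_def]
  refine integral_congr_ae ?_
  filter_upwards [flowVector_ae_eq hP hw φ t, flowVector_ae_eq hP hw ψ s] with ξ h1 h2
  have h3 : 𝓕 (schwartzConj ψ : E → ℂ) ξ = (starRingEnd ℂ) (𝓕⁻ (ψ : E → ℂ) ξ) := by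
    rw [Real.fourier_eq', Real.fourierInv_eq', ← integral_conj]
    refine integral_congr_ae (Filter.Eventually.of_forall fun x => ?_)
    simp only [schwartzConj_apply, smul_eq_mul, map_mul, ← Complex.exp_conj, Complex.conj_ofReal,
      Complex.conj_I]
    push_cast
    ring_nf
  have h4 : Complex.exp (Complex.I * (((t - s) * P ξ : ℝ) : ℂ)) =
      Complex.exp (Complex.I * ((t * P ξ : ℝ) : ℂ)) *
        (starRingEnd ℂ) (Complex.exp (Complex.I * ((s * P ξ : ℝ) : ℂ))) := by
    rw [← Complex.exp_conj, ← Complex.exp_add]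
    simp only [map_mul, Complex.conj_ofReal, Complex.conj_I]
    push_cast
    ring_nf
  rw [h1, h2, h3, h4]
  simp only [flowSymbol, RCLike.inner_apply, map_mul, Complex.conj_conj, Complex.conj_ofReal]
  push_cast
  ring

/-- The phase is unimodular, so the right side is free of `t`: approximation of test functions is
uniform in time. -/
theorem norm_flowVector_sub_le {P w : E → ℝ} (hP : P.HasTemperateGrowth)
    (hw : w.HasTemperateGrowth) (φ ψ : 𝓢(E, ℂ)) (t : ℝ) :
    ‖flowVector P w φ t - flowVector P w ψ t‖ ≤
      ‖(SchwartzMap.smulLeftCLM ℂ (fun ξ => (w ξ : ℂ)) (𝓕⁻ φ)).toLp 2 volume -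
        (SchwartzMap.smulLeftCLM ℂ (fun ξ => (w ξ : ℂ)) (𝓕⁻ ψ)).toLp 2 volume‖ := by
  refine Lp.norm_le_norm_of_ae_le ?_
  filter_upwards [flowVector_ae_eq hP hw φ t, flowVector_ae_eq hP hw ψ t,
    Lp.coeFn_sub (flowVector P w φ t) (flowVector P w ψ t),
    Lp.coeFn_sub ((SchwartzMap.smulLeftCLM ℂ (fun ξ => (w ξ : ℂ)) (𝓕⁻ φ)).toLp 2 volume)
      ((SchwartzMap.smulLeftCLM ℂ (fun ξ => (w ξ : ℂ)) (𝓕⁻ ψ)).toLp 2 volume),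
    SchwartzMap.coeFn_toLp (SchwartzMap.smulLeftCLM ℂ (fun ξ => (w ξ : ℂ)) (𝓕⁻ φ)) 2 volume,
    SchwartzMap.coeFn_toLp (SchwartzMap.smulLeftCLM ℂ (fun ξ => (w ξ : ℂ)) (𝓕⁻ ψ)) 2 volume]
    with ξ h1 h2 h3 h4 h5 h6
  rw [h3, h4, Pi.sub_apply, Pi.sub_apply, h1, h2, h5, h6, ← map_sub, RCLike.norm_conj,
    SchwartzMap.smulLeftCLM_apply_apply (hasTemperateGrowth_ofReal_comp hw),
    SchwartzMap.smulLeftCLM_apply_apply (hasTemperateGrowth_ofReal_comp hw),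
    SchwartzMap.fourierInv_coe, SchwartzMap.fourierInv_coe, smul_eq_mul, smul_eq_mul, ← mul_sub,
    ← mul_sub, norm_mul, norm_mul, flowSymbol, norm_mul, norm_cexp_I_mul_ofReal, one_mul]

theorem continuous_flowVector {P w : E → ℝ} (hP : P.HasTemperateGrowth)
    (hw : w.HasTemperateGrowth) (φ : 𝓢(E, ℂ)) : Continuous (flowVector P w φ) := by
  set G : 𝓢(E, ℂ) := SchwartzMap.smulLeftCLM ℂ (fun ξ => ((P ξ * w ξ : ℝ) : ℂ)) (𝓕⁻ φ) with hG
  have key : ∀ t s, ‖flowVector P w φ t - flowVector P w φ s‖ ≤ |t - s| * ‖G.toLp 2 volume‖ := by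
    intro t s
    refine Lp.norm_le_mul_norm_of_ae_le_mul ?_
    filter_upwards [flowVector_ae_eq hP hw φ t, flowVector_ae_eq hP hw φ s,
      Lp.coeFn_sub (flowVector P w φ t) (flowVector P w φ s), SchwartzMap.coeFn_toLp G 2 volume]
      with ξ h1 h2 h3 h4
    have h5 : Complex.exp (Complex.I * ((t * P ξ : ℝ) : ℂ)) -
        Complex.exp (Complex.I * ((s * P ξ : ℝ) : ℂ)) =
        Complex.exp (Complex.I * ((s * P ξ : ℝ) : ℂ)) *
          (Complex.exp (Complex.I * (((t - s) * P ξ : ℝ) : ℂ)) - 1) := by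
      rw [mul_sub, ← Complex.exp_add, mul_one]
      push_cast
      ring_nf
    rw [h3, h4, Pi.sub_apply, h1, h2, ← map_sub, RCLike.norm_conj, ← sub_mul, flowSymbol,
      flowSymbol, ← sub_mul, h5, hG,
      SchwartzMap.smulLeftCLM_apply_apply (hasTemperateGrowth_ofReal_comp
        (f := fun ξ => P ξ * w ξ) (hP.mul hw)),
      SchwartzMap.fourierInv_coe, smul_eq_mul]
    simp only [norm_mul, norm_cexp_I_mul_ofReal, one_mul, Complex.ofReal_mul (P ξ)]
    have h6 := norm_exp_I_mul_ofReal_sub_one_le (x := (t - s) * P ξ)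
    rw [norm_mul, Real.norm_eq_abs (t - s)] at h6
    rw [Complex.norm_real (P ξ), ← mul_assoc, ← mul_assoc]
    gcongr
  rw [continuous_iff_continuousAt]
  intro s
  rw [ContinuousAt, tendsto_iff_norm_sub_tendsto_zero]
  refine squeeze_zero (fun _ => norm_nonneg _) (fun t => key t s) ?_
  have : Continuous fun t : ℝ => |t - s| * ‖G.toLp 2 volume‖ := by fun_prop
  simpa using this.tendsto s

/-- Subsets of `L^p × L²` are separable, so one sequence of test functions approximates all others
in both norms at once. A countable supremum then computes the `L^r` norm simultaneously for every
time. -/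
theorem exists_seq_norm_flowVector_sub_lt {P w : E → ℝ} (hP : P.HasTemperateGrowth)
    (hw : w.HasTemperateGrowth) {p : ℝ≥0∞} (hp1 : 1 ≤ p) (hpt : p ≠ ⊤) :
    ∃ h : ℕ → 𝓢(E, ℂ), ∀ φ : 𝓢(E, ℂ), ∀ ε > 0, ∃ i,
      (eLpNorm (h i) p volume).toReal ≤ (eLpNorm φ p volume).toReal + ε ∧
      ∀ t, ‖flowVector P w φ t - flowVector P w (h i) t‖ ≤ ε := by
  haveI : Fact (1 ≤ p) := ⟨hp1⟩
  haveI : Fact (p ≠ ⊤) := ⟨hpt⟩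
  haveI : Fact ((1 : ℝ≥0∞) ≤ 2) := ⟨by norm_num⟩
  haveI : Fact ((2 : ℝ≥0∞) ≠ ⊤) := ⟨by norm_num⟩
  set J : 𝓢(E, ℂ) → Lp ℂ p (volume : Measure E) × Lp ℂ 2 (volume : Measure E) := fun φ =>
    (φ.toLp p, (SchwartzMap.smulLeftCLM ℂ (fun ξ => (w ξ : ℂ)) (𝓕⁻ φ)).toLp 2) with hJ
  haveI : Nonempty (Set.range J) := ⟨⟨J 0, 0, rfl⟩⟩
  obtain ⟨x, hx⟩ := TopologicalSpace.exists_dense_seq (Set.range J)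
  choose h hh using fun i => (x i).2
  refine ⟨h, fun φ ε hε => ?_⟩
  obtain ⟨i, hi⟩ := hx.exists_dist_lt ⟨J φ, φ, rfl⟩ hε
  refine ⟨i, ?_, fun t => (norm_flowVector_sub_le hP hw φ (h i) t).trans ?_⟩
  all_goals
    rw [Subtype.dist_eq, ← hh, Prod.dist_eq, max_lt_iff, dist_eq_norm, dist_eq_norm] at hi
  · have h1 := norm_sub_norm_le ((h i).toLp p volume) (φ.toLp p volume)
    rw [norm_sub_rev] at h1
    rw [← SchwartzMap.norm_toLp, ← SchwartzMap.norm_toLp]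
    linarith [hi.1]
  · exact hi.2.le

end FlowVector

/-- The `L^r` norm at time `t` is bounded by the supremum of the pairings of `𝓕 f` with the
normalized flow vectors of a countable family. The bilinear decay `hB` is the kernel bound required
by the abstract `TT*` lemma. -/
theorem lintegral_distLpNorm_flow_rpow_le {n : ℕ} {P w : EuclideanSpace ℝ (Fin n) → ℝ}
    (hP : P.HasTemperateGrowth) (hw : w.HasTemperateGrowth) {p r : ℝ≥0∞}
    (hpr : ENNReal.HolderConjugate p r) (hp2 : p ≤ 2) {q : ℝ} (hq : 2 < q) {K : ℝ} (hK : 0 ≤ K)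
    (hB : ∀ t : ℝ, t ≠ 0 → ∀ φ ψ : 𝓢(EuclideanSpace ℝ (Fin n), ℂ),
      ‖∫ ξ, Complex.exp (Complex.I * ((t * P ξ : ℝ) : ℂ)) * ((w ξ ^ 2 : ℝ) : ℂ) *
        (𝓕⁻ (φ : EuclideanSpace ℝ (Fin n) → ℂ) ξ * 𝓕 (ψ : EuclideanSpace ℝ (Fin n) → ℂ) ξ)‖ ≤
      K * |t| ^ (-(2 / q)) * ((eLpNorm φ p volume).toReal * (eLpNorm ψ p volume).toReal))
    {f : EuclideanSpace ℝ (Fin n) → ℂ} (hf : MemLp f 2 volume)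
    {u : 𝓢'(EuclideanSpace ℝ (Fin n), ℂ)}
    (hu : ∀ φ : 𝓢(EuclideanSpace ℝ (Fin n), ℂ), u φ = ∫ x, φ x * f x) :
    ∫⁻ t, distLpNorm r (TemperedDistribution.fourierMultiplierCLM ℂ (flowSymbol P w t) u) ^ q ≤
      ENNReal.ofReal ((2 * (2 / (1 - 2 / q) + 2)) ^ (q / 2) * K ^ (q / 2) *
        (eLpNorm f 2 volume).toReal ^ q) := by
  have hpt : p ≠ ⊤ := (hp2.trans_lt (by simp)).ne
  haveI : Fact (1 ≤ p) := ⟨hpr.one_le⟩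
  haveI : Fact ((1 : ℝ≥0∞) ≤ 2) := ⟨by norm_num⟩
  obtain ⟨h, hh⟩ := exists_seq_norm_flowVector_sub_lt hP hw hpr.one_le hpt
  set N : ℕ → ℝ := fun i => (eLpNorm (h i) p volume).toReal with hN
  have hN0 : ∀ i, 0 ≤ N i := fun i => ENNReal.toReal_nonneg
  set F : Lp ℂ 2 (volume : Measure (EuclideanSpace ℝ (Fin n))) := 𝓕 (hf.toLp f) with hF
  have hFn : ‖F‖ = (eLpNorm f 2 volume).toReal := by
    rw [hF, Lp.norm_fourier_eq, Lp.norm_toLp]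
  -- If `N i = 0` then `(N i)⁻¹ = 0` and the vector is zero; that index is treated separately below,
  -- where `h i = 0`.
  set v : ℕ → ℝ → Lp ℂ 2 (volume : Measure (EuclideanSpace ℝ (Fin n))) := fun i t =>
    (((N i)⁻¹ : ℝ) : ℂ) • flowVector P w (h i) t with hv
  have hvc : ∀ i, Continuous (v i) := fun i =>
    (continuous_flowVector hP hw (h i)).const_smul (((N i)⁻¹ : ℝ) : ℂ)
  have hker : ∀ i j t s, t ≠ s → ‖inner ℂ (v i t) (v j s)‖ ≤ K * |t - s| ^ (-(2 / q)) := by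
    intro i j t s hts
    have h1 := hB (t - s) (sub_ne_zero.2 hts) (h i) (schwartzConj (h j))
    rw [← inner_flowVector_flowVector hP hw, eLpNorm_schwartzConj] at h1
    simp only [hv]
    rw [inner_smul_left, inner_smul_right, norm_mul, norm_mul, RCLike.norm_conj, Complex.norm_real,
      Complex.norm_real, Real.norm_of_nonneg (inv_nonneg.2 (hN0 i)),
      Real.norm_of_nonneg (inv_nonneg.2 (hN0 j))]
    have h2 : ∀ i, (N i)⁻¹ * N i ≤ 1 := fun i => inv_mul_le_one
    calc (N i)⁻¹ * ((N j)⁻¹ * ‖inner ℂ (flowVector P w (h i) t) (flowVector P w (h j) s)‖)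
        ≤ (N i)⁻¹ * ((N j)⁻¹ * (K * |t - s| ^ (-(2 / q)) * (N i * N j))) := by
          have := inv_nonneg.2 (hN0 i)
          have := inv_nonneg.2 (hN0 j)
          gcongr
      _ = K * |t - s| ^ (-(2 / q)) * (((N i)⁻¹ * N i) * ((N j)⁻¹ * N j)) := by ring
      _ ≤ K * |t - s| ^ (-(2 / q)) * (1 * 1) := by
          have := hN0 j
          gcongr
          · exact h2 i
          · exact h2 j
      _ = _ := by ring
  rw [← hFn]
  refine le_trans (lintegral_mono fun t => ENNReal.rpow_le_rpow ?_ (by linarith))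
    (lintegral_iSup_inner_rpow_le hq hvc hK hker F)
  by_cases htop : (⨆ i, ‖inner ℂ (v i t) F‖ₑ) = ⊤
  · rw [htop]; exact le_top
  set S := (⨆ i, ‖inner ℂ (v i t) F‖ₑ).toReal with hS
  have hS0 : 0 ≤ S := ENNReal.toReal_nonneg
  have hSi : ∀ i, ‖inner ℂ (v i t) F‖ ≤ S := fun i => by
    rw [← toReal_enorm]
    exact ENNReal.toReal_mono htop (le_iSup (fun i => ‖inner ℂ (v i t) F‖ₑ) i)
  rw [← ENNReal.ofReal_toReal htop]
  refine distLpNorm_le_of_forall_norm_le hpr hp2 hS0 _ fun φ => ?_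
  rw [← inner_flowVector_fourier hP hw hf hu]
  refine le_of_forall_pos_le_add fun ε hε => ?_
  set δ := ε / (S + ‖F‖ + 1) with hδ
  have hD : 0 < S + ‖F‖ + 1 := by positivity
  obtain ⟨i, hi1, hi2⟩ := hh φ δ (by positivity)
  have h3 : ‖inner ℂ (flowVector P w (h i) t) F‖ ≤ S * N i := by
    rcases (hN0 i).eq_or_lt with h0 | h0
    · have h4 : h i = 0 := by
        have h5 : (h i).toLp p volume = 0 := by
          rw [← norm_eq_zero, SchwartzMap.norm_toLp]; exact h0.symm
        exact SchwartzMap.injective_toLp p volume (h5.trans (by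
          simpa using ((SchwartzMap.toLpCLM ℂ ℂ p (volume :
            Measure (EuclideanSpace ℝ (Fin n)))).map_zero).symm))
      have h5 : flowVector P w (h i) t = 0 := by
        rw [← norm_eq_zero]
        refine le_antisymm ?_ (norm_nonneg _)
        have h6 : flowVector P w (h i) t =ᵐ[volume] (0 : EuclideanSpace ℝ (Fin n) → ℂ) := by
          filter_upwards [flowVector_ae_eq hP hw (h i) t] with ξ hξ
          rw [hξ, h4, ← SchwartzMap.fourierInv_coe]
          simp
        rw [(Lp.eq_zero_iff_ae_eq_zero).2 h6, norm_zero]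
      rw [h5, inner_zero_left, norm_zero]
      exact mul_nonneg hS0 (hN0 i)
    · have h4 := hSi i
      simp only [hv] at h4
      rw [inner_smul_left, norm_mul, RCLike.norm_conj, Complex.norm_real,
        Real.norm_of_nonneg (inv_nonneg.2 (hN0 i)), inv_mul_le_iff₀ h0] at h4
      linarith
  calc ‖inner ℂ (flowVector P w φ t) F‖
      = ‖inner ℂ (flowVector P w φ t - flowVector P w (h i) t) F +
          inner ℂ (flowVector P w (h i) t) F‖ := by rw [← inner_add_left, sub_add_cancel]
    _ ≤ δ * ‖F‖ + S * ((eLpNorm φ p volume).toReal + δ) := by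
        refine (norm_add_le _ _).trans (add_le_add ?_ (h3.trans ?_))
        · exact (norm_inner_le_norm _ _).trans (by gcongr; exact hi2 t)
        · gcongr
    _ = S * (eLpNorm φ p volume).toReal + δ * (S + ‖F‖) := by ring
    _ ≤ S * (eLpNorm φ p volume).toReal + ε := by
        gcongr
        rw [hδ, div_mul_eq_mul_div, div_le_iff₀ hD]
        nlinarith

/-- The energy endpoint, by Plancherel: the symbol is bounded by one. -/
theorem distLpNorm_two_flow_le {n : ℕ} {P w : EuclideanSpace ℝ (Fin n) → ℝ}
    (hP : P.HasTemperateGrowth) (hw : w.HasTemperateGrowth) (hw1 : ∀ ξ, |w ξ| ≤ 1)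
    {f : EuclideanSpace ℝ (Fin n) → ℂ} (hf : MemLp f 2 volume)
    {u : 𝓢'(EuclideanSpace ℝ (Fin n), ℂ)}
    (hu : ∀ φ : 𝓢(EuclideanSpace ℝ (Fin n), ℂ), u φ = ∫ x, φ x * f x) (t : ℝ) :
    distLpNorm 2 (TemperedDistribution.fourierMultiplierCLM ℂ (flowSymbol P w t) u) ≤
      eLpNorm f 2 volume := by
  haveI : Fact ((1 : ℝ≥0∞) ≤ 2) := ⟨by norm_num⟩
  rw [← ENNReal.ofReal_toReal hf.eLpNorm_ne_top]
  refine distLpNorm_le_of_forall_norm_le inferInstance le_rfl ENNReal.toReal_nonneg _ fun φ => ?_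
  rw [← inner_flowVector_fourier hP hw hf hu]
  refine (norm_inner_le_norm _ _).trans ?_
  rw [Lp.norm_fourier_eq, Lp.norm_toLp, mul_comm]
  gcongr
  have h0 : ‖φ.toLp 2 (volume : Measure (EuclideanSpace ℝ (Fin n)))‖ =
      ‖(𝓕⁻ φ : 𝓢(EuclideanSpace ℝ (Fin n), ℂ)).toLp 2 volume‖ := by
    conv_lhs => rw [← FourierTransform.fourier_fourierInv_eq (F := 𝓢(EuclideanSpace ℝ (Fin n), ℂ))
        φ]
    rw [← SchwartzMap.toLp_fourier_eq, Lp.norm_fourier_eq]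
  rw [← SchwartzMap.norm_toLp, h0]
  refine Lp.norm_le_norm_of_ae_le ?_
  filter_upwards [flowVector_ae_eq hP hw φ t, SchwartzMap.coeFn_toLp (𝓕⁻ φ) 2 volume] with ξ h1 h2
  rw [h1, h2, RCLike.norm_conj, norm_mul, flowSymbol, norm_mul, norm_cexp_I_mul_ofReal, one_mul,
    Complex.norm_real, SchwartzMap.fourierInv_coe]
  exact mul_le_of_le_one_left (norm_nonneg _) (hw1 ξ)

theorem distLpNorm_top_flow_le {n : ℕ} {m : EuclideanSpace ℝ (Fin n) → ℂ}
    (hm : m.HasTemperateGrowth) {K : ℝ} (hK : 0 ≤ K)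
    (hB : ∀ {v : EuclideanSpace ℝ (Fin n) → ℂ}, Integrable v →
      ∀ φ : 𝓢(EuclideanSpace ℝ (Fin n), ℂ),
      ‖∫ ξ, m ξ * (𝓕⁻ v ξ * 𝓕 (φ : EuclideanSpace ℝ (Fin n) → ℂ) ξ)‖ ≤
        K * ((∫ x, ‖v x‖) * ∫ x, ‖φ x‖))
    {f : EuclideanSpace ℝ (Fin n) → ℂ} (hf : MemLp f 1 volume)
    {u : 𝓢'(EuclideanSpace ℝ (Fin n), ℂ)}
    (hu : ∀ φ : 𝓢(EuclideanSpace ℝ (Fin n), ℂ), u φ = ∫ x, φ x * f x) :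
    distLpNorm ⊤ (TemperedDistribution.fourierMultiplierCLM ℂ m u) ≤
      ENNReal.ofReal K * eLpNorm f 1 volume := by
  have hfi : Integrable f := memLp_one_iff_integrable.1 hf
  rw [← ENNReal.ofReal_toReal hf.eLpNorm_ne_top, ← ENNReal.ofReal_mul hK]
  have hnorm : ∀ {g : EuclideanSpace ℝ (Fin n) → ℂ}, Integrable g →
      (eLpNorm g 1 volume).toReal = ∫ x, ‖g x‖ := fun {g} hg => by
    rw [eLpNorm_one_eq_lintegral_enorm, integral_norm_eq_lintegral_enorm hg.1]
  refine distLpNorm_le_of_forall_norm_le (p := 1) inferInstance (by norm_num)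
    (mul_nonneg hK ENNReal.toReal_nonneg) _ fun φ => ?_
  -- The reflections are chosen so that `𝓕⁻` of the first function is `𝓕 f` and `𝓕` of the second is
  -- `𝓕⁻ φ`: the bilinear form becomes the multiplier applied to `u` and tested on `φ`.
  have h1 := hB hfi.comp_neg (𝓕⁻ (𝓕⁻ φ))
  have h2 : ∀ x, (𝓕⁻ (𝓕⁻ φ)) x = φ (-x) := fun x => by
    rw [SchwartzMap.fourierInv_coe, Real.fourierInv_eq_fourier_neg, ← SchwartzMap.fourier_coe,
      FourierTransform.fourier_fourierInv_eq]
  have h3 : 𝓕⁻ (fun x => f (-x)) = 𝓕 f := by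
    rw [Real.fourierInv_eq_fourier_comp_neg]; simp
  rw [← SchwartzMap.fourier_coe, FourierTransform.fourier_fourierInv_eq, h3,
    integral_neg_eq_self (fun x => ‖f x‖)] at h1
  simp_rw [h2] at h1
  rw [integral_neg_eq_self (fun x => ‖φ x‖)] at h1
  rw [hnorm hfi, hnorm φ.integrable, mul_assoc,
      TemperedDistribution.fourierMultiplierCLM_apply_apply,
    hu, SchwartzMap.fourier_coe, integral_mul_fourier_eq (SchwartzMap.integrable _) hfi]
  refine le_of_eq_of_le ?_ h1
  congr 1
  refine integral_congr_ae (Filter.Eventually.of_forall fun ξ => ?_)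
  simp only
  rw [SchwartzMap.smulLeftCLM_apply_apply hm, smul_eq_mul]
  ring

/-- The norm is an infimum over representatives. If there is none it is `∞`, and the right side is
`∞` because `c ≠ 0`. -/
theorem le_mul_distLpNorm {n : ℕ} {p c X : ℝ≥0∞} (hc0 : c ≠ 0) (hct : c ≠ ⊤)
    {u : 𝓢'(EuclideanSpace ℝ (Fin n), ℂ)}
    (h : ∀ f : EuclideanSpace ℝ (Fin n) → ℂ, MemLp f p volume →
      (∀ φ : 𝓢(EuclideanSpace ℝ (Fin n), ℂ), u φ = ∫ x, φ x * f x) →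
      X ≤ c * eLpNorm f p volume) :
    X ≤ c * distLpNorm p u := by
  rw [← ENNReal.div_le_iff' hc0 hct]
  exact le_iInf fun f => le_iInf fun hf => le_iInf fun hu =>
    ENNReal.div_le_of_le_mul' (h f hf hu)

end Strichartz

/-! ### The high-frequency flow -/

section HighFrequencyFlow

theorem distLpNorm_smul_le {n : ℕ} (p : ℝ≥0∞) {c : ℝ} (hc : 0 < c)
    (u : 𝓢'(EuclideanSpace ℝ (Fin n), ℂ)) :
    distLpNorm p ((c : ℂ) • u) ≤ ENNReal.ofReal c * distLpNorm p u := by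
  refine le_mul_distLpNorm (by simpa using hc) ENNReal.ofReal_ne_top fun f hf hu => ?_
  have h1 : eLpNorm ((c : ℂ) • f) p volume = ENNReal.ofReal c * eLpNorm f p volume := by
    rw [eLpNorm_const_smul, ← ofReal_norm, Complex.norm_real, Real.norm_of_nonneg hc.le]
  rw [← h1]
  refine (iInf_le _ ((c : ℂ) • f)).trans ((iInf_le _ (hf.const_smul _)).trans (iInf_le _ ?_))
  intro φ
  have h2 : ((c : ℂ) • u) φ = (c : ℂ) • u φ := rfl
  rw [h2, hu, smul_eq_mul, ← integral_const_mul]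
  refine integral_congr_ae (Filter.Eventually.of_forall fun x => ?_)
  simp only [Pi.smul_apply, smul_eq_mul]
  ring

/-! ### Regularity and scaling of the high-frequency symbols -/

section Symbols

variable {E : Type*} [NormedAddCommGroup E] [InnerProductSpace ℝ E] [FiniteDimensional ℝ E]

theorem hasTemperateGrowth_one_sub_comp_norm {χ : ℝ → ℂ} (hχ : ContDiff ℝ ∞ χ)
    (hχc : HasCompactSupport χ) {y h : ℝ} (hy : 0 < y) (hh : 0 < h)
    (hχ1 : ∀ x ∈ Set.Icc (-y) y, χ x = 1) :
    (fun ξ : E => 1 - χ (h * ‖ξ‖)).HasTemperateGrowth := by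
  refine (Function.HasTemperateGrowth.const (1 : ℂ)).sub (HasCompactSupport.hasTemperateGrowth ?_
      ?_)
  · obtain ⟨R, hR⟩ := hχc.isCompact.isBounded.subset_closedBall (0 : ℝ)
    refine HasCompactSupport.intro (isCompact_closedBall (0 : E) (R / h)) fun ξ hξ => ?_
    by_contra h1
    have h2 := hR (subset_tsupport _ h1)
    have h3 : R / h < ‖ξ‖ := by simpa using hξ
    rw [mem_closedBall_zero_iff, Real.norm_of_nonneg (by positivity)] at h2
    rw [div_lt_iff₀ hh] at h3
    linarith
  · rw [contDiff_iff_contDiffAt]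
    intro ξ
    by_cases hξ : ξ = 0
    · have h1 : (fun ξ : E => χ (h * ‖ξ‖)) =ᶠ[nhds ξ] fun _ => 1 := by
        have h2 : ∀ᶠ ζ in nhds ξ, h * ‖ζ‖ < y := by
          have h3 : Continuous fun ζ : E => h * ‖ζ‖ := by fun_prop
          exact h3.continuousAt.eventually_lt_const (by simpa [hξ] using hy)
        filter_upwards [h2] with ζ hζ
        have : 0 ≤ h * ‖ζ‖ := by positivity
        exact hχ1 _ ⟨by linarith, hζ.le⟩
      exact contDiffAt_const.congr_of_eventuallyEq h1
    · exact hχ.contDiffAt.comp ξ (contDiffAt_const.mul (contDiffAt_norm ℝ hξ))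

theorem sqrt_mul_norm_two_pi_smul (μ : ℝ) (ξ : E) :
    √μ * ‖(2 * π) • ξ‖ = 2 * π * √μ * ‖ξ‖ := by
  rw [norm_smul, Real.norm_of_nonneg (by positivity)]; ring

theorem norm_two_pi_smul_rpow {μ : ℝ} (hμ : 0 < μ) (s : ℝ) (ξ : E) :
    ‖(2 * π) • ξ‖ ^ s = μ ^ (-(s / 2)) * (2 * π * √μ * ‖ξ‖) ^ s := by
  rw [← sqrt_mul_norm_two_pi_smul, mul_rpow (by positivity) (norm_nonneg _), Real.sqrt_eq_rpow,
    ← rpow_mul hμ.le, ← mul_assoc, ← rpow_add hμ, show -(s / 2) + 1 / 2 * s = 0 by ring, rpow_zero,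
    one_mul]

/-- `|ξ| ^ s` may be singular at the origin, but `1 - χ` vanishes there, so it may be replaced by a
regularized power. -/
theorem hasTemperateGrowth_highFreqWeight {χ : ℝ → ℂ} (hχ : ContDiff ℝ ∞ χ)
    (hχc : HasCompactSupport χ) {y μ : ℝ} (hy : 0 < y) (hμ : 0 < μ)
    (hχ1 : ∀ x ∈ Set.Icc (-y) y, χ x = 1) (s : ℝ) :
    (fun ξ : E => ((‖(2 * π) • ξ‖ ^ s : ℝ) : ℂ) * (1 - χ (√μ * ‖(2 * π) • ξ‖))).HasTemperateGrowth
        := by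
  have hh : 0 < 2 * π * √μ := by positivity
  have h1 := hasTemperateGrowth_one_sub_comp_norm (E := E) hχ hχc hy hh hχ1
  have h2 := hasTemperateGrowth_ofReal_comp (hasTemperateGrowth_highFreqSymbol (E := E) hh hy s)
  have h3 := (Function.HasTemperateGrowth.const (E := E) (((μ ^ (-(s / 2)) : ℝ)) : ℂ)).mul (h2.mul
      h1)
  refine (congrArg Function.HasTemperateGrowth (funext fun ξ => ?_)).mp h3
  rw [sqrt_mul_norm_two_pi_smul, norm_two_pi_smul_rpow hμ, Pi.mul_apply, Pi.mul_apply]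
  by_cases hξ : y ≤ 2 * π * √μ * ‖ξ‖
  · rw [highFreqSymbol_eq hy hξ]; push_cast; ring
  · have h0 : 0 ≤ 2 * π * √μ * ‖ξ‖ := by positivity
    rw [hχ1 _ ⟨by linarith, (not_le.1 hξ).le⟩]; simp

end Symbols

/-- The flow is a multiplier applied to the weighted datum. Since `1 - χ` vanishes for `h |ξ| ≤ y`,
only the values of `m` on `h |ξ| ≥ y` matter, which leaves room for a smooth choice. The factor `μ ^
(s / 2)` converts powers of `|D|` into powers of `√μ |D|`. -/
theorem highFreqFlow_eq {n : ℕ} (a b c d : ℝ) {χ : ℝ → ℂ} (hχ : ContDiff ℝ ∞ χ)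
    (hχc : HasCompactSupport χ) {y μ : ℝ} (hy : 0 < y) (hμ : 0 < μ)
    (hχ1 : ∀ x ∈ Set.Icc (-y) y, χ x = 1) (s t : ℝ) {m : EuclideanSpace ℝ (Fin n) → ℂ}
    (hm : m.HasTemperateGrowth) (hme : ∀ ξ, y ≤ 2 * π * √μ * ‖ξ‖ →
      m ξ = Complex.exp (Complex.I * ((t / √μ * abcdPhase a b c d (2 * π * √μ * ‖ξ‖) : ℝ) : ℂ)) *
        (((2 * π * √μ * ‖ξ‖) ^ (-s) : ℝ) : ℂ)) (u₀ : 𝓢'(EuclideanSpace ℝ (Fin n), ℂ)) :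
    highFreqFlow a b c d μ χ t u₀ = ((μ ^ (s / 2) : ℝ) : ℂ) •
      TemperedDistribution.fourierMultiplierCLM ℂ m (highFreqWeight μ χ s u₀) := by
  have hW := hasTemperateGrowth_highFreqWeight (E := EuclideanSpace ℝ (Fin n)) hχ hχc hy hμ hχ1 s
  unfold highFreqFlow highFreqWeight fourierMult
  rw [TemperedDistribution.fourierMultiplierCLM_fourierMultiplierCLM_apply hW hm]
  have h1 := TemperedDistribution.fourierMultiplierCLM_smul (F := ℂ) (hW.mul hm)
    ((μ ^ (s / 2) : ℝ) : ℂ)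
  have h2 := congrArg (fun T => T u₀) h1
  refine Eq.trans ?_ h2
  congr 2
  funext ξ
  simp only [Pi.smul_apply, Pi.mul_apply, smul_eq_mul]
  rw [sqrt_mul_norm_two_pi_smul, norm_two_pi_smul_rpow hμ]
  have h0 : 0 ≤ 2 * π * √μ * ‖ξ‖ := by positivity
  by_cases hξ : y ≤ 2 * π * √μ * ‖ξ‖
  · have h3 : (2 * π * √μ * ‖ξ‖) ^ s * (2 * π * √μ * ‖ξ‖) ^ (-s) = 1 := by
      rw [← rpow_add (hy.trans_le hξ), add_neg_cancel, rpow_zero]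
    have h4 : μ ^ (s / 2) * μ ^ (-(s / 2)) = 1 := by
      rw [← rpow_add hμ, add_neg_cancel, rpow_zero]
    have h5 : ((μ ^ (s / 2) : ℝ) : ℂ) * ((μ ^ (-(s / 2)) : ℝ) : ℂ) *
        ((((2 * π * √μ * ‖ξ‖) ^ s : ℝ) : ℂ) * (((2 * π * √μ * ‖ξ‖) ^ (-s) : ℝ) : ℂ)) = 1 := by
      rw [← Complex.ofReal_mul, ← Complex.ofReal_mul, h3, h4]; simp
    rw [hme ξ hξ, Complex.ofReal_mul (μ ^ (-(s / 2)))]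
    calc _ = 1 * (Complex.exp (Complex.I *
          ((t / √μ * abcdPhase a b c d (2 * π * √μ * ‖ξ‖) : ℝ) : ℂ)) *
            (1 - χ (2 * π * √μ * ‖ξ‖))) := (one_mul _).symm
      _ = _ := by rw [← h5]; ring
  · rw [hχ1 _ ⟨by linarith, (not_le.1 hξ).le⟩]; simp

end HighFrequencyFlow

/-! ### Kernel bounds in physical scaling and the dispersive estimate -/

section MainEstimates

open FourierTransform

/-- The bound on the kernel of `exp (i t g (h |D|)) (h |D|) ^ (β₀ (1 + i τ))`, truncated to
`y ≤ 2 h |D| ≤ 2 ^ (N + 1) y`. -/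
def KernelBound (n : ℕ) (g : ℝ → ℝ) (β₀ σ y C : ℝ) : Prop :=
  ∀ (h t τ : ℝ) (N : ℕ) (x : EuclideanSpace ℝ (Fin n)), 0 < h → t ≠ 0 →
    ‖∫ ξ, Complex.exp (Complex.I * ((2 * π * inner ℝ x ξ : ℝ) : ℂ)) *
      (Complex.exp ((1 + τ * Complex.I) * ((β₀ * Real.log (h * ‖ξ‖) : ℝ) : ℂ)) *
        truncatedSymbol g h y t N ξ)‖ ≤ C * h ^ (-(n : ℝ)) * |t| ^ (-σ) * (1 + |τ|) ^ 2

/-- Weighting by `h |ξ|` instead of `|ξ|` multiplies the kernel by a complex power of `h` of modulus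
`h ^ β₀`, which leaves the scale-invariant factor `h ^ (-n)`. -/
theorem exists_kernelBound {n : ℕ} (hn : n = 1 ∨ n = 2) {g : ℝ → ℝ} (hgc : Continuous g)
    {ℓ β β₀ σ : ℝ} (hg : HasPhaseExpansion g ℓ β) (hβ0 : β ≠ 0) (hβ1 : β ≠ 1)
    (hexp : DyadicExponents ℓ β (((n : ℝ) - 1) / 2) (β₀ + (n - 1)) σ) :
    ∃ y C : ℝ, 1 ≤ y ∧ 0 < C ∧ KernelBound n g β₀ σ y C := by
  obtain ⟨y, C, hy, hC, hb⟩ := exists_kernel_bound hn hgc hg hβ0 hβ1 hexp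
  refine ⟨y, C, hy, hC, fun h t τ N x hh ht => ?_⟩
  have hy0 : 0 < y := by linarith
  have heq : ∀ ξ : EuclideanSpace ℝ (Fin n),
      Complex.exp ((1 + τ * Complex.I) * ((β₀ * Real.log (h * ‖ξ‖) : ℝ) : ℂ)) *
        truncatedSymbol g h y t N ξ =
      Complex.exp ((1 + τ * Complex.I) * ((β₀ * Real.log h : ℝ) : ℂ)) *
        (Complex.exp (Complex.I * ((t * g (h * ‖ξ‖) : ℝ) : ℂ)) *
          Complex.exp (β₀ * (1 + τ * Complex.I) * (Real.log ‖ξ‖ : ℂ)) *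
          ((radialCutoff (h * ‖ξ‖ / y) - radialCutoff (h * ‖ξ‖ / y / 2 ^ N) : ℝ) : ℂ)) := by
    intro ξ
    by_cases h0 : truncatedSymbol g h y t N ξ = 0
    · have h1 : ((radialCutoff (h * ‖ξ‖ / y) - radialCutoff (h * ‖ξ‖ / y / 2 ^ N) : ℝ) : ℂ) = 0 :=
          by
        unfold truncatedSymbol at h0
        exact (mul_eq_zero.1 h0).resolve_left (Complex.exp_ne_zero _)
      rw [h0, h1, mul_zero, mul_zero, mul_zero]
    · have h1 : 0 < h * ‖ξ‖ := (by positivity : 0 < y / 2).trans (truncatedSymbol_ne_zero hh hy0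
          h0).1
      have h2 : ‖ξ‖ ≠ 0 := (pos_of_mul_pos_right h1 hh.le).ne'
      unfold truncatedSymbol
      rw [Real.log_mul hh.ne' h2]
      have h3 : Complex.exp ((1 + τ * Complex.I) *
          ((β₀ * (Real.log h + Real.log ‖ξ‖) : ℝ) : ℂ)) =
          Complex.exp ((1 + τ * Complex.I) * ((β₀ * Real.log h : ℝ) : ℂ)) *
            Complex.exp (β₀ * (1 + τ * Complex.I) * (Real.log ‖ξ‖ : ℂ)) := by
        rw [← Complex.exp_add]; push_cast; ring_nf
      rw [h3]; ring
  simp_rw [heq, mul_left_comm _ (Complex.exp ((1 + τ * Complex.I) * ((β₀ * Real.log h : ℝ) : ℂ)))]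
  rw [integral_const_mul, norm_mul, Complex.norm_exp, Complex.re_mul_ofReal]
  have h1 : (1 + τ * Complex.I).re = 1 := by simp
  have h2 : Real.exp (β₀ * Real.log h) = h ^ β₀ := by rw [rpow_def_of_pos hh, mul_comm]
  have h3 : h ^ β₀ * h ^ (-(n + β₀)) = h ^ (-(n : ℝ)) := by rw [← rpow_add hh]; ring_nf
  rw [h1, one_mul, h2]
  calc _ ≤ h ^ β₀ * (C * (1 + |τ|) ^ 2 * h ^ (-(n + β₀)) * |t| ^ (-σ)) := by
        gcongr; exact hb h t τ N x hh ht
    _ = C * (h ^ β₀ * h ^ (-(n + β₀))) * |t| ^ (-σ) * (1 + |τ|) ^ 2 := by ring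
    _ = _ := by rw [h3]

/-- The frequency-rescaled phase of the flow. -/
noncomputable def flowPhase {n : ℕ} (a b c d μ y : ℝ) (ξ : EuclideanSpace ℝ (Fin n)) : ℝ :=
  (√μ)⁻¹ * regularizedPhase a b c d (2 * π * √μ) y ξ

variable {n : ℕ} {a b c d : ℝ}

theorem hasTemperateGrowth_flowPhase (ha : a ≤ 0) (hb : 0 ≤ b) (hc : c ≤ 0) (hd : 0 ≤ d)
    {μ y : ℝ} (hμ : 0 < μ) (hy : 0 < y) :
    (flowPhase a b c d μ y : EuclideanSpace ℝ (Fin n) → ℝ).HasTemperateGrowth :=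
  (Function.HasTemperateGrowth.const _).mul
    (hasTemperateGrowth_regularizedPhase ha hb hc hd (by positivity) hy)

theorem mul_flowPhase (μ y t : ℝ) (ξ : EuclideanSpace ℝ (Fin n)) :
    t * flowPhase a b c d μ y ξ = t / √μ * regularizedPhase a b c d (2 * π * √μ) y ξ := by
  unfold flowPhase; ring

/-- The flow has semiclassical parameter `h = 2π√μ` and time `t / √μ`; this collects the resulting
powers of `μ`. -/
theorem kernel_constant_eq {C μ t σ : ℝ} (hμ : 0 < μ) :
    C * (2 * π * √μ) ^ (-(n : ℝ)) * |t / √μ| ^ (-σ) =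
      C * (2 * π) ^ (-(n : ℝ)) * μ ^ ((σ - n) / 2) * |t| ^ (-σ) := by
  rw [abs_div, abs_of_nonneg (sqrt_nonneg μ), mul_rpow (by positivity) (by positivity),
    div_rpow (abs_nonneg _) (by positivity), Real.sqrt_eq_rpow, ← rpow_mul hμ.le, ← rpow_mul hμ.le,
    show (σ - n) / 2 = 1 / 2 * -(n : ℝ) - 1 / 2 * -σ by ring, rpow_sub hμ]
  field_simp

theorem norm_integral_flow_le (ha : a ≤ 0) (hb : 0 ≤ b) (hc : c ≤ 0) (hd : 0 ≤ d)
    {β₀ σ y C : ℝ} (hy : 0 < y) (hC : 0 < C) (hker : KernelBound n (abcdPhase a b c d) β₀ σ y C)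
    {μ : ℝ} (hμ : 0 < μ) {t : ℝ} (ht : t ≠ 0) :
    (∀ {u : EuclideanSpace ℝ (Fin n) → ℂ}, Integrable u → ∀ f : 𝓢(EuclideanSpace ℝ (Fin n), ℂ),
      ‖∫ ξ, Complex.exp (Complex.I * ((t * flowPhase a b c d μ y ξ : ℝ) : ℂ)) *
        ((highFreqSymbol (2 * π * √μ) y (β₀ / 2) ξ ^ 2 : ℝ) : ℂ) *
          (𝓕⁻ u ξ * 𝓕 (f : EuclideanSpace ℝ (Fin n) → ℂ) ξ)‖ ≤
        C * (2 * π) ^ (-(n : ℝ)) * μ ^ ((σ - n) / 2) * |t| ^ (-σ) *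
          ((∫ x, ‖u x‖) * ∫ x, ‖f x‖)) ∧
    ∀ {θ p : ℝ}, 0 ≤ θ → θ ≤ 1 → 0 < p → p / 2 * (1 + θ) = 1 →
      ∀ f₁ f₂ : 𝓢(EuclideanSpace ℝ (Fin n), ℂ),
      ‖∫ ξ, Complex.exp (Complex.I * ((t * flowPhase a b c d μ y ξ : ℝ) : ℂ)) *
        ((highFreqSymbol (2 * π * √μ) y (θ * β₀ / 2) ξ ^ 2 : ℝ) : ℂ) *
          (𝓕⁻ (f₁ : EuclideanSpace ℝ (Fin n) → ℂ) ξ *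
            𝓕 (f₂ : EuclideanSpace ℝ (Fin n) → ℂ) ξ)‖ ≤
        (2 * Real.exp 1 * (C * (2 * π) ^ (-(n : ℝ)) * μ ^ ((σ - n) / 2))) ^ θ * |t| ^ (-(σ * θ)) *
          ((eLpNorm f₁ (ENNReal.ofReal p) volume).toReal *
            (eLpNorm f₂ (ENNReal.ofReal p) volume).toReal) := by
  have hh : 0 < 2 * π * √μ := by positivity
  have hK : 0 ≤ C * (2 * π) ^ (-(n : ℝ)) * μ ^ ((σ - n) / 2) * |t| ^ (-σ) := by positivity
  obtain ⟨h1, h2⟩ := norm_integral_cexp_mul_highFreqSymbol_le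
    (continuous_abcdPhase (a := a) (c := c) hb hd) hh hy (t := t / √μ) (β₀ := β₀) hK
    (P := regularizedPhase a b c d (2 * π * √μ) y)
    (fun ξ : EuclideanSpace ℝ (Fin n) => regularizedPhase_eq ha hb hc hd hy)
    (fun τ N x => by
      rw [← kernel_constant_eq hμ]
      exact hker _ _ τ N x hh (div_ne_zero ht (by positivity)))
  simp_rw [mul_flowPhase]
  refine ⟨h1, fun {θ p} hθ0 hθ1 hp0 hp f₁ f₂ => (h2 hθ0 hθ1 hp0 hp f₁ f₂).trans (le_of_eq ?_)⟩
  have hpE : ENNReal.ofReal p ≠ 0 := by simpa using hp0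
  rw [← SchwartzMap.norm_toLp, ← SchwartzMap.norm_toLp,
    SchwartzMap.norm_toLp' hpE ENNReal.ofReal_ne_top,
    SchwartzMap.norm_toLp' hpE ENNReal.ofReal_ne_top, ENNReal.toReal_ofReal hp0.le, one_div,
    ← mul_assoc (2 * Real.exp 1), mul_rpow (by positivity) (by positivity),
    ← rpow_mul (abs_nonneg t), neg_mul]

/-- The whole weight `(h |ξ|) ^ β₀` sits in the multiplier, as the square of the half weight, and is
compensated by `|D| ^ (-β₀)` on the datum. -/
theorem distLpNorm_top_highFreqFlow_le (ha : a ≤ 0) (hb : 0 ≤ b) (hc : c ≤ 0) (hd : 0 ≤ d)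
    {β₀ σ y C : ℝ} (hy : 0 < y) (hC : 0 < C) (hker : KernelBound n (abcdPhase a b c d) β₀ σ y C)
    {χ : ℝ → ℂ} (hχ : ContDiff ℝ ∞ χ) (hχc : HasCompactSupport χ)
    (hχ1 : ∀ x ∈ Set.Icc (-y) y, χ x = 1) {μ : ℝ} (hμ : 0 < μ) {t : ℝ} (ht : t ≠ 0)
    (u₀ : 𝓢'(EuclideanSpace ℝ (Fin n), ℂ)) :
    distLpNorm ⊤ (highFreqFlow a b c d μ χ t u₀) ≤
      ENNReal.ofReal (C * (2 * π) ^ (-(n : ℝ)) * μ ^ ((σ - n - β₀) / 2) * |t| ^ (-σ)) *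
        distLpNorm 1 (highFreqWeight μ χ (-β₀) u₀) := by
  have hh : 0 < 2 * π * √μ := by positivity
  have hP := hasTemperateGrowth_flowPhase (n := n) ha hb hc hd hμ hy
  have hw := hasTemperateGrowth_highFreqSymbol (E := EuclideanSpace ℝ (Fin n)) hh hy (β₀ / 2)
  set m : EuclideanSpace ℝ (Fin n) → ℂ := flowSymbol (flowPhase a b c d μ y)
    (fun ξ => highFreqSymbol (2 * π * √μ) y (β₀ / 2) ξ ^ 2) t with hm
  have hmt : m.HasTemperateGrowth := hasTemperateGrowth_flowSymbol hP (hw.pow 2) t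
  rw [highFreqFlow_eq a b c d hχ hχc hy hμ hχ1 (-β₀) t hmt]
  · refine (distLpNorm_smul_le _ (by positivity) _).trans
      (le_mul_distLpNorm ?_ ENNReal.ofReal_ne_top fun f hf hu => ?_)
    · have : 0 < |t| := abs_pos.2 ht
      simpa using (by positivity :
        0 < C * (2 * π) ^ (-(n : ℝ)) * μ ^ ((σ - n - β₀) / 2) * |t| ^ (-σ))
    · refine (mul_le_mul_right (distLpNorm_top_flow_le hmt (by positivity)
        (norm_integral_flow_le ha hb hc hd hy hC hker hμ ht).1 hf hu) _).trans (le_of_eq ?_)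
      rw [← mul_assoc, ← ENNReal.ofReal_mul (by positivity),
        show (σ - n - β₀) / 2 = -β₀ / 2 + (σ - n) / 2 by ring, rpow_add hμ]
      congr 2
      ring
  · intro ξ hξ
    rw [hm, flowSymbol, mul_flowPhase, regularizedPhase_eq ha hb hc hd hy (by linarith),
      highFreqSymbol_eq hy hξ, ← rpow_natCast, ← rpow_mul (hy.le.trans hξ), neg_neg]
    congr 3
    push_cast; ring

end MainEstimates

/-! ### Strichartz estimates for admissible pairs -/

section MixedNorm

/-- `q = 2` with `σ ≤ 1` would force `σ = 1` and `r = ∞`, the excluded endpoint. So apart from the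
energy pair `(∞, 2)` one has `q > 2`, as Hardy-Littlewood-Sobolev requires, and `2 / q = σ θ` with
`θ = 1 - 2/r`. -/
theorem SharpAdmissible.eq_top_or {σ : ℝ} (hσ0 : 0 < σ) (hσ1 : σ ≤ 1) {q r : ℝ≥0∞}
    (h : SharpAdmissible σ q r) :
    (q = ⊤ ∧ r = 2) ∨ (q ≠ ⊤ ∧ 2 < q.toReal ∧ (r⁻¹).toReal < 1 / 2 ∧
      2 / q.toReal = σ * (1 - 2 * (r⁻¹).toReal)) := by
  obtain ⟨hq, hr, he, hne⟩ := h
  have hρ0 : 0 ≤ (r⁻¹).toReal := ENNReal.toReal_nonneg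
  by_cases hqt : q = ⊤
  · left
    refine ⟨hqt, ?_⟩
    have h1 : (r⁻¹).toReal = 1 / 2 := by
      rw [hqt] at he
      simp only [ENNReal.inv_top, ENNReal.toReal_zero, zero_add] at he
      have h2 : σ * (r⁻¹).toReal = σ * (1 / 2) := by linarith
      exact mul_left_cancel₀ hσ0.ne' h2
    have hrt : r ≠ ⊤ := fun h => by rw [h] at h1; norm_num at h1
    rw [ENNReal.toReal_inv, one_div, inv_inj] at h1
    rw [← ENNReal.ofReal_toReal hrt, h1]; simp
  · right
    rw [ENNReal.toReal_inv q] at he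
    have hQ2 : 2 ≤ q.toReal := by
      have := ENNReal.toReal_mono hqt hq
      simpa using this
    have hQ0 : 0 < q.toReal := by linarith
    have hi : 0 < q.toReal⁻¹ := inv_pos.2 hQ0
    have h1 : 2 / q.toReal = σ * (1 - 2 * (r⁻¹).toReal) := by
      rw [div_eq_mul_inv]; linarith
    refine ⟨hqt, lt_of_le_of_ne hQ2 fun h2 => hne ?_, ?_, h1⟩
    · rw [← h2] at h1
      norm_num at h1
      have h3 : σ * (r⁻¹).toReal = 0 := by
        have : 0 ≤ σ * (r⁻¹).toReal := by positivity
        rw [← ENNReal.toReal_inv] at h1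
        linarith
      have h4 : (r⁻¹).toReal = 0 := (mul_eq_zero.1 h3).resolve_left hσ0.ne'
      refine ⟨?_, ?_, ?_⟩
      · rw [← ENNReal.ofReal_toReal hqt, ← h2]; simp
      · rcases (ENNReal.toReal_eq_zero_iff _).1 h4 with h5 | h5
        · exact ENNReal.inv_eq_zero.1 h5
        · rw [ENNReal.inv_eq_top] at h5; rw [h5] at hr; simp at hr
      · rw [← ENNReal.toReal_inv, h4] at h1; linarith
    · by_contra! h2
      have h3 : 0 < 2 / q.toReal := by positivity
      rw [h1] at h3
      have := pos_of_mul_pos_right h3 hσ0.le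
      linarith

variable {n : ℕ} {a b c d : ℝ}

theorem mixedNorm_le_of_lintegral_le {q r : ℝ≥0∞} (hqt : q ≠ ⊤) (hq0 : 0 < q.toReal)
    {F : ℝ → 𝓢'(EuclideanSpace ℝ (Fin n), ℂ)} {X : ℝ} (hX : 0 ≤ X)
    (h : ∫⁻ t, distLpNorm r (F t) ^ q.toReal ≤ ENNReal.ofReal (X ^ q.toReal)) :
    mixedNorm q r F ≤ ENNReal.ofReal X := by
  have hq : q ≠ 0 := fun h => by simp [h] at hq0
  unfold mixedNorm
  rw [eLpNorm_eq_lintegral_rpow_enorm_toReal hq hqt]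
  simp only [enorm_eq_self]
  calc _ ≤ ENNReal.ofReal (X ^ q.toReal) ^ (1 / q.toReal) := by gcongr
    _ = _ := by
      rw [ENNReal.ofReal_rpow_of_nonneg (by positivity) (by positivity), ← rpow_mul hX,
        mul_one_div_cancel hq0.ne', rpow_one]

theorem rpow_mul_rpow_half {μ x y θ A B N Q : ℝ} (hB : 0 < B) (hA : 0 < A) (hμ : 0 < μ)
    (hN : 0 ≤ N) :
    (μ ^ x) ^ Q * (B ^ (Q / 2) * (A ^ θ * μ ^ y) ^ (Q / 2) * N ^ Q) =
      (B ^ (1 / 2 : ℝ) * A ^ (θ / 2) * (μ ^ x * μ ^ (y / 2)) * N) ^ Q := by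
  have h1 : ∀ X : ℝ, 0 ≤ X → X ^ (Q / 2) = (X ^ (1 / 2 : ℝ)) ^ Q := fun X hX => by
    rw [← rpow_mul hX]; ring_nf
  rw [h1 B hB.le, h1 (A ^ θ * μ ^ y) (by positivity), mul_rpow (z := 1 / 2) (by positivity)
    (by positivity), ← rpow_mul hA.le, ← rpow_mul hμ.le y, ← mul_rpow (by positivity) (by
        positivity),
    ← mul_rpow (by positivity) (by positivity), ← mul_rpow (by positivity) (by positivity),
    mul_one_div, mul_one_div]
  congr 1
  ring

/-- The multiplier carries the weight `(h |ξ|) ^ (θ β₀ / 2)`. Its square is the interpolated weight,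
which has decay `|t| ^ (-σθ) = |t| ^ (-2/q)`, so `TT*` applies. The constant enters to the power
`1/2`, whence the halved power of `μ`. -/
theorem exists_mixedNorm_highFreqFlow_le (ha : a ≤ 0) (hb : 0 ≤ b) (hc : c ≤ 0) (hd : 0 ≤ d)
    {β₀ σ y C : ℝ} (hy : 0 < y) (hC : 0 < C) (hker : KernelBound n (abcdPhase a b c d) β₀ σ y C)
    (hσ0 : 0 < σ) (hσ1 : σ ≤ 1) {q r : ℝ≥0∞} (hqr : SharpAdmissible σ q r) :
    ∃ C' : ℝ, 0 < C' ∧ ∀ χ : ℝ → ℂ, ContDiff ℝ ∞ χ → HasCompactSupport χ →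
      (∀ x ∈ Set.Icc (-y) y, χ x = 1) → ∀ μ : ℝ, 0 < μ →
      ∀ u₀ : 𝓢'(EuclideanSpace ℝ (Fin n), ℂ),
      mixedNorm q r (fun t => highFreqFlow a b c d μ χ t u₀) ≤
        ENNReal.ofReal (C' * μ ^ ((σ - n - β₀) / 2 * (1 / 2 - (r⁻¹).toReal))) *
          distLpNorm 2 (highFreqWeight μ χ (-β₀ * (1 / 2 - (r⁻¹).toReal)) u₀) := by
  set ρ := (r⁻¹).toReal with hρ
  have hρ0 : 0 ≤ ρ := ENNReal.toReal_nonneg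
  set θ := 1 - 2 * ρ with hθ
  set s := -β₀ * (1 / 2 - ρ) with hs
  have flow_eq : ∀ χ : ℝ → ℂ, ContDiff ℝ ∞ χ → HasCompactSupport χ →
      (∀ x ∈ Set.Icc (-y) y, χ x = 1) → ∀ μ : ℝ, 0 < μ → ∀ t,
      ∀ u₀ : 𝓢'(EuclideanSpace ℝ (Fin n), ℂ),
      highFreqFlow a b c d μ χ t u₀ = ((μ ^ (s / 2) : ℝ) : ℂ) •
        TemperedDistribution.fourierMultiplierCLM ℂ (flowSymbol (flowPhase a b c d μ y)
          (highFreqSymbol (2 * π * √μ) y (θ * β₀ / 2)) t) (highFreqWeight μ χ s u₀) := by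
    intro χ hχ hχc hχ1 μ hμ t u₀
    have hh : 0 < 2 * π * √μ := by positivity
    refine highFreqFlow_eq a b c d hχ hχc hy hμ hχ1 s t (hasTemperateGrowth_flowSymbol
      (hasTemperateGrowth_flowPhase ha hb hc hd hμ hy)
      (hasTemperateGrowth_highFreqSymbol hh hy _) t) (fun ξ hξ => ?_) u₀
    rw [flowSymbol, mul_flowPhase, regularizedPhase_eq ha hb hc hd hy (by linarith),
      highFreqSymbol_eq hy hξ]
    congr 3
    rw [hs, hθ]; ring
  rcases hqr.eq_top_or hσ0 hσ1 with ⟨rfl, rfl⟩ | ⟨hqt, hq2, hρ1, hqσ⟩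
  · refine ⟨1, one_pos, fun χ hχ hχc hχ1 μ hμ u₀ => ?_⟩
    have hh : 0 < 2 * π * √μ := by positivity
    have hρe : ρ = 1 / 2 := by rw [hρ]; simp
    have hθ0 : θ * β₀ / 2 = 0 := by rw [hθ, hρe]; ring
    have hs0 : s / 2 = 0 := by rw [hs, hρe]; ring
    simp_rw [flow_eq χ hχ hχc hχ1 μ hμ, hθ0, hs0, hρe]
    simp only [rpow_zero, Complex.ofReal_one, one_smul, sub_self, mul_zero, mul_one]
    refine le_mul_distLpNorm (by simp) (by simp) fun f hf hu => ?_
    rw [ENNReal.ofReal_one, one_mul]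
    unfold mixedNorm
    rw [eLpNorm_exponent_top]
    refine eLpNormEssSup_le_of_ae_enorm_bound (Filter.Eventually.of_forall fun t => ?_)
    rw [enorm_eq_self]
    refine distLpNorm_two_flow_le (hasTemperateGrowth_flowPhase ha hb hc hd hμ hy)
      (hasTemperateGrowth_highFreqSymbol hh hy _) (fun ξ => ?_) hf hu t
    unfold highFreqSymbol
    rw [zero_div, rpow_zero, one_mul, abs_of_nonneg (cutoffRoot_nonneg _)]
    exact cutoffRoot_le_one _
  · set Q := q.toReal with hQ
    have hQ0 : 0 < Q := by linarith
    have hθ0 : 0 < θ := by rw [hθ]; linarith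
    have hθ1 : θ ≤ 1 := by rw [hθ]; linarith
    set A := 2 * Real.exp 1 * (C * (2 * π) ^ (-(n : ℝ))) with hA
    have hA0 : 0 < A := by positivity
    set cQ := 2 * (2 / (1 - 2 / Q) + 2) with hcQ
    have hcQ0 : 0 < cQ := by
      have : 2 / Q < 1 := by rwa [div_lt_one hQ0]
      have : 0 < 1 - 2 / Q := by linarith
      positivity
    refine ⟨cQ ^ (1 / 2 : ℝ) * A ^ (θ / 2), by positivity, fun χ hχ hχc hχ1 μ hμ u₀ => ?_⟩
    have hh : 0 < 2 * π * √μ := by positivity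
    -- The dual exponent of `r`, which is also the exponent reached by interpolation at `θ`.
    set p := 1 / (1 - ρ) with hp
    have hρ2 : 0 < 1 - ρ := by linarith
    have hp0 : 0 < p := by positivity
    have hpθ : p / 2 * (1 + θ) = 1 := by rw [hp, hθ]; field_simp; ring
    have hp2 : p ≤ 2 := by rw [hp, div_le_iff₀ hρ2]; linarith
    have hr0 : r⁻¹ ≠ ⊤ := by
      rw [Ne, ENNReal.inv_eq_top]
      rintro rfl
      have := hqr.2.1
      simp at this
    have hpr : ENNReal.HolderConjugate (ENNReal.ofReal p) r := by
      rw [ENNReal.holderConjugate_iff, ← ENNReal.ofReal_inv_of_pos hp0,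
        ← ENNReal.ofReal_toReal hr0, ← ENNReal.ofReal_add (by positivity) hρ0]
      rw [hp]; simp
    have hp2' : ENNReal.ofReal p ≤ 2 := by
      rw [← ENNReal.ofReal_ofNat 2]; exact ENNReal.ofReal_le_ofReal hp2
    set K := (2 * Real.exp 1 * (C * (2 * π) ^ (-(n : ℝ)) * μ ^ ((σ - n) / 2))) ^ θ with hK
    have hK0 : 0 ≤ K := by positivity
    refine le_mul_distLpNorm (by simp only [ne_eq, ENNReal.ofReal_eq_zero, not_le]; positivity)
      ENNReal.ofReal_ne_top fun f hf hu => ?_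
    set N := (eLpNorm f 2 volume).toReal with hN
    have hN0 : 0 ≤ N := ENNReal.toReal_nonneg
    have key := lintegral_distLpNorm_flow_rpow_le
      (hasTemperateGrowth_flowPhase (n := n) ha hb hc hd hμ hy)
      (hasTemperateGrowth_highFreqSymbol hh hy (θ * β₀ / 2)) hpr hp2' hq2 hK0
      (fun t ht φ ψ => by
        rw [hqσ]
        exact (norm_integral_flow_le ha hb hc hd hy hC hker hμ ht).2 hθ0.le hθ1 hp0 hpθ φ ψ) hf hu
    rw [← ENNReal.ofReal_toReal hf.eLpNorm_ne_top, ← ENNReal.ofReal_mul (by positivity)]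
    refine mixedNorm_le_of_lintegral_le hqt hQ0 (by positivity) ?_
    have hms : 0 < μ ^ (s / 2) := by positivity
    calc ∫⁻ t, distLpNorm r (highFreqFlow a b c d μ χ t u₀) ^ Q
        ≤ ∫⁻ t, ENNReal.ofReal (μ ^ (s / 2)) ^ Q * distLpNorm r
            (TemperedDistribution.fourierMultiplierCLM ℂ (flowSymbol (flowPhase a b c d μ y)
              (highFreqSymbol (2 * π * √μ) y (θ * β₀ / 2)) t) (highFreqWeight μ χ s u₀)) ^ Q := by
          refine lintegral_mono fun t => ?_
          rw [flow_eq χ hχ hχc hχ1 μ hμ, ← ENNReal.mul_rpow_of_nonneg _ _ hQ0.le]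
          exact ENNReal.rpow_le_rpow (distLpNorm_smul_le _ hms _) hQ0.le
      _ ≤ ENNReal.ofReal (μ ^ (s / 2)) ^ Q *
            ENNReal.ofReal (cQ ^ (Q / 2) * K ^ (Q / 2) * N ^ Q) := by
          rw [lintegral_const_mul' _ _ (ENNReal.rpow_ne_top_of_nonneg hQ0.le ENNReal.ofReal_ne_top)]
          gcongr
      _ = ENNReal.ofReal ((cQ ^ (1 / 2 : ℝ) * A ^ (θ / 2) *
            μ ^ ((σ - n - β₀) / 2 * (1 / 2 - ρ)) * N) ^ Q) := by
          rw [ENNReal.ofReal_rpow_of_nonneg hms.le hQ0.le, ← ENNReal.ofReal_mul (by positivity)]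
          congr 1
          have e1 : K = A ^ θ * μ ^ ((σ - n) / 2 * θ) := by
            rw [hK, ← mul_assoc (2 * Real.exp 1), mul_rpow (by positivity) (by positivity),
              ← rpow_mul hμ.le]
          have e2 : μ ^ ((σ - n - β₀) / 2 * (1 / 2 - ρ)) =
              μ ^ (s / 2) * μ ^ ((σ - n) / 2 * θ / 2) := by
            rw [← rpow_add hμ, hs, hθ]; ring_nf
          rw [e1, e2]
          exact rpow_mul_rpow_half hcQ0 hA0 hμ hN0

end MixedNorm

/-! ### Assembly of the estimates -/

theorem mainTheorem11 (a b c d : ℝ) (ha : a ≤ 0) (hb : 0 ≤ b) (hc : c ≤ 0) (hd : 0 ≤ d)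
    (hnd : 0 < ((a + b) * (a + d) * (c + b) * (c + d)) ^ 2 + (a + b + c + d) ^ 2)
    (n : ℕ) (hn : n = 1 ∨ n = 2)
    (ℓ α : ℝ) (hT : (ℓ, α) = abcdTable a b c d) :
    ∃ y₁ : ℝ, 0 < y₁ ∧
      ∀ χ : ℝ → ℂ, ContDiff ℝ ∞ χ → HasCompactSupport χ →
        (∀ y ∈ Set.Icc (-y₁) y₁, χ y = 1) →
      ∀ q r : ℝ≥0∞, SharpAdmissible ((n : ℝ) / 2) q r →
      ∃ C : ℝ, 0 < C ∧ ∀ μ : ℝ, 0 < μ → μ ≤ 1 →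
        ∀ u₀ : 𝓢'(EuclideanSpace ℝ (Fin n), ℂ),
          ((n = 2 ∧ ℓ ≠ 0) →
            (∀ t : ℝ, t ≠ 0 →
              distLpNorm ∞ (highFreqFlow a b c d μ χ t u₀) ≤
                ENNReal.ofReal (C * μ ^ (-((α + 1) / 4)) / |t|) *
                  distLpNorm 1 (highFreqWeight μ χ ((1 - α) / 2) u₀)) ∧
            mixedNorm q r (fun t => highFreqFlow a b c d μ χ t u₀) ≤
              ENNReal.ofReal (C * μ ^ (-((α + 1) / 4) * (1 / 2 - (r⁻¹).toReal))) *
                distLpNorm 2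
                  (highFreqWeight μ χ ((1 - α) / 2 * (1 / 2 - (r⁻¹).toReal)) u₀)) ∧
          (¬ (n = 2 ∧ ℓ ≠ 0) →
            (∀ t : ℝ, t ≠ 0 →
              distLpNorm ∞ (highFreqFlow a b c d μ χ t u₀) ≤
                ENNReal.ofReal
                    (C * μ ^ (-((n : ℝ) / 2 * ((α + 1) / 2))) / |t| ^ ((n : ℝ) / 2)) *
                  distLpNorm 1 (highFreqWeight μ χ (-((n : ℝ) / 2 * α)) u₀)) ∧
            mixedNorm q r (fun t => highFreqFlow a b c d μ χ t u₀) ≤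
              ENNReal.ofReal
                  (C * μ ^ (-((n : ℝ) / 2 * ((α + 1) / 2)) * (1 / 2 - (r⁻¹).toReal))) *
                distLpNorm 2
                  (highFreqWeight μ χ (-((n : ℝ) / 2 * α) * (1 / 2 - (r⁻¹).toReal)) u₀)) := by
  obtain ⟨hphase, hα0, hα1, hℓ0, hℓα⟩ := abcdPhase_expansion ha hb hc hd hnd hT
  have hσ0 : 0 < (n : ℝ) / 2 := by rcases hn with rfl | rfl <;> norm_num
  have hσ1 : (n : ℝ) / 2 ≤ 1 := by rcases hn with rfl | rfl <;> norm_num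
  -- Minus the exponent of `|D|` in the dispersive estimate. It solves `γ + 1 = β / 2`, `β` or `(β +
  -- 1) / 2`, according to the case, with `γ = β₀ + n - 1` and `β = α + 2`.
  set β₀ : ℝ := if n = 2 ∧ ℓ ≠ 0 then (α - 1) / 2 else (n : ℝ) / 2 * α with hβ₀
  have hexp : DyadicExponents ℓ (α + 2) (((n : ℝ) - 1) / 2) (β₀ + (n - 1)) ((n : ℝ) / 2) := by
    by_cases h : n = 2 ∧ ℓ ≠ 0
    · rw [hβ₀, if_pos h, h.1]
      refine Or.inr (Or.inr ⟨by norm_num, by push_cast; ring, by norm_num,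
        lt_of_le_of_ne hℓ0 h.2.symm, by linarith [hℓα h.2]⟩)
    · rw [hβ₀, if_neg h]
      rcases hn with rfl | rfl
      · exact Or.inl ⟨by norm_num, by push_cast; ring, by norm_num⟩
      · exact Or.inr (Or.inl ⟨by norm_num, by push_cast; ring, by norm_num,
          by simpa using h⟩)
  obtain ⟨y, C₁, hy1, hC₁, hker⟩ := exists_kernelBound hn (continuous_abcdPhase hb hd) hphase hα0
    hα1 hexp
  have hy : 0 < y := by linarith
  refine ⟨y, hy, fun χ hχ hχc hχ1 q r hqr => ?_⟩
  obtain ⟨C₂, hC₂, hmix⟩ :=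
    exists_mixedNorm_highFreqFlow_le ha hb hc hd hy hC₁ hker hσ0 hσ1 hqr
  set A := C₁ * (2 * π) ^ (-(n : ℝ)) with hA
  have hA0 : 0 < A := by positivity
  have hdisp : ∀ μ : ℝ, 0 < μ → ∀ (t : ℝ), t ≠ 0 → ∀ u₀ : 𝓢'(EuclideanSpace ℝ (Fin n), ℂ),
      distLpNorm ⊤ (highFreqFlow a b c d μ χ t u₀) ≤
        ENNReal.ofReal ((A + C₂) * μ ^ (((n : ℝ) / 2 - n - β₀) / 2) / |t| ^ ((n : ℝ) / 2)) *
          distLpNorm 1 (highFreqWeight μ χ (-β₀) u₀) := fun μ hμ t ht u₀ => by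
    refine (distLpNorm_top_highFreqFlow_le ha hb hc hd hy hC₁ hker hχ hχc hχ1 hμ ht u₀).trans ?_
    gcongr
    rw [rpow_neg (abs_nonneg t), ← div_eq_mul_inv]
    gcongr
    linarith
  have hstr : ∀ μ : ℝ, 0 < μ → ∀ u₀ : 𝓢'(EuclideanSpace ℝ (Fin n), ℂ),
      mixedNorm q r (fun t => highFreqFlow a b c d μ χ t u₀) ≤
        ENNReal.ofReal ((A + C₂) *
          μ ^ (((n : ℝ) / 2 - n - β₀) / 2 * (1 / 2 - (r⁻¹).toReal))) *
          distLpNorm 2 (highFreqWeight μ χ (-β₀ * (1 / 2 - (r⁻¹).toReal)) u₀) :=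
    fun μ hμ u₀ => by
      refine (hmix χ hχ hχc hχ1 μ hμ u₀).trans ?_
      gcongr
      linarith
  -- The sum of the dispersive and Strichartz constants serves both estimates.
  refine ⟨A + C₂, by positivity, fun μ hμ _ u₀ => ⟨fun h => ?_, fun h => ?_⟩⟩
  · rw [if_pos h] at hβ₀
    have e1 : ((n : ℝ) / 2 - n - β₀) / 2 = -((α + 1) / 4) := by
      rw [hβ₀, h.1]; push_cast; ring
    have e2 : -β₀ = (1 - α) / 2 := by rw [hβ₀]; ring
    have e3 : (n : ℝ) / 2 = 1 := by rw [h.1]; norm_num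
    rw [← e1, ← e2]
    refine ⟨fun t ht => ?_, hstr μ hμ u₀⟩
    have := hdisp μ hμ t ht u₀
    rwa [show |t| ^ ((n : ℝ) / 2) = |t| by rw [e3, rpow_one]] at this
  · rw [if_neg h] at hβ₀
    have e1 : ((n : ℝ) / 2 - n - β₀) / 2 = -((n : ℝ) / 2 * ((α + 1) / 2)) := by
      rw [hβ₀]; ring
    rw [← e1, ← hβ₀]
    exact ⟨fun t ht => hdisp μ hμ t ht u₀, hstr μ hμ u₀⟩
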